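/- Let $(R,\mathfrak m)$ be a Noetherian local ring of dimension $d>0$ with infinite residue field. For $k=1,\dots,d$ let $F_k$ be a free $R$-module of finite rank $r_k$ and let $M_k\subsetneq F_k$ be a proper submodule such that $F_k/M_k$ has finite length. Work in the symmetric algebra $S(F)$ of $F=F_1\oplus\cdots\oplus F_d$. For a submodule $N\subseteq F_k$, let $S_n(N)\subseteq S(F)$ denote the image of the $n$-th symmetric power of $N$, i.e. the $n$-th power of $N$, regarded as an $R$-submodule of $S(F)$. Let $(B_1,\dots,B_d)$ be a joint reduction of $(M_1,\dots,M_d)$: each $B_k\subseteq M_k$ is a submodule generated by $r_k$ elements, and for some $n\ge 0$ $$S_{n+1}(M_1)\cdots S_{n+1}(M_d)=\sum_{k=1}^d S_{n+1}(M_1)\cdots S_{n+1}(M_{k-1})\,B_kS_n(M_k)\,S_{n+1}(M_{k+1})\cdots S_{n+1}(M_d).$$ For each $k$ let $\phi_k$ be an endomorphism of $F_k$ with image $B_k$, and let $K(\phi_k)$ be the complex $0\to F_k\xrightarrow{\phi_k}F_k\to 0$ in degrees $1$ and $0$. Then there is a unique polynomial $p\in\mathbb Q[n_1,\dots,n_d]$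 (the joint Buchsbaum–Rim polynomial) such that, for all sufficiently large $n_1,\dots,n_d$, the $R$-module $$\frac{S_{n_1}(F_1)\cdots S_{n_d}(F_d)}{S_{n_1}(M_1)\cdots S_{n_d}(M_d)}$$ has finite length equal to $p(n_1,\dots,n_d)$; the homology modules of the complex $K(\phi_1)\otimes_R\cdots\otimes_R K(\phi_d)$ have finite length; and the mixed Buchsbaum–Rim multiplicity $br(M_1|\cdots|M_d)$, defined as $r_1!\cdots r_d!$ times the coefficient of $n_1^{r_1}\cdots n_d^{r_d}$ in $p$, satisfies $$br(M_1|\cdots|M_d)=\chi\bigl(K(\phi_1)\otimes_R\cdots\otimes_R K(\phi_d)\bigr)=\sum_{i\ge 0}(-1)^i\,\mathrm{length}_R\,H_i\bigl(K(\phi_1)\otimes_R\cdots\otimes_R K(\phi_d)\bigr).$$ -/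

import Mathlib

open CategoryTheory
open scoped TensorProduct

/-! ### Koszul complexes of commuting endomorphisms -/

/-- The subsets of `{0, …, q - 1}` with exactly `p` elements. -/
abbrev KoszulIndex (q p : ℕ) : Type := {s : Finset (Fin q) // s.card = p}

/-- For `k ∉ s`, the set `s ∪ {k}`, which has one element more. -/
def KoszulIndex.insert {q p : ℕ} (s : KoszulIndex q p) (k : {k : Fin q // k ∉ s.1}) :
    KoszulIndex q (p + 1) :=
  ⟨Insert.insert k.1 s.1, by rw [Finset.card_insert_of_notMem k.2, s.2]⟩

/-- The exponent of the Koszul sign: the number of elements of `s` that are smaller than `k`. -/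
def koszulExponent {q : ℕ} (s : Finset (Fin q)) (k : Fin q) : ℕ := (s.filter (· < k)).card

lemma koszulExponent_insert_of_lt {q : ℕ} {s : Finset (Fin q)} {k l : Fin q} (hk : k ∉ s)
    (h : k < l) : koszulExponent (insert k s) l = koszulExponent s l + 1 := by
  unfold koszulExponent
  rw [Finset.filter_insert, if_pos h, Finset.card_insert_of_notMem (by simp [hk])]

lemma koszulExponent_insert_of_not_lt {q : ℕ} {s : Finset (Fin q)} {k l : Fin q}
    (h : ¬ k < l) : koszulExponent (insert k s) l = koszulExponent s l := by
  unfold koszulExponent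
  rw [Finset.filter_insert, if_neg h]

/-- The differential `K_{p+1} → K_p` of the Koszul complex on a family `Φ` of endomorphisms of `T`,
where `K_p` is the direct sum of copies of `T` indexed by the `p`-element subsets of `Fin q`.
The copy of `T` with index `{i_1 < ⋯ < i_{p+1}}` is sent to the copy with index
`{i_1 < ⋯ < i_{p+1}} \ {i_j}` by `(-1)^(j-1) Φ_{i_j}`. -/
noncomputable def koszulDifferential {R : Type*} [CommRing R] {T : Type*} [AddCommGroup T]
    [Module R T] {q : ℕ} (Φ : Fin q → Module.End R T) (p : ℕ) :
    (KoszulIndex q (p + 1) → T) →ₗ[R] (KoszulIndex q p → T) :=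
  LinearMap.pi fun s => ∑ k : {k : Fin q // k ∉ s.1},
    ((-1 : R) ^ koszulExponent s.1 k.1) • (Φ k.1 ∘ₗ LinearMap.proj (s.insert k))

lemma koszulDifferential_apply {R : Type*} [CommRing R] {T : Type*} [AddCommGroup T]
    [Module R T] {q : ℕ} (Φ : Fin q → Module.End R T) (p : ℕ) (x : KoszulIndex q (p + 1) → T)
    (s : KoszulIndex q p) :
    koszulDifferential Φ p x s = ∑ k : {k : Fin q // k ∉ s.1},
      ((-1 : R) ^ koszulExponent s.1 k.1) • Φ k.1 (x (s.insert k)) := by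
  simp [koszulDifferential, LinearMap.sum_apply]

lemma koszulDifferential_comp {R : Type*} [CommRing R] {T : Type*} [AddCommGroup T]
    [Module R T] {q : ℕ} (Φ : Fin q → Module.End R T) (hΦ : ∀ k l, Commute (Φ k) (Φ l)) (p : ℕ) :
    koszulDifferential Φ p ∘ₗ koszulDifferential Φ (p + 1) = 0 := by
  refine LinearMap.ext fun x => funext fun s => ?_
  simp only [LinearMap.comp_apply, koszulDifferential_apply, map_sum, map_smul, Finset.smul_sum,
    LinearMap.zero_apply, Pi.zero_apply]
  rw [Finset.sum_sigma']
  have mem : ∀ a : (Σ k : {k : Fin q // k ∉ s.1}, {l : Fin q // l ∉ (s.insert k).1}),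
      a.2.1 ≠ a.1.1 ∧ a.2.1 ∉ s.1 := fun a => by
    have := a.2.2
    simpa [KoszulIndex.insert] using this
  refine Finset.sum_involution
    (fun a _ => ⟨⟨a.2.1, (mem a).2⟩, ⟨a.1.1, by
      simp [KoszulIndex.insert, a.1.2, (mem a).1.symm]⟩⟩) ?_ ?_ ?_ ?_
  · rintro a -
    have e : (s.insert a.1).insert a.2 =
        (s.insert ⟨a.2.1, (mem a).2⟩).insert ⟨a.1.1, by
          simp [KoszulIndex.insert, a.1.2, (mem a).1.symm]⟩ := by
      apply Subtype.ext
      simp [KoszulIndex.insert, Finset.insert_comm]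
    have c : Φ a.1.1 (Φ a.2.1 (x ((s.insert a.1).insert a.2))) =
        Φ a.2.1 (Φ a.1.1 (x ((s.insert a.1).insert a.2))) :=
      LinearMap.congr_fun (hΦ a.1.1 a.2.1) _
    simp only [← e, c, smul_smul, ← add_smul, ← pow_add]
    convert zero_smul R _
    simp only [KoszulIndex.insert]
    rcases lt_or_gt_of_ne (mem a).1 with h | h
    · rw [koszulExponent_insert_of_not_lt (not_lt.2 h.le),
        koszulExponent_insert_of_lt (mem a).2 h, ← add_assoc, pow_succ,
        add_comm (koszulExponent s.1 a.2.1)]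
      ring
    · rw [koszulExponent_insert_of_not_lt (not_lt.2 h.le),
        koszulExponent_insert_of_lt a.1.2 h, ← add_assoc, pow_succ,
        add_comm (koszulExponent s.1 a.2.1)]
      ring
  · rintro a - - h
    exact (mem a).1 (by simpa using congrArg (fun b => (b.1.1 : Fin q)) h)
  · intro a _
    simp
  · intro a _
    rfl

/-- The Koszul complex `K(Φ_1, …, Φ_q; T)` of commuting endomorphisms of an `R`-module `T`. -/
noncomputable def koszulComplex {R : Type*} [CommRing R] {T : Type*} [AddCommGroup T]
    [Module R T] {q : ℕ} (Φ : Fin q → Module.End R T) (hΦ : ∀ k l, Commute (Φ k) (Φ l)) :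
    ChainComplex (ModuleCat R) ℕ :=
  ChainComplex.of (fun p => ModuleCat.of R (KoszulIndex q p → T))
    (fun p => ModuleCat.ofHom (koszulDifferential Φ p))
    (fun p => by
      rw [← ModuleCat.ofHom_comp, koszulDifferential_comp Φ hΦ]
      rfl)

/-! ### The tensor product of the complexes `0 → F_k → F_k → 0` -/

/-- The endomorphism `1 ⊗ ⋯ ⊗ φ_k ⊗ ⋯ ⊗ 1` of `F_1 ⊗ ⋯ ⊗ F_q`. -/
noncomputable def tensorEnd {R : Type*} [CommRing R] {q : ℕ} {F : Fin q → Type*}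
    [∀ k, AddCommGroup (F k)] [∀ k, Module R (F k)] (φ : ∀ k, Module.End R (F k)) (k : Fin q) :
    Module.End R (⨂[R] k, F k) :=
  PiTensorProduct.map (Function.update (fun _ => LinearMap.id) k (φ k))

lemma tensorEnd_commute {R : Type*} [CommRing R] {q : ℕ} {F : Fin q → Type*}
    [∀ k, AddCommGroup (F k)] [∀ k, Module R (F k)] (φ : ∀ k, Module.End R (F k)) (k l : Fin q) :
    Commute (tensorEnd φ k) (tensorEnd φ l) := by
  show tensorEnd φ k ∘ₗ tensorEnd φ l = tensorEnd φ l ∘ₗ tensorEnd φ k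
  unfold tensorEnd
  rw [← PiTensorProduct.map_comp, ← PiTensorProduct.map_comp]
  congr 1
  funext i
  by_cases hk : i = k
  · subst hk
    by_cases hl : i = l
    · subst hl
      rfl
    · simp [Function.update_of_ne hl]
  · simp [Function.update_of_ne hk]

/-- The complex `K(φ_1) ⊗ ⋯ ⊗ K(φ_q)`, where `K(φ_k)` is the complex `0 → F_k → F_k → 0` with
differential `φ_k`, placed in homological degrees `1` and `0`.

The module in degree `p` of this `q`-fold tensor product is the direct sum, over all choices of a
degree `0` or `1` in each factor with total `p`, that is over all `p`-element sets
`s ⊆ {1, …, q}` (those factors which are taken in degree `1`), of `F_1 ⊗ ⋯ ⊗ F_q`. On the summand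
`s` the differential is, by the usual sign rule for tensor products of complexes,
`∑_{k ∈ s} (-1)^{#{i ∈ s | i < k}} 1 ⊗ ⋯ ⊗ φ_k ⊗ ⋯ ⊗ 1`, the `k`-th term having values in the
summand `s \ {k}`. So it is the Koszul complex of the endomorphisms `1 ⊗ ⋯ ⊗ φ_k ⊗ ⋯ ⊗ 1` of
`F_1 ⊗ ⋯ ⊗ F_q`. -/
noncomputable def tensorKoszulComplex {R : Type*} [CommRing R] {q : ℕ} {F : Fin q → Type*}
    [∀ k, AddCommGroup (F k)] [∀ k, Module R (F k)] (φ : ∀ k, Module.End R (F k)) :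
    ChainComplex (ModuleCat R) ℕ :=
  koszulComplex (tensorEnd φ) (tensorEnd_commute φ)

/-- All homology modules of the complex have finite length. -/
def HasFiniteLengthHomology {R : Type*} [CommRing R] (C : ChainComplex (ModuleCat R) ℕ) : Prop :=
  ∀ p, IsFiniteLength R (C.homology p)

/-- The Euler–Poincaré characteristic of a bounded complex whose homology has finite length: the
alternating sum of the lengths of its homology modules. -/
noncomputable def eulerPoincareChar {R : Type*} [CommRing R] (C : ChainComplex (ModuleCat R) ℕ) :
    ℤ :=
  ∑ᶠ p : ℕ, (-1) ^ p * ((Module.length R (C.homology p)).toNat : ℤ)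

/-! ### Products of symmetric powers, and joint reductions -/

/-- For a submodule `N` of `F_k`, its image in degree one of the symmetric algebra `S(F)` of
`F = F_1 ⊕ ⋯ ⊕ F_q`. The power `(symImage k N) ^ n` is the image `S_n(N)` in `S(F)` of the `n`-th
symmetric power of `N`. -/
noncomputable def symImage {R : Type*} [CommRing R] {q : ℕ} {F : Fin q → Type*}
    [∀ k, AddCommGroup (F k)] [∀ k, Module R (F k)] (k : Fin q) (N : Submodule R (F k)) :
    Submodule R (SymmetricAlgebra R (∀ k, F k)) :=
  N.map (SymmetricAlgebra.ι R (∀ k, F k) ∘ₗ LinearMap.single R F k)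

/-- The submodule `S_{n_1}(M_1) ⋯ S_{n_q}(M_q)` of `S(F)`, where `F = F_1 ⊕ ⋯ ⊕ F_q`. -/
noncomputable def symProd {R : Type*} [CommRing R] {q : ℕ} {F : Fin q → Type*}
    [∀ k, AddCommGroup (F k)] [∀ k, Module R (F k)] (M : ∀ k, Submodule R (F k)) (n : Fin q → ℕ) :
    Submodule R (SymmetricAlgebra R (∀ k, F k)) :=
  ∏ k, symImage k (M k) ^ n k

/-- `(B_1, …, B_q)` is a joint reduction of `(M_1, …, M_q)`, where `M_k` is a submodule of the free
module `F_k`: each `B_k ⊆ M_k` is generated by `rank F_k` elements, and for some `n` the submodule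
`S_{n+1}(M_1) ⋯ S_{n+1}(M_q)` of `S(F_1 ⊕ ⋯ ⊕ F_q)` is the sum over `k` of the submodules
`S_{n+1}(M_1) ⋯ B_k S_n(M_k) ⋯ S_{n+1}(M_q)`. -/
structure IsJointReduction {R : Type*} [CommRing R] {q : ℕ} {F : Fin q → Type*}
    [∀ k, AddCommGroup (F k)] [∀ k, Module R (F k)] (B M : ∀ k, Submodule R (F k)) : Prop where
  le : ∀ k, B k ≤ M k
  generated : ∀ k, ∃ b : Fin (Module.finrank R (F k)) → F k,
    Submodule.span R (Set.range b) = B k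
  equation : ∃ n : ℕ, symProd M (fun _ => n + 1) =
    ∑ k, symImage k (B k) * symProd M (Function.update (fun _ => n + 1) k n)

/-! ### The joint Buchsbaum–Rim polynomial and the mixed Buchsbaum–Rim multiplicity -/

/-- The joint Buchsbaum–Rim function: the length of
`S_{n_1}(F_1) ⋯ S_{n_q}(F_q) / S_{n_1}(M_1) ⋯ S_{n_q}(M_q)`. -/
noncomputable def jointBuchsbaumRimFunction {R : Type*} [CommRing R] {q : ℕ} {F : Fin q → Type*}
    [∀ k, AddCommGroup (F k)] [∀ k, Module R (F k)] (M : ∀ k, Submodule R (F k)) (n : Fin q → ℕ) :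
    ℕ∞ :=
  Module.length R (symProd (fun k => (⊤ : Submodule R (F k))) n ⧸
    (symProd M n).submoduleOf (symProd (fun k => (⊤ : Submodule R (F k))) n))

/-- The polynomial `p` with rational coefficients is the joint Buchsbaum–Rim polynomial of
`M_1, …, M_q`: for all sufficiently large `n_1, …, n_q`, the value of the joint Buchsbaum–Rim
function is finite and equal to `p(n_1, …, n_q)`. -/
def IsJointBuchsbaumRimPolynomial {R : Type*} [CommRing R] {q : ℕ} {F : Fin q → Type*}
    [∀ k, AddCommGroup (F k)] [∀ k, Module R (F k)] (M : ∀ k, Submodule R (F k))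
    (p : MvPolynomial (Fin q) ℚ) : Prop :=
  ∃ N : ℕ, ∀ n : Fin q → ℕ, (∀ k, N ≤ n k) →
    ∃ ℓ : ℕ, jointBuchsbaumRimFunction M n = (ℓ : ℕ∞) ∧
      MvPolynomial.eval (fun k => (n k : ℚ)) p = (ℓ : ℚ)

open Classical in
/-- The mixed Buchsbaum–Rim multiplicity `br(M_1 | ⋯ | M_q)`: the number `r_1! ⋯ r_q!` times the
coefficient of `n_1^{r_1} ⋯ n_q^{r_q}` in the joint Buchsbaum–Rim polynomial, where `r_k` is the
rank of `F_k`. -/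
noncomputable def mixedBuchsbaumRimMultiplicity {R : Type*} [CommRing R] {q : ℕ}
    {F : Fin q → Type*} [∀ k, AddCommGroup (F k)] [∀ k, Module R (F k)]
    (M : ∀ k, Submodule R (F k)) : ℚ :=
  if h : ∃ p, IsJointBuchsbaumRimPolynomial M p then
    (∏ k, ((Module.finrank R (F k)).factorial : ℚ)) *
      h.choose.coeff (Finsupp.equivFunOnFinite.symm fun k => Module.finrank R (F k))
  else 0

/-! Write S for the polynomial ring S(F), graded by ℤ^d, on which the columns of a matrix of φ_k act
as linear forms of degree e_k. For commuting homogeneous operators x_1, …, x_s on a graded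
subquotient N, a multiplicity symbol is defined recursively: [x_1, …, x_s | N] is [x_2, …, x_s | N /
x_1 N] minus the degree-shifted [x_2, …, x_s | (0 :_N x_1)], and for the empty list it is the length
of N in each degree. The symbol behaves well as soon as every subquotient killed by all x_i has
finite length in large degrees. It is additive in N, independent of the order of the operators, zero
in large degrees if those subquotients vanish there, and an iterated difference of the length
function if N itself has finite length. These are formal facts about modular lattices
(`LatOp.Additive.act`, `LatOp.act_comm`, `LatOp.Additive.symb_eq_of_mem`).

The theorem follows by computing the symbol of all columns on S in large degrees in two ways. Let A
be the subalgebra of S generated by the M_k. A subquotient of A killed by a joint reduction vanishes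
in large degrees, so only S / A contributes, and the symbol is the difference of the length function
of S / A taken r_k times in each direction e_k (`IsReduction.famSymb_eq`). The same argument with
full generating systems of one M_k and one F_k shows that enough differences in one direction
annihilate the length function, which is therefore eventually polynomial (`exists_backDiff_eq_zero`,
`exists_mvPolynomial_famLength`).

On the other side, let φ be a square matrix of size r and E a finitely generated module on which the
lengths involved are finite. The symbol of the r columns of φ on E[T_1, …, T_r] is, in large
degrees, the length of the cokernel minus the length of the kernel of φ on E^r
(`polSymb_eq_matSymb`). Dévissage reduces this to E = R / P. If det φ lies in P, both sides vanish.
Otherwise E is a domain, and the cokernel of φ on forms of degree m has length C(m + r - 1, r) times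
that of coker φ (`subLength_eq`), whose r-th difference is the length of coker φ. Applied block by
block, with the degrees sent to infinity one after another, this exchanges the columns of φ_k in
large degree for the single operator φ_k in degree one (`famSymb_columns_eq`). There remains the
symbol of φ_1, …, φ_d on the part of degree (1, …, 1), which is F_1 ⊗ ⋯ ⊗ F_d. By the long exact
homology sequence of a cone it is the Euler–Poincaré characteristic of the Koszul complex
(`altSum_koszulLength`).

All finiteness in this second computation comes from the determinants of the φ_k, which generate an
ideal of finite colength (`length_quotient_detIdeal_ne_top`). So the iterated difference of the
polynomial is the constant χ, and comparing coefficients gives the formula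
(`coeff_of_polyBackDiff_const`). -/

open Filter
/-! ### Euler symbols of operators on modular lattices -/

/-- An operator on a lattice `L` (direct and inverse image), with a shift of the value group. -/
structure LatOp (L Γ : Type*) [AddCommGroup Γ] where
  push : L → L
  pull : L → L
  shift : Γ →+ Γ

namespace LatOp

variable {L Γ : Type*} [Lattice L] [AddCommGroup Γ]

/-- The Euler difference `ψ(N / xN) - ψ(0 :_N x)` for the interval `N = V / U`. -/
def act (x : LatOp L Γ) (ψ : L → L → Γ) (U V : L) : Γ :=
  ψ (U ⊔ x.push V) V - x.shift (ψ U (V ⊓ x.pull U))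

/-- The iterated Euler difference of a list of operators. -/
def symb : List (LatOp L Γ) → (L → L → Γ) → L → L → Γ
  | [], ψ => ψ
  | x :: l, ψ => x.act (symb l ψ)

/-- The identities satisfied by direct and inverse images along an endomorphism that preserves all
elements of the lattice. -/
structure Good (x : LatOp L Γ) : Prop where
  gc : GaloisConnection x.push x.pull
  push_le : ∀ U, x.push U ≤ U
  push_inf_pull : ∀ U V, x.push (V ⊓ x.pull U) = x.push V ⊓ U
  pull_sup_push : ∀ U V, x.pull (U ⊔ x.push V) = x.pull U ⊔ V

lemma Good.le_pull {x : LatOp L Γ} (hx : x.Good) (U : L) : U ≤ x.pull U :=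
  hx.gc.le_u (hx.push_le U)

/-- Two operators commute. -/
structure Comm (x y : LatOp L Γ) : Prop where
  push : ∀ U, x.push (y.push U) = y.push (x.push U)
  pull : ∀ U, x.pull (y.pull U) = y.pull (x.pull U)
  shift : ∀ a, x.shift (y.shift a) = y.shift (x.shift a)

/-- A family of pairwise commuting operators. -/
structure System (Y : Set (LatOp L Γ)) : Prop where
  good : ∀ x ∈ Y, x.Good
  comm : ∀ x ∈ Y, ∀ y ∈ Y, x.Comm y

/-- A class of intervals that is closed under subintervals. -/
def Hereditary (C : L → L → Prop) : Prop :=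
  ∀ ⦃U V⦄, C U V → ∀ ⦃U' V'⦄, U ≤ U' → U' ≤ V' → V' ≤ V → C U' V'

/-- The intervals all of whose subintervals killed by `x` are in `C`. -/
def kill (x : LatOp L Γ) (C : L → L → Prop) (U V : L) : Prop :=
  ∀ U' V', U ≤ U' → U' ≤ V' → V' ≤ V → x.push V' ≤ U' → C U' V'

/-- The intervals all of whose subintervals killed by all operators of the list are in `C`. -/
def kills (l : List (LatOp L Γ)) (C : L → L → Prop) (U V : L) : Prop :=
  ∀ U' V', U ≤ U' → U' ≤ V' → V' ≤ V → (∀ x ∈ l, x.push V' ≤ U') → C U' V'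

/-- A function on intervals which is additive on the class `C` and compatible with the isomorphism
theorems for the identity and for the operators in `Y`. -/
structure Additive (Y : Set (LatOp L Γ)) (C : L → L → Prop) (ψ : L → L → Γ) : Prop where
  add : ∀ U W V, U ≤ W → W ≤ V → C U V → ψ U V = ψ U W + ψ W V
  inf_sup : ∀ U V, C (U ⊓ V) V → C U (U ⊔ V) → ψ (U ⊓ V) V = ψ U (U ⊔ V)
  iso : ∀ y ∈ Y, ∀ U V, C (V ⊓ y.pull U) V → C U (U ⊔ y.push V) →
    ψ U (U ⊔ y.push V) = y.shift (ψ (V ⊓ y.pull U) V)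

lemma kills_hereditary (l : List (LatOp L Γ)) (C : L → L → Prop) : Hereditary (kills l C) :=
  fun _ _ h _ _ h1 _ h3 U' V' h1' h2' h3' hx =>
    h U' V' (h1.trans h1') h2' (h3'.trans h3) hx

/-- Being killed by x passes to subintervals, so the condition for a list can be imposed one
operator at a time. Inductions over lists of operators rest on this. -/
lemma kills_cons_iff {x : LatOp L Γ} (hx : x.Good) {l : List (LatOp L Γ)}
    {C : L → L → Prop} {U V : L} :
    kills (x :: l) C U V ↔ x.kill (kills l C) U V := by
  constructor
  · intro h U' V' h1 h2 h3 hk U'' V'' h1' h2' h3' hk'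
    refine h U'' V'' (h1.trans h1') h2' (h3'.trans h3) ?_
    intro y hy
    rcases List.mem_cons.1 hy with rfl | hy
    · exact (hx.gc.monotone_l h3').trans (hk.trans h1')
    · exact hk' y hy
  · intro h U' V' h1 h2 h3 hk
    exact h U' V' h1 h2 h3 (hk x (by simp)) U' V' le_rfl h2 le_rfl
      fun y hy => hk y (by simp [hy])

lemma kills_mono {l l' : List (LatOp L Γ)} {C : L → L → Prop} {U V : L}
    (hl : ∀ x ∈ l, x ∈ l') (h : kills l C U V) : kills l' C U V :=
  fun U' V' h1 h2 h3 hk => h U' V' h1 h2 h3 fun x hx => hk x (hl x hx)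

/-- For N = V / U, both N / xN and (0 :_N x) are killed by x. This lemma and the next say that `act`
evaluates its argument only on intervals controlled by `kill`, so N itself need not lie in the
class. -/
lemma kill_top {x : LatOp L Γ} (hx : x.Good) {C : L → L → Prop} {U V : L} (hUV : U ≤ V)
    (h : x.kill C U V) : C (U ⊔ x.push V) V :=
  h _ _ le_sup_left (sup_le hUV (hx.push_le V)) le_rfl le_sup_right

lemma kill_bot {x : LatOp L Γ} (hx : x.Good) {C : L → L → Prop} {U V : L} (hUV : U ≤ V)
    (h : x.kill C U V) : C U (V ⊓ x.pull U) :=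
  h _ _ le_rfl (le_inf hUV (hx.le_pull U)) inf_le_left
    ((hx.gc.monotone_l inf_le_right).trans (hx.gc.l_u_le U))

variable {Y : Set (LatOp L Γ)} {C : L → L → Prop} {ψ : L → L → Γ}

lemma Additive.congr_class (h : Additive Y C ψ) {C' : L → L → Prop} 
    (hC : ∀ U V, U ≤ V → C' U V → C U V) : Additive Y C' ψ where
  add U W V h1 h2 h3 := h.add U W V h1 h2 (hC _ _ (h1.trans h2) h3)
  inf_sup U V h1 h2 := h.inf_sup U V (hC _ _ inf_le_right h1) (hC _ _ le_sup_left h2)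
  iso y hy U V h1 h2 := h.iso y hy U V (hC _ _ inf_le_left h1) (hC _ _ le_sup_left h2)

/-- On an interval in the class the Euler difference is the difference operator of the shift. -/
theorem Additive.act_eq_of_mem (hC : Hereditary C) (h : Additive Y C ψ) {x : LatOp L Γ}
    (hx : x.Good) (hxY : x ∈ Y) {U V : L} (hUV : U ≤ V) (hc : C U V) :
    x.act ψ U V = ψ U V - x.shift (ψ U V) := by
  have hxV := hx.push_le V
  have h1 := h.add U (U ⊔ x.push V) V le_sup_left (sup_le hUV hxV) hc
  have h2 := h.add U (V ⊓ x.pull U) V (le_inf hUV (hx.le_pull U)) inf_le_left hc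
  -- With N = V / U, the operator identifies N / (0 :_N x) with xN up to the shift. These two terms
  -- cancel and only N and its shift remain.
  have h3 := h.iso x hxY U V (hC hc (le_inf hUV (hx.le_pull U)) inf_le_left le_rfl)
    (hC hc le_rfl le_sup_left (sup_le hUV hxV))
  have h4 := congrArg x.shift h2
  rw [map_add] at h4
  rw [LatOp.act, h4, h1, h3]
  abel

variable {l l' : List (LatOp L Γ)}

/-- The symbol only depends on the values on the subintervals killed by all operators. -/
theorem symb_congr {ψ ψ' : L → L → Γ} (hl : ∀ x ∈ l, x.Good) {U V : L} (hUV : U ≤ V)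
    (h : ∀ U' V', U ≤ U' → U' ≤ V' → V' ≤ V → (∀ x ∈ l, x.push V' ≤ U') → ψ U' V' = ψ' U' V') :
    symb l ψ U V = symb l ψ' U V := by
  induction l generalizing U V with
  | nil => exact h U V le_rfl hUV le_rfl (by simp)
  | cons x l ih =>
    have hl' := fun y hy => hl y (List.mem_cons_of_mem _ hy)
    have hx : x.Good := hl x (by simp)
    simp only [symb, LatOp.act]
    rw [ih hl' (sup_le hUV (hx.push_le V)), ih hl' (le_inf hUV (hx.le_pull U))]
    · intro U' V' h1 h2 h3 hk
      refine h U' V' h1 h2 (h3.trans inf_le_left) (List.forall_mem_cons.2 ⟨?_, hk⟩)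
      exact (hx.gc.monotone_l (h3.trans inf_le_right)).trans ((hx.gc.l_u_le U).trans h1)
    · intro U' V' h1 h2 h3 hk
      refine h U' V' (le_sup_left.trans h1) h2 h3 (List.forall_mem_cons.2 ⟨?_, hk⟩)
      exact (hx.gc.monotone_l h3).trans (le_sup_right.trans h1)

/-- The symbol sees only the values on killed subintervals, so the function can be replaced by zero
everywhere. -/
theorem symb_eq_zero (hl : ∀ x ∈ l, x.Good) {U V : L} (hUV : U ≤ V)
    (h : ∀ U' V', U ≤ U' → U' ≤ V' → V' ≤ V → (∀ x ∈ l, x.push V' ≤ U') → ψ U' V' = 0) :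
    symb l ψ U V = 0 := by
  rw [symb_congr (ψ' := fun _ _ => 0) hl hUV h]
  clear h hl hUV
  induction l generalizing U V with
  | nil => rfl
  | cons x l ih => simp [symb, LatOp.act, ih]

lemma symb_append (l l' : List (LatOp L Γ)) (ψ : L → L → Γ) :
    symb (l ++ l') ψ = symb l (symb l' ψ) := by
  induction l with
  | nil => rfl
  | cons x l ih => simp [symb, ih]

/-- Comparison of symbols in two lattices. -/
theorem symb_rel {L' Γ' : Type*} [Lattice L'] [AddCommGroup Γ'] {ψ : L → L → Γ}
    {ψ' : L' → L' → Γ'} (P : L → L → L' → L' → Prop) (Q : Γ → Γ' → Prop)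
    (hQ : ∀ a a' b b', Q a a' → Q b b' → Q (a - b) (a' - b'))
    {l : List (LatOp L Γ)} {l' : List (LatOp L' Γ')}
    (hl : List.Forall₂ (fun x x' => (∀ a a', Q a a' → Q (x.shift a) (x'.shift a')) ∧
      ∀ U V U' V', P U V U' V' → P (U ⊔ x.push V) V (U' ⊔ x'.push V') V' ∧
        P U (V ⊓ x.pull U) U' (V' ⊓ x'.pull U')) l l')
    (hψ : ∀ U V U' V', P U V U' V' → Q (ψ U V) (ψ' U' V'))
    {U V : L} {U' V' : L'} (h : P U V U' V') : Q (symb l ψ U V) (symb l' ψ' U' V') := by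
  -- An Euler difference forms two new intervals, one shift and one difference. Relations compatible
  -- with these operations therefore propagate along the lists.
  induction hl generalizing U V U' V' with
  | nil => exact hψ _ _ _ _ h
  | cons hx _ ih =>
    exact hQ _ _ _ _ (ih (hx.2 _ _ _ _ h).1) (hx.1 _ _ (ih (hx.2 _ _ _ _ h).2))

variable [IsModularLattice L]

lemma inf_sup_of_le {a b c : L} (h : b ≤ a) : a ⊓ (b ⊔ c) = b ⊔ a ⊓ c := by
  rw [inf_comm, sup_inf_assoc_of_le _ h, inf_comm]

/-- The Euler difference of an additive function is additive. -/
theorem Additive.act (hY : System Y) (h : Additive Y C ψ)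
    {x : LatOp L Γ} (hxY : x ∈ Y) : Additive Y (x.kill C) (x.act ψ) := by
  have hx := hY.good x hxY
  have mono := hx.gc.monotone_l
  have pmono := hx.gc.monotone_u
  refine ⟨?_, ?_, ?_⟩
  -- Additivity is the snake lemma for x on 0 → N' → N → N'' → 0 with N' = W / U, N = V / U, N'' = V
  -- / W. First N / xN is split into N'' / xN'' and the image of N'.
  · intro U W V hUW hWV hc
    have kC : ∀ {U' V'}, U ≤ U' → U' ≤ V' → V' ≤ V → x.push V' ≤ U' → C U' V' :=
      fun h1 h2 h3 h4 => hc _ _ h1 h2 h3 h4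
    have hxW : x.push W ≤ W := hx.push_le W
    have hxV : x.push V ≤ V := hx.push_le V
    have hUV := hUW.trans hWV
    simp only [LatOp.act]
    have e1 : ψ (U ⊔ x.push V) V = ψ (U ⊔ x.push V) (W ⊔ x.push V) + ψ (W ⊔ x.push V) V :=
      h.add _ _ _ (sup_le_sup_right hUW _) (sup_le hWV hxV)
        (kC le_sup_left (sup_le hUV hxV) le_rfl le_sup_right)
    have e2 : ψ ((U ⊔ x.push V) ⊓ W) W = ψ (U ⊔ x.push V) (W ⊔ x.push V) := by
      have : (U ⊔ x.push V) ⊔ W = W ⊔ x.push V := by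
        rw [sup_right_comm, sup_eq_right.2 hUW]
      rw [← this]
      refine h.inf_sup _ _ ?_ ?_
      · exact kC (le_inf le_sup_left hUW) inf_le_right hWV
          (le_inf ((mono hWV).trans le_sup_right) hxW)
      · rw [this]
        exact kC le_sup_left (sup_le_sup_right hUW _) (sup_le hWV hxV)
          ((mono (sup_le hWV hxV)).trans le_sup_right)
    -- The kernel of N' / xN' → N / xN is (N' ∩ xN) / xN'.
    have hIW : U ⊔ x.push W ≤ (U ⊔ x.push V) ⊓ W :=
      le_inf (sup_le_sup_left (mono hWV) _) (sup_le hUW hxW)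
    have e3 : ψ (U ⊔ x.push W) W =
        ψ (U ⊔ x.push W) ((U ⊔ x.push V) ⊓ W) + ψ ((U ⊔ x.push V) ⊓ W) W :=
      h.add _ _ _ hIW inf_le_right (kC le_sup_left (sup_le hUW hxW) hWV le_sup_right)
    have killU : x.push (V ⊓ x.pull U) ≤ U := (mono inf_le_right).trans (hx.gc.l_u_le U)
    have killW : x.push (V ⊓ x.pull W) ≤ W := (mono inf_le_right).trans (hx.gc.l_u_le W)
    have lU : U ≤ V ⊓ x.pull U := le_inf hUV (hx.le_pull U)
    have lW : W ≤ V ⊓ x.pull W := le_inf hWV (hx.le_pull W)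
    -- Dually, (0 :_N x) splits into (0 :_{N'} x) and its image in (0 :_{N''} x).
    have f1 : ψ U (V ⊓ x.pull U) = ψ U (W ⊓ x.pull U) + ψ (W ⊓ x.pull U) (V ⊓ x.pull U) :=
      h.add _ _ _ (le_inf hUW (hx.le_pull U)) (inf_le_inf_right _ hWV)
        (kC le_rfl lU inf_le_left killU)
    have f2 : ψ (W ⊓ x.pull U) (V ⊓ x.pull U) = ψ W (W ⊔ V ⊓ x.pull U) := by
      have : W ⊓ x.pull U = W ⊓ (V ⊓ x.pull U) := by rw [← inf_assoc, inf_eq_left.2 hWV]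
      rw [this]
      refine h.inf_sup _ _ ?_ ?_
      · rw [← this]
        exact kC (le_inf hUW (hx.le_pull U)) (inf_le_inf_right _ hWV) inf_le_left
          (killU.trans (le_inf hUW (hx.le_pull U)))
      · refine kC hUW le_sup_left (sup_le hWV inf_le_left) ?_
        rw [hx.gc.l_sup]
        exact sup_le hxW (killU.trans hUW)
    have hle : W ⊔ V ⊓ x.pull U ≤ V ⊓ x.pull W := sup_le lW (inf_le_inf_left _ (pmono hUW))
    have f3 : ψ W (V ⊓ x.pull W) = ψ W (W ⊔ V ⊓ x.pull U) + ψ (W ⊔ V ⊓ x.pull U) (V ⊓ x.pull W) :=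
      h.add _ _ _ le_sup_left hle (kC hUW lW inf_le_left killW)
    -- The connecting map: x carries the cokernel of (0 :_N x) → (0 :_{N''} x) isomorphically onto
    -- the kernel of N' / xN' → N / xN. The two defects differ by the shift and cancel.
    have g : ψ (U ⊔ x.push W) ((U ⊔ x.push V) ⊓ W) =
        x.shift (ψ (W ⊔ V ⊓ x.pull U) (V ⊓ x.pull W)) := by
      have a1 : (U ⊔ x.push V) ⊓ W = (U ⊔ x.push W) ⊔ x.push (V ⊓ x.pull W) := by
        rw [hx.push_inf_pull, sup_inf_assoc_of_le _ hUW, sup_assoc,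
          sup_eq_right.2 (le_inf (mono hWV) hxW)]
      have a2 : W ⊔ V ⊓ x.pull U = (V ⊓ x.pull W) ⊓ x.pull (U ⊔ x.push W) := by
        rw [hx.pull_sup_push, inf_assoc, inf_eq_right.2 (sup_le (pmono hUW) (hx.le_pull W)),
          sup_comm (x.pull U), inf_sup_of_le hWV]
      rw [a1, a2]
      refine h.iso x hxY _ _ ?_ ?_
      · rw [← a2]
        exact kC (hUW.trans le_sup_left) hle inf_le_left (killW.trans le_sup_left)
      · rw [← a1]
        exact kC le_sup_left hIW (inf_le_right.trans hWV) ((mono inf_le_right).trans le_sup_right)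
    rw [e1, e3, ← e2, f1, f3, f2, g]
    simp only [map_add]
    abel
  -- Direct and inverse images are compatible with V / (U ∩ V) ≅ (U + V) / U, so this isomorphism
  -- restricts to the two intervals in the Euler difference.
  · intro U V h1 h2
    simp only [LatOp.act]
    have hxV : x.push V ≤ V := hx.push_le V
    have i1 : ((U ⊔ x.push V) ⊓ V) = U ⊓ V ⊔ x.push V := by
      rw [inf_comm, sup_comm U, inf_sup_of_le hxV, inf_comm, sup_comm]
    have i2 : (U ⊔ x.push V) ⊔ V = U ⊔ V := by rw [sup_assoc, sup_eq_right.2 hxV]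
    have i3 : U ⊔ x.push (U ⊔ V) = U ⊔ x.push V := by
      rw [hx.gc.l_sup, ← sup_assoc, sup_eq_left.2 (hx.push_le U)]
    have i4 : V ⊓ x.pull (U ⊓ V) = V ⊓ x.pull U := by
      rw [hx.gc.u_inf, inf_comm (x.pull U), ← inf_assoc, inf_eq_left.2 (hx.le_pull V)]
    have i5 : (U ⊔ V) ⊓ x.pull U = U ⊔ V ⊓ x.pull U := sup_inf_assoc_of_le _ (hx.le_pull U)
    have i6 : U ⊓ (V ⊓ x.pull U) = U ⊓ V := by
      rw [← inf_assoc, inf_eq_left.2 (inf_le_left.trans (hx.le_pull U))]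
    congr 1
    · rw [← i1, i3, ← i2]
      refine h.inf_sup _ _ ?_ ?_
      · rw [i1]; exact kill_top hx inf_le_right h1
      · rw [i2, ← i3]; exact kill_top hx le_sup_left h2
    · congr 1
      rw [i4, i5, ← i6]
      refine h.inf_sup _ _ ?_ ?_
      · rw [i6, ← i4]; exact kill_bot hx inf_le_right h1
      · rw [← i5]; exact kill_bot hx le_sup_left h2
  -- The isomorphism induced by y commutes with x and hence carries N / xN and (0 :_N x) to the
  -- corresponding intervals of the image.
  · intro y hyY U V h1 h2
    have hy := hY.good y hyY
    have hxy := hY.comm x hxY y hyY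
    simp only [LatOp.act]
    have i1 : U ⊔ x.push (U ⊔ y.push V) = U ⊔ y.push (x.push V) := by
      rw [hx.gc.l_sup, ← sup_assoc, sup_eq_left.2 (hx.push_le U), hxy.push]
    have i2 : U ⊔ y.push V = (U ⊔ y.push (x.push V)) ⊔ y.push V := by
      rw [sup_assoc, sup_eq_right.2 (hy.gc.monotone_l (hx.push_le V))]
    have i3 : V ⊓ y.pull (U ⊔ y.push (x.push V)) = V ⊓ y.pull U ⊔ x.push V := by
      rw [hy.pull_sup_push, sup_comm, inf_sup_of_le (hx.push_le V), sup_comm]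
    have i4 : (U ⊔ y.push V) ⊓ x.pull U = U ⊔ y.push (V ⊓ x.pull (y.pull U)) := by
      rw [sup_inf_assoc_of_le _ (hx.le_pull U), hxy.pull, hy.push_inf_pull]
    have i5 : V ⊓ x.pull (y.pull U) ⊓ y.pull U = V ⊓ y.pull U := by
      rw [inf_assoc, inf_eq_right.2 (hx.le_pull _)]
    have i6 : V ⊓ x.pull (V ⊓ y.pull U) = V ⊓ x.pull (y.pull U) := by
      rw [hx.gc.u_inf, ← inf_assoc, inf_eq_left.2 (hx.le_pull V)]
    rw [map_sub, ← hxy.shift]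
    congr 1
    · rw [i1, i2, ← i3]
      refine h.iso y hyY _ _ ?_ ?_
      · rw [i3]; exact kill_top hx inf_le_left h1
      · rw [← i2, ← i1]; exact kill_top hx le_sup_left h2
    · congr 1
      rw [i4, i6, ← i5]
      refine h.iso y hyY _ _ ?_ ?_
      · rw [i5, ← i6]; exact kill_bot hx inf_le_left h1
      · rw [← i4]; exact kill_bot hx le_sup_left h2

/-- Each operator relaxes the condition for additivity from an interval to its subintervals killed
by that operator, so a list only requires control of subintervals killed by all its members. -/
theorem Additive.symb (hY : System Y) (h : Additive Y C ψ)
    {l : List (LatOp L Γ)} (hl : ∀ x ∈ l, x ∈ Y) : Additive Y (kills l C) (symb l ψ) := by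
  induction l with
  | nil => exact h.congr_class fun U V hUV hk => hk U V le_rfl hUV le_rfl (by simp)
  | cons x l ih =>
    have hx : x ∈ Y := hl x (by simp)
    exact ((ih fun y hy => hl y (by simp [hy])).act hY hx).congr_class
      fun U V _ => (kills_cons_iff (hY.good x hx)).1

/-- Euler differences with respect to two commuting operators commute. -/
theorem act_comm (hY : System Y) (h : Additive Y C ψ) {x y : LatOp L Γ}
    (hxY : x ∈ Y) (hyY : y ∈ Y) {U V : L} (hUV : U ≤ V) (hc : kills [x, y] C U V) :
    x.act (y.act ψ) U V = y.act (x.act ψ) U V := by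
  -- both sides are rewritten into an expression which is symmetric in the two operators
  suffices key : ∀ x ∈ Y, ∀ y ∈ Y, kills [x, y] C U V → x.act (y.act ψ) U V =
      ψ (U ⊔ x.push V ⊔ y.push V) V
      - ψ (U ⊔ x.push (y.push V)) ((U ⊔ x.push V) ⊓ (U ⊔ y.push V))
      - x.shift (ψ (U ⊔ y.push (V ⊓ x.pull U)) (V ⊓ x.pull U))
      - y.shift (ψ (U ⊔ x.push (V ⊓ y.pull U)) (V ⊓ y.pull U))
      + x.shift (y.shift (ψ (V ⊓ x.pull U ⊔ V ⊓ y.pull U) (V ⊓ x.pull (y.pull U))))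
      + x.shift (y.shift (ψ U (V ⊓ x.pull U ⊓ y.pull U))) by
    have hxy := hY.comm x hxY y hyY
    rw [key x hxY y hyY hc, key y hyY x hxY (kills_mono (by simp) hc), hxy.push, hxy.pull,
      hxy.shift, hxy.shift, sup_right_comm, inf_comm (U ⊔ x.push V), sup_comm (V ⊓ x.pull U),
      inf_right_comm V]
    abel
  clear hxY hyY hc x y
  intro x hxY y hyY hc
  have hx := hY.good x hxY
  have hy := hY.good y hyY
  have hxy := hY.comm x hxY y hyY
  have xm := hx.gc.monotone_l
  have ym := hy.gc.monotone_l
  have kC : ∀ {U' V'}, U ≤ U' → U' ≤ V' → V' ≤ V → x.push V' ≤ U' → y.push V' ≤ U' → C U' V' :=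
    fun h1 h2 h3 h4 h5 => hc _ _ h1 h2 h3 (by simp [h4, h5])
  have hxV := hx.push_le V
  have hyV := hy.push_le V
  have lxU := hx.le_pull U
  have lyU := hy.le_pull U
  -- With N = V / U: A / U is (0 :_N y), A' is the preimage in V of (0 :_{N/xN} y), and D / U is (0
  -- :_N xy).
  set A := V ⊓ y.pull U with hA
  set A' := V ⊓ y.pull (U ⊔ x.push V) with hA'
  set D := V ⊓ x.pull (y.pull U) with hD
  have UA : U ≤ A := le_inf hUV lyU
  have yA : y.push A ≤ U := (ym inf_le_right).trans (hy.gc.l_u_le U)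
  have yA' : y.push A' ≤ U ⊔ x.push V := (ym inf_le_right).trans (hy.gc.l_u_le _)
  have AA' : A ≤ A' := inf_le_inf_left _ (hy.gc.monotone_u le_sup_left)
  have XA' : U ⊔ x.push V ≤ A' := le_inf (sup_le hUV hxV) (hy.le_pull _)
  have xyD : x.push (y.push D) ≤ U := by
    rw [hxy.push]
    exact (ym ((xm inf_le_right).trans (hx.gc.l_u_le _))).trans (hy.gc.l_u_le U)
  have AD : A ≤ D := le_inf inf_le_left (inf_le_right.trans (hx.le_pull _))
  have xD : x.push D ≤ A :=
    le_inf ((hx.push_le _).trans inf_le_left) ((xm inf_le_right).trans (hx.gc.l_u_le _))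
  have BD : V ⊓ x.pull U ≤ D := inf_le_inf_left _ (hx.gc.monotone_u lyU)
  have yD : y.push D ≤ V ⊓ x.pull U := by
    refine le_inf ((hy.push_le _).trans inf_le_left) ?_
    rw [hD, hxy.pull]
    exact (ym inf_le_right).trans (hy.gc.l_u_le _)
  -- the first correction term
  have p1 : ψ (U ⊔ x.push V) A' = ψ (U ⊔ x.push V) (A ⊔ x.push V) + ψ (A ⊔ x.push V) A' :=
    h.add _ _ _ (sup_le_sup_right UA _) (sup_le AA' (le_sup_right.trans XA'))
      (kC le_sup_left XA' inf_le_left ((xm inf_le_left).trans le_sup_right) yA')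
  have p2 : ψ ((U ⊔ x.push V) ⊓ A) A = ψ (U ⊔ x.push V) (A ⊔ x.push V) := by
    have : (U ⊔ x.push V) ⊔ A = A ⊔ x.push V := by rw [sup_right_comm, sup_eq_right.2 UA]
    rw [← this]
    refine h.inf_sup _ _ ?_ ?_
    · exact kC (le_inf le_sup_left UA) inf_le_right inf_le_left
        (le_inf ((xm inf_le_left).trans le_sup_right) (hx.push_le A))
        (yA.trans (le_inf le_sup_left UA))
    · rw [this]
      refine kC le_sup_left (sup_le_sup_right UA _) (sup_le inf_le_left hxV)
        ((xm (sup_le inf_le_left hxV)).trans le_sup_right) ?_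
      exact (ym (sup_le AA' (le_sup_right.trans XA'))).trans yA'
  have p3 : ψ (U ⊔ x.push A) A =
      ψ (U ⊔ x.push A) ((U ⊔ x.push V) ⊓ A) + ψ ((U ⊔ x.push V) ⊓ A) A :=
    h.add _ _ _ (le_inf (sup_le_sup_left (xm inf_le_left) _) (sup_le UA (hx.push_le A)))
      inf_le_right (kC le_sup_left (sup_le UA (hx.push_le A)) inf_le_left le_sup_right
        (yA.trans le_sup_left))
  -- Multiplication by y maps A' / (A + xV) isomorphically onto (xN ∩ yN) / xyN, a quotient
  -- symmetric in x and y.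
  have p4 : y.shift (ψ (A ⊔ x.push V) A') =
      ψ (U ⊔ x.push (y.push V)) ((U ⊔ x.push V) ⊓ (U ⊔ y.push V)) := by
    have a1 : (U ⊔ x.push V) ⊓ (U ⊔ y.push V) = (U ⊔ y.push (x.push V)) ⊔ y.push A' := by
      rw [hy.push_inf_pull, inf_comm, sup_inf_assoc_of_le _ le_sup_left, sup_assoc,
        sup_eq_right.2 (le_inf (ym hxV) ((hy.push_le _).trans le_sup_right))]
    have a2 : A ⊔ x.push V = A' ⊓ y.pull (U ⊔ y.push (x.push V)) := by
      rw [hy.pull_sup_push, inf_assoc, inf_eq_right.2 (sup_le (hy.gc.monotone_u le_sup_left)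
        (le_sup_right.trans (hy.le_pull _))), sup_comm (y.pull U), inf_sup_of_le hxV, sup_comm]
    rw [a1, a2, hxy.push]
    refine (h.iso y hyY _ _ ?_ ?_).symm
    · rw [← a2]
      exact kC (UA.trans le_sup_left) (sup_le AA' (le_sup_right.trans XA')) inf_le_left
        ((xm inf_le_left).trans le_sup_right) (yA'.trans (sup_le_sup_right UA _))
    · rw [← a1]
      refine kC le_sup_left ?_ (inf_le_left.trans (sup_le hUV hxV)) ?_ ?_
      · exact le_inf (sup_le_sup_left (hy.push_le _) _) (sup_le_sup_left (ym hxV) _)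
      · refine (xm inf_le_right).trans ?_
        rw [hx.gc.l_sup, hxy.push]
        exact sup_le_sup_right (hx.push_le U) _
      · refine (ym inf_le_left).trans ?_
        rw [hy.gc.l_sup]
        exact sup_le_sup_right (hy.push_le U) _
  -- the second correction term
  have p5 : ψ (U ⊔ x.push A) ((U ⊔ x.push V) ⊓ A) = x.shift (ψ (V ⊓ x.pull U ⊔ A) D) := by
    have a1 : (U ⊔ x.push V) ⊓ A = (U ⊔ x.push A) ⊔ x.push D := by
      have : x.push D = x.push V ⊓ A := by
        rw [← hx.push_inf_pull, hA, hx.gc.u_inf, ← inf_assoc, inf_eq_left.2 (hx.le_pull V)]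
      rw [this, sup_inf_assoc_of_le _ UA, sup_assoc,
        sup_eq_right.2 (le_inf (xm inf_le_left) (hx.push_le A))]
    have a2 : V ⊓ x.pull U ⊔ A = D ⊓ x.pull (U ⊔ x.push A) := by
      rw [hx.pull_sup_push, sup_comm (x.pull U), inf_sup_of_le AD, hD, inf_assoc,
        inf_eq_right.2 (hx.gc.monotone_u lyU), sup_comm]
    rw [a1, a2]
    -- Here x maps D modulo (0 :_N x) + (0 :_N y) isomorphically onto (xN ∩ (0 :_N y)) / x(0 :_N y).
    -- The source is again symmetric in the two operators.
    refine h.iso x hxY _ _ ?_ ?_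
    · rw [← a2]
      exact kC (UA.trans le_sup_right) (sup_le BD AD) inf_le_left (xD.trans le_sup_right)
        (yD.trans le_sup_left)
    · rw [← a1]
      refine kC le_sup_left ?_ (inf_le_right.trans inf_le_left) ((xm inf_le_right).trans le_sup_right)
        ((ym inf_le_right).trans (yA.trans le_sup_left))
      exact le_inf (sup_le_sup_left (xm inf_le_left) _) (sup_le UA (hx.push_le A))
  simp only [LatOp.act]
  rw [← hA', p1, ← p2, eq_sub_of_add_eq' p3.symm, p5, map_add, map_sub, p4, ← hxy.shift, map_sub]
  abel

/-- The symbol does not depend on the order of the operators. -/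
theorem symb_perm (hY : System Y) (h : Additive Y C ψ)
    (hl : ∀ x ∈ l, x ∈ Y) (hp : l.Perm l') {U V : L} (hUV : U ≤ V) (hc : kills l C U V) :
    symb l ψ U V = symb l' ψ U V := by
  induction hp generalizing U V with
  | nil => rfl
  | cons x hp ih =>
    have hx := hY.good x (hl x (by simp))
    have hk := (kills_cons_iff hx).1 hc
    have hl' := fun y hy => hl y (List.mem_cons_of_mem _ hy)
    simp only [symb, LatOp.act]
    rw [ih hl' (sup_le hUV (hx.push_le V)) (kill_top hx hUV hk),
      ih hl' (le_inf hUV (hx.le_pull U)) (kill_bot hx hUV hk)]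
  | swap x y l =>
    have hx : x ∈ Y := hl x (by simp)
    have hy : y ∈ Y := hl y (by simp)
    -- The symbol of the common tail is additive on the intervals whose killed subintervals are in
    -- the class, so it may serve as the function on which the two leading operators act.
    refine act_comm hY
      (h.symb hY fun z hz => hl z (by simp [hz])) hy hx hUV ?_
    intro U' V' h1 h2 h3 hk U'' V'' h1' h2' h3' hk'
    refine hc U'' V'' (h1.trans h1') h2' (h3'.trans h3) ?_
    intro z hz
    rcases List.mem_cons.1 hz with rfl | hz
    · exact ((hY.good _ hy).gc.monotone_l h3').trans ((hk _ (by simp)).trans h1')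
    · rcases List.mem_cons.1 hz with rfl | hz
      · exact ((hY.good _ hx).gc.monotone_l h3').trans ((hk _ (by simp)).trans h1')
      · exact hk' z hz
  | trans h1 _ ih1 ih2 =>
    rw [ih1 hl hUV hc]
    exact ih2 (fun x hx => hl x (h1.mem_iff.2 hx)) hUV
      (kills_mono (fun x hx => h1.mem_iff.1 hx) hc)

/-- On an interval in the class the symbol is an iterated difference. -/
theorem Additive.symb_eq_of_mem (hY : System Y) (hC : Hereditary C) (h : Additive Y C ψ)
    (hl : ∀ x ∈ l, x ∈ Y) {U V : L} (hUV : U ≤ V) (hc : C U V) :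
    LatOp.symb l ψ U V = l.foldr (fun x a => a - x.shift a) (ψ U V) := by
  induction l with
  | nil => rfl
  | cons x l ih =>
    have hl' := fun y hy => hl y (List.mem_cons_of_mem _ hy)
    have hx : x ∈ Y := hl x (by simp)
    have hc' : kills l C U V := fun U' V' h1 h2 h3 _ => hC hc h1 h2 h3
    rw [LatOp.symb, (h.symb hY hl').act_eq_of_mem (kills_hereditary l C) (hY.good x hx) hx hUV hc',
      ih hl', List.foldr_cons]

end LatOp

/-! ### Relative length -/

section RelLength

variable {R E E₁ E₂ : Type*} [CommRing R] [AddCommGroup E] [Module R E]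
  [AddCommGroup E₁] [Module R E₁] [AddCommGroup E₂] [Module R E₂]

lemma mem_submoduleOf_iff {U V : Submodule R E} {x : V} : x ∈ U.submoduleOf V ↔ (x : E) ∈ U :=
  Iff.rfl

/-- The length of `V / (U ∩ V)`. -/
noncomputable def relLength (U V : Submodule R E) : ℕ∞ :=
  Module.length R (V ⧸ U.submoduleOf V)

lemma relLength_eq_zero {U V : Submodule R E} : relLength U V = 0 ↔ V ≤ U := by
  rw [relLength, Module.length_eq_zero_iff, Submodule.Quotient.subsingleton_iff,
    Submodule.submoduleOf, Submodule.comap_subtype_eq_top]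

lemma relLength_self (U : Submodule R E) : relLength U U = 0 := relLength_eq_zero.2 le_rfl

lemma relLength_top (U : Submodule R E) : relLength U ⊤ = Module.length R (E ⧸ U) := by
  refine LinearEquiv.length_eq (Submodule.Quotient.equiv _ _ Submodule.topEquiv ?_)
  ext x
  simp [Submodule.submoduleOf]

/-- Relative lengths agree if a linear map induces an isomorphism of the quotients. -/
lemma relLength_eq_of_map (θ : E₁ →ₗ[R] E₂) {U₁ V₁ : Submodule R E₁} {U₂ V₂ : Submodule R E₂}
    (hV : V₂ = U₂ ⊔ V₁.map θ) (hU : U₁ = V₁ ⊓ U₂.comap θ) : relLength U₁ V₁ = relLength U₂ V₂ := by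
  have hθ : ∀ v ∈ V₁, θ v ∈ V₂ := fun v hv => hV ▸ Submodule.mem_sup_right ⟨v, hv, rfl⟩
  let f : V₁ →ₗ[R] V₂ ⧸ U₂.submoduleOf V₂ := (Submodule.mkQ _) ∘ₗ θ.restrict hθ
  have hker : LinearMap.ker f = U₁.submoduleOf V₁ := by
    ext ⟨v, hv⟩
    simp only [f, LinearMap.mem_ker, LinearMap.comp_apply, Submodule.mkQ_apply,
      Submodule.Quotient.mk_eq_zero, mem_submoduleOf_iff, hU, Submodule.mem_inf,
      Submodule.mem_comap]
    exact ⟨fun h => ⟨hv, h⟩, fun h => h.2⟩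
  have hsurj : Function.Surjective f := by
    intro y
    obtain ⟨⟨w, hw⟩, rfl⟩ := Submodule.mkQ_surjective _ y
    have hw' := hw
    rw [hV] at hw'
    obtain ⟨u, hu, v, hv, rfl⟩ := Submodule.mem_sup.1 hw'
    obtain ⟨v, hv, rfl⟩ := hv
    refine ⟨⟨v, hv⟩, ?_⟩
    simp only [f, LinearMap.comp_apply, Submodule.mkQ_apply]
    refine (Submodule.Quotient.eq _).2 ?_
    rw [mem_submoduleOf_iff]
    simpa using hu
  rw [relLength, relLength, ← hker]
  exact (f.quotKerEquivOfSurjective hsurj).length_eq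

lemma relLength_add {U W V : Submodule R E} (h1 : U ≤ W) (h2 : W ≤ V) :
    relLength U V = relLength U W + relLength W V := by
  have c1 : U.submoduleOf W ≤ (U.submoduleOf V).comap (Submodule.inclusion h2) := fun x hx => hx
  have c2 : U.submoduleOf V ≤ (W.submoduleOf V).comap LinearMap.id := fun x hx => h1 hx
  refine Module.length_eq_add_of_exact (Submodule.mapQ _ _ _ c1) (Submodule.mapQ _ _ _ c2) ?_ ?_ ?_
  · rw [← LinearMap.ker_eq_bot, Submodule.ker_mapQ]
    rw [eq_bot_iff]
    rintro _ ⟨x, hx, rfl⟩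
    exact (Submodule.Quotient.mk_eq_zero _).2 hx
  · intro y
    obtain ⟨y, rfl⟩ := Submodule.mkQ_surjective _ y
    exact ⟨Submodule.mkQ _ y, rfl⟩
  · rw [LinearMap.exact_iff, Submodule.ker_mapQ, Submodule.range_mapQ]
    congr 1
    ext x
    simp only [Submodule.mem_comap, LinearMap.id_apply, mem_submoduleOf_iff,
      LinearMap.mem_range]
    exact ⟨fun h => ⟨⟨x.1, h⟩, rfl⟩, by rintro ⟨y, rfl⟩; exact y.2⟩

/-- The isomorphism theorem for a homomorphism θ. Together with the next lemma it supplies the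
fields `iso` and `inf_sup` of `LatOp.Additive`. -/
lemma relLength_inf_comap (θ : E₁ →ₗ[R] E₂) (V : Submodule R E₁) (U : Submodule R E₂) :
    relLength (V ⊓ U.comap θ) V = relLength U (U ⊔ V.map θ) :=
  relLength_eq_of_map θ rfl rfl

lemma relLength_inf (U V : Submodule R E) : relLength (U ⊓ V) V = relLength U (U ⊔ V) :=
  relLength_eq_of_map LinearMap.id (by simp) (by simp [inf_comm])

lemma relLength_le {U U' V' V : Submodule R E} (h1 : U ≤ U') (h2 : U' ≤ V') (h3 : V' ≤ V) :
    relLength U' V' ≤ relLength U V := by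
  rw [relLength_add (h1.trans h2) h3, relLength_add h1 h2, add_assoc]
  exact le_add_left (le_add_right le_rfl)

end RelLength

/-! ### Families of submodules -/

section Families

variable {R E ι : Type*} [CommRing R] [AddCommGroup E] [Module R E] [AddCommGroup ι]

/-- The operator on families of submodules given by an endomorphism of degree `e`. -/
def famOp (p : Module.End R E × ι) : LatOp (ι → Submodule R E) (ι → ℤ) where
  push U n := (U (n - p.2)).map p.1
  pull U n := (U (n + p.2)).comap p.1
  shift :=
    { toFun := fun f n => f (n - p.2)
      map_zero' := rfl
      map_add' := fun _ _ => rfl }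

/-- The relative length of two families. -/
noncomputable def famLength (U V : ι → Submodule R E) (n : ι) : ℤ :=
  ((relLength (U n) (V n)).toNat : ℤ)

/-- The Euler symbol of a list of homogeneous endomorphisms on the family `V / U`. -/
noncomputable def famSymb (l : List (Module.End R E × ι)) (U V : ι → Submodule R E) : ι → ℤ :=
  LatOp.symb (l.map famOp) famLength U V

/-- The families that are preserved by the homogeneous endomorphisms `y t`. -/
def StableFam {τ : Type*} (y : τ → Module.End R E × ι) : Sublattice (ι → Submodule R E) where
  carrier := {U | ∀ t n, (U n).map (y t).1 ≤ U (n + (y t).2)}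
  supClosed' := by
    intro U hU V hV t n
    simp only [Pi.sup_apply, Submodule.map_sup]
    exact sup_le_sup (hU t n) (hV t n)
  infClosed' := by
    intro U hU V hV t n
    simp only [Pi.inf_apply]
    exact le_inf ((Submodule.map_mono inf_le_left).trans (hU t n))
      ((Submodule.map_mono inf_le_right).trans (hV t n))

variable {τ : Type*} {y : τ → Module.End R E × ι}

lemma StableFam.push_mem (hy : ∀ s t, Commute (y s).1 (y t).1) (t : τ) {U : ι → Submodule R E}
    (hU : U ∈ StableFam y) : (famOp (y t)).push U ∈ StableFam y := by
  intro s n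
  simp only [famOp]
  rw [← Submodule.map_comp]
  have : (y s).1 ∘ₗ (y t).1 = (y t).1 ∘ₗ (y s).1 := (hy s t).eq
  rw [this, Submodule.map_comp]
  refine Submodule.map_mono ((hU s _).trans (le_of_eq ?_))
  congr 1
  abel

lemma StableFam.pull_mem (hy : ∀ s t, Commute (y s).1 (y t).1) (t : τ) {U : ι → Submodule R E}
    (hU : U ∈ StableFam y) : (famOp (y t)).pull U ∈ StableFam y := by
  intro s n
  simp only [famOp]
  rintro _ ⟨x, hx, rfl⟩
  have hx' : (y t).1 x ∈ U (n + (y t).2) := hx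
  have h := hU s _ ⟨_, hx', rfl⟩
  have e : (y s).1 ((y t).1 x) = (y t).1 ((y s).1 x) := LinearMap.congr_fun (hy s t).eq x
  rw [e, add_right_comm] at h
  exact h

variable {E₁ E₂ ι₁ ι₂ : Type*} [AddCommGroup E₁] [Module R E₁] [AddCommGroup E₂] [Module R E₂]
  [AddCommGroup ι₁] [AddCommGroup ι₂]

/-- The Euler symbol only depends on the isomorphism class of `V / U`. -/
theorem famSymb_eq_of_map (θ : E₁ →ₗ[R] E₂) (s : ι₁ → ι₂)
    {y₁ : τ → Module.End R E₁ × ι₁} {y₂ : τ → Module.End R E₂ × ι₂}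
    (hy₁ : ∀ s t, Commute (y₁ s).1 (y₁ t).1) (hy₂ : ∀ s t, Commute (y₂ s).1 (y₂ t).1)
    (hs : ∀ t n, s (n + (y₁ t).2) = s n + (y₂ t).2)
    {U₁ V₁ : ι₁ → Submodule R E₁} {U₂ V₂ : ι₂ → Submodule R E₂}
    (hθ : ∀ t n, ∀ x ∈ V₁ n, θ ((y₁ t).1 x) = (y₂ t).1 (θ x))
    (hU₁ : U₁ ∈ StableFam y₁) (hV₁ : V₁ ∈ StableFam y₁)
    (hU₂ : U₂ ∈ StableFam y₂) (hV₂ : V₂ ∈ StableFam y₂)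
    (hV : ∀ n, V₂ (s n) = U₂ (s n) ⊔ (V₁ n).map θ)
    (hU : ∀ n, U₁ n = V₁ n ⊓ (U₂ (s n)).comap θ) (l : List τ) (n : ι₁) :
    famSymb (l.map y₁) U₁ V₁ n = famSymb (l.map y₂) U₂ V₂ (s n) := by
  have hs' : ∀ t n, s (n - (y₁ t).2) = s n - (y₂ t).2 := fun t n => by
    rw [eq_sub_iff_add_eq, ← hs, sub_add_cancel]
  revert n
  -- The relation records that the four families are stable and that θ induces degreewise
  -- isomorphisms of the subquotients. The work is to see that this persists for N / yN and (0 :_N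
  -- y).
  refine LatOp.symb_rel
    (P := fun (U₁ V₁ : ι₁ → Submodule R E₁) (U₂ V₂ : ι₂ → Submodule R E₂) => (U₁ ∈ StableFam y₁ ∧ V₁ ∈ StableFam y₁ ∧ U₂ ∈ StableFam y₂ ∧
      V₂ ∈ StableFam y₂) ∧ (∀ t n, ∀ x ∈ V₁ n, θ ((y₁ t).1 x) = (y₂ t).1 (θ x)) ∧
      (∀ n, V₂ (s n) = U₂ (s n) ⊔ (V₁ n).map θ) ∧
      ∀ n, U₁ n = V₁ n ⊓ (U₂ (s n)).comap θ)
    (Q := fun (a : ι₁ → ℤ) (a' : ι₂ → ℤ) => ∀ n, a n = a' (s n)) ?_ ?_ ?_ ⟨⟨hU₁, hV₁, hU₂, hV₂⟩, hθ, hV, hU⟩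
  · intro a a' b b' h1 h2 n
    simp [h1 n, h2 n]
  · rw [List.map_map, List.map_map, List.forall₂_map_left_iff, List.forall₂_map_right_iff,
      List.forall₂_same]
    intro t _
    refine ⟨fun a a' h n => ?_, ?_⟩
    · change a (n - (y₁ t).2) = a' (s n - (y₂ t).2)
      rw [h, hs']
    rintro U₁ V₁ U₂ V₂ ⟨⟨hU₁, hV₁, hU₂, hV₂⟩, hθ, hV, hU⟩
    have memV : ∀ n v, v ∈ V₁ n → θ v ∈ V₂ (s n) := fun n v hv => by
      rw [hV]; exact Submodule.mem_sup_right ⟨v, hv, rfl⟩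
    have memU : ∀ n v, v ∈ U₁ n → θ v ∈ U₂ (s n) := fun n v hv => by
      rw [hU] at hv; exact hv.2
    have leU : ∀ n, U₁ n ≤ V₁ n := fun n => by rw [hU]; exact inf_le_left
    refine ⟨⟨⟨Sublattice.supClosed _ hU₁ (StableFam.push_mem hy₁ t hV₁), hV₁,
      Sublattice.supClosed _ hU₂ (StableFam.push_mem hy₂ t hV₂), hV₂⟩, hθ, ?_, ?_⟩,
      ⟨hU₁, Sublattice.infClosed _ hV₁ (StableFam.pull_mem hy₁ t hU₁), hU₂,
      Sublattice.infClosed _ hV₂ (StableFam.pull_mem hy₂ t hU₂)⟩,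
      fun t n x hx => hθ t n x hx.1, ?_, ?_⟩
    · intro n
      have hle : (V₂ (s n - (y₂ t).2)).map (y₂ t).1 ≤ V₂ (s n) := by
        simpa using hV₂ t (s n - (y₂ t).2)
      change V₂ (s n) = (U₂ (s n) ⊔ (V₂ (s n - (y₂ t).2)).map (y₂ t).1) ⊔ (V₁ n).map θ
      rw [sup_right_comm, ← hV, sup_eq_left.2 hle]
    · intro n
      change U₁ n ⊔ (V₁ (n - (y₁ t).2)).map (y₁ t).1 =
        V₁ n ⊓ (U₂ (s n) ⊔ (V₂ (s n - (y₂ t).2)).map (y₂ t).1).comap θ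
      have hle : (V₁ (n - (y₁ t).2)).map (y₁ t).1 ≤ V₁ n := by
        simpa using hV₁ t (n - (y₁ t).2)
      have hleU : (U₂ (s n - (y₂ t).2)).map (y₂ t).1 ≤ U₂ (s n) := by
        simpa using hU₂ t (s n - (y₂ t).2)
      refine le_antisymm (sup_le (le_inf (leU n) fun v hv => Submodule.mem_sup_left (memU n v hv))
        (le_inf hle ?_)) ?_
      · rintro _ ⟨v, hv, rfl⟩
        refine Submodule.mem_sup_right ⟨θ v, ?_, (hθ t _ v hv).symm⟩
        have := memV _ v hv
        rwa [hs'] at this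
      -- If θ v = u + y w with w in V₂, write w = u' + θ v' with v' in V₁. Then v - y v' is mapped
      -- into U₂ and so lies in U₁.
      · rintro v ⟨hv, hv'⟩
        obtain ⟨u, hu, w, hw, huw⟩ := Submodule.mem_sup.1 hv'
        obtain ⟨w, hw, rfl⟩ := hw
        have hw' : w ∈ V₂ (s (n - (y₁ t).2)) := by rw [hs']; exact hw
        rw [hV] at hw'
        obtain ⟨u', hu', _, ⟨v', hv'', rfl⟩, rfl⟩ := Submodule.mem_sup.1 hw'
        rw [hs'] at hu'
        refine Submodule.mem_sup.2 ⟨v - (y₁ t).1 v', ?_, (y₁ t).1 v', ⟨v', hv'', rfl⟩, by simp⟩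
        rw [hU]
        refine ⟨Submodule.sub_mem _ hv (hle ⟨v', hv'', rfl⟩), ?_⟩
        rw [SetLike.mem_coe, Submodule.mem_comap, map_sub, ← huw, hθ t _ v' hv'', map_add]
        have : u + ((y₂ t).1 u' + (y₂ t).1 (θ v')) - (y₂ t).1 (θ v') = u + (y₂ t).1 u' := by abel
        rw [this]
        exact Submodule.add_mem _ hu (hleU ⟨u', hu', rfl⟩)
    · intro n
      change V₂ (s n) ⊓ (U₂ (s n + (y₂ t).2)).comap (y₂ t).1 =
        U₂ (s n) ⊔ (V₁ n ⊓ (U₁ (n + (y₁ t).2)).comap (y₁ t).1).map θ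
      have hUV : U₂ (s n) ≤ V₂ (s n) := by rw [hV]; exact le_sup_left
      refine le_antisymm ?_ (sup_le (le_inf hUV ?_) ?_)
      · rintro v ⟨hv, hv'⟩
        rw [SetLike.mem_coe, hV] at hv
        obtain ⟨u, hu, _, ⟨w, hw, rfl⟩, rfl⟩ := Submodule.mem_sup.1 hv
        refine Submodule.mem_sup.2 ⟨u, hu, θ w, ⟨w, ⟨hw, ?_⟩, rfl⟩, rfl⟩
        rw [SetLike.mem_coe, Submodule.mem_comap, hU]
        refine ⟨hV₁ t n ⟨w, hw, rfl⟩, ?_⟩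
        rw [SetLike.mem_coe, Submodule.mem_comap, hs, hθ t _ w hw]
        have h1 : (y₂ t).1 (u + θ w) ∈ U₂ (s n + (y₂ t).2) := hv'
        rw [map_add] at h1
        exact (Submodule.add_mem_iff_right _ (hU₂ t _ ⟨u, hu, rfl⟩)).1 h1
      · exact Submodule.map_le_iff_le_comap.1 (hU₂ t _)
      · rintro _ ⟨v, ⟨hv, hv'⟩, rfl⟩
        refine ⟨memV n v hv, ?_⟩
        have := memU _ _ hv'
        rwa [hs, hθ t _ v hv] at this
    · intro n
      change U₁ n = (V₁ n ⊓ (U₁ (n + (y₁ t).2)).comap (y₁ t).1) ⊓ (U₂ (s n)).comap θ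
      refine le_antisymm (le_inf (le_inf (leU n) ?_) fun v hv => memU n v hv) ?_
      · exact Submodule.map_le_iff_le_comap.1 (hU₁ t _)
      · rw [hU n]
        exact le_inf (inf_le_left.trans inf_le_left) inf_le_right
  · rintro U₁ V₁ U₂ V₂ ⟨_, _, hV, hU⟩ n
    simp only [famLength]
    rw [relLength_eq_of_map θ (hV n) (hU n)]

end Families

/-! ### Symbols of families along a filter -/

section Eventual

variable {R E ι κ τ : Type*} [CommRing R] [AddCommGroup E] [Module R E] [AddCommGroup ι]

/-- The functions that vanish eventually along a filter. -/
def eventuallyZero (F : Filter κ) : AddSubgroup (κ → ℤ) where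
  carrier := {f | ∀ᶠ n in F, f n = 0}
  zero_mem' := Eventually.of_forall fun _ => rfl
  add_mem' := by
    intro a b ha hb
    filter_upwards [ha, hb] with n h1 h2
    simp [h1, h2]
  neg_mem' := by
    intro a ha
    filter_upwards [ha] with n h1
    simp [h1]

lemma eventuallyZero_mk_eq {F : Filter κ} {f g : κ → ℤ} :
    (QuotientAddGroup.mk f : (κ → ℤ) ⧸ eventuallyZero F) = QuotientAddGroup.mk g ↔
      ∀ᶠ n in F, f n = g n := by
  rw [QuotientAddGroup.eq]
  constructor <;> intro h
  · filter_upwards [h] with n hn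
    have : -f n + g n = 0 := hn
    omega
  · filter_upwards [h] with n hn
    simp [hn]

variable [AddCommGroup κ]

/-- The shift of functions modulo those that vanish eventually. -/
def germShift (F : Filter κ) (e : κ) (he : Tendsto (fun n => n - e) F F) :
    ((κ → ℤ) ⧸ eventuallyZero F) →+ ((κ → ℤ) ⧸ eventuallyZero F) :=
  QuotientAddGroup.map _ _
    { toFun := fun f n => f (n - e), map_zero' := rfl, map_add' := fun _ _ => rfl }
    (fun _ hf => he.eventually hf)

lemma germShift_mk (F : Filter κ) (e : κ) (he : Tendsto (fun n => n - e) F F) (f : κ → ℤ) :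
    germShift F e he (QuotientAddGroup.mk f) = QuotientAddGroup.mk fun n => f (n - e) := rfl

lemma germShift_comm {F : Filter κ} {e e' : κ} (he : Tendsto (fun n => n - e) F F)
    (he' : Tendsto (fun n => n - e') F F) (a : (κ → ℤ) ⧸ eventuallyZero F) :
    germShift F e he (germShift F e' he' a) = germShift F e' he' (germShift F e he a) := by
  obtain ⟨f, rfl⟩ := QuotientAddGroup.mk_surjective a
  simp only [germShift_mk]
  congr 1
  funext n
  congr 1
  abel

variable {y : τ → Module.End R E × ι}

instance : IsModularLattice (StableFam y) :=
  ⟨fun {_} y {_} h n => IsModularLattice.sup_inf_le_assoc_of_le (y.1 n) (h n)⟩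

/-- The operator on the lattice of stable families. -/
def stableOp (hy : ∀ s t, Commute (y s).1 (y t).1) {Γ : Type*} [AddCommGroup Γ] (σ : τ → Γ →+ Γ)
    (t : τ) : LatOp (StableFam y) Γ where
  push U := ⟨(famOp (y t)).push U.1, StableFam.push_mem hy t U.2⟩
  pull U := ⟨(famOp (y t)).pull U.1, StableFam.pull_mem hy t U.2⟩
  shift := σ t

lemma stableOp_push_le_iff (hy : ∀ s t, Commute (y s).1 (y t).1) {Γ : Type*} [AddCommGroup Γ]
    (σ : τ → Γ →+ Γ) (t : τ) {U V : StableFam y} :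
    (stableOp hy σ t).push V ≤ U ↔ ∀ n, (V.1 n).map (y t).1 ≤ U.1 (n + (y t).2) := by
  constructor
  · intro h n
    have := h (n + (y t).2)
    simpa [stableOp, famOp] using this
  · intro h n
    have := h (n - (y t).2)
    simpa [stableOp, famOp] using this

/-- The identities for images and preimages hold degree by degree for every linear map. Stability of
the families is needed only for `push_le`. -/
lemma stableOp_good (hy : ∀ s t, Commute (y s).1 (y t).1) {Γ : Type*} [AddCommGroup Γ]
    (σ : τ → Γ →+ Γ) (t : τ) : (stableOp hy σ t).Good where
  gc U V := by
    rw [stableOp_push_le_iff]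
    exact forall_congr' fun n => Submodule.map_le_iff_le_comap
  push_le U := (stableOp_push_le_iff hy σ t).2 (U.2 t)
  push_inf_pull U V := by
    apply Subtype.ext
    funext n
    change (V.1 (n - (y t).2) ⊓ (U.1 (n - (y t).2 + (y t).2)).comap (y t).1).map (y t).1 =
      (V.1 (n - (y t).2)).map (y t).1 ⊓ U.1 n
    rw [sub_add_cancel]
    ext x
    constructor
    · rintro ⟨v, ⟨hv, hv'⟩, rfl⟩
      exact ⟨⟨v, hv, rfl⟩, hv'⟩
    · rintro ⟨⟨v, hv, rfl⟩, hv'⟩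
      exact ⟨v, ⟨hv, hv'⟩, rfl⟩
  pull_sup_push U V := by
    apply Subtype.ext
    funext n
    change (U.1 (n + (y t).2) ⊔ (V.1 (n + (y t).2 - (y t).2)).map (y t).1).comap (y t).1 =
      (U.1 (n + (y t).2)).comap (y t).1 ⊔ V.1 n
    rw [add_sub_cancel_right]
    ext x
    constructor
    · intro hx
      obtain ⟨u, hu, _, ⟨v, hv, rfl⟩, h⟩ := Submodule.mem_sup.1 hx
      refine Submodule.mem_sup.2 ⟨x - v, ?_, v, hv, by simp⟩
      rw [Submodule.mem_comap, map_sub, ← h, add_sub_cancel_right]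
      exact hu
    · intro hx
      obtain ⟨u, hu, v, hv, rfl⟩ := Submodule.mem_sup.1 hx
      rw [Submodule.mem_comap, map_add]
      exact Submodule.add_mem_sup hu ⟨v, hv, rfl⟩

lemma stableOp_system (hy : ∀ s t, Commute (y s).1 (y t).1) {Γ : Type*} [AddCommGroup Γ]
    (σ : τ → Γ →+ Γ) (hσ : ∀ s t a, σ s (σ t a) = σ t (σ s a)) :
    LatOp.System (Set.range (stableOp hy σ)) where
  good := by
    rintro _ ⟨t, rfl⟩
    exact stableOp_good hy σ t
  comm := by
    rintro _ ⟨s, rfl⟩ _ ⟨t, rfl⟩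
    refine ⟨fun U => ?_, fun U => ?_, hσ s t⟩
    · apply Subtype.ext
      funext n
      change ((U.1 (n - (y s).2 - (y t).2)).map (y t).1).map (y s).1 =
        ((U.1 (n - (y t).2 - (y s).2)).map (y s).1).map (y t).1
      rw [sub_right_comm, ← Submodule.map_comp, ← Submodule.map_comp]
      congr 1
      exact (hy s t).eq
    · apply Subtype.ext
      funext n
      change ((U.1 (n + (y s).2 + (y t).2)).comap (y t).1).comap (y s).1 =
        ((U.1 (n + (y t).2 + (y s).2)).comap (y s).1).comap (y t).1
      rw [add_right_comm, ← Submodule.comap_comp, ← Submodule.comap_comp]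
      congr 1
      exact (hy t s).eq

variable {F : Filter ι}

/-- The relative length of stable families, up to functions that vanish eventually. -/
noncomputable def germLength (F : Filter ι) (U V : StableFam y) : (ι → ℤ) ⧸ eventuallyZero F :=
  QuotientAddGroup.mk (famLength U.1 V.1)

/-- The relative length is eventually finite. -/
def FiniteAlong (F : Filter ι) (U V : StableFam y) : Prop :=
  ∀ᶠ n in F, relLength (U.1 n) (V.1 n) ≠ ⊤

/-- Finiteness enters only in `add`, where lengths are truncated to natural numbers. The isomorphism
theorems equate lengths already in `ℕ∞`. Values are germs along the filter because finiteness is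
available only in large degrees. -/
theorem germLength_additive (hy : ∀ s t, Commute (y s).1 (y t).1)
    (hF : ∀ t, Tendsto (fun n => n - (y t).2) F F) :
    LatOp.Additive (Set.range (stableOp hy fun t => germShift F (y t).2 (hF t)))
      (FiniteAlong F) (germLength (y := y) F) where
  add U W V h1 h2 h := by
    refine eventuallyZero_mk_eq.2 ?_
    filter_upwards [h] with n hn
    have e := relLength_add (h1 n) (h2 n)
    rw [e] at hn
    simp only [famLength]
    rw [e, ENat.toNat_add (fun h => hn (by simp [h])) (fun h => hn (by simp [h]))]
    simp [famLength]
  inf_sup U V _ _ := by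
    refine eventuallyZero_mk_eq.2 (Eventually.of_forall fun n => ?_)
    exact congrArg (fun a : ℕ∞ => (a.toNat : ℤ)) (relLength_inf (U.1 n) (V.1 n))
  iso := by
    rintro _ ⟨t, rfl⟩ U V _ _
    refine (eventuallyZero_mk_eq (g := fun n => _)).2 (Eventually.of_forall fun n => ?_)
    have := relLength_inf_comap (y t).1 (V.1 (n - (y t).2)) (U.1 n)
    refine congrArg (fun a : ℕ∞ => (a.toNat : ℤ)) (this.symm.trans ?_)
    change _ = relLength (V.1 (n - (y t).2) ⊓ (U.1 (n - (y t).2 + (y t).2)).comap (y t).1) _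
    rw [sub_add_cancel]

/-- Passing to germs commutes with shifts and differences. Thus the lattice results, proved for
germs, become statements about the integer-valued symbol that hold eventually. -/
lemma germSymb_eq_mk (hy : ∀ s t, Commute (y s).1 (y t).1)
    (hF : ∀ t, Tendsto (fun n => n - (y t).2) F F) (l : List τ) (U V : StableFam y) :
    LatOp.symb (l.map (stableOp hy fun t => germShift F (y t).2 (hF t))) (germLength F) U V =
      QuotientAddGroup.mk (famSymb (l.map y) U.1 V.1) := by
  refine LatOp.symb_rel
    (P := fun (U V : StableFam y) (U' V' : ι → Submodule R E) => U.1 = U' ∧ V.1 = V')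
    (Q := fun (a : (ι → ℤ) ⧸ eventuallyZero F) (a' : ι → ℤ) => a = QuotientAddGroup.mk a')
    ?_ ?_ ?_ ⟨rfl, rfl⟩
  · rintro _ a' _ b' rfl rfl
    rfl
  · rw [List.map_map, List.forall₂_map_left_iff, List.forall₂_map_right_iff, List.forall₂_same]
    intro t _
    refine ⟨?_, ?_⟩
    · rintro _ a' rfl
      rfl
    · rintro U V _ _ ⟨rfl, rfl⟩
      exact ⟨⟨rfl, rfl⟩, rfl, rfl⟩
  · rintro U V _ _ ⟨rfl, rfl⟩
    rfl

/-- All stable subintervals killed by the operators in the list are eventually of finite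
length. -/
def FiniteKilled (F : Filter ι) (y : τ → Module.End R E × ι) (l : List τ)
    (U V : ι → Submodule R E) : Prop :=
  ∀ U' ∈ StableFam y, ∀ V' ∈ StableFam y, U ≤ U' → U' ≤ V' → V' ≤ V →
    (∀ t ∈ l, ∀ n, (V' n).map (y t).1 ≤ U' (n + (y t).2)) →
    ∀ᶠ n in F, relLength (U' n) (V' n) ≠ ⊤

lemma kills_finiteAlong (hy : ∀ s t, Commute (y s).1 (y t).1)
    {Γ : Type*} [AddCommGroup Γ] (σ : τ → Γ →+ Γ) {l : List τ} {U V : StableFam y}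
    (h : FiniteKilled F y l U.1 V.1) :
    LatOp.kills (l.map (stableOp hy σ)) (FiniteAlong F) U V := by
  intro U' V' h1 h2 h3 hk
  refine h U'.1 U'.2 V'.1 V'.2 h1 h2 h3 fun t ht => ?_
  exact (stableOp_push_le_iff hy σ t).1 (hk _ (List.mem_map_of_mem ht))

variable {U W V : ι → Submodule R E} {l l' : List τ}

/-- This and the following theorems are the general properties of symbols, read in the modular
lattice of stable families with germs of functions as values. -/
theorem famSymb_perm (hy : ∀ s t, Commute (y s).1 (y t).1)
    (hF : ∀ t, Tendsto (fun n => n - (y t).2) F F) (hU : U ∈ StableFam y) (hV : V ∈ StableFam y)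
    (hUV : U ≤ V) (hp : l.Perm l') (hk : FiniteKilled F y l U V) :
    ∀ᶠ n in F, famSymb (l.map y) U V n = famSymb (l'.map y) U V n := by
  have := LatOp.symb_perm (stableOp_system hy _ fun s t => germShift_comm (hF s) (hF t))
    (germLength_additive hy hF) (l := l.map (stableOp hy fun t => germShift F (y t).2 (hF t)))
    (by
      intro x hx
      obtain ⟨t, _, rfl⟩ := List.mem_map.1 hx
      exact ⟨t, rfl⟩) (hp.map _) (U := ⟨U, hU⟩) (V := ⟨V, hV⟩) hUV
    (kills_finiteAlong hy _ hk)
  rw [germSymb_eq_mk, germSymb_eq_mk, eventuallyZero_mk_eq] at this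
  exact this

theorem famSymb_add (hy : ∀ s t, Commute (y s).1 (y t).1)
    (hF : ∀ t, Tendsto (fun n => n - (y t).2) F F) (hU : U ∈ StableFam y) (hW : W ∈ StableFam y)
    (hV : V ∈ StableFam y) (h1 : U ≤ W) (h2 : W ≤ V) (hk : FiniteKilled F y l U V) :
    ∀ᶠ n in F, famSymb (l.map y) U V n =
      famSymb (l.map y) U W n + famSymb (l.map y) W V n := by
  have := ((germLength_additive hy hF).symb
    (stableOp_system hy _ fun s t => germShift_comm (hF s) (hF t))
    (l := l.map (stableOp hy fun t => germShift F (y t).2 (hF t)))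
    (by
      intro x hx
      obtain ⟨t, _, rfl⟩ := List.mem_map.1 hx
      exact ⟨t, rfl⟩)).add ⟨U, hU⟩ ⟨W, hW⟩ ⟨V, hV⟩ h1 h2 (kills_finiteAlong hy _ hk)
  rw [germSymb_eq_mk, germSymb_eq_mk, germSymb_eq_mk, ← QuotientAddGroup.mk_add,
    eventuallyZero_mk_eq] at this
  exact this

/-- The iterated backward difference. -/
def backDiff (l : List ι) (f : ι → ℤ) : ι → ℤ := l.foldr (fun e g n => g n - g (n - e)) f

/-- When all subquotients killed by l' are eventually finite, the interval already lies in the class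
on which the symbol of l' is additive. Every further operator then acts as a mere difference
operator. -/
theorem famSymb_append (hy : ∀ s t, Commute (y s).1 (y t).1)
    (hF : ∀ t, Tendsto (fun n => n - (y t).2) F F) (hU : U ∈ StableFam y) (hV : V ∈ StableFam y)
    (hUV : U ≤ V) (hk : FiniteKilled F y l' U V) :
    ∀ᶠ n in F, famSymb ((l ++ l').map y) U V n =
      backDiff (l.map fun t => (y t).2) (famSymb (l'.map y) U V) n := by
  let σ := fun t => germShift F (y t).2 (hF t)
  have hr : ∀ l : List τ, ∀ x ∈ l.map (stableOp hy σ), x ∈ Set.range (stableOp hy σ) := by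
    intro l x hx
    obtain ⟨t, _, rfl⟩ := List.mem_map.1 hx
    exact ⟨t, rfl⟩
  have hs := stableOp_system hy σ fun s t => germShift_comm (hF s) (hF t)
  have := ((germLength_additive hy hF).symb hs (hr l')).symb_eq_of_mem hs
    (LatOp.kills_hereditary _ _) (hr l) (U := ⟨U, hU⟩) (V := ⟨V, hV⟩) hUV
    (kills_finiteAlong hy _ hk)
  rw [← LatOp.symb_append, ← List.map_append, germSymb_eq_mk, germSymb_eq_mk] at this
  refine (eventuallyZero_mk_eq (g := backDiff (l.map fun t => (y t).2)
    (famSymb (l'.map y) U V))).1 ?_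
  rw [this]
  clear this hk
  induction l with
  | nil => rfl
  | cons t l ih =>
    rw [List.map_cons, List.foldr_cons, ih]
    rfl

/-- Killed subquotients that vanish in large degrees have zero germ of length, and the symbol
depends on nothing else. -/
theorem famSymb_eq_zero (hy : ∀ s t, Commute (y s).1 (y t).1)
    (hF : ∀ t, Tendsto (fun n => n - (y t).2) F F) (hU : U ∈ StableFam y) (hV : V ∈ StableFam y)
    (hUV : U ≤ V)
    (hk : ∀ U' ∈ StableFam y, ∀ V' ∈ StableFam y, U ≤ U' → U' ≤ V' → V' ≤ V →
      (∀ t ∈ l, ∀ n, (V' n).map (y t).1 ≤ U' (n + (y t).2)) → ∀ᶠ n in F, V' n ≤ U' n) :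
    ∀ᶠ n in F, famSymb (l.map y) U V n = 0 := by
  have := LatOp.symb_eq_zero (ψ := germLength F)
    (l := l.map (stableOp hy fun t => germShift F (y t).2 (hF t)))
    (by
      intro x hx
      obtain ⟨t, _, rfl⟩ := List.mem_map.1 hx
      exact stableOp_good hy _ t) (U := ⟨U, hU⟩) (V := ⟨V, hV⟩) hUV (by
    intro U' V' h1 h2 h3 hx
    refine (eventuallyZero_mk_eq (g := 0)).2 ?_
    filter_upwards [hk U'.1 U'.2 V'.1 V'.2 h1 h2 h3 fun t ht =>
      (stableOp_push_le_iff hy _ t).1 (hx _ (List.mem_map_of_mem ht))] with n hn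
    simp [famLength, relLength_eq_zero.2 hn])
  rw [germSymb_eq_mk] at this
  exact (eventuallyZero_mk_eq (g := 0)).1 this

end Eventual

/-! ### Finite generation of stable families -/

section Noetherian

variable {R E ι τ : Type*} [CommRing R] [AddCommGroup E] [Module R E] [AddCommGroup ι]

/-- The endomorphism of the direct sum of copies of `E` induced by a homogeneous endomorphism. -/
noncomputable def shiftEnd (p : Module.End R E × ι) : Module.End R (ι →₀ E) :=
  Finsupp.lmapDomain E R (· + p.2) ∘ₗ Finsupp.mapRange.linearMap p.1

lemma shiftEnd_single (p : Module.End R E × ι) (n : ι) (v : E) :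
    shiftEnd p (Finsupp.single n v) = Finsupp.single (n + p.2) (p.1 v) := by
  simp [shiftEnd, Finsupp.mapDomain_single]

lemma shiftEnd_apply (p : Module.End R E × ι) (f : ι →₀ E) (n : ι) :
    shiftEnd p f n = p.1 (f (n - p.2)) := by
  have : n = (n - p.2) + p.2 := by abel
  conv_lhs => rw [this]
  simp only [shiftEnd, LinearMap.comp_apply, Finsupp.lmapDomain_apply]
  rw [Finsupp.mapDomain_apply (add_left_injective p.2)]
  simp

lemma shiftEnd_commute {p q : Module.End R E × ι} (h : Commute p.1 q.1) :
    Commute (shiftEnd p) (shiftEnd q) := by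
  refine LinearMap.ext fun f => Finsupp.ext fun n => ?_
  change shiftEnd p (shiftEnd q f) n = shiftEnd q (shiftEnd p f) n
  rw [shiftEnd_apply, shiftEnd_apply, shiftEnd_apply, shiftEnd_apply, sub_right_comm]
  exact LinearMap.congr_fun h.eq _

variable [IsNoetherianRing R] [Finite τ] {y : τ → Module.End R E × ι}

open scoped IsMulCommutative in
/-- A stable family inside a finitely generated stable family is generated in bounded degrees. -/
theorem StableFam.exists_bound (hy : ∀ s t, Commute (y s).1 (y t).1)
    {V : ι → Submodule R E} (hV : V ∈ StableFam y) {S : Set (ι × E)} (hS : S.Finite)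
    (hVS : ∀ W ∈ StableFam y, (∀ p ∈ S, p.2 ∈ W p.1) → V ≤ W) (c : ι →+ ℤ) :
    ∃ N : ℤ, ∀ n, N < c n →
      V n ≤ ⨆ t : {t : τ // c (y t).2 ≠ 0}, (V (n - (y t).2)).map (y t).1 := by
  classical
  -- Commutativity and finiteness of the system make A a finitely generated commutative R-algebra,
  -- hence Noetherian. Stable families become graded A-submodules of the direct sum.
  let A := Algebra.adjoin R (Set.range fun t => shiftEnd (y t))
  have hcomm : ∀ a ∈ Set.range (fun t => shiftEnd (y t)), ∀ b ∈ Set.range fun t => shiftEnd (y t),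
      a * b = b * a := by
    rintro _ ⟨s, rfl⟩ _ ⟨t, rfl⟩
    exact shiftEnd_commute (hy s t)
  have := Algebra.isMulCommutative_adjoin R hcomm
  have hfg : A.FG := ⟨(Set.finite_range fun t => shiftEnd (y t)).toFinset, by simp [A]⟩
  have : Algebra.FiniteType R A := (Subalgebra.fg_iff_finiteType _).1 hfg
  have : IsNoetherianRing A := Algebra.FiniteType.isNoetherianRing R A
  -- graded submodules of the direct sum
  let gr : (W : ι → Submodule R E) → W ∈ StableFam y → Submodule A (ι →₀ E) := fun W hW =>
    { carrier := {f | ∀ n, f n ∈ W n}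
      zero_mem' := fun n => (W n).zero_mem
      add_mem' := fun ha hb n => (W n).add_mem (ha n) (hb n)
      smul_mem' := by
        rintro ⟨a, ha⟩ f hf
        change ∀ n, (a f) n ∈ W n
        induction ha using Algebra.adjoin_induction generalizing f with
        | mem x hx =>
          obtain ⟨t, rfl⟩ := hx
          intro n
          rw [shiftEnd_apply]
          have := hW t _ ⟨_, hf (n - (y t).2), rfl⟩
          rwa [sub_add_cancel] at this
        | algebraMap r => exact fun n => (W n).smul_mem r (hf n)
        | add a b _ _ h1 h2 => exact fun n => (W n).add_mem (h1 hf n) (h2 hf n)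
        | mul a b _ _ h1 h2 => exact h1 (h2 hf) }
  let B : Submodule A (ι →₀ E) := Submodule.span A ((fun p => Finsupp.single p.1 p.2) '' S)
  have hB : B.FG := Submodule.fg_span (hS.image _)
  have shift_mem : ∀ t, ∀ f ∈ B, shiftEnd (y t) f ∈ B := fun t f hf =>
    B.smul_mem (⟨shiftEnd (y t), Algebra.subset_adjoin ⟨t, rfl⟩⟩ : A) hf
  let W : ι → Submodule R E := fun n =>
    { carrier := {v | Finsupp.single n v ∈ B}
      zero_mem' := by simp
      add_mem' := fun ha hb => by
        change Finsupp.single _ (_ + _) ∈ B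
        rw [Finsupp.single_add]
        exact B.add_mem ha hb
      smul_mem' := fun r v hv => by
        change Finsupp.single _ (r • v) ∈ B
        have := B.smul_mem (algebraMap R A r) hv
        rwa [algebraMap_smul, Finsupp.smul_single] at this }
  have hW : W ∈ StableFam y := by
    rintro t n _ ⟨v, hv, rfl⟩
    have := shift_mem t _ hv
    rwa [shiftEnd_single] at this
  have hVW : V ≤ W := hVS W hW fun p hp => Submodule.subset_span ⟨p, hp, rfl⟩
  have hVB : gr V hV ≤ B := by
    intro f hf
    rw [← Finsupp.sum_single f]
    exact Submodule.sum_mem _ fun n _ => hVW n (hf n)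
  have : IsNoetherian A B := isNoetherian_of_fg_of_noetherian (R := A) (M := ι →₀ E) B hB
  -- The graded submodule of V is generated by homogeneous elements. By the Noetherian property
  -- finitely many of them suffice, and N bounds the values of c on their degrees.
  let X : Set (ι →₀ E) := {f | ∃ n, ∃ v ∈ V n, f = Finsupp.single n v}
  have hX : Submodule.span A X = gr V hV := by
    refine le_antisymm (Submodule.span_le.2 ?_) fun f hf => ?_
    · rintro _ ⟨n, v, hv, rfl⟩ m
      by_cases h : n = m
      · subst h
        simpa using hv
      · simp [Finsupp.single_eq_of_ne' h]
    · rw [← Finsupp.sum_single f]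
      exact Submodule.sum_mem _ fun n _ => Submodule.subset_span ⟨n, f n, hf n, rfl⟩
  have hXfg : (Submodule.span A X).FG := hX ▸ isNoetherian_submodule.1 ‹_› _ hVB
  obtain ⟨T, hTX, hT⟩ := (Submodule.fg_span_iff_fg_span_finset_subset X).1 hXfg
  have hN : ∃ N : ℤ, ∀ f ∈ T, ∃ n, ∃ v ∈ V n, f = Finsupp.single n v ∧ c n ≤ N := by
    clear hT
    induction T using Finset.induction_on with
    | empty => exact ⟨0, by simp⟩
    | insert f T _ ih =>
      obtain ⟨N, hN⟩ := ih fun g hg => hTX (by simp [Finset.mem_coe.1 hg])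
      obtain ⟨n, v, hv, rfl⟩ := hTX (Finset.mem_coe.2 (Finset.mem_insert_self f T))
      refine ⟨max N (c n), fun g hg => ?_⟩
      rcases Finset.mem_insert.1 hg with rfl | hg
      · exact ⟨n, v, hv, rfl, le_max_right _ _⟩
      · obtain ⟨n', v', hv', h, hle⟩ := hN g hg
        exact ⟨n', v', hv', h, hle.trans (le_max_left _ _)⟩
  obtain ⟨N, hN⟩ := hN
  refine ⟨N, ?_⟩
  -- Z agrees with V up to the bound and beyond it keeps only what comes from operators with c ≠ 0.
  -- It is stable and contains the generators of V, so it contains V.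
  let Z : ι → Submodule R E := fun n => if c n ≤ N then V n else
    ⨆ t : {t : τ // c (y t).2 ≠ 0}, (V (n - (y t).2)).map (y t).1
  have hZV : ∀ n, Z n ≤ V n := by
    intro n
    simp only [Z]
    split_ifs with h
    · exact le_rfl
    · refine iSup_le fun t => (hV t _).trans (le_of_eq ?_)
      rw [sub_add_cancel]
  have hZ : Z ∈ StableFam y := by
    intro s n
    by_cases h : c (n + (y s).2) ≤ N
    · have : Z (n + (y s).2) = V (n + (y s).2) := if_pos h
      rw [this]
      exact (Submodule.map_mono (hZV n)).trans (hV s n)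
    have e : Z (n + (y s).2) = ⨆ t : {t : τ // c (y t).2 ≠ 0},
        (V (n + (y s).2 - (y t).2)).map (y t).1 := if_neg h
    rw [e]
    -- Only an operator with c ≠ 0 can cross the bound, and its image is by definition part of Z.
    -- Above the bound, commutativity moves y s past y t.
    by_cases h' : c n ≤ N
    · have h0 : c (y s).2 ≠ 0 := by
        intro h0
        rw [map_add, h0, add_zero] at h
        exact h h'
      refine le_trans ?_ (le_iSup _ ⟨s, h0⟩)
      rw [add_sub_cancel_right]
      exact Submodule.map_mono (hZV n)
    · have e' : Z n = ⨆ t : {t : τ // c (y t).2 ≠ 0}, (V (n - (y t).2)).map (y t).1 := if_neg h'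
      rw [e', Submodule.map_iSup]
      refine iSup_mono fun t => ?_
      rw [← Submodule.map_comp]
      have hc : (y s).1 ∘ₗ (y t.1).1 = (y t.1).1 ∘ₗ (y s).1 := (hy s t).eq
      rw [hc, Submodule.map_comp]
      refine Submodule.map_mono ((hV s _).trans (le_of_eq ?_))
      congr 1
      abel
  have hle : gr V hV ≤ gr Z hZ := by
    rw [← hX, hT, Submodule.span_le]
    intro f hf
    obtain ⟨n, v, hv, rfl, hn⟩ := hN f hf
    intro m
    by_cases h : n = m
    · subst h
      have : Z n = V n := if_pos hn
      rw [this]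
      simpa using hv
    · simp [Finsupp.single_eq_of_ne' h]
  intro n hn v hv
  have hv' : Finsupp.single n v ∈ gr V hV := hX ▸ Submodule.subset_span ⟨n, v, hv, rfl⟩
  have := hle hv' n
  rw [Finsupp.single_eq_same] at this
  have e : Z n = _ := if_neg (not_le.2 hn)
  rwa [e] at this

end Noetherian

/-! ### Functions that are eventually polynomial -/

section Polynomials

open fwdDiff

lemma fwdDiff_comm {M G : Type*} [AddCommMonoid M] [AddCommGroup G] (a b : M) :
    Function.Commute (fwdDiff a : (M → G) → M → G) (fwdDiff b) := by
  intro f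
  funext n
  simp only [fwdDiff, add_right_comm n a b]
  abel

lemma exists_polynomial_choose (i : ℕ) :
    ∃ q : Polynomial ℚ, ∀ m : ℕ, q.eval (m : ℚ) = (m.choose i : ℚ) := by
  refine ⟨Polynomial.C ((i.factorial : ℚ)⁻¹) * descPochhammer ℚ i, fun m => ?_⟩
  have h : (i.factorial : ℚ) ≠ 0 := by positivity
  rw [Polynomial.eval_mul, Polynomial.eval_C, descPochhammer_eval_eq_descFactorial,
    Nat.descFactorial_eq_factorial_mul_choose]
  push_cast
  field_simp

variable {d : ℕ}

lemma fwdDiff_iter_eq_zero_of_ge {N : ℤ} {e : Fin d → ℤ} (he : 0 ≤ e) {g : (Fin d → ℤ) → ℚ}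
    (hg : ∀ n, (∀ k, N ≤ n k) → g n = 0) (j : ℕ) (n : Fin d → ℤ) (hn : ∀ k, N ≤ n k) :
    (fwdDiff e)^[j] g n = 0 := by
  induction j generalizing n with
  | zero => exact hg n hn
  | succ j ih =>
    rw [Function.iterate_succ_apply', fwdDiff, ih n hn,
      ih (n + e) fun k => (hn k).trans (le_add_of_nonneg_right (he k)), sub_zero]

/-- Newton's formula in the variable k expands f in the binomials C(n_k - N, i). The coefficients
are the iterated differences of f at n_k = N; they vanish for i ≥ s and depend on one variable
fewer, which allows induction on T. -/
theorem exists_mvPolynomial_of_fwdDiff (N : ℤ) (s : ℕ) (T : Finset (Fin d))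
    (f : (Fin d → ℤ) → ℚ)
    (h1 : ∀ k ∈ T, ∀ n, (∀ i, N ≤ n i) → (fwdDiff (Pi.single k (1 : ℤ)))^[s] f n = 0)
    (h2 : ∀ n n', (∀ i, N ≤ n i) → (∀ i, N ≤ n' i) → (∀ k ∈ T, n k = n' k) → f n = f n') :
    ∃ p : MvPolynomial (Fin d) ℚ,
      ∀ n, (∀ i, N ≤ n i) → MvPolynomial.eval (fun k => (n k : ℚ)) p = f n := by
  classical
  induction T using Finset.induction_on generalizing f with
  | empty =>
    refine ⟨MvPolynomial.C (f fun _ => N), fun n hn => ?_⟩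
    rw [MvPolynomial.eval_C]
    exact h2 _ _ (fun _ => le_rfl) hn (by simp)
  | insert k T hk ih =>
    let e : Fin d → ℤ := Pi.single k 1
    let g : ℕ → (Fin d → ℤ) → ℚ := fun i n => (fwdDiff e)^[i] f (Function.update n k N)
    have hup : ∀ n : Fin d → ℤ, (∀ i, N ≤ n i) → ∀ i, N ≤ Function.update n k N i := by
      intro n hn i
      by_cases h : i = k
      · subst h; simp
      · simp [h, hn i]
    have comm_up : ∀ k' ≠ k, ∀ (h : (Fin d → ℤ) → ℚ) (j : ℕ),
        (fwdDiff (Pi.single k' (1 : ℤ)))^[j] (fun n => h (Function.update n k N)) =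
          fun n => (fwdDiff (Pi.single k' (1 : ℤ)))^[j] h (Function.update n k N) := by
      intro k' hk' h j
      induction j with
      | zero => rfl
      | succ j ih =>
        rw [Function.iterate_succ_apply', Function.iterate_succ_apply', ih]
        funext n
        simp only [fwdDiff]
        refine congrArg₂ _ (congrArg _ ?_) rfl
        funext i
        by_cases hi : i = k
        · subst hi
          simp [hk'.symm]
        · simp [hi]
    have key : ∀ i, ∃ p : MvPolynomial (Fin d) ℚ,
        ∀ n, (∀ i, N ≤ n i) → MvPolynomial.eval (fun k => (n k : ℚ)) p = g i n := by
      intro i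
      refine ih (g i) ?_ ?_
      · intro k' hk' n hn
        have hne : k' ≠ k := fun h => hk (h ▸ hk')
        rw [comm_up k' hne, ((fwdDiff_comm _ _).iterate_iterate s i).eq]
        exact fwdDiff_iter_eq_zero_of_ge (Pi.single_nonneg.2 zero_le_one)
          (h1 k' (by simp [hk'])) i _ (hup n hn)
      · intro n n' hn hn' hnn
        -- iterated differences of `f` only depend on the relevant coordinates
        have : ∀ (j : ℕ) (n n' : Fin d → ℤ), (∀ i, N ≤ n i) → (∀ i, N ≤ n' i) →
            (∀ k' ∈ insert k T, n k' = n' k') → (fwdDiff e)^[j] f n = (fwdDiff e)^[j] f n' := by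
          intro j
          induction j with
          | zero => exact h2
          | succ j ihj =>
            intro n n' hn hn' h
            have he : ∀ i, 0 ≤ e i := (Pi.single_nonneg.2 zero_le_one : (0 : Fin d → ℤ) ≤ e)
            rw [Function.iterate_succ_apply', fwdDiff, fwdDiff, ihj n n' hn hn' h,
              ihj (n + e) (n' + e) (fun i => (hn i).trans (le_add_of_nonneg_right (he i)))
                (fun i => (hn' i).trans (le_add_of_nonneg_right (he i)))
                fun k' hk' => by simp [h k' hk']]
        refine this i _ _ (hup n hn) (hup n' hn') fun k' hk' => ?_
        by_cases hkk : k' = k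
        · subst hkk; simp
        · simp [hkk, hnn k' (Finset.mem_of_mem_insert_of_ne hk' hkk)]
    choose p hp using key
    choose q hq using exists_polynomial_choose
    refine ⟨∑ i ∈ Finset.range s, (Polynomial.aeval (MvPolynomial.X k - MvPolynomial.C (N : ℚ))
      (q i)) * p i, fun n hn => ?_⟩
    obtain ⟨m, hm⟩ : ∃ m : ℕ, n k = N + m := ⟨(n k - N).toNat, by have := hn k; omega⟩
    have hy : n = Function.update n k N + m • e := by
      funext i
      by_cases hi : i = k
      · subst hi
        simp [e, hm]
      · simp [e, hi]
    have hN := shift_eq_sum_fwdDiff_iter e f m (Function.update n k N)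
    rw [← hy] at hN
    rw [hN, map_sum]
    have hz : ∀ i, s ≤ i → (fwdDiff e)^[i] f (Function.update n k N) = 0 := by
      intro i hi
      obtain ⟨j, rfl⟩ := Nat.exists_eq_add_of_le' hi
      rw [Function.iterate_add_apply]
      exact fwdDiff_iter_eq_zero_of_ge (Pi.single_nonneg.2 zero_le_one) (h1 k (by simp)) j _
        (hup n hn)
    have e1 : ∀ i, MvPolynomial.eval (fun k => (n k : ℚ))
        ((Polynomial.aeval (MvPolynomial.X k - MvPolynomial.C (N : ℚ)) (q i)) * p i) =
        m.choose i • (fwdDiff e)^[i] f (Function.update n k N) := by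
      intro i
      rw [map_mul, hp i n hn, nsmul_eq_mul, ← hq i m]
      congr 1
      rw [Polynomial.aeval_def, Polynomial.hom_eval₂, ← Polynomial.eval₂_id]
      congr 1
      · ext; simp
      · simp [hm]
    simp only [e1]
    -- Both sums are extended to the larger of the two ranges: terms with i ≥ s vanish because the
    -- differences do, terms with i > m because the binomial coefficient does.
    refine (Finset.sum_subset (Finset.range_subset_range.2 (le_max_left s (m + 1)))
      fun i _ hi => ?_).trans (Finset.sum_subset
        (Finset.range_subset_range.2 (le_max_right s (m + 1))) fun i _ hi => ?_).symm
    · rw [hz i (by simpa using hi), smul_zero]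
    · rw [Nat.choose_eq_zero_of_lt (by simpa using hi), zero_smul]

/-- The backward difference of a polynomial in the variable `k`. -/
noncomputable def polyBackDiff (k : Fin d) (p : MvPolynomial (Fin d) ℚ) :
    MvPolynomial (Fin d) ℚ :=
  p - MvPolynomial.bind₁ (fun i => MvPolynomial.X i - if i = k then 1 else 0) p

lemma eval_polyBackDiff (k : Fin d) (p : MvPolynomial (Fin d) ℚ) (n : Fin d → ℤ) :
    MvPolynomial.eval (fun i => (n i : ℚ)) (polyBackDiff k p) =
      MvPolynomial.eval (fun i => (n i : ℚ)) p -
        MvPolynomial.eval (fun i => (((n - Pi.single k 1 : Fin d → ℤ) i : ℤ) : ℚ)) p := by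
  rw [polyBackDiff, map_sub]
  congr 1
  rw [← MvPolynomial.coe_aeval_eq_eval, ← MvPolynomial.coe_aeval_eq_eval]
  simp only [RingHom.coe_coe]
  rw [MvPolynomial.aeval_bind₁]
  congr 2
  funext i
  by_cases h : i = k
  · subst h; simp
  · simp [h]

/-- All coefficients of `p` at exponents strictly above `β` vanish. -/
def VanishAbove (p : MvPolynomial (Fin d) ℚ) (β : Fin d →₀ ℕ) : Prop :=
  ∀ γ, β ≤ γ → γ ≠ β → p.coeff γ = 0

lemma coeff_bind_monomial (k : Fin d) (γ β : Fin d →₀ ℕ) (c : ℚ) :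
    (MvPolynomial.bind₁ (fun i => MvPolynomial.X i - if i = k then 1 else 0)
      (MvPolynomial.monomial γ c)).coeff β =
      if γ.erase k = β.erase k then c * ((-1) ^ (γ k - β k) * ((γ k).choose (β k) : ℚ)) else 0 := by
  classical
  have h1 : MvPolynomial.monomial γ c =
      MvPolynomial.monomial (γ.erase k) c * MvPolynomial.X (R := ℚ) k ^ γ k := by
    rw [MvPolynomial.X_pow_eq_monomial, MvPolynomial.monomial_mul, mul_one,
      Finsupp.erase_add_single]
  have h2 : MvPolynomial.bind₁ (fun i => MvPolynomial.X i - if i = k then 1 else 0)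
      (MvPolynomial.monomial (γ.erase k) c) = MvPolynomial.monomial (γ.erase k) c := by
    rw [MvPolynomial.bind₁_monomial, MvPolynomial.monomial_eq]
    congr 1
    refine Finset.prod_congr rfl fun i hi => ?_
    have : i ≠ k := by
      rintro rfl
      simp at hi
    simp [this]
  have h3 : (MvPolynomial.X (R := ℚ) k - 1) ^ γ k = ∑ m ∈ Finset.range (γ k + 1),
      MvPolynomial.monomial (Finsupp.single k m) ((-1) ^ (γ k - m) * ((γ k).choose m : ℚ)) := by
    rw [sub_eq_add_neg, add_pow]
    refine Finset.sum_congr rfl fun m _ => ?_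
    rw [MvPolynomial.X_pow_eq_monomial, mul_assoc]
    have : ((-1) ^ (γ k - m) * ((γ k).choose m : MvPolynomial (Fin d) ℚ)) =
        MvPolynomial.C ((-1) ^ (γ k - m) * ((γ k).choose m : ℚ)) := by simp
    rw [this, mul_comm, MvPolynomial.C_mul_monomial, mul_one]
  rw [h1, map_mul, h2, map_pow, MvPolynomial.bind₁_X_right, if_pos rfl, h3, Finset.mul_sum,
    MvPolynomial.coeff_sum]
  simp only [MvPolynomial.monomial_mul, MvPolynomial.coeff_monomial]
  have h4 : ∀ m, (γ.erase k + Finsupp.single k m = β) ↔ (γ.erase k = β.erase k ∧ m = β k) := by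
    intro m
    constructor
    · rintro rfl
      simp
    · rintro ⟨h, rfl⟩
      rw [h, Finsupp.erase_add_single]
  simp only [h4]
  by_cases h : γ.erase k = β.erase k
  · simp only [h, true_and, if_true]
    rw [Finset.sum_ite_eq' (Finset.range (γ k + 1)) (β k)]
    split_ifs with h5
    · rfl
    · rw [Nat.choose_eq_zero_of_lt (by simpa using h5)]
      simp
  · simp [h]

/-- An exponent γ contributes to the coefficient at β only if it agrees with β outside k and γ_k ≥
β_k. The case γ = β cancels, γ_k = β_k + 1 gives the factor β_k + 1, and larger γ_k are excluded by
the hypothesis. -/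
lemma coeff_polyBackDiff {k : Fin d} {p : MvPolynomial (Fin d) ℚ} {β : Fin d →₀ ℕ}
    (h : VanishAbove p (β + Finsupp.single k 1)) :
    (polyBackDiff k p).coeff β = (β k + 1) * p.coeff (β + Finsupp.single k 1) := by
  classical
  have e : ∀ q : MvPolynomial (Fin d) ℚ, (polyBackDiff k q).coeff β =
      ∑ γ ∈ q.support, ((if γ = β then q.coeff γ else 0) - (if γ.erase k = β.erase k then
        q.coeff γ * ((-1) ^ (γ k - β k) * ((γ k).choose (β k) : ℚ)) else 0)) := by
    intro q
    rw [polyBackDiff, MvPolynomial.coeff_sub, Finset.sum_sub_distrib]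
    congr 1
    · rw [Finset.sum_ite_eq']
      split_ifs with h
      · rfl
      · simpa using h
    · conv_lhs => rw [q.as_sum, map_sum, MvPolynomial.coeff_sum]
      simp only [coeff_bind_monomial]
  rw [e, Finset.sum_eq_single (β + Finsupp.single k 1)]
  · rw [if_neg (by simp), if_pos (by simp)]
    simp
    ring
  · intro γ hγ hne
    have hnle : ¬ β + Finsupp.single k 1 ≤ γ := fun hle =>
      (MvPolynomial.mem_support_iff.1 hγ) (h γ hle hne)
    by_cases h1 : γ = β
    · subst h1; simp
    rw [if_neg h1]
    by_cases h2 : γ.erase k = β.erase k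
    · rw [if_pos h2]
      have h3 : γ k < β k := by
        by_contra hlt
        have hi : ∀ i, i ≠ k → γ i = β i := fun i hi => by
          have := DFunLike.congr_fun h2 i
          simpa [hi] using this
        rcases (not_lt.1 hlt).eq_or_lt with h4 | h4
        · apply h1
          ext i
          by_cases hik : i = k
          · subst hik; exact h4.symm
          · exact hi i hik
        · apply hnle
          intro i
          by_cases hik : i = k
          · subst hik; simpa using h4
          · simp [Finsupp.single_eq_of_ne hik, hi i hik]
      rw [Nat.choose_eq_zero_of_lt h3]
      simp
    · rw [if_neg h2, sub_zero]
  · intro hn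
    rw [MvPolynomial.notMem_support_iff.1 hn]
    simp

/-- Among the offending exponents one of maximal degree has nothing above it. The coefficient
formula then applies there and produces a nonzero coefficient of the difference strictly above β. -/
lemma VanishAbove.of_polyBackDiff {k : Fin d} {p : MvPolynomial (Fin d) ℚ} {β : Fin d →₀ ℕ}
    (h : VanishAbove (polyBackDiff k p) β) : VanishAbove p (β + Finsupp.single k 1) := by
  classical
  intro γ hγ hne
  by_contra hc
  let T := p.support.filter fun γ => β + Finsupp.single k 1 ≤ γ ∧ γ ≠ β + Finsupp.single k 1
  obtain ⟨δ, hδ, hmax⟩ := T.exists_max_image (fun γ => γ.degree)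
    ⟨γ, by simp [T, hc, hγ, hne]⟩
  simp only [T, Finset.mem_filter, MvPolynomial.mem_support_iff] at hδ hmax
  have hU : VanishAbove p δ := by
    intro ε hε hεδ
    by_contra hcε
    have h1 := hmax ε ⟨hcε, hδ.2.1.trans hε, fun h => hεδ (le_antisymm (h ▸ hδ.2.1) hε)⟩
    obtain ⟨η, rfl⟩ := exists_add_of_le hε
    rw [map_add] at h1
    have : η = 0 := (Finsupp.degree_eq_zero_iff η).1 (by omega)
    exact hεδ (by simp [this])
  have hk : Finsupp.single k 1 ≤ δ := le_trans (by simp) hδ.2.1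
  obtain ⟨δ', rfl⟩ := exists_add_of_le hk
  rw [add_comm] at hδ hU
  have h2 := coeff_polyBackDiff hU
  rw [h δ' (by simpa using hδ.2.1) (fun h => hδ.2.2 (by rw [h]))] at h2
  have : ((δ' k : ℚ) + 1) ≠ 0 := by positivity
  rcases mul_eq_zero.1 h2.symm with h3 | h3
  · exact this h3
  · exact hδ.1 h3

/-- Since β has no k-component, the factors picked up in the r steps are exactly 1, …, r. -/
lemma polyBackDiff_iter {k : Fin d} (r : ℕ) {p : MvPolynomial (Fin d) ℚ} {β : Fin d →₀ ℕ}
    (hβ : β k = 0) (h : VanishAbove ((polyBackDiff k)^[r] p) β) :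
    VanishAbove p (β + Finsupp.single k r) ∧
      ((polyBackDiff k)^[r] p).coeff β = r.factorial * p.coeff (β + Finsupp.single k r) := by
  induction r generalizing p with
  | zero => simpa using h
  | succ r ih =>
    rw [Function.iterate_succ_apply] at h ⊢
    obtain ⟨h1, h2⟩ := ih h
    have h3 := h1.of_polyBackDiff
    have h4 := coeff_polyBackDiff h3
    rw [add_assoc, ← Finsupp.single_add] at h3 h4
    refine ⟨h3, ?_⟩
    rw [h2, h4, Nat.factorial_succ]
    simp [hβ]
    ring

/-- If an iterated backward difference of `p` is constant, it is the corresponding coefficient of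
`p`, up to factorials. -/
theorem coeff_of_polyBackDiff_const {p : MvPolynomial (Fin d) ℚ} {c : ℚ} (r : Fin d → ℕ)
    (l : List (Fin d)) (hl : l.Nodup)
    (h : l.foldr (fun k q => (polyBackDiff k)^[r k] q) p = MvPolynomial.C c) :
    (l.map fun k => ((r k).factorial : ℚ)).prod *
      p.coeff (l.map fun k => Finsupp.single k (r k)).sum = c := by
  classical
  have key : ∀ (l : List (Fin d)), l.Nodup → ∀ β : Fin d →₀ ℕ, (∀ k ∈ l, β k = 0) →
      VanishAbove (l.foldr (fun k q => (polyBackDiff k)^[r k] q) p) β →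
      (l.foldr (fun k q => (polyBackDiff k)^[r k] q) p).coeff β =
        (l.map fun k => ((r k).factorial : ℚ)).prod *
          p.coeff (β + (l.map fun k => Finsupp.single k (r k)).sum) := by
    intro l
    induction l with
    | nil => simp
    | cons k l ih =>
      intro hnd β hβ hU
      obtain ⟨hk, hnd⟩ := List.nodup_cons.1 hnd
      rw [List.foldr_cons] at hU ⊢
      obtain ⟨h1, h2⟩ := polyBackDiff_iter (r k) (hβ k (by simp)) hU
      rw [h2, ih hnd _ _ h1]
      · simp only [List.map_cons, List.prod_cons, List.sum_cons, add_assoc, mul_assoc]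
      · intro i hi
        have : i ≠ k := fun h => hk (h ▸ hi)
        simp [hβ i (by simp [hi]), Finsupp.single_eq_of_ne this]
  -- A constant has no coefficient strictly above 0. Vanishing above the multidegree of the r k for
  -- p itself is deduced from this, so no bound on the degree of p is needed.
  have := key l hl 0 (by simp) (by
    rw [h]
    intro γ _ hγ
    rw [MvPolynomial.coeff_C, if_neg (fun h => hγ h.symm)])
  rw [h] at this
  simpa using this.symm

end Polynomials

/-! ### Iterated limits -/

section IteratedFilter

variable {d : ℕ}

/-- The filter on `ℤ^d` for which the first `j` coordinates tend to infinity one after the other,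
the last one fastest, and the remaining coordinates are `1`. -/
noncomputable def iterFilter (d : ℕ) : ℕ → Filter (Fin d → ℤ)
  | 0 => pure 1
  | j + 1 => if h : j < d then
      (iterFilter d j).bind fun n => map (Function.update n ⟨j, h⟩) atTop
    else iterFilter d j

lemma eventually_iterFilter_succ {j : ℕ} (h : j < d) {P : (Fin d → ℤ) → Prop} :
    (∀ᶠ n in iterFilter d (j + 1), P n) ↔
      ∀ᶠ n in iterFilter d j, ∀ᶠ m in atTop, P (Function.update n ⟨j, h⟩ m) := by
  rw [iterFilter, dif_pos h, eventually_bind]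
  simp only [eventually_map]

lemma iterFilter_eq_one {j : ℕ} (hj : j ≤ d) :
    ∀ᶠ n in iterFilter d j, ∀ k : Fin d, j ≤ k → n k = 1 := by
  induction j with
  | zero => simp [iterFilter]
  | succ j ih =>
    rw [eventually_iterFilter_succ (by omega)]
    filter_upwards [ih (by omega)] with n hn
    refine Eventually.of_forall fun m k hk => ?_
    rw [Function.update_of_ne (by rintro rfl; simp at hk)]
    exact hn k (by omega)

lemma iterFilter_ge {j : ℕ} (hj : j ≤ d) (N : ℤ) :
    ∀ᶠ n in iterFilter d j, ∀ k : Fin d, (k : ℕ) < j → N ≤ n k := by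
  induction j with
  | zero => simp
  | succ j ih =>
    rw [eventually_iterFilter_succ (by omega)]
    filter_upwards [ih (by omega)] with n hn
    filter_upwards [eventually_ge_atTop N] with m hm k hk
    by_cases h : k = ⟨j, by omega⟩
    · rw [h, Function.update_self]
      exact hm
    · rw [Function.update_of_ne h]
      refine hn k ?_
      have : (k : ℕ) ≠ j := fun h' => h (Fin.ext h')
      omega

/-- Letting the coordinates grow one after the other eventually makes all of them large, so
statements for large n hold along the iterated limit. -/
lemma iterFilter_le_atTop : iterFilter d d ≤ atTop := by
  refine fun s hs => ?_
  obtain ⟨a, ha⟩ := mem_atTop_sets.1 hs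
  obtain ⟨N, hN⟩ : ∃ N : ℤ, ∀ k, a k ≤ N := by
    obtain ⟨N, hN⟩ := Set.Finite.bddAbove (Set.finite_range a)
    exact ⟨N, fun k => hN ⟨k, rfl⟩⟩
  filter_upwards [iterFilter_ge le_rfl N] with n hn
  exact ha n fun k => (hN k).trans (hn k k.2)

/-- Only the first j coordinates are free; the others are frozen at 1. Shifts along the free
coordinates preserve the limit, so the general theory of symbols applies along it. -/
lemma tendsto_iterFilter {j : ℕ} (hj : j ≤ d) (k : Fin d) (hk : (k : ℕ) < j) :
    Tendsto (fun n => n - Pi.single k 1) (iterFilter d j) (iterFilter d j) := by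
  induction j with
  | zero => omega
  | succ j ih =>
    have hjd : j < d := by omega
    refine tendsto_iff_eventually.2 fun P hP => ?_
    rw [eventually_iterFilter_succ hjd] at hP ⊢
    by_cases h : (k : ℕ) = j
    · have hk' : k = ⟨j, hjd⟩ := Fin.ext h
      subst hk'
      filter_upwards [hP] with n hn
      have : Tendsto (fun m : ℤ => m - 1) atTop atTop := tendsto_atTop_add_const_right _ _ tendsto_id
      filter_upwards [this.eventually hn] with m hm
      convert hm using 1
      funext i
      by_cases hi : i = ⟨j, hjd⟩
      · subst hi; simp
      · simp [hi]
    · have hkj : k ≠ ⟨j, hjd⟩ := fun h' => h (congrArg Fin.val h')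
      filter_upwards [(ih (by omega) (by omega)).eventually hP] with n hn
      filter_upwards [hn] with m hm
      convert hm using 1
      funext i
      by_cases hi : i = ⟨j, hjd⟩
      · subst hi
        simp [Pi.single_eq_of_ne hkj.symm]
      · simp [hi]

lemma mvPolynomial_eq_zero_of_eval_nat {p : MvPolynomial (Fin d) ℚ} (N : ℕ)
    (h : ∀ n : Fin d → ℕ, (∀ k, N ≤ n k) → MvPolynomial.eval (fun k => (n k : ℚ)) p = 0) :
    p = 0 := by
  refine MvPolynomial.funext_set (fun _ => ((↑) : ℕ → ℚ) '' Set.Ici N)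
    (fun _ => (Set.Ici_infinite N).image Nat.cast_injective.injOn) fun x hx => ?_
  choose n hn hnx using fun k => hx k (Set.mem_univ k)
  have : x = fun k => (n k : ℚ) := funext fun k => (hnx k).symm
  rw [this, h n hn, map_zero]

/-- A polynomial that vanishes eventually along the iterated limit is zero. -/
lemma mvPolynomial_eq_zero_of_iterFilter {p : MvPolynomial (Fin d) ℚ}
    (h : ∀ᶠ n in iterFilter d d, MvPolynomial.eval (fun k => (n k : ℚ)) p = 0) : p = 0 := by
  -- Induction on the number of free coordinates. Coordinate j is specialized to an arbitrary
  -- integer, which is allowed because a one-variable polynomial vanishing at all large integers is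
  -- zero.
  have key : ∀ j ≤ d, ∀ p : MvPolynomial (Fin d) ℚ,
      (∀ᶠ n in iterFilter d j, MvPolynomial.eval (fun k => (n k : ℚ)) p = 0) →
      ∀ n : Fin d → ℤ, (∀ k : Fin d, j ≤ k → n k = 1) →
        MvPolynomial.eval (fun k => (n k : ℚ)) p = 0 := by
    intro j
    induction j with
    | zero =>
      intro _ p hp n hn
      have : n = 1 := funext fun k => hn k (Nat.zero_le _)
      rw [this]
      simpa [iterFilter] using hp
    | succ j ih =>
      intro hj p hp n hn
      have hjd : j < d := by omega
      rw [eventually_iterFilter_succ hjd] at hp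
      -- all specializations of the coordinate `j` vanish
      let q : ℤ → MvPolynomial (Fin d) ℚ := fun m =>
        MvPolynomial.bind₁ (Function.update MvPolynomial.X ⟨j, hjd⟩ (MvPolynomial.C (m : ℚ))) p
      have hq : ∀ m (n : Fin d → ℤ), MvPolynomial.eval (fun k => (n k : ℚ)) (q m) =
          MvPolynomial.eval (fun k => (Function.update n ⟨j, hjd⟩ m k : ℚ)) p := by
        intro m n
        rw [← MvPolynomial.coe_aeval_eq_eval, ← MvPolynomial.coe_aeval_eq_eval]
        simp only [RingHom.coe_coe, q]
        rw [MvPolynomial.aeval_bind₁]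
        congr 2
        funext i
        by_cases hi : i = ⟨j, hjd⟩
        · subst hi; simp
        · simp [hi]
      have hall : ∀ m, ∀ᶠ n in iterFilter d j, MvPolynomial.eval (fun k => (n k : ℚ)) (q m) = 0 := by
        intro m
        filter_upwards [hp] with n hn
        rw [hq]
        let u : Polynomial ℚ := MvPolynomial.aeval
          (Function.update (fun k => Polynomial.C (n k : ℚ)) ⟨j, hjd⟩ Polynomial.X) p
        have hu : ∀ m : ℤ, u.eval (m : ℚ) =
            MvPolynomial.eval (fun k => (Function.update n ⟨j, hjd⟩ m k : ℚ)) p := by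
          intro m
          change Polynomial.evalRingHom (m : ℚ) u = MvPolynomial.eval₂ (RingHom.id ℚ) _ p
          simp only [u]
          rw [MvPolynomial.aeval_def, MvPolynomial.hom_eval₂]
          congr 1
          · ext; simp
          · funext i
            by_cases hi : i = ⟨j, hjd⟩
            · subst hi; simp
            · simp [hi]
        rw [← hu]
        have : u = 0 := by
          refine Polynomial.eq_zero_of_infinite_isRoot u ?_
          obtain ⟨a, ha⟩ := eventually_atTop.1 hn
          refine ((Set.Ici_infinite a).image (f := ((↑) : ℤ → ℚ)) Int.cast_injective.injOn).mono ?_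
          rintro _ ⟨m, hm, rfl⟩
          rw [Set.mem_ofPred_eq, Polynomial.IsRoot, hu]
          exact ha m hm
        rw [this, Polynomial.eval_zero]
      have h1 := ih (by omega) (q (n ⟨j, hjd⟩)) (hall _) (Function.update n ⟨j, hjd⟩ 1) (by
        intro k hk
        by_cases hkj : k = ⟨j, hjd⟩
        · subst hkj; simp
        · rw [Function.update_of_ne hkj]
          refine hn k ?_
          have : (k : ℕ) ≠ j := fun h' => hkj (Fin.ext h')
          omega)
      rw [hq] at h1
      simpa using h1
  refine mvPolynomial_eq_zero_of_eval_nat 0 fun n _ => ?_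
  have := key d le_rfl p h (fun k => (n k : ℤ)) fun k hk => absurd k.2 (by omega)
  simpa using this

end IteratedFilter

/-! ### Finite length criteria -/

section Cofinite

variable {R E : Type*} [CommRing R] [AddCommGroup E] [Module R E]

/-- A finitely generated module is of finite length over a submodule which contains its multiple by
an ideal of finite colength. -/
lemma relLength_ne_top_of_smul_le {U V : Submodule R E} (hV : V.FG) {J : Ideal R}
    (hJ : Module.length R (R ⧸ J) ≠ ⊤) (hle : J • V ≤ U) : relLength U V ≠ ⊤ := by
  classical
  obtain ⟨n, s, hs⟩ := Submodule.fg_iff_exists_fin_generating_family.1 hV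
  let Q := V ⧸ U.submoduleOf V
  have hsV : ∀ i, s i ∈ V := fun i => hs ▸ Submodule.subset_span ⟨i, rfl⟩
  let q : Fin n → Q := fun i => Submodule.Quotient.mk ⟨s i, hsV i⟩
  have hker : ∀ i, J ≤ LinearMap.ker (LinearMap.toSpanSingleton R Q (q i)) := by
    intro i r hr
    rw [LinearMap.mem_ker, LinearMap.toSpanSingleton_apply]
    change r • Submodule.Quotient.mk _ = 0
    rw [← Submodule.Quotient.mk_smul, Submodule.Quotient.mk_eq_zero]
    exact hle (Submodule.smul_mem_smul hr (hsV i))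
  let f : (Fin n → R ⧸ J) →ₗ[R] Q := ∑ i, (Submodule.liftQ J _ (hker i)) ∘ₗ LinearMap.proj i
  have hf : Function.Surjective f := by
    intro x
    obtain ⟨⟨v, hv⟩, rfl⟩ := Submodule.Quotient.mk_surjective _ x
    have hv' := hv
    rw [← hs, Submodule.mem_span_range_iff_exists_fun] at hv'
    obtain ⟨c, rfl⟩ := hv'
    refine ⟨fun i => Submodule.Quotient.mk (c i), ?_⟩
    have : (⟨∑ i, c i • s i, hv⟩ : V) = ∑ i, c i • (⟨s i, hsV i⟩ : V) := by
      apply Subtype.ext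
      simp
    rw [this]
    simp only [f, LinearMap.sum_apply, LinearMap.comp_apply, LinearMap.proj_apply]
    rw [← Submodule.mkQ_apply, map_sum]
    refine Finset.sum_congr rfl fun i _ => ?_
    rw [← Submodule.mkQ_apply, Submodule.mkQ_apply, Submodule.liftQ_apply, map_smul]
    rfl
  have h1 := Module.length_le_of_surjective f hf
  rw [Module.length_pi_of_fintype] at h1
  intro h
  rw [relLength] at h
  rw [h, top_le_iff] at h1
  have := WithTop.sum_eq_top.1 h1
  obtain ⟨i, _, hi⟩ := this
  exact hJ hi

/-- Filter R ⊇ J ⊇ IJ. The ideal J is finitely generated and J / IJ is killed by I, so it has finite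
length. -/
lemma length_quotient_mul_ne_top [IsNoetherianRing R] {I J : Ideal R}
    (hI : Module.length R (R ⧸ I) ≠ ⊤) (hJ : Module.length R (R ⧸ J) ≠ ⊤) :
    Module.length R (R ⧸ I * J) ≠ ⊤ := by
  rw [← relLength_top] at hI ⊢
  rw [relLength_add (Ideal.mul_le_right (I := I) (J := J)) le_top]
  have h1 : relLength (I * J) J ≠ ⊤ :=
    relLength_ne_top_of_smul_le (IsNoetherian.noetherian J) (J := I) (by rwa [← relLength_top])
      le_rfl
  have h2 : relLength J (⊤ : Ideal R) ≠ ⊤ := by rwa [relLength_top]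
  exact WithTop.add_ne_top.2 ⟨h1, h2⟩

lemma length_quotient_pow_ne_top [IsNoetherianRing R] {I : Ideal R}
    (hI : Module.length R (R ⧸ I) ≠ ⊤) (n : ℕ) : Module.length R (R ⧸ I ^ n) ≠ ⊤ := by
  induction n with
  | zero =>
    rw [pow_zero, ← relLength_top, Ideal.one_eq_top, relLength_self]
    simp
  | succ n ih =>
    rw [pow_succ]
    exact length_quotient_mul_ne_top ih hI

lemma length_quotient_mono {I J : Ideal R} (h : I ≤ J) (hI : Module.length R (R ⧸ I) ≠ ⊤) :
    Module.length R (R ⧸ J) ≠ ⊤ := by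
  rw [← relLength_top] at hI ⊢
  rw [relLength_add h le_top] at hI
  exact (WithTop.add_ne_top.1 hI).2

/-- `U` contains the multiple of `V` by an ideal of finite colength. -/
def Cofinite (U V : Submodule R E) : Prop :=
  ∃ J : Ideal R, Module.length R (R ⧸ J) ≠ ⊤ ∧ J • V ≤ U

end Cofinite

/-! ### Finite colength of products and powers of submodules -/

section Products

variable {R A : Type*} [CommRing R] [CommRing A] [Algebra R A]

lemma Cofinite.one : Cofinite (1 : Submodule R A) 1 :=
  ⟨⊤, by rw [← relLength_top, relLength_self]; simp, by simp⟩

variable [IsNoetherianRing R]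

lemma Cofinite.mul {U V U' V' : Submodule R A} (h : Cofinite U V) (h' : Cofinite U' V') :
    Cofinite (U * U') (V * V') := by
  obtain ⟨J, hJ, hle⟩ := h
  obtain ⟨J', hJ', hle'⟩ := h'
  refine ⟨J * J', length_quotient_mul_ne_top hJ hJ', ?_⟩
  rw [Submodule.smul_le]
  intro r hr x hx
  induction hr using Submodule.mul_induction_on' with
  | mem_mul_mem a ha b hb =>
    induction hx using Submodule.mul_induction_on' with
    | mem_mul_mem v hv w hw =>
      have : (a * b) • (v * w) = (a • v) * (b • w) := by
        rw [smul_mul_smul_comm]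
      rw [this]
      exact Submodule.mul_mem_mul (hle (Submodule.smul_mem_smul ha hv))
        (hle' (Submodule.smul_mem_smul hb hw))
    | add x _ y _ hx hy =>
      rw [smul_add]
      exact Submodule.add_mem _ hx hy
  | add a _ b _ ha hb =>
    rw [add_smul]
    exact Submodule.add_mem _ ha hb

lemma Cofinite.pow {U V : Submodule R A} (h : Cofinite U V) (n : ℕ) : Cofinite (U ^ n) (V ^ n) := by
  induction n with
  | zero => simpa using Cofinite.one
  | succ n ih =>
    rw [pow_succ, pow_succ]
    exact ih.mul h

lemma Cofinite.prod {ι : Type*} {U V : ι → Submodule R A} (s : Finset ι)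
    (h : ∀ i, Cofinite (U i) (V i)) : Cofinite (∏ i ∈ s, U i) (∏ i ∈ s, V i) := by
  classical
  induction s using Finset.induction_on with
  | empty => simpa using Cofinite.one
  | insert i s hi ih =>
    rw [Finset.prod_insert hi, Finset.prod_insert hi]
    exact (h i).mul ih

end Products

/-! ### The families of products of powers -/

section ProdFam

lemma eventually_atTop_iff_forall_le {d : ℕ} {P : (Fin d → ℤ) → Prop} :
    (∀ᶠ n in atTop, P n) ↔ ∃ N : ℤ, ∀ n, (∀ k, N ≤ n k) → P n := by
  rw [eventually_atTop]
  constructor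
  · rintro ⟨a, ha⟩
    obtain ⟨N, hN⟩ := (Set.finite_range a).bddAbove
    exact ⟨N, fun n hn => ha n fun k => (hN ⟨k, rfl⟩).trans (hn k)⟩
  · rintro ⟨N, hN⟩
    exact ⟨fun _ => N, fun n hn => hN n hn⟩

variable {R A : Type*} [CommRing R] [CommRing A] [Algebra R A] {d : ℕ}

/-- The family of the products of powers of submodules. -/
noncomputable def prodFam (M : Fin d → Submodule R A) (n : Fin d → ℤ) : Submodule R A :=
  open Classical in if 0 ≤ n then ∏ k, M k ^ (n k).toNat else ⊥

lemma prodFam_of_nonneg (M : Fin d → Submodule R A) {n : Fin d → ℤ} (hn : 0 ≤ n) :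
    prodFam M n = ∏ k, M k ^ (n k).toNat := if_pos hn

lemma prodFam_natCast (M : Fin d → Submodule R A) (n : Fin d → ℕ) :
    prodFam M (fun k => (n k : ℤ)) = ∏ k, M k ^ n k := by
  rw [prodFam_of_nonneg M fun k => by simp]
  simp

lemma prodFam_mono {M F : Fin d → Submodule R A} (h : ∀ k, M k ≤ F k) :
    prodFam M ≤ prodFam F := by
  intro n
  by_cases hn : 0 ≤ n
  · rw [prodFam_of_nonneg M hn, prodFam_of_nonneg F hn]
    exact Finset.prod_le_prod' fun k _ => pow_le_pow_left' (h k) _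
  · rw [prodFam, if_neg hn]
    exact bot_le

variable {τ : Type*}

/-- The system of multiplications by elements `a t` which have degree `e_{κ t}`. -/
def mulSys (R : Type*) {A : Type*} [CommRing R] [CommRing A] [Algebra R A] {d : ℕ} {τ : Type*}
    (a : τ → A) (κ : τ → Fin d) (t : τ) : Module.End R A × (Fin d → ℤ) :=
  (LinearMap.mulLeft R (a t), Pi.single (κ t) 1)

/-- The submodule generated by the elements of degree `e_k`. -/
def genMod (R : Type*) {A : Type*} [CommRing R] [CommRing A] [Algebra R A] {d : ℕ} {τ : Type*}
    (a : τ → A) (κ : τ → Fin d) (k : Fin d) : Submodule R A :=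
  Submodule.span R (a '' {t | κ t = k})

lemma mulSys_commute (a : τ → A) (κ : τ → Fin d) (s t : τ) :
    Commute (mulSys R a κ s).1 (mulSys R a κ t).1 :=
  LinearMap.ext fun _ => mul_left_comm _ _ _

lemma mulSys_tendsto (a : τ → A) (κ : τ → Fin d) (t : τ) :
    Tendsto (fun n => n - (mulSys R a κ t).2) atTop atTop := by
  simp only [sub_eq_add_neg]
  exact tendsto_atTop_add_const_right _ _ tendsto_id

lemma mem_genMod (a : τ → A) (κ : τ → Fin d) (t : τ) : a t ∈ genMod R a κ (κ t) :=
  Submodule.subset_span ⟨t, rfl, rfl⟩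

lemma span_mul_le_iff {S : Set A} {U V : Submodule R A} :
    Submodule.span R S * U ≤ V ↔ ∀ x ∈ S, U.map (LinearMap.mulLeft R x) ≤ V := by
  rw [Submodule.mul_le]
  constructor
  · rintro h x hx _ ⟨u, hu, rfl⟩
    exact h x (Submodule.subset_span hx) u hu
  · intro h x hx u hu
    induction hx using Submodule.span_induction with
    | mem x hx => exact h x hx ⟨u, hu, rfl⟩
    | zero => simp
    | add x y _ _ h1 h2 => rw [add_mul]; exact V.add_mem h1 h2
    | smul r x _ h1 => rw [smul_mul_assoc]; exact V.smul_mem r h1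

variable {a : τ → A} {κ : τ → Fin d}

/-- Stability under multiplication by generators depends only on the modules they span. Stable
families are thus the graded submodules over the multigraded algebra generated by the `a t`. -/
lemma mem_stableFam_mulSys {U : (Fin d → ℤ) → Submodule R A} :
    U ∈ StableFam (mulSys R a κ) ↔ ∀ k n, genMod R a κ k * U n ≤ U (n + Pi.single k 1) := by
  simp only [genMod, span_mul_le_iff]
  constructor
  · rintro h k n _ ⟨t, rfl, rfl⟩
    exact h t n
  · intro h t n
    exact h (κ t) n _ ⟨t, rfl, rfl⟩

lemma bot_mem_stableFam {E ι : Type*} [AddCommGroup E] [Module R E] [AddCommGroup ι]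
    (y : τ → Module.End R E × ι) : (⊥ : ι → Submodule R E) ∈ StableFam y := by
  intro t n
  simp

lemma mul_prodFam_le (M : Fin d → Submodule R A) (k : Fin d) (n : Fin d → ℤ) :
    M k * prodFam M n ≤ prodFam M (n + Pi.single k 1) := by
  by_cases hn : 0 ≤ n
  · have hn' : 0 ≤ n + Pi.single k 1 := add_nonneg hn (by simp)
    rw [prodFam_of_nonneg M hn, prodFam_of_nonneg M hn', ← Finset.mul_prod_erase _ _
      (Finset.mem_univ k), ← Finset.mul_prod_erase (a := k) _ (fun i => M i ^ ((n + _) i).toNat)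
      (Finset.mem_univ k), ← mul_assoc, ← pow_succ']
    refine le_of_eq ?_
    congr 1
    · congr 1
      have := hn k
      simp only [Pi.add_apply, Pi.single_eq_same, Pi.zero_apply] at this ⊢
      omega
    · refine Finset.prod_congr rfl fun i hi => ?_
      simp [Finset.ne_of_mem_erase hi]
  · rw [prodFam, if_neg hn]
    simp

lemma prodFam_mem_stableFam {M : Fin d → Submodule R A} (h : ∀ t, a t ∈ M (κ t)) :
    prodFam M ∈ StableFam (mulSys R a κ) := by
  rw [mem_stableFam_mulSys]
  intro k n
  refine (mul_le_mul_left (Submodule.span_le.2 ?_) _).trans (mul_prodFam_le M k n)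
  rintro _ ⟨t, rfl, rfl⟩
  exact h t

lemma prod_pow_mul_le {U : (Fin d → ℤ) → Submodule R A} (hU : U ∈ StableFam (mulSys R a κ))
    (p : Fin d → ℕ) (n : Fin d → ℤ) :
    (∏ k, genMod R a κ k ^ p k) * U n ≤ U (n + fun k => (p k : ℤ)) := by
  rw [mem_stableFam_mulSys] at hU
  have h1 : ∀ k (j : ℕ) n, genMod R a κ k ^ j * U n ≤ U (n + Pi.single k (j : ℤ)) := by
    intro k j
    induction j with
    | zero => intro n; simp
    | succ j ih =>
      intro n
      rw [pow_succ, mul_assoc]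
      refine (mul_le_mul_right (hU k n) _).trans ((ih _).trans (le_of_eq ?_))
      rw [add_assoc, ← Pi.single_add]
      push_cast
      rw [add_comm (1 : ℤ)]
  have h2 : ∀ s : Finset (Fin d), ∀ n, (∏ k ∈ s, genMod R a κ k ^ p k) * U n ≤
      U (n + ∑ k ∈ s, Pi.single k (p k : ℤ)) := by
    intro s
    induction s using Finset.induction_on with
    | empty => intro n; simp
    | insert k s hk ih =>
      intro n
      rw [Finset.prod_insert hk, Finset.sum_insert hk, mul_assoc]
      refine (mul_le_mul_right (ih n) _).trans ((h1 _ _ _).trans (le_of_eq ?_))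
      rw [add_assoc, add_comm (Pi.single k _)]
  refine (h2 Finset.univ n).trans (le_of_eq ?_)
  rw [Finset.univ_sum_single]

/-- The algebra generated by the `a t` is cyclic over itself. Its family is generated by 1 in degree
0, which gives the finite generation required by `StableFam.exists_bound`. -/
lemma prodFam_genMod_le {U : (Fin d → ℤ) → Submodule R A} (hU : U ∈ StableFam (mulSys R a κ))
    (h1 : 1 ∈ U 0) : prodFam (genMod R a κ) ≤ U := by
  intro n
  by_cases hn : 0 ≤ n
  · rw [prodFam_of_nonneg _ hn]
    intro x hx
    have := prod_pow_mul_le hU (fun k => (n k).toNat) 0 (Submodule.mul_mem_mul hx h1)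
    rw [mul_one, zero_add] at this
    convert this using 2
    funext k
    exact (Int.toNat_of_nonneg (hn k)).symm
  · rw [prodFam, if_neg hn]
    exact bot_le

/-- The elements of the list generate a joint reduction of the modules generated by all
elements. -/
def IsReduction (R : Type*) {A : Type*} [CommRing R] [CommRing A] [Algebra R A] {d : ℕ} {τ : Type*}
    (a : τ → A) (κ : τ → Fin d) (l : List τ) : Prop :=
  ∃ m : ℕ, ∏ k, genMod R a κ k ^ (m + 1) ≤ ⨆ k, Submodule.span R (a '' {t | t ∈ l ∧ κ t = k}) *
    ∏ i, genMod R a κ i ^ (Function.update (fun _ => m + 1) k m i)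

/-- The reduction equation already holds with m = 0, since one factor can be taken from the list. A
complete generating system in a single direction is therefore a joint reduction. -/
lemma isReduction_of_span {l : List τ} {k : Fin d}
    (h : genMod R a κ k ≤ Submodule.span R (a '' {t | t ∈ l ∧ κ t = k})) :
    IsReduction R a κ l := by
  refine ⟨0, le_trans ?_ (le_iSup _ k)⟩
  rw [← Finset.mul_prod_erase _ _ (Finset.mem_univ k), ← Finset.mul_prod_erase
    (a := k) _ (fun i => genMod R a κ i ^ _) (Finset.mem_univ k)]
  simp only [zero_add, pow_one, Function.update_self, pow_zero, one_mul]
  refine mul_le_mul' h (le_of_eq (Finset.prod_congr rfl fun i hi => ?_))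
  simp [Finset.ne_of_mem_erase hi]

variable [IsNoetherianRing R] [Finite τ]

/-- Bounded generation is applied to the k-th coordinate of the degree. The operators on which this
coordinate does not vanish are precisely those of degree e_k. -/
lemma exists_bound_mulSys {V : (Fin d → ℤ) → Submodule R A} (hV : V ∈ StableFam (mulSys R a κ))
    (hle : V ≤ prodFam (genMod R a κ)) :
    ∃ N : ℤ, ∀ k n, N < n k → V n ≤ genMod R a κ k * V (n - Pi.single k 1) := by
  have h : ∀ k : Fin d, ∃ N : ℤ, ∀ n : Fin d → ℤ, N < n k →
      V n ≤ genMod R a κ k * V (n - Pi.single k 1) := by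
    intro k
    obtain ⟨N, hN⟩ := StableFam.exists_bound (mulSys_commute a κ) hV
      (S := {(0, 1)}) (Set.finite_singleton _)
      (fun W hW h => hle.trans (prodFam_genMod_le hW (h _ rfl))) (Pi.evalAddMonoidHom _ k)
    refine ⟨N, fun n hn => (hN n hn).trans (iSup_le ?_)⟩
    rintro ⟨t, ht⟩
    have htk : κ t = k := by
      by_contra h
      exact ht (by simp [mulSys, Ne.symm h])
    subst htk
    rintro _ ⟨v, hv, rfl⟩
    exact Submodule.mul_mem_mul (mem_genMod a κ t) hv
  choose N hN using h
  obtain ⟨N', hN'⟩ := (Set.finite_range N).bddAbove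
  exact ⟨N', fun k n hn => hN k n ((hN' ⟨k, rfl⟩).trans_lt hn)⟩

lemma exists_bound_prod_pow {V : (Fin d → ℤ) → Submodule R A}
    (hV : V ∈ StableFam (mulSys R a κ)) (hle : V ≤ prodFam (genMod R a κ)) :
    ∃ N : ℤ, ∀ (p : Fin d → ℕ) n, (∀ k, N ≤ n k) →
      V (n + fun k => (p k : ℤ)) ≤ (∏ k, genMod R a κ k ^ p k) * V n := by
  obtain ⟨N, hN⟩ := exists_bound_mulSys hV hle
  refine ⟨N, fun p => ?_⟩
  have h1 : ∀ k (j : ℕ) n, (∀ k, N ≤ n k) →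
      V (n + Pi.single k (j : ℤ)) ≤ genMod R a κ k ^ j * V n := by
    intro k j
    induction j with
    | zero => intro n _; simp
    | succ j ih =>
      intro n hn
      refine (hN k _ ?_).trans ?_
      · have := hn k
        simp
        omega
      rw [pow_succ', mul_assoc]
      refine mul_le_mul_right (le_trans (le_of_eq ?_) (ih n hn)) _
      rw [add_sub_assoc, ← Pi.single_sub]
      push_cast
      rw [add_sub_cancel_right]
  have h2 : ∀ s : Finset (Fin d), ∀ n, (∀ k, N ≤ n k) →
      V (n + ∑ k ∈ s, Pi.single k (p k : ℤ)) ≤ (∏ k ∈ s, genMod R a κ k ^ p k) * V n := by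
    intro s
    induction s using Finset.induction_on with
    | empty => intro n _; simp
    | insert k s hk ih =>
      intro n hn
      rw [Finset.prod_insert hk, Finset.sum_insert hk, mul_assoc, add_comm (Pi.single k _),
        ← add_assoc]
      refine (h1 _ _ _ ?_).trans (mul_le_mul_right (ih n hn) _)
      intro i
      refine (hn i).trans (le_add_of_nonneg_right ?_)
      rw [Finset.sum_apply]
      exact Finset.sum_nonneg fun j _ => by
        by_cases h : i = j
        · subst h; simp
        · simp [h]
  intro n hn
  have := h2 Finset.univ n hn
  rwa [Finset.univ_sum_single] at this

variable {l : List τ} {U V : (Fin d → ℤ) → Submodule R A}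

/-- A family killed by a joint reduction vanishes in large degrees. -/
lemma IsReduction.eventually_le (hl : IsReduction R a κ l)
    (hV : V ∈ StableFam (mulSys R a κ)) (hle : V ≤ prodFam (genMod R a κ))
    (hk : ∀ t ∈ l, ∀ n, (V n).map (mulSys R a κ t).1 ≤ U (n + (mulSys R a κ t).2)) :
    ∀ᶠ n in atTop, V n ≤ U n := by
  obtain ⟨N, hN⟩ := exists_bound_prod_pow hV hle
  obtain ⟨m, hm⟩ := hl
  refine eventually_atTop_iff_forall_le.2 ⟨N + (m + 1), fun n hn => ?_⟩
  -- In large degrees V n is the product of the (m+1)-st powers of the generating modules with V in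
  -- degree n - (m+1, …, m+1). The reduction equation extracts from it a factor in the list, and
  -- that factor maps V into U.
  have h1 := hN (fun _ => m + 1) (n - fun _ => ((m + 1 : ℕ) : ℤ)) fun k => by
    have := hn k
    simp
    omega
  rw [sub_add_cancel] at h1
  refine h1.trans ((mul_le_mul_left hm _).trans ?_)
  rw [Submodule.iSup_mul]
  refine iSup_le fun k => ?_
  rw [mul_assoc]
  have h2 := prod_pow_mul_le hV (Function.update (fun _ => m + 1) k m)
    (n - fun _ => ((m + 1 : ℕ) : ℤ))
  have e : (n - fun _ => ((m + 1 : ℕ) : ℤ)) +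
      (fun i => ((Function.update (fun _ => m + 1) k m i : ℕ) : ℤ)) = n - Pi.single k 1 := by
    funext i
    by_cases h : i = k
    · subst h; simp; ring
    · simp [h]
  rw [e] at h2
  refine (mul_le_mul_right h2 _).trans ?_
  rw [span_mul_le_iff]
  rintro _ ⟨t, ⟨ht, rfl⟩, rfl⟩
  have := hk t ht (n - Pi.single (κ t) 1)
  simpa [mulSys] using this

variable {F : Fin d → Submodule R A}

lemma relLength_prodFam_ne_top {M : Fin d → Submodule R A} (hF : ∀ k, (F k).FG)
    (hM : ∀ k, Cofinite (M k) (F k)) (n : Fin d → ℤ) :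
    relLength (prodFam M n) (prodFam F n) ≠ ⊤ := by
  by_cases hn : 0 ≤ n
  · rw [prodFam_of_nonneg _ hn, prodFam_of_nonneg _ hn]
    obtain ⟨J, hJ, hle⟩ := Cofinite.prod Finset.univ fun k => (hM k).pow (n k).toNat
    refine relLength_ne_top_of_smul_le ?_ hJ hle
    exact Finset.prod_induction _ Submodule.FG (fun _ _ => Submodule.FG.mul) ⟨{1}, by
      rw [Finset.coe_singleton, Submodule.one_eq_span]⟩ fun k _ => (hF k).pow _
  · rw [prodFam, if_neg hn, prodFam, if_neg hn, relLength_self]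
    simp

/-- Let A be the family generated by the `a t`. A subquotient V' / U' killed by the reduction
satisfies V' ∩ A ≤ U' in large degrees, so its length is at most that of F / A, which is finite. The
larger system y makes room for further operators. -/
lemma IsReduction.finiteKilled {σ : Type*} (hl : IsReduction R a κ l)
    (hF : ∀ k, (F k).FG) (hM : ∀ k, Cofinite (genMod R a κ k) (F k))
    (hMF : ∀ k, genMod R a κ k ≤ F k)
    {y : σ → Module.End R A × (Fin d → ℤ)} (hy : StableFam y ≤ StableFam (mulSys R a κ))
    {l' : List σ} (hl' : l'.map y = l.map (mulSys R a κ)) :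
    FiniteKilled atTop y l' ⊥ (prodFam F) := by
  intro U' hU' V' hV' _ h2 h3 hk
  have hA : prodFam (genMod R a κ) ∈ StableFam (mulSys R a κ) :=
    prodFam_mem_stableFam (mem_genMod a κ)
  have hkt : ∀ t ∈ l, ∀ n, (V' n).map (mulSys R a κ t).1 ≤ U' (n + (mulSys R a κ t).2) := by
    intro t ht n
    have : mulSys R a κ t ∈ l'.map y := hl' ▸ List.mem_map_of_mem ht
    obtain ⟨s, hs, e⟩ := List.mem_map.1 this
    rw [← e]
    exact hk s hs n
  have := hl.eventually_le (V := V' ⊓ prodFam (genMod R a κ)) (U := U')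
    (Sublattice.infClosed _ (hy hV') hA) inf_le_right
    fun t ht n => (Submodule.map_mono inf_le_left).trans (hkt t ht n)
  filter_upwards [this] with n hn htop
  have h4 : relLength (U' n) (V' n) ≤ relLength (prodFam (genMod R a κ) n) (prodFam F n) := by
    calc _ ≤ relLength (V' n ⊓ prodFam (genMod R a κ) n) (V' n) := relLength_le hn (h2 n) le_rfl
      _ = relLength (prodFam (genMod R a κ) n) (prodFam (genMod R a κ) n ⊔ V' n) := by
        rw [inf_comm, relLength_inf]
      _ ≤ _ := relLength_le le_rfl le_sup_left (sup_le (prodFam_mono hMF n) (h3 n))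
  rw [htop, top_le_iff] at h4
  exact relLength_prodFam_ne_top hF hM n h4

/-- The symbol of a joint reduction is a difference of the length function. -/
theorem IsReduction.famSymb_eq (hl : IsReduction R a κ l)
    (hF : ∀ k, (F k).FG) (hM : ∀ k, Cofinite (genMod R a κ k) (F k))
    (hMF : ∀ k, genMod R a κ k ≤ F k) :
    ∀ᶠ n in atTop, famSymb (l.map (mulSys R a κ)) ⊥ (prodFam F) n =
      backDiff (l.map fun t => Pi.single (κ t) 1)
        (famLength (prodFam (genMod R a κ)) (prodFam F)) n := by
  have hA : prodFam (genMod R a κ) ∈ StableFam (mulSys R a κ) :=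
    prodFam_mem_stableFam (mem_genMod a κ)
  have hG : prodFam F ∈ StableFam (mulSys R a κ) :=
    prodFam_mem_stableFam fun t => hMF _ (mem_genMod a κ t)
  have hb := bot_mem_stableFam (mulSys R a κ)
  have hk := hl.finiteKilled hF hM hMF le_rfl rfl
  have hAG := prodFam_mono hMF
  -- The symbol on the whole algebra splits into that of the subalgebra and that of the quotient.
  -- The first part vanishes because the list is a reduction of the subalgebra.
  have h1 := famSymb_add (mulSys_commute a κ) (mulSys_tendsto a κ) hb hA hG bot_le hAG hk
  have h2 := famSymb_eq_zero (mulSys_commute a κ) (mulSys_tendsto a κ) hb hA bot_le (l := l)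
    (fun U' _ V' hV' _ _ h3 hk => hl.eventually_le hV' h3 hk)
  -- The quotient has finite length in every degree, so the empty tail is admissible and every
  -- operator of l acts as a difference.
  have h3 := famSymb_append (mulSys_commute a κ) (mulSys_tendsto a κ) hA hG hAG (l := l) (l' := [])
    (fun U' _ V' _ h1 h2 h3 _ => Eventually.of_forall fun n htop =>
      relLength_prodFam_ne_top hF hM n (top_le_iff.1 (htop.symm.le.trans
        (relLength_le (h1 n) (h2 n) (h3 n)))))
  filter_upwards [h1, h2, h3] with n e1 e2 e3
  rw [e1, e2, zero_add]
  rw [List.append_nil] at e3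
  exact e3

lemma backDiff_replicate {ι : Type*} [AddCommGroup ι] (e : ι) (s : ℕ) (f : ι → ℤ) (n : ι) :
    backDiff (List.replicate s e) f n = (fwdDiff e)^[s] f (n - s • e) := by
  induction s generalizing n with
  | zero => simp [backDiff]
  | succ s ih =>
    have e1 : backDiff (List.replicate (s + 1) e) f n = backDiff (List.replicate s e) f n -
      backDiff (List.replicate s e) f (n - e) := rfl
    rw [e1, ih, ih, Function.iterate_succ_apply', fwdDiff]
    congr 2
    · rw [succ_nsmul, sub_add_eq_sub_sub, sub_add_cancel]
    · rw [succ_nsmul, add_comm, sub_add_eq_sub_sub]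

lemma backDiff_append {ι : Type*} [AddCommGroup ι] (l l' : List ι) (f : ι → ℤ) :
    backDiff (l ++ l') f = backDiff l (backDiff l' f) := List.foldr_append

lemma backDiff_congr {ι : Type*} [AddCommGroup ι] {Φ : Filter ι} {l : List ι}
    (hl : ∀ e ∈ l, Tendsto (fun n => n - e) Φ Φ) {f g : ι → ℤ} (h : ∀ᶠ n in Φ, f n = g n) :
    ∀ᶠ n in Φ, backDiff l f n = backDiff l g n := by
  induction l with
  | nil => exact h
  | cons e l ih =>
    have := ih fun e he => hl e (by simp [he])
    filter_upwards [this, (hl e (by simp)).eventually this] with n h1 h2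
    exact congrArg₂ (· - ·) h1 h2

/-- The difference of the length function in one variable vanishes eventually. -/
theorem exists_backDiff_eq_zero {σ : Type*} [Finite σ] (u : σ → A) (μ : σ → Fin d)
    (hM : ∀ k, Cofinite (genMod R a κ k) (genMod R u μ k))
    (hMF : ∀ k, genMod R a κ k ≤ genMod R u μ k) (k : Fin d) :
    ∃ s : ℕ, ∀ᶠ n in atTop, backDiff (List.replicate s (Pi.single k (1 : ℤ)))
      (famLength (prodFam (genMod R a κ)) (prodFam (genMod R u μ))) n = 0 := by
  classical
  have hF : ∀ k, (genMod R u μ k).FG := fun k => Submodule.fg_span ((Set.toFinite _).image _)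
  have := Fintype.ofFinite τ
  have := Fintype.ofFinite σ
  obtain ⟨l, hl⟩ : ∃ l : List τ, ∀ t, t ∈ l ↔ κ t = k :=
    ⟨(Finset.univ.filter fun t => κ t = k).toList, fun t => by simp⟩
  obtain ⟨l', hl'⟩ : ∃ l : List σ, ∀ t, t ∈ l ↔ μ t = k :=
    ⟨(Finset.univ.filter fun t => μ t = k).toList, fun t => by simp⟩
  have hlr : IsReduction R a κ l := isReduction_of_span (k := k) (by simp [hl, genMod])
  -- Generators of both algebras are put into one system, so that both lists act on one lattice of
  -- stable families.
  let w : τ ⊕ σ → A := Sum.elim a u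
  let ν : τ ⊕ σ → Fin d := Sum.elim κ μ
  have hw : ∀ k, genMod R w ν k = genMod R u μ k := by
    intro k
    refine le_antisymm (Submodule.span_le.2 ?_) (Submodule.span_mono ?_)
    · rintro _ ⟨t | t, ht, rfl⟩
      · exact hMF k (Submodule.subset_span ⟨t, ht, rfl⟩)
      · exact Submodule.subset_span ⟨t, ht, rfl⟩
    · rintro _ ⟨t, ht, rfl⟩
      exact ⟨Sum.inr t, ht, rfl⟩
  have hl2 : IsReduction R w ν (l'.map Sum.inr ++ l.map Sum.inl) := by
    refine isReduction_of_span (k := k) ?_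
    rw [hw]
    refine Submodule.span_mono ?_
    rintro _ ⟨t, ht, rfl⟩
    exact ⟨Sum.inr t, by simpa [hl', ν] using ht, rfl⟩
  have hsub : StableFam (mulSys R w ν) ≤ StableFam (mulSys R a κ) := fun U hU t => hU (Sum.inl t)
  have hk := hlr.finiteKilled hF hM hMF hsub (l' := l.map Sum.inl)
    (by rw [List.map_map]; rfl)
  have hb := bot_mem_stableFam (mulSys R w ν)
  have hG : prodFam (genMod R u μ) ∈ StableFam (mulSys R w ν) :=
    prodFam_mem_stableFam fun t => hw _ ▸ mem_genMod w ν t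
  -- Because the symbol of l is finite, adding the generators of the larger module in direction k
  -- only takes further differences.
  have h1 := famSymb_append (mulSys_commute w ν) (mulSys_tendsto w ν) hb hG bot_le
    (l := l'.map Sum.inr) hk
  -- The enlarged list contains all generators of degree e_k of the ambient algebra, so every
  -- subquotient it kills vanishes in large degrees.
  have h2 := famSymb_eq_zero (mulSys_commute w ν) (mulSys_tendsto w ν) hb hG bot_le
    (l := l'.map Sum.inr ++ l.map Sum.inl)
    (fun U' _ V' hV' _ _ h3 hk => hl2.eventually_le hV' (by
      have : genMod R w ν = genMod R u μ := funext hw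
      rwa [this]) hk)
  have h3 := hlr.famSymb_eq hF hM hMF
  have hdeg : ∀ e : Fin d → ℤ, Tendsto (fun n => n - e) atTop atTop := fun e => by
    simp only [sub_eq_add_neg]
    exact tendsto_atTop_add_const_right _ _ tendsto_id
  have h4 := backDiff_congr (l := (l'.map Sum.inr).map fun t => (mulSys R w ν t).2)
    (fun e _ => hdeg e) h3
  refine ⟨l'.length + l.length, ?_⟩
  filter_upwards [h1, h2, h4] with n e1 e2 e4
  rw [List.replicate_add, backDiff_append]
  have r1 : List.replicate l'.length (Pi.single k (1 : ℤ)) =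
      (l'.map Sum.inr).map fun t => (mulSys R w ν t).2 := by
    rw [List.map_map]
    symm
    refine List.eq_replicate_iff.2 ⟨by simp, ?_⟩
    simp only [List.mem_map]
    rintro _ ⟨t, ht, rfl⟩
    simp [mulSys, ν, (hl' t).1 ht]
  have r2 : List.replicate l.length (Pi.single k (1 : ℤ)) =
      l.map fun t => (Pi.single (κ t) 1 : Fin d → ℤ) := by
    symm
    refine List.eq_replicate_iff.2 ⟨by simp, ?_⟩
    simp only [List.mem_map]
    rintro _ ⟨t, ht, rfl⟩
    simp [(hl t).1 ht]
  rw [r1, r2, ← e4]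
  have : (l.map Sum.inl).map (mulSys R w ν) = l.map (mulSys R a κ) := by
    rw [List.map_map]; rfl
  rw [← e2, e1, this]

/-- The length function is eventually given by a polynomial. -/
theorem exists_mvPolynomial_famLength {σ : Type*} [Finite σ] (u : σ → A) (μ : σ → Fin d)
    (hM : ∀ k, Cofinite (genMod R a κ k) (genMod R u μ k))
    (hMF : ∀ k, genMod R a κ k ≤ genMod R u μ k) :
    ∃ p : MvPolynomial (Fin d) ℚ, ∀ᶠ n in atTop,
      MvPolynomial.eval (fun k => ((n k : ℤ) : ℚ)) p =
        famLength (prodFam (genMod R a κ)) (prodFam (genMod R u μ)) n := by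
  set f := famLength (prodFam (genMod R a κ)) (prodFam (genMod R u μ))
  choose s hs using exists_backDiff_eq_zero u μ hM hMF
  choose N hN using fun k => eventually_atTop_iff_forall_le.1 (hs k)
  obtain ⟨N', hN'⟩ := (Set.finite_range N).bddAbove
  obtain ⟨S, hS⟩ := (Set.finite_range s).bddAbove
  have h1 : ∀ k ∈ Finset.univ, ∀ n : Fin d → ℤ, (∀ i, N' ≤ n i) →
      (fwdDiff (Pi.single k (1 : ℤ)))^[S] (fun n => ((f n : ℤ) : ℚ)) n = 0 := by
    intro k _ n hn
    have key : ∀ (j : ℕ) m, (fwdDiff (Pi.single k (1 : ℤ)))^[j] (fun n => ((f n : ℤ) : ℚ)) m =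
        (((fwdDiff (Pi.single k (1 : ℤ)))^[j] f m : ℤ) : ℚ) := by
      intro j
      induction j with
      | zero => intro m; rfl
      | succ j ih =>
        intro m
        rw [Function.iterate_succ_apply', Function.iterate_succ_apply', fwdDiff, fwdDiff, ih, ih]
        push_cast
        rfl
    have hle : s k ≤ S := hS ⟨k, rfl⟩
    rw [← Nat.sub_add_cancel hle, Function.iterate_add_apply]
    refine fwdDiff_iter_eq_zero_of_ge (N := N') (by simp) (fun m hm => ?_) _ _ hn
    rw [key]
    have := hN k (m + s k • Pi.single k 1) fun i =>
      (hN' ⟨k, rfl⟩).trans ((hm i).trans (le_add_of_nonneg_right (by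
        by_cases h : i = k
        · subst h; simp
        · simp [h])))
    rw [backDiff_replicate, add_sub_cancel_right] at this
    exact_mod_cast this
  obtain ⟨p, hp⟩ := exists_mvPolynomial_of_fwdDiff N' S Finset.univ _ h1
    fun n n' _ _ h => by rw [funext fun k => h k (Finset.mem_univ k)]
  exact ⟨p, eventually_atTop_iff_forall_le.2 ⟨N', hp⟩⟩

end ProdFam

/-! ### Linear substitutions in polynomial rings over one-dimensional domains -/

section Substitution

variable {A : Type*} [CommRing A] {r : ℕ}

/-- The substitution `T_i ↦ ∑ j, φ j i T_j`. -/
noncomputable def linSub (φ : Matrix (Fin r) (Fin r) A) :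
    MvPolynomial (Fin r) A →ₐ[A] MvPolynomial (Fin r) A :=
  MvPolynomial.aeval fun i => ∑ j, φ j i • MvPolynomial.X j

lemma linSub_X (φ : Matrix (Fin r) (Fin r) A) (i : Fin r) :
    linSub φ (MvPolynomial.X i) = ∑ j, φ j i • MvPolynomial.X j := by
  rw [linSub, MvPolynomial.aeval_X]

lemma linSub_mul (φ ψ : Matrix (Fin r) (Fin r) A) :
    linSub (φ * ψ) = (linSub φ).comp (linSub ψ) := by
  refine MvPolynomial.algHom_ext fun i => ?_
  rw [AlgHom.comp_apply, linSub_X, linSub_X, map_sum]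
  simp only [map_smul, linSub_X, Finset.smul_sum, smul_smul, Matrix.mul_apply, Finset.sum_smul]
  rw [Finset.sum_comm]
  simp only [mul_comm]

lemma linSub_one : linSub (1 : Matrix (Fin r) (Fin r) A) = AlgHom.id A _ := by
  refine MvPolynomial.algHom_ext fun i => ?_
  simp [linSub_X, Matrix.one_apply]

lemma linSub_mem (φ : Matrix (Fin r) (Fin r) A) {m : ℕ} {f : MvPolynomial (Fin r) A}
    (hf : f ∈ MvPolynomial.homogeneousSubmodule (Fin r) A m) :
    linSub φ f ∈ MvPolynomial.homogeneousSubmodule (Fin r) A m := by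
  have := MvPolynomial.IsHomogeneous.aeval hf
    (fun i => ∑ j, φ j i • (MvPolynomial.X j : MvPolynomial (Fin r) A)) (n := 1) (fun i => by
      refine Submodule.sum_mem (MvPolynomial.homogeneousSubmodule (Fin r) A 1) fun j _ => ?_
      exact Submodule.smul_mem _ _ (MvPolynomial.isHomogeneous_X A j))
  rwa [one_mul] at this

lemma coeff_linSub_diagonal (D : Fin r → A) (f : MvPolynomial (Fin r) A) (β : Fin r →₀ ℕ) :
    (linSub (Matrix.diagonal D) f).coeff β = (∏ i, D i ^ β i) * f.coeff β := by
  classical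
  have hX : ∀ i, linSub (Matrix.diagonal D) (MvPolynomial.X i) =
      D i • MvPolynomial.X i := by
    intro i
    rw [linSub_X, Finset.sum_eq_single i]
    · simp
    · intro j _ h
      simp [Matrix.diagonal_apply_ne _ h]
    · simp
  induction f using MvPolynomial.induction_on' with
  | monomial γ c =>
    have : linSub (Matrix.diagonal D) (MvPolynomial.monomial γ c) =
        MvPolynomial.monomial γ ((∏ i, D i ^ γ i) * c) := by
      have h0 : ∀ c, MvPolynomial.monomial γ c = c • ∏ i, (MvPolynomial.X i :
          MvPolynomial (Fin r) A) ^ γ i := fun c => by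
        rw [MvPolynomial.monomial_eq, MvPolynomial.smul_eq_C_mul, Finsupp.prod_fintype]
        simp
      rw [h0 c, h0 (_ * c), map_smul, map_prod]
      simp only [map_pow, hX, smul_pow]
      rw [Finset.prod_smul, smul_smul, mul_comm]
    rw [this, MvPolynomial.coeff_monomial, MvPolynomial.coeff_monomial]
    split_ifs with h
    · rw [h]
    · rw [mul_zero]
  | add p q hp hq => rw [map_add, MvPolynomial.coeff_add, hp, hq, MvPolynomial.coeff_add, mul_add]

/-- The length of the cokernel of the substitution in degree `m`. -/
noncomputable def subLength (φ : Matrix (Fin r) (Fin r) A) (m : ℕ) : ℕ∞ :=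
  relLength ((MvPolynomial.homogeneousSubmodule (Fin r) A m).map (linSub φ).toLinearMap)
    (MvPolynomial.homogeneousSubmodule (Fin r) A m)

lemma subLength_one (m : ℕ) : subLength (1 : Matrix (Fin r) (Fin r) A) m = 0 := by
  rw [subLength, relLength_eq_zero, linSub_one]
  simp

/-- By symmetry every variable has the same total exponent over the monomials of degree m. So r
times this total is m · C(m+r-1, r-1), which equals r · C(m+r-1, r). This is the source of the
binomial factor in `subLength_eq`. -/
lemma sum_finsuppAntidiag_apply (i : Fin r) (m : ℕ) :
    ∑ β ∈ Finset.finsuppAntidiag (Finset.univ : Finset (Fin r)) m, β i = (m + r - 1).choose r := by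
  classical
  have hsymm : ∀ j, ∑ β ∈ Finset.finsuppAntidiag (Finset.univ : Finset (Fin r)) m, β j =
      ∑ β ∈ Finset.finsuppAntidiag (Finset.univ : Finset (Fin r)) m, β i := by
    intro j
    refine Finset.sum_equiv (Finsupp.domCongr (Equiv.swap i j)).toEquiv ?_ ?_
    · intro β
      simp only [Finset.mem_finsuppAntidiag, Finset.subset_univ, and_true]
      have : ∑ k, (Finsupp.domCongr (Equiv.swap i j)).toEquiv β k = ∑ k, β k := by
        refine Equiv.sum_comp (Equiv.swap i j).symm β
      exact ⟨fun h => this.trans h, fun h => this.symm.trans h⟩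
    · intro β _
      simp [Finsupp.domCongr]
  have h1 : ∑ j : Fin r, ∑ β ∈ Finset.finsuppAntidiag (Finset.univ : Finset (Fin r)) m, β j =
      (Finset.finsuppAntidiag (Finset.univ : Finset (Fin r)) m).card * m := by
    rw [Finset.sum_comm, Finset.card_eq_sum_ones, Finset.sum_mul]
    refine Finset.sum_congr rfl fun β hβ => ?_
    rw [one_mul]
    exact (Finset.mem_finsuppAntidiag.1 hβ).1
  rw [Finset.sum_congr rfl fun j _ => hsymm j, Finset.sum_const, Finset.card_univ,
    Fintype.card_fin, smul_eq_mul, Finset.card_finsuppAntidiag_nat_eq_choose, Finset.card_univ,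
    Fintype.card_fin] at h1
  have hr : 0 < r := i.pos
  refine Nat.eq_of_mul_eq_mul_left hr (h1.trans ?_)
  have h2 := Nat.choose_succ_right_eq (m + r - 1) (r - 1)
  rw [Nat.sub_add_cancel hr] at h2
  have h3 : m + r - 1 - (r - 1) = m := by omega
  rw [h3] at h2
  rw [mul_comm, mul_comm r, h2, mul_comm]
  congr 1
  have h4 : r + m - 1 = m + r - 1 := by omega
  rw [h4]
  exact Nat.choose_symm_of_eq_add (by omega)

/-- The length of `A / aA`. -/
noncomputable def ordLength (a : A) : ℕ∞ := relLength (Ideal.span {a}) (⊤ : Ideal A)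

lemma ordLength_one : ordLength (1 : A) = 0 := by
  rw [ordLength, relLength_eq_zero, Ideal.span_singleton_one]

/-- A diagonal substitution multiplies each monomial by a scalar, so its cokernel is a direct sum of
cyclic modules. -/
lemma subLength_diagonal_eq_sum (D : Fin r → A) (m : ℕ) :
    subLength (Matrix.diagonal D) m =
      ∑ β ∈ Finset.finsuppAntidiag (Finset.univ : Finset (Fin r)) m,
        ordLength (∏ i, D i ^ β i) := by
  classical
  set I := Finset.finsuppAntidiag (Finset.univ : Finset (Fin r)) m
  have hI : ∀ β : Fin r →₀ ℕ, β ∈ I ↔ β.degree = m := by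
    intro β
    simp [I, Finset.mem_finsuppAntidiag, Finsupp.degree_eq_sum]
  let θ : (I → A) →ₗ[A] MvPolynomial (Fin r) A :=
    ∑ β : I, MvPolynomial.monomial β.1 ∘ₗ LinearMap.proj β
  have hθ : ∀ c γ, (θ c).coeff γ = if h : γ ∈ I then c ⟨γ, h⟩ else 0 := by
    intro c γ
    simp only [θ, LinearMap.sum_apply, LinearMap.comp_apply, LinearMap.proj_apply,
      MvPolynomial.coeff_sum, MvPolynomial.coeff_monomial]
    split_ifs with h
    · rw [Finset.sum_eq_single ⟨γ, h⟩]
      · simp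
      · rintro ⟨β, hβ⟩ _ hne
        exact if_neg fun h => hne (Subtype.ext h)
      · simp
    · exact Finset.sum_eq_zero fun β _ => if_neg fun (h' : β.1 = γ) => h (h' ▸ β.2)
  have hV : ∀ f, f ∈ MvPolynomial.homogeneousSubmodule (Fin r) A m ↔ ∃ c, θ c = f := by
    intro f
    constructor
    · intro hf
      refine ⟨fun β => f.coeff β, MvPolynomial.ext _ _ fun γ => ?_⟩
      rw [hθ]
      split_ifs with h
      · rfl
      · exact (MvPolynomial.IsHomogeneous.coeff_eq_zero hf (fun h' => h ((hI γ).2 h'))).symm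
    · rintro ⟨c, rfl⟩
      intro γ hγ
      rw [hθ] at hγ
      have : γ ∈ I := by
        by_contra h
        simp [h] at hγ
      rw [← (hI γ).1 this]
      exact (DFunLike.congr_fun Finsupp.degree_eq_weight_one γ).symm
  have hD : ∀ c, linSub (Matrix.diagonal D) (θ c) = θ fun β => (∏ i, D i ^ β.1 i) * c β := by
    intro c
    refine MvPolynomial.ext _ _ fun γ => ?_
    rw [coeff_linSub_diagonal, hθ, hθ]
    split_ifs <;> simp
  have hinj : Function.Injective θ := by
    intro c c' h
    funext β
    have := congrArg (MvPolynomial.coeff β.1) h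
    simpa [hθ] using this
  have h1 : relLength (Submodule.pi Set.univ fun β : I => Ideal.span {∏ i, D i ^ β.1 i})
      (⊤ : Submodule A (I → A)) = subLength (Matrix.diagonal D) m := by
    refine relLength_eq_of_map θ ?_ ?_
    · have e : (⊤ : Submodule A (I → A)).map θ =
          MvPolynomial.homogeneousSubmodule (Fin r) A m := by
        ext f
        rw [hV, Submodule.map_top, LinearMap.mem_range]
      rw [e, right_eq_sup]
      rintro _ ⟨f, hf, rfl⟩
      exact linSub_mem _ hf
    · ext c
      simp only [Submodule.mem_pi, Set.mem_univ, true_implies, Submodule.mem_inf,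
        Submodule.mem_top, true_and, Submodule.mem_comap, Submodule.mem_map,
        Ideal.mem_span_singleton']
      constructor
      · intro h
        choose c' hc' using h
        refine ⟨θ c', (hV _).2 ⟨c', rfl⟩, ?_⟩
        rw [AlgHom.toLinearMap_apply, hD]
        congr 1
        funext β
        rw [mul_comm, hc']
      · rintro ⟨f, hf, hfc⟩ β
        obtain ⟨c', rfl⟩ := (hV _).1 hf
        rw [AlgHom.toLinearMap_apply, hD] at hfc
        exact ⟨c' β, by rw [← hinj hfc, mul_comm]⟩
  rw [← h1, relLength_top, (Submodule.quotientPi _).length_eq, Module.length_pi_of_fintype,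
    ← Finset.sum_coe_sort I fun β => ordLength (∏ i, D i ^ β i)]
  exact Finset.sum_congr rfl fun β _ => (relLength_top _).symm

variable [IsDomain A]

lemma linSub_diagonal_injective {D : Fin r → A} (hD : ∀ i, D i ≠ 0) :
    Function.Injective (linSub (Matrix.diagonal D)) := by
  intro f f' h
  refine MvPolynomial.ext _ _ fun β => ?_
  have := congrArg (MvPolynomial.coeff β) h
  rw [coeff_linSub_diagonal, coeff_linSub_diagonal] at this
  exact mul_left_cancel₀ (Finset.prod_ne_zero_iff.2 fun i _ => pow_ne_zero _ (hD i)) this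

lemma linSub_injective {φ : Matrix (Fin r) (Fin r) A} (hφ : φ.det ≠ 0) :
    Function.Injective (linSub φ) := by
  have h1 : φ.adjugate * φ = Matrix.diagonal fun _ => φ.det := by
    rw [Matrix.adjugate_mul, Matrix.smul_one_eq_diagonal]
  have h2 := linSub_diagonal_injective (D := fun _ : Fin r => φ.det) fun _ => hφ
  rw [← h1, linSub_mul] at h2
  exact Function.Injective.of_comp (f := linSub φ.adjugate) h2

/-- Filter the forms V of degree m by V ⊇ φV ⊇ φψV. Since the substitution φ is injective on a
domain, φV / φψV is isomorphic to V / ψV. -/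
lemma subLength_mul {φ : Matrix (Fin r) (Fin r) A} (hφ : φ.det ≠ 0)
    (ψ : Matrix (Fin r) (Fin r) A) (m : ℕ) :
    subLength (φ * ψ) m = subLength φ m + subLength ψ m := by
  set V := MvPolynomial.homogeneousSubmodule (Fin r) A m
  have hle : ∀ φ : Matrix (Fin r) (Fin r) A, V.map (linSub φ).toLinearMap ≤ V := by
    rintro φ _ ⟨f, hf, rfl⟩
    exact linSub_mem φ hf
  have e : V.map (linSub (φ * ψ)).toLinearMap =
      (V.map (linSub ψ).toLinearMap).map (linSub φ).toLinearMap := by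
    rw [← Submodule.map_comp, linSub_mul]
    rfl
  have h1 : relLength (V.map (linSub (φ * ψ)).toLinearMap) (V.map (linSub φ).toLinearMap) =
      relLength (V.map (linSub ψ).toLinearMap) V := by
    symm
    refine relLength_eq_of_map (linSub φ).toLinearMap ?_ ?_
    · rw [e, right_eq_sup]
      exact Submodule.map_mono (hle ψ)
    · rw [e, Submodule.comap_map_eq_of_injective (linSub_injective hφ), inf_eq_right.2 (hle ψ)]
  rw [subLength, relLength_add (e ▸ Submodule.map_mono (hle ψ)) (hle φ), h1, add_comm]
  rfl

lemma ordLength_mul {a : A} (ha : a ≠ 0) (b : A) :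
    ordLength (a * b) = ordLength a + ordLength b := by
  have h1 : relLength (Ideal.span {a * b}) (Ideal.span {a}) = relLength (Ideal.span {b}) ⊤ := by
    symm
    refine relLength_eq_of_map (LinearMap.mulLeft A a) ?_ ?_
    · ext x
      simp only [Submodule.mem_sup, Ideal.mem_span_singleton', Submodule.map_top,
        LinearMap.mem_range, LinearMap.mulLeft_apply]
      constructor
      · rintro ⟨c, rfl⟩
        exact ⟨0, ⟨0, by simp⟩, a * c, ⟨c, rfl⟩, by ring⟩
      · rintro ⟨_, ⟨c, rfl⟩, _, ⟨c', rfl⟩, rfl⟩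
        exact ⟨c * b + c', by ring⟩
    · ext x
      simp only [Submodule.mem_inf, Submodule.mem_top, true_and, Submodule.mem_comap,
        LinearMap.mulLeft_apply, Ideal.mem_span_singleton, mul_dvd_mul_iff_left ha]
  rw [ordLength, relLength_add (W := Ideal.span {a}) (by
    rw [Ideal.span_singleton_le_span_singleton]; exact dvd_mul_right a b) le_top, h1, add_comm]
  rfl

lemma ordLength_pow {a : A} (ha : a ≠ 0) (n : ℕ) : ordLength (a ^ n) = n * ordLength a := by
  induction n with
  | zero => simp [ordLength_one]
  | succ n ih =>
    rw [pow_succ, ordLength_mul (pow_ne_zero n ha), ih]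
    push_cast
    rw [add_mul, one_mul]

lemma ordLength_prod {D : Fin r → A} (hD : ∀ i, D i ≠ 0) (β : Fin r → ℕ) (s : Finset (Fin r)) :
    ordLength (∏ i ∈ s, D i ^ β i) = ∑ i ∈ s, β i * ordLength (D i) := by
  classical
  induction s using Finset.induction_on with
  | empty => simp [ordLength_one]
  | insert i s hi ih =>
    rw [Finset.prod_insert hi, Finset.sum_insert hi, ordLength_mul (pow_ne_zero _ (hD i)), ih,
      ordLength_pow (hD i)]

lemma subLength_diagonal {D : Fin r → A} (hD : ∀ i, D i ≠ 0) (m : ℕ) :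
    subLength (Matrix.diagonal D) m = (m + r - 1).choose r * ∑ i, ordLength (D i) := by
  rw [subLength_diagonal_eq_sum]
  simp only [ordLength_prod hD]
  rw [Finset.sum_comm, Finset.mul_sum]
  refine Finset.sum_congr rfl fun i _ => ?_
  rw [← Finset.sum_mul, ← sum_finsuppAntidiag_apply i m]
  push_cast
  rfl

lemma subLength_diagonal_ne_top (hA : ∀ a : A, a ≠ 0 → ordLength a ≠ ⊤)
    {D : Fin r → A} (hD : ∀ i, D i ≠ 0) (m : ℕ) :
    subLength (Matrix.diagonal D) m ≠ ⊤ := by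
  rw [subLength_diagonal hD]
  refine WithTop.mul_ne_top (ENat.natCast_ne_top _) ?_
  exact WithTop.sum_ne_top.2 fun i _ => hA _ (hD i)

/-- The product of φ with its adjugate is the scalar matrix det φ, so the length for φ is a summand
of a finite one. -/
lemma subLength_ne_top (hA : ∀ a : A, a ≠ 0 → ordLength a ≠ ⊤)
    {φ : Matrix (Fin r) (Fin r) A} (hφ : φ.det ≠ 0) (m : ℕ) :
    subLength φ m ≠ ⊤ := by
  have h := subLength_diagonal_ne_top hA (D := fun _ : Fin r => φ.det) (fun _ => hφ) m
  rw [← Matrix.smul_one_eq_diagonal, ← Matrix.mul_adjugate, subLength_mul hφ] at h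
  exact (WithTop.add_ne_top.1 h).1

/-- The length of the cokernel of a substitution is a multiple of that in degree one. -/
theorem subLength_eq (hA : ∀ a : A, a ≠ 0 → ordLength a ≠ ⊤)
    {φ : Matrix (Fin r) (Fin r) A} (hφ : φ.det ≠ 0) (m : ℕ) :
    subLength φ m = (m + r - 1).choose r * subLength φ 1 := by
  classical
  let K := FractionRing A
  have inj : Function.Injective (algebraMap A K) := IsFractionRing.injective A K
  -- Elimination works only over the fraction field, while lengths make sense only for integral
  -- matrices. The predicate therefore asserts the formula for all integral multiples of N.
  let Q : Matrix (Fin r) (Fin r) K → Prop := fun N => ∀ s : A, s ≠ 0 →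
    ∀ φ : Matrix (Fin r) (Fin r) A, φ.map (algebraMap A K) = algebraMap A K s • N →
      ∀ m, subLength φ m = (m + r - 1).choose r * subLength φ 1
  have one_choose : (1 + r - 1).choose r = 1 := by simp
  have diag : ∀ D : Fin r → A, (∀ i, D i ≠ 0) → ∀ m, subLength (Matrix.diagonal D) m =
      (m + r - 1).choose r * subLength (Matrix.diagonal D) 1 := by
    intro D hD m
    rw [subLength_diagonal hD, subLength_diagonal hD, one_choose]
    simp
  have det_map : ∀ φ : Matrix (Fin r) (Fin r) A,
      (φ.map (algebraMap A K)).det = algebraMap A K φ.det := fun φ =>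
    ((algebraMap A K).map_det φ).symm
  have hQ : Q (φ.map (algebraMap A K)) := by
    refine Matrix.diagonal_transvection_induction_of_det_ne_zero Q _ ?_ ?_ ?_ ?_
    · rw [det_map]
      exact fun h => hφ (inj (h.trans (map_zero _).symm))
    · intro D hD s hs φ hφ
      have e : φ = Matrix.diagonal fun i => φ i i := by
        ext i j
        by_cases h : i = j
        · subst h; simp
        · have := congrFun (congrFun hφ i) j
          rw [Matrix.diagonal_apply_ne _ h]
          refine inj ?_
          simpa [Matrix.diagonal_apply_ne _ h] using this
      have hne : ∀ i, φ i i ≠ 0 := by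
        intro i h
        have := congrFun (congrFun hφ i) i
        simp only [Matrix.map_apply, h, map_zero, Matrix.smul_apply, Matrix.diagonal_apply_eq,
          smul_eq_mul] at this
        rw [Matrix.det_diagonal, Finset.prod_ne_zero_iff] at hD
        exact mul_ne_zero (fun h => hs (inj (h.trans (map_zero _).symm))) (hD i (by simp)) this.symm
      rw [e]
      exact diag _ hne
    · rintro ⟨i, j, hij, c⟩ s hs φ hφ m
      set a := φ i j
      -- An integral multiple s · (1 + c E_ij) is not a scalar times an integral transvection, but
      -- it equals D' (1 + a E_ij) D'' with a = sc. The outer factors are diagonal with entries 1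
      -- and s, and the middle one is invertible over A.
      let D' : Fin r → A := fun k => if k = i then 1 else s
      let D'' : Fin r → A := fun k => if k = i then s else 1
      have hD' : ∀ k, D' k ≠ 0 := fun k => by simp only [D']; split_ifs <;> simp [hs]
      have hD'' : ∀ k, D'' k ≠ 0 := fun k => by simp only [D'']; split_ifs <;> simp [hs]
      have e : φ = Matrix.diagonal D' * (Matrix.transvection i j a * Matrix.diagonal D'') := by
        ext p q
        rw [Matrix.diagonal_mul, Matrix.mul_diagonal]
        have h := congrFun (congrFun hφ p) q
        simp only [Matrix.map_apply, Matrix.smul_apply, Matrix.TransvectionStruct.toMatrix,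
          Matrix.transvection, Matrix.add_apply, Matrix.one_apply, Matrix.single_apply,
          smul_eq_mul, D', D''] at h ⊢
        by_cases hpi : p = i
        · subst hpi
          by_cases hqj : q = j
          · subst hqj
            simp [hij, a, Ne.symm hij]
          · refine inj (h.trans ?_)
            by_cases hpq : p = q
            · subst hpq; simp [Ne.symm hqj]
            · simp [hpq, Ne.symm hqj]
        · refine inj (h.trans ?_)
          by_cases hpq : p = q
          · subst hpq; simp [hpi, Ne.symm hpi]
          · simp [hpq, Ne.symm hpi]
      have ht : (Matrix.transvection i j a).det ≠ 0 := by
        rw [Matrix.det_transvection_of_ne i j hij]; exact one_ne_zero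
      have ht0 : ∀ m, subLength (Matrix.transvection i j a) m = 0 := by
        intro m
        have h := subLength_mul ht (Matrix.transvection i j (-a)) m
        rw [Matrix.transvection_mul_transvection_same i j hij, add_neg_cancel,
          Matrix.transvection_zero, subLength_one] at h
        exact (add_eq_zero.1 h.symm).1
      have hd : (Matrix.diagonal D').det ≠ 0 := by
        rw [Matrix.det_diagonal, Finset.prod_ne_zero_iff]
        exact fun k _ => hD' k
      rw [e, subLength_mul hd, subLength_mul ht, subLength_mul hd, subLength_mul ht, ht0, ht0,
        diag _ hD' m, diag _ hD'' m]
      ring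
    · intro N₁ N₂ hN₁ hN₂ h1 h2 s hs φ hφ m
      have clear : ∀ N : Matrix (Fin r) (Fin r) K, N.det ≠ 0 → ∃ s : A, s ≠ 0 ∧
          ∃ φ : Matrix (Fin r) (Fin r) A, φ.map (algebraMap A K) = algebraMap A K s • N ∧
            φ.det ≠ 0 := by
        intro N hN
        obtain ⟨s, hs⟩ := IsLocalization.exist_integer_multiples_of_finite
          (nonZeroDivisors A) (fun p : Fin r × Fin r => N p.1 p.2)
        choose f hf using hs
        have hs0 : (s : A) ≠ 0 := nonZeroDivisors.coe_ne_zero s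
        have e : (Matrix.of fun i j => f (i, j)).map (algebraMap A K) =
            algebraMap A K s • N := by
          ext i j
          simp only [Matrix.map_apply, Matrix.of_apply, hf, Matrix.smul_apply, smul_eq_mul]
          rw [Algebra.smul_def]
        refine ⟨s, hs0, _, e, fun h => ?_⟩
        have := congrArg Matrix.det e
        rw [det_map, h, map_zero, Matrix.det_smul] at this
        exact mul_ne_zero (pow_ne_zero _ fun h => hs0 (inj (h.trans (map_zero _).symm))) hN
          this.symm
      obtain ⟨s₁, hs₁, φ₁, e₁, d₁⟩ := clear N₁ hN₁
      obtain ⟨s₂, hs₂, φ₂, e₂, d₂⟩ := clear N₂ hN₂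
      have dd : ∀ s : A, s ≠ 0 → (Matrix.diagonal fun _ : Fin r => s).det ≠ 0 := by
        intro s hs
        rw [Matrix.det_diagonal, Finset.prod_ne_zero_iff]
        exact fun k _ => hs
      -- After clearing denominators, s₁s₂φ = sφ₁φ₂. Lengths are additive on products and the
      -- formula holds for scalar matrices, so it follows for φ by cancelling a finite length.
      have e : (Matrix.diagonal fun _ => s₁ * s₂) * φ =
          (Matrix.diagonal fun _ => s) * (φ₁ * φ₂) := by
        refine Matrix.map_injective inj ?_
        change (_ * φ).map (algebraMap A K) = (_ * (φ₁ * φ₂)).map (algebraMap A K)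
        rw [Matrix.map_mul, Matrix.map_mul, Matrix.map_mul, hφ, e₁, e₂,
          Matrix.diagonal_map (map_zero _), Matrix.diagonal_map (map_zero _),
          ← Matrix.smul_one_eq_diagonal, ← Matrix.smul_one_eq_diagonal]
        simp only [smul_mul_assoc, mul_smul_comm, one_mul, smul_smul, map_mul]
        congr 1
        ring
      have k : ∀ m, subLength (Matrix.diagonal fun _ : Fin r => s₁ * s₂) m + subLength φ m =
          subLength (Matrix.diagonal fun _ : Fin r => s) m +
            (subLength φ₁ m + subLength φ₂ m) := by
        intro m
        rw [← subLength_mul d₁, ← subLength_mul (dd _ hs), ← e,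
          ← subLength_mul (dd _ (mul_ne_zero hs₁ hs₂))]
      have hfin := subLength_diagonal_ne_top hA (D := fun _ : Fin r => s₁ * s₂)
        (fun _ => mul_ne_zero hs₁ hs₂) m
      have key : subLength φ m + subLength (Matrix.diagonal fun _ : Fin r => s₁ * s₂) m =
          (m + r - 1).choose r * subLength φ 1 +
            subLength (Matrix.diagonal fun _ : Fin r => s₁ * s₂) m := by
        rw [add_comm, k m, add_comm (_ * _), diag _ (fun _ => mul_ne_zero hs₁ hs₂) m, ← mul_add,
          k 1, diag _ (fun _ => hs) m, h1 s₁ hs₁ φ₁ e₁ m, h2 s₂ hs₂ φ₂ e₂ m]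
        ring
      exact (WithTop.add_right_inj hfin).1 key
  exact hQ 1 one_ne_zero φ (by simp) m

end Substitution

/-! ### Polynomials with coefficients in a module -/

section PolMod

/-- Polynomials in `r` variables with coefficients in a module. -/
abbrev PolMod (r : ℕ) (E : Type*) [AddCommGroup E] : Type _ := (Fin r →₀ ℕ) →₀ E

variable {R E E₁ E₂ : Type*} [CommRing R] [AddCommGroup E] [Module R E]
  [AddCommGroup E₁] [Module R E₁] [AddCommGroup E₂] [Module R E₂] {r : ℕ}

/-- Multiplication by the linear form with coefficients `c`. -/
noncomputable def linMul (c : Fin r → R) : Module.End R (PolMod r E) :=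
  ∑ j, c j • Finsupp.lmapDomain E R (· + Finsupp.single j 1)

lemma linMul_single (c : Fin r → R) (β : Fin r →₀ ℕ) (v : E) :
    linMul c (Finsupp.single β v) = ∑ j, c j • Finsupp.single (β + Finsupp.single j 1) v := by
  simp [linMul, LinearMap.sum_apply, Finsupp.mapDomain_single]

lemma linMul_commute (c c' : Fin r → R) :
    Commute (linMul c : Module.End R (PolMod r E)) (linMul c') := by
  refine Finsupp.lhom_ext fun β v => ?_
  change linMul c (linMul c' _) = linMul c' (linMul c _)
  simp only [linMul_single, map_sum, map_smul, Finset.smul_sum]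
  rw [Finset.sum_comm]
  refine Finset.sum_congr rfl fun i _ => Finset.sum_congr rfl fun j _ => ?_
  rw [smul_smul, smul_smul, mul_comm, add_right_comm]

lemma mapRange_linMul (θ : E₁ →ₗ[R] E₂) (c : Fin r → R) (f : PolMod r E₁) :
    Finsupp.mapRange.linearMap θ (linMul c f) = linMul c (Finsupp.mapRange.linearMap θ f) := by
  induction f using Finsupp.induction_linear with
  | zero => simp
  | add f g hf hg => rw [map_add, map_add, hf, hg, map_add, map_add]
  | single β v => simp [linMul_single, map_sum, map_smul]

lemma linMul_sum {κ : Type*} (s : Finset κ) (a : κ → R) (c : κ → Fin r → R) (f : PolMod r E) :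
    linMul (∑ i ∈ s, a i • c i) f = ∑ i ∈ s, a i • linMul (c i) f := by
  induction f using Finsupp.induction_linear with
  | zero => simp
  | add f g hf hg => simp only [map_add, hf, hg, smul_add, Finset.sum_add_distrib]
  | single β v =>
    simp only [linMul_single, Finset.sum_apply, Pi.smul_apply, smul_eq_mul, Finset.sum_smul,
      Finset.smul_sum, smul_smul]
    rw [Finset.sum_comm]

/-- The homogeneous polynomials of degree `m` with coefficients in `V`. -/
def polSub (r : ℕ) (V : Submodule R E) (m : ℤ) : Submodule R (PolMod r E) where
  carrier := {f | (∀ β, f β ∈ V) ∧ ∀ β, (β.degree : ℤ) ≠ m → f β = 0}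
  zero_mem' := ⟨fun _ => V.zero_mem, fun _ _ => rfl⟩
  add_mem' := fun {f g} hf hg => ⟨fun β => V.add_mem (hf.1 β) (hg.1 β), fun β hβ => by
    rw [Finsupp.add_apply, hf.2 β hβ, hg.2 β hβ, add_zero]⟩
  smul_mem' := fun c f hf => ⟨fun β => V.smul_mem c (hf.1 β), fun β hβ => by
    rw [Finsupp.smul_apply, hf.2 β hβ, smul_zero]⟩

lemma mem_polSub {V : Submodule R E} {m : ℤ} {f : PolMod r E} :
    f ∈ polSub r V m ↔ (∀ β, f β ∈ V) ∧ ∀ β, (β.degree : ℤ) ≠ m → f β = 0 := Iff.rfl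

lemma single_mem_polSub {V : Submodule R E} (β : Fin r →₀ ℕ) {v : E} (hv : v ∈ V) :
    Finsupp.single β v ∈ polSub r V β.degree := by
  classical
  refine ⟨fun γ => ?_, fun γ hγ => ?_⟩
  · rw [Finsupp.single_apply]
    split_ifs
    · exact hv
    · exact V.zero_mem
  · exact Finsupp.single_eq_of_ne fun h => hγ (by rw [h])

lemma polSub_le_iff {V : Submodule R E} {m : ℤ} {W : Submodule R (PolMod r E)} :
    polSub r V m ≤ W ↔ ∀ β : Fin r →₀ ℕ, (β.degree : ℤ) = m → ∀ v ∈ V, Finsupp.single β v ∈ W := by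
  constructor
  · rintro h β rfl v hv
    exact h (single_mem_polSub β hv)
  · intro h f hf
    rw [← Finsupp.sum_single f]
    refine Submodule.sum_mem _ fun β hβ => h β ?_ _ (hf.1 β)
    by_contra hne
    exact (Finsupp.mem_support_iff.1 hβ) (hf.2 β hne)

lemma polSub_mono {U V : Submodule R E} (h : U ≤ V) : polSub r U ≤ polSub r V :=
  fun _ _ hf => ⟨fun β => h (hf.1 β), hf.2⟩

lemma map_linMul_polSub_le (c : Fin r → R) (V : Submodule R E) (m : ℤ) :
    (polSub r V m).map (linMul c) ≤ polSub r V (m + 1) := by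
  rw [Submodule.map_le_iff_le_comap, polSub_le_iff]
  rintro β rfl v hv
  rw [Submodule.mem_comap, linMul_single]
  refine Submodule.sum_mem _ fun j _ => Submodule.smul_mem _ _ ?_
  have := single_mem_polSub (β + Finsupp.single j 1) hv
  simpa using this

lemma polSub_map (θ : E₁ →ₗ[R] E₂) (V : Submodule R E₁) (m : ℤ) :
    (polSub r V m).map (Finsupp.mapRange.linearMap θ) = polSub r (V.map θ) m := by
  refine le_antisymm ?_ ?_
  · rintro _ ⟨f, hf, rfl⟩
    exact ⟨fun β => ⟨f β, hf.1 β, by simp⟩, fun β hβ => by simp [hf.2 β hβ]⟩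
  · rw [polSub_le_iff]
    rintro β rfl _ ⟨v, hv, rfl⟩
    exact ⟨Finsupp.single β v, single_mem_polSub β hv, by simp⟩

lemma polSub_sup (U V : Submodule R E) (m : ℤ) :
    polSub r (U ⊔ V) m = polSub r U m ⊔ polSub r V m := by
  refine le_antisymm ?_ (sup_le (polSub_mono le_sup_left m) (polSub_mono le_sup_right m))
  rw [polSub_le_iff]
  rintro β rfl v hv
  obtain ⟨a, ha, b, hb, rfl⟩ := Submodule.mem_sup.1 hv
  rw [Finsupp.single_add]
  exact Submodule.add_mem_sup (single_mem_polSub β ha) (single_mem_polSub β hb)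

lemma polSub_inf_comap (θ : E₁ →ₗ[R] E₂) (V : Submodule R E₁) (U : Submodule R E₂) (m : ℤ) :
    polSub r (V ⊓ U.comap θ) m =
      polSub r V m ⊓ (polSub r U m).comap (Finsupp.mapRange.linearMap θ) := by
  ext f
  simp only [mem_polSub, Submodule.mem_inf, Submodule.mem_comap, Finsupp.mapRange.linearMap_apply,
    Finsupp.mapRange_apply]
  constructor
  · rintro ⟨h1, h2⟩
    exact ⟨⟨fun β => (h1 β).1, h2⟩, fun β => (h1 β).2, fun β hβ => by rw [h2 β hβ, map_zero]⟩
  · rintro ⟨⟨h1, h2⟩, h3, _⟩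
    exact ⟨fun β => ⟨h1 β, h3 β⟩, h2⟩

lemma polSub_bot (m : ℤ) : polSub r (⊥ : Submodule R E) m = ⊥ := by
  rw [eq_bot_iff, polSub_le_iff]
  rintro β _ v hv
  rw [(Submodule.mem_bot R).1 hv]
  simp

lemma polSub_fg {V : Submodule R E} (hV : V.FG) (m : ℤ) : (polSub r V m).FG := by
  classical
  have : polSub r V m = ⨆ β ∈ (Finset.finsuppAntidiag (Finset.univ : Finset (Fin r)) m.toNat).filter
      fun β => (β.degree : ℤ) = m, V.map (Finsupp.lsingle β) := by
    refine le_antisymm ?_ (iSup₂_le fun β hβ => ?_)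
    · rw [polSub_le_iff]
      rintro β rfl v hv
      refine Submodule.mem_iSup_of_mem β (Submodule.mem_iSup_of_mem ?_ ⟨v, hv, rfl⟩)
      rw [Finset.mem_filter, Finset.mem_finsuppAntidiag]
      exact ⟨⟨by simp [Finsupp.degree_eq_sum, - Nat.cast_sum], Finset.subset_univ _⟩, rfl⟩
    · rintro _ ⟨v, hv, rfl⟩
      rw [← (Finset.mem_filter.1 hβ).2]
      exact single_mem_polSub β hv
  rw [this]
  exact Submodule.fg_biSup _ _ fun β _ => hV.map _

/-- The matrix `φ` acting on tuples. -/
def matEnd (φ : Matrix (Fin r) (Fin r) R) : Module.End R (Fin r → E) :=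
  LinearMap.pi fun j => ∑ i, φ j i • LinearMap.proj i

lemma matEnd_apply (φ : Matrix (Fin r) (Fin r) R) (v : Fin r → E) (j : Fin r) :
    matEnd φ v j = ∑ i, φ j i • v i := by
  simp [matEnd, LinearMap.sum_apply]

lemma matEnd_mul (φ ψ : Matrix (Fin r) (Fin r) R) :
    (matEnd (φ * ψ) : Module.End R (Fin r → E)) = matEnd φ * matEnd ψ := by
  refine LinearMap.ext fun v => funext fun j => ?_
  rw [Module.End.mul_apply, matEnd_apply, matEnd_apply]
  simp only [matEnd_apply, Matrix.mul_apply, Finset.smul_sum, Finset.sum_smul, smul_smul]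
  exact Finset.sum_comm

lemma matEnd_smul_one (x : R) (v : Fin r → E) :
    matEnd (x • (1 : Matrix (Fin r) (Fin r) R)) v = x • v := by
  funext j
  rw [matEnd_apply, Finset.sum_eq_single j]
  · simp
  · intro i _ h
    simp [Ne.symm h]
  · simp

lemma matEnd_adjugate (φ : Matrix (Fin r) (Fin r) R) (v : Fin r → E) :
    matEnd φ (matEnd φ.adjugate v) = φ.det • v := by
  rw [← Module.End.mul_apply, ← matEnd_mul, Matrix.mul_adjugate, matEnd_smul_one]

lemma matEnd_adjugate_commute (φ : Matrix (Fin r) (Fin r) R) :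
    Commute (matEnd φ : Module.End R (Fin r → E)) (matEnd φ.adjugate) := by
  rw [Commute, SemiconjBy, ← matEnd_mul, ← matEnd_mul, Matrix.mul_adjugate, Matrix.adjugate_mul]

/-- The tuples with entries in `V`. -/
def powSub (r : ℕ) (V : Submodule R E) : Submodule R (Fin r → E) := Submodule.pi Set.univ fun _ => V

lemma mem_powSub {V : Submodule R E} {v : Fin r → E} : v ∈ powSub r V ↔ ∀ i, v i ∈ V := by
  simp [powSub, Submodule.mem_pi]

lemma matEnd_mem_powSub (φ : Matrix (Fin r) (Fin r) R) {V : Submodule R E} {v : Fin r → E}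
    (hv : v ∈ powSub r V) : matEnd φ v ∈ powSub r V := by
  rw [mem_powSub] at hv ⊢
  intro j
  rw [matEnd_apply]
  exact Submodule.sum_mem _ fun i _ => V.smul_mem _ (hv i)

lemma powSub_mono {U V : Submodule R E} (h : U ≤ V) : powSub r U ≤ powSub r V :=
  fun _ hv => mem_powSub.2 fun i => h (mem_powSub.1 hv i)

lemma powSub_fg {V : Submodule R E} (hV : V.FG) : (powSub r V).FG :=
  Submodule.fg_pi fun _ => hV

end PolMod

/-! ### Symbols of a matrix on polynomials and on tuples over a module -/

section Symbols

variable {R E E₁ E₂ : Type*} [CommRing R] [AddCommGroup E] [Module R E]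
  [AddCommGroup E₁] [Module R E₁] [AddCommGroup E₂] [Module R E₂] {r : ℕ}

/-- The multiplications by the columns of a matrix and by the variables. -/
noncomputable def polSys (E : Type*) [AddCommGroup E] [Module R E] (φ : Matrix (Fin r) (Fin r) R) :
    Fin r ⊕ Fin r → Module.End R (PolMod r E) × ℤ
  | Sum.inl i => (linMul fun j => φ j i, 1)
  | Sum.inr j => (linMul (Pi.single j 1), 1)

lemma polSys_commute (φ : Matrix (Fin r) (Fin r) R) (s t : Fin r ⊕ Fin r) :
    Commute (polSys E φ s).1 (polSys E φ t).1 := by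
  rcases s with s | s <;> rcases t with t | t <;> exact linMul_commute _ _

lemma polSys_snd (φ : Matrix (Fin r) (Fin r) R) (t : Fin r ⊕ Fin r) : (polSys E φ t).2 = 1 := by
  rcases t with t | t <;> rfl

lemma polSys_tendsto (φ : Matrix (Fin r) (Fin r) R) (t : Fin r ⊕ Fin r) :
    Tendsto (fun n => n - (polSys E φ t).2) atTop atTop := by
  simp only [sub_eq_add_neg]
  exact tendsto_atTop_add_const_right _ _ tendsto_id

lemma polSub_mem_stableFam (φ : Matrix (Fin r) (Fin r) R) (V : Submodule R E) :
    polSub r V ∈ StableFam (polSys E φ) := by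
  rintro (t | t) n <;> exact map_linMul_polSub_le _ _ _

/-- The symbol of the columns of a matrix on polynomials with coefficients in `V / U`. -/
noncomputable def polSymb (φ : Matrix (Fin r) (Fin r) R) (U V : Submodule R E) : ℤ → ℤ :=
  famSymb (((List.finRange r).map Sum.inl).map (polSys E φ)) (polSub r U) (polSub r V)

lemma polSymb_eq_of_map (φ : Matrix (Fin r) (Fin r) R) (θ : E₁ →ₗ[R] E₂) {U₁ V₁ : Submodule R E₁}
    {U₂ V₂ : Submodule R E₂} (hV : V₂ = U₂ ⊔ V₁.map θ) (hU : U₁ = V₁ ⊓ U₂.comap θ) :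
    polSymb φ U₁ V₁ = polSymb φ U₂ V₂ := by
  funext n
  refine famSymb_eq_of_map (Finsupp.mapRange.linearMap θ) id (polSys_commute φ) (polSys_commute φ)
    ?_ ?_ (polSub_mem_stableFam φ _) (polSub_mem_stableFam φ _) (polSub_mem_stableFam φ _)
    (polSub_mem_stableFam φ _) ?_ ?_ _ n
  · intro t n
    rw [polSys_snd, polSys_snd]
    rfl
  · rintro (t | t) _ f - <;> exact mapRange_linMul θ _ f
  · intro n
    rw [hV, polSub_sup, polSub_map, id]
  · intro n
    rw [hU, polSub_inf_comap, id]

/-- The action of a matrix and of its adjugate on tuples. -/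
def matSys (E : Type*) [AddCommGroup E] [Module R E] (φ : Matrix (Fin r) (Fin r) R) :
    Bool → Module.End R (Fin r → E) × Unit
  | true => (matEnd φ, ())
  | false => (matEnd φ.adjugate, ())

lemma matSys_commute (φ : Matrix (Fin r) (Fin r) R) (s t : Bool) :
    Commute (matSys E φ s).1 (matSys E φ t).1 := by
  rcases s with s | s <;> rcases t with t | t
  · exact Commute.refl _
  · exact (matEnd_adjugate_commute φ).symm
  · exact matEnd_adjugate_commute φ
  · exact Commute.refl _

lemma powSub_mem_stableFam (φ : Matrix (Fin r) (Fin r) R) (V : Submodule R E) :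
    (fun _ => powSub r V) ∈ StableFam (matSys E φ) := by
  rintro (t | t) n _ ⟨v, hv, rfl⟩ <;> exact matEnd_mem_powSub _ hv

/-- The symbol of a matrix on tuples with entries in `V / U`. -/
noncomputable def matSymb (φ : Matrix (Fin r) (Fin r) R) (U V : Submodule R E) : ℤ :=
  famSymb ([true].map (matSys E φ)) (fun _ => powSub r U) (fun _ => powSub r V) ()

lemma matSymb_eq_of_map (φ : Matrix (Fin r) (Fin r) R) (θ : E₁ →ₗ[R] E₂) {U₁ V₁ : Submodule R E₁}
    {U₂ V₂ : Submodule R E₂} (hV : V₂ = U₂ ⊔ V₁.map θ) (hU : U₁ = V₁ ⊓ U₂.comap θ) :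
    matSymb φ U₁ V₁ = matSymb φ U₂ V₂ := by
  have hcomm : ∀ (φ : Matrix (Fin r) (Fin r) R) (v : Fin r → E₁),
      θ.compLeft (Fin r) (matEnd φ v) = matEnd φ (θ.compLeft (Fin r) v) := by
    intro φ v
    funext j
    simp [matEnd_apply, map_sum]
  refine famSymb_eq_of_map (θ.compLeft (Fin r)) id (matSys_commute φ) (matSys_commute φ)
    (fun _ _ => rfl) ?_ (powSub_mem_stableFam φ _) (powSub_mem_stableFam φ _)
    (powSub_mem_stableFam φ _) (powSub_mem_stableFam φ _) ?_ ?_ _ ()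
  · rintro (t | t) _ v - <;> exact hcomm _ v
  · intro _
    rw [hV]
    refine le_antisymm ?_ (sup_le (powSub_mono le_sup_left) ?_)
    · intro v hv
      rw [mem_powSub] at hv
      choose a ha b hb hab using fun i => Submodule.mem_sup.1 (hv i)
      choose c hc hcb using hb
      refine Submodule.mem_sup.2 ⟨a, mem_powSub.2 ha, b, ⟨c, mem_powSub.2 hc, ?_⟩, funext hab⟩
      funext i
      exact hcb i
    · rintro _ ⟨v, hv, rfl⟩
      exact mem_powSub.2 fun i => Submodule.mem_sup_right ⟨v i, mem_powSub.1 hv i, rfl⟩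
  · intro _
    rw [hU]
    ext v
    simp only [mem_powSub, Submodule.mem_inf, Submodule.mem_comap, forall_and]
    rfl

/-- Cramer's rule: det φ times a variable is a combination of the columns of φ. -/
lemma smul_linMul_single (φ : Matrix (Fin r) (Fin r) R) (j : Fin r) (f : PolMod r E) :
    φ.det • linMul (Pi.single j (1 : R)) f = ∑ i, φ.adjugate i j • linMul (fun k => φ k i) f := by
  rw [← linMul_sum]
  have := linMul_sum {()} (fun _ => φ.det) (fun _ => (Pi.single j 1 : Fin r → R)) f
  simp only [Finset.sum_singleton] at this
  rw [← this]
  congr 2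
  funext k
  have h := congrFun (congrFun (Matrix.mul_adjugate φ) k) j
  rw [Matrix.mul_apply, Matrix.smul_apply, Matrix.one_apply] at h
  simp only [Finset.sum_apply, Pi.smul_apply, smul_eq_mul, Pi.single_apply]
  rw [← smul_eq_mul, ← h]
  exact Finset.sum_congr rfl fun i _ => mul_comm _ _

variable [IsNoetherianRing R] {K : Ideal R} {φ : Matrix (Fin r) (Fin r) R} {U V W : Submodule R E}

lemma relLength_ne_top_of_le_fg {U V V' : Submodule R E} {x : R} (hV : V.FG) (hV' : V' ≤ V)
    (hJ : Module.length R (R ⧸ K ⊔ Ideal.span {x}) ≠ ⊤) (hK : K • V' ≤ U)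
    (hx : ∀ v ∈ V', x • v ∈ U) : relLength U V' ≠ ⊤ := by
  have : IsNoetherian R V := isNoetherian_of_fg_of_noetherian V hV
  refine relLength_ne_top_of_smul_le (isNoetherian_submodule.1 ‹_› V' hV') hJ ?_
  rw [Submodule.sup_smul, sup_le_iff]
  refine ⟨hK, ?_⟩
  rw [Submodule.smul_le]
  intro a ha v hv
  obtain ⟨c, rfl⟩ := Ideal.mem_span_singleton'.1 ha
  rw [mul_smul]
  exact U.smul_mem c (hx v hv)

/-- A stable family of polynomials is generated in bounded degrees by multiplication by the
variables. -/
lemma exists_bound_polSys (φ : Matrix (Fin r) (Fin r) R) (hV : V.FG)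
    {V' : ℤ → Submodule R (PolMod r E)} (hS : V' ∈ StableFam (polSys E φ))
    (hV' : V' ≤ polSub r V) :
    ∃ N : ℤ, ∀ m, N < m → V' m ≤
      ⨆ j, (V' (m - 1)).map (linMul (Pi.single j (1 : R))) := by
  obtain ⟨S, hS'⟩ := hV
  let y : Fin r → Module.End R (PolMod r E) × ℤ := fun j => (linMul (Pi.single j 1), 1)
  obtain ⟨N, hN⟩ := StableFam.exists_bound (y := y) (fun _ _ => linMul_commute _ _)
    (V := V') (fun t => hS (Sum.inr t)) (S := (fun v => ((0 : ℤ), Finsupp.single 0 v)) '' S)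
    ((Finset.finite_toSet S).image _) (by
      intro W hW hSW
      refine hV'.trans fun m => ?_
      have h0 : V ≤ (W 0).comap (Finsupp.lsingle 0) := by
        rw [← hS', Submodule.span_le]
        intro v hv
        exact hSW _ ⟨v, hv, rfl⟩
      have key : ∀ (k : ℕ) (β : Fin r →₀ ℕ), β.degree = k → ∀ v ∈ V,
          Finsupp.single β v ∈ W k := by
        intro k
        induction k with
        | zero =>
          intro β hβ v hv
          rw [(Finsupp.degree_eq_zero_iff β).1 hβ]
          exact h0 hv
        | succ k ih =>
          intro β hβ v hv
          have : β ≠ 0 := by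
            rintro rfl
            simp at hβ
          obtain ⟨j, hj⟩ := Finsupp.ne_iff.1 this
          have e : β - Finsupp.single j 1 + Finsupp.single j 1 = β :=
            tsub_add_cancel_of_le (by
              rw [Finsupp.single_le_iff]
              exact Nat.one_le_iff_ne_zero.2 hj)
          have hd : (β - Finsupp.single j 1).degree = k := by
            have := congrArg Finsupp.degree e
            rw [map_add, hβ, Finsupp.degree_single] at this
            omega
          have := hW j _ ⟨_, ih _ hd v hv, rfl⟩
          simp only [y, linMul_single] at this
          rw [Finset.sum_eq_single j] at this
          · rw [e] at this
            simpa using this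
          · intro i _ hij
            simp [hij]
          · simp
      rw [polSub_le_iff]
      rintro β rfl v hv
      exact key _ β rfl v hv) (AddMonoidHom.id ℤ)
  refine ⟨N, fun m hm => (hN m hm).trans (iSup_le ?_)⟩
  rintro ⟨j, -⟩
  exact le_iSup (fun j => (V' (m - 1)).map (linMul (Pi.single j (1 : R)))) j

/-- Since the variables belong to the system, a stable family is generated by them from the
preceding degree once the degree is large. By Cramer's rule a subquotient killed by the columns is
then killed by det φ, and also by K. -/
lemma polSys_finiteKilled (hJ : Module.length R (R ⧸ K ⊔ Ideal.span {φ.det}) ≠ ⊤) (hV : V.FG)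
    (hK : K • V ≤ U) :
    FiniteKilled atTop (polSys E φ) ((List.finRange r).map Sum.inl) (polSub r U) (polSub r V) := by
  intro U' hU' V' hV' h1 h2 h3 hk
  obtain ⟨N, hN⟩ := exists_bound_polSys φ hV hV' h3
  filter_upwards [eventually_gt_atTop N] with m hm
  refine relLength_ne_top_of_le_fg (polSub_fg hV m) (h3 m) hJ ?_ ?_
  · rw [Submodule.smul_le]
    intro a ha f hf
    refine h1 m ⟨fun β => hK (Submodule.smul_mem_smul ha ((h3 m hf).1 β)), fun β hβ => ?_⟩
    rw [Finsupp.smul_apply, (h3 m hf).2 β hβ, smul_zero]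
  · intro f hf
    have hle : V' m ≤ (U' m).comap (LinearMap.lsmul R _ φ.det) := by
      refine (hN m hm).trans (iSup_le fun j => ?_)
      rintro _ ⟨g, hg, rfl⟩
      rw [Submodule.mem_comap, LinearMap.lsmul_apply, smul_linMul_single φ]
      refine Submodule.sum_mem _ fun i _ => Submodule.smul_mem _ _ ?_
      have := hk (Sum.inl i) (by simp) (m - 1) ⟨g, hg, rfl⟩
      rwa [polSys_snd, sub_add_cancel] at this
    exact hle hf

/-- The adjugate belongs to the system, so V' is stable under it. Then det φ = φ · adj φ maps V'
into φV', hence into U'. -/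
lemma matSys_finiteKilled (hJ : Module.length R (R ⧸ K ⊔ Ideal.span {φ.det}) ≠ ⊤) (hV : V.FG)
    (hK : K • V ≤ U) :
    FiniteKilled (pure ()) (matSys E φ) [true] (fun _ => powSub r U) (fun _ => powSub r V) := by
  intro U' hU' V' hV' h1 h2 h3 hk
  rw [eventually_pure]
  refine relLength_ne_top_of_le_fg (powSub_fg hV) (h3 ()) hJ ?_ ?_
  · rw [Submodule.smul_le]
    intro a ha v hv
    refine h1 () (mem_powSub.2 fun i => hK (Submodule.smul_mem_smul ha ?_))
    exact mem_powSub.1 (h3 () hv) i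
  · intro v hv
    rw [← matEnd_adjugate]
    have h4 := hV' false () ⟨v, hv, rfl⟩
    exact hk true (by simp) () ⟨_, h4, rfl⟩

lemma polSymb_add (hJ : Module.length R (R ⧸ K ⊔ Ideal.span {φ.det}) ≠ ⊤) (hV : V.FG)
    (hK : K • V ≤ U) (h1 : U ≤ W) (h2 : W ≤ V) :
    ∀ᶠ m in atTop, polSymb φ U V m = polSymb φ U W m + polSymb φ W V m :=
  famSymb_add (polSys_commute φ) (polSys_tendsto φ) (polSub_mem_stableFam φ U)
    (polSub_mem_stableFam φ W) (polSub_mem_stableFam φ V) (polSub_mono h1) (polSub_mono h2)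
    (polSys_finiteKilled hJ hV hK)

lemma matSymb_add (hJ : Module.length R (R ⧸ K ⊔ Ideal.span {φ.det}) ≠ ⊤) (hV : V.FG)
    (hK : K • V ≤ U) (h1 : U ≤ W) (h2 : W ≤ V) :
    matSymb φ U V = matSymb φ U W + matSymb φ W V :=
  eventually_pure.1 (famSymb_add (matSys_commute φ) (fun _ => tendsto_pure_pure _ _)
    (powSub_mem_stableFam φ U) (powSub_mem_stableFam φ W) (powSub_mem_stableFam φ V)
    (fun _ => powSub_mono h1) (fun _ => powSub_mono h2) (matSys_finiteKilled hJ hV hK))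

end Symbols

/-! ### Comparison of the symbols of a matrix: the case of a domain -/

section RestrictScalars

variable {R A E ι : Type*} [CommRing R] [CommRing A] [Algebra R A] [AddCommGroup E] [Module R E]
  [Module A E] [IsScalarTower R A E] [AddCommGroup ι]

lemma relLength_restrictScalars (h : Function.Surjective (algebraMap R A)) (U V : Submodule A E) :
    relLength (U.restrictScalars R) (V.restrictScalars R) = relLength U V := by
  rw [relLength, relLength, ← Module.length_eq_of_surjective (R := A) h]
  exact (Submodule.Quotient.restrictScalarsEquiv R (U.submoduleOf V)).length_eq

/-- Images and preimages do not depend on the scalars, and lengths agree along a surjection of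
rings. This turns symbols over R with coefficients in R / P into symbols over the domain R / P. -/
lemma famSymb_restrictScalars (h : Function.Surjective (algebraMap R A))
    (l : List (Module.End A E × ι)) (U V : ι → Submodule A E) :
    famSymb (l.map fun p => (p.1.restrictScalars R, p.2)) (fun n => (U n).restrictScalars R)
      (fun n => (V n).restrictScalars R) = famSymb l U V := by
  refine LatOp.symb_rel
    (P := fun (U' V' : ι → Submodule R E) (U V : ι → Submodule A E) =>
      (U' = fun n => (U n).restrictScalars R) ∧ V' = fun n => (V n).restrictScalars R)
    (Q := fun a a' => a = a') ?_ ?_ ?_ ⟨rfl, rfl⟩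
  · rintro _ a' _ b' rfl rfl
    rfl
  · rw [List.map_map, List.forall₂_map_left_iff, List.forall₂_map_right_iff, List.forall₂_same]
    intro p _
    refine ⟨?_, ?_⟩
    · rintro _ a rfl
      rfl
    · rintro _ _ U V ⟨rfl, rfl⟩
      refine ⟨⟨?_, rfl⟩, rfl, rfl⟩
      funext n
      ext x
      simp only [famOp, Function.comp_apply, Pi.sup_apply, Submodule.restrictScalars_mem,
        Submodule.mem_sup]
      rfl
  · rintro _ _ U V ⟨rfl, rfl⟩
    funext n
    simp only [famLength]
    rw [relLength_restrictScalars h]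

end RestrictScalars

/-! ### Substitutions over a local domain and their symbols -/

section Domain

variable {A : Type*} [CommRing A] {r : ℕ}

/-- If `A / xA` has finite length for a nonzero nonunit `x`, then this holds for all nonzero
elements. -/
lemma ordLength_ne_top [IsDomain A] [IsNoetherianRing A] [IsLocalRing A] {x : A}
    (hu : ¬ IsUnit x) (h : ordLength x ≠ ⊤) {a : A} (ha : a ≠ 0) : ordLength a ≠ ⊤ := by
  -- For a prime Q containing x, the domain A / Q has finite length, so it is a field.
  have prime_max : ∀ Q : Ideal A, Q.IsPrime → x ∈ Q → Q = IsLocalRing.maximalIdeal A := by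
    intro Q hQ hxQ
    rw [ordLength, relLength_top] at h
    have h1 : Module.length A (A ⧸ Q) ≠ ⊤ :=
      length_quotient_mono (by rwa [Ideal.span_singleton_le_iff_mem]) h
    rw [Module.length_eq_of_surjective (R := A ⧸ Q) Ideal.Quotient.mk_surjective,
      Module.length_ne_top_iff, ← isArtinianRing_iff_isFiniteLength] at h1
    have : IsField (A ⧸ Q) := IsArtinianRing.isField_of_isDomain _
    exact IsLocalRing.eq_maximalIdeal (Ideal.Quotient.maximal_of_isField Q this)
  have hxm : x ∈ IsLocalRing.maximalIdeal A := hu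
  have hmin : IsLocalRing.maximalIdeal A ∈ (Ideal.span {x}).minimalPrimes := by
    refine ⟨⟨inferInstance, by rwa [Ideal.span_singleton_le_iff_mem]⟩, fun Q hQ _ => ?_⟩
    exact (prime_max Q hQ.1 (hQ.2 (Ideal.mem_span_singleton_self x))).ge
  -- The maximal ideal is minimal over xA, so Krull's principal ideal theorem bounds its height, and
  -- the dimension of A is at most one.
  have hht := Ideal.height_le_one_of_isPrincipal_of_mem_minimalPrimes _ _ hmin
  rw [ordLength, relLength_top,
    Module.length_eq_of_surjective (R := A ⧸ Ideal.span {a}) Ideal.Quotient.mk_surjective,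
    Module.length_ne_top_iff, ← isArtinianRing_iff_isFiniteLength]
  -- A nonmaximal prime containing a ≠ 0 would give a chain of length two below the maximal ideal.
  -- So A / aA is Noetherian of dimension zero and has finite length.
  have : Ring.KrullDimLE 0 (A ⧸ Ideal.span {a}) := by
    rw [Ring.krullDimLE_zero_iff]
    intro Q hQ
    set P := Q.comap (Ideal.Quotient.mk (Ideal.span {a}))
    have hP : P.IsPrime := Ideal.comap_isPrime _ _
    have haP : a ∈ P := by
      rw [Ideal.mem_comap, Ideal.Quotient.eq_zero_iff_mem.2 (Ideal.mem_span_singleton_self a)]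
      exact Q.zero_mem
    have hPm : P = IsLocalRing.maximalIdeal A := by
      by_contra hne
      have hlt : P < IsLocalRing.maximalIdeal A :=
        lt_of_le_of_ne (IsLocalRing.le_maximalIdeal hP.ne_top) hne
      have h0 : (⊥ : Ideal A) < P := bot_lt_iff_ne_bot.2 fun h => ha (by
        rw [h] at haP; exact haP)
      have h1 := (Ideal.height_add_one_le_of_lt_of_isPrime hlt).trans hht
      have h2 := Ideal.height_add_one_le_of_lt_of_isPrime h0
      have h3 : (1 : ℕ∞) + 1 ≤ 1 := (add_le_add_left (le_trans (by simp) h2) 1).trans h1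
      exact absurd h3 (by decide)
    have : P.IsMaximal := hPm ▸ inferInstance
    have hs : Function.Surjective (Ideal.Quotient.mk (Ideal.span {a})) :=
      Ideal.Quotient.mk_surjective
    have h2 := Ideal.map_eq_top_or_isMaximal_of_surjective _ hs this
    rw [Ideal.map_comap_of_surjective _ hs] at h2
    exact h2.resolve_left hQ.ne_top
  exact IsNoetherianRing.isArtinianRing_of_krullDimLE_zero

/-- The length of the cokernel of a substitution is a multiple of that in degree one, if the
determinant has finite colength. -/
lemma subLength_eq_of_det [IsDomain A] [IsNoetherianRing A] [IsLocalRing A]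
    {φ : Matrix (Fin r) (Fin r) A} (hφ : φ.det ≠ 0) (h : ordLength φ.det ≠ ⊤) (m : ℕ) :
    subLength φ m = (m + r - 1).choose r * subLength φ 1 ∧ subLength φ m ≠ ⊤ := by
  -- A unit determinant gives no information about the dimension of A, but then φ is invertible and
  -- all lengths are zero.
  by_cases hu : IsUnit φ.det
  · have h0 : ∀ m, subLength φ m = 0 := by
      intro m
      have := subLength_mul hφ φ⁻¹ m
      rw [Matrix.mul_nonsing_inv _ hu, subLength_one] at this
      exact (add_eq_zero.1 this.symm).1
    simp [h0]
  · have hA : ∀ a : A, a ≠ 0 → ordLength a ≠ ⊤ := fun a ha => ordLength_ne_top hu h ha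
    exact ⟨subLength_eq hA hφ m, subLength_ne_top hA hφ m⟩

/-- The `r`-th difference of a binomial polynomial of degree `r`. -/
lemma backDiff_replicate_choose {g : ℤ} {f : (Fin 1 → ℤ) → ℤ}
    (hf : ∀ m : ℕ, f (fun _ => (m : ℤ)) = (m + r - 1).choose r * g) :
    ∀ᶠ n in atTop, backDiff (List.replicate r (Pi.single 0 1)) f n = g := by
  -- By Pascal's rule every difference lowers the lower index of the binomial by one.
  have key : ∀ j, j ≤ r → ∀ m : ℕ, (fwdDiff (Pi.single 0 (1 : ℤ)))^[j] f (fun _ => (m : ℤ)) =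
      (m + r - 1).choose (r - j) * g := by
    intro j
    induction j with
    | zero => exact fun _ m => hf m
    | succ j ih =>
      intro hj m
      have e : (fun _ => (m : ℤ)) + Pi.single 0 (1 : ℤ) = fun _ : Fin 1 => ((m + 1 : ℕ) : ℤ) := by
        funext i
        rw [Subsingleton.elim i 0]
        simp
      rw [Function.iterate_succ_apply', fwdDiff, e, ih (by omega), ih (by omega)]
      have e1 : m + 1 + r - 1 = (m + r - 1) + 1 := by omega
      have e2 : r - j = (r - (j + 1)) + 1 := by omega
      rw [e1, e2, Nat.choose_succ_succ]
      push_cast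
      ring
  refine eventually_atTop_iff_forall_le.2 ⟨r, fun n hn => ?_⟩
  rw [backDiff_replicate]
  have hn0 := hn 0
  have e : n - r • Pi.single 0 1 = fun _ => (((n 0 - r).toNat : ℕ) : ℤ) := by
    funext i
    rw [Subsingleton.elim i 0]
    simp
    omega
  rw [e, key r le_rfl]
  simp

lemma prodFam_span_X (φ : Matrix (Fin r) (Fin r) A) (n : Fin 1 → ℤ) (hn : 0 ≤ n) :
    prodFam (fun _ => (MvPolynomial.homogeneousSubmodule (Fin r) A 1).map
      (linSub φ).toLinearMap) n =
        (MvPolynomial.homogeneousSubmodule (Fin r) A (n 0).toNat).map (linSub φ).toLinearMap := by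
  rw [prodFam_of_nonneg _ hn, Fin.prod_univ_one, ← Submodule.map_pow,
    MvPolynomial.homogeneousSubmodule_one_pow]

lemma prodFam_homogeneousSubmodule (n : Fin 1 → ℤ) (hn : 0 ≤ n) :
    prodFam (fun _ => MvPolynomial.homogeneousSubmodule (Fin r) A 1) n =
      MvPolynomial.homogeneousSubmodule (Fin r) A (n 0).toNat := by
  rw [prodFam_of_nonneg _ hn, Fin.prod_univ_one, MvPolynomial.homogeneousSubmodule_one_pow]

/-- The symbol of the columns of a matrix on the polynomial ring over a domain. -/
theorem famSymb_linSub [IsDomain A] [IsNoetherianRing A] [IsLocalRing A]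
    {φ : Matrix (Fin r) (Fin r) A} (hφ : φ.det ≠ 0) (h : ordLength φ.det ≠ ⊤) :
    ∀ᶠ n in atTop, famSymb ((List.finRange r).map (mulSys A
      (fun i => linSub φ (MvPolynomial.X i)) fun _ => (0 : Fin 1))) ⊥
        (prodFam fun _ => MvPolynomial.homogeneousSubmodule (Fin r) A 1) n =
          ((subLength φ 1).toNat : ℤ) := by
  set a : Fin r → MvPolynomial (Fin r) A := fun i => linSub φ (MvPolynomial.X i)
  have hgen : genMod A a (fun _ => (0 : Fin 1)) = fun _ =>
      (MvPolynomial.homogeneousSubmodule (Fin r) A 1).map (linSub φ).toLinearMap := by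
    funext k
    rw [MvPolynomial.homogeneousSubmodule_one_eq_span_X, Submodule.map_span, ← Set.range_comp,
      genMod, Subsingleton.elim k 0]
    simp only [Set.ofPred_true, Set.image_univ]
    rfl
  have hle : ∀ k, genMod A a (fun _ => (0 : Fin 1)) k ≤
      MvPolynomial.homogeneousSubmodule (Fin r) A 1 := by
    intro k
    rw [hgen]
    rintro _ ⟨f, hf, rfl⟩
    exact linSub_mem φ hf
  -- The columns generate the subalgebra, so they are a reduction of it. The symbol is thus the r-th
  -- difference of the length of the cokernel of the substitution.
  have hl : IsReduction A a (fun _ => (0 : Fin 1)) (List.finRange r) :=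
    isReduction_of_span (k := 0) (by simp [genMod])
  have hcof : ∀ k, Cofinite (genMod A a (fun _ => (0 : Fin 1)) k)
      (MvPolynomial.homogeneousSubmodule (Fin r) A 1) := by
    intro k
    refine ⟨Ideal.span {φ.det}, by rwa [← relLength_top], ?_⟩
    rw [Submodule.smul_le, hgen]
    intro c hc f hf
    obtain ⟨c, rfl⟩ := Ideal.mem_span_singleton'.1 hc
    rw [mul_smul]
    refine Submodule.smul_mem _ _ ⟨linSub φ.adjugate f, linSub_mem _ hf, ?_⟩
    have e : linSub φ (linSub φ.adjugate f) = linSub (Matrix.diagonal fun _ => φ.det) f := by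
      rw [← Matrix.smul_one_eq_diagonal, ← Matrix.mul_adjugate, linSub_mul]
      rfl
    rw [AlgHom.toLinearMap_apply, e]
    refine MvPolynomial.ext _ _ fun β => ?_
    rw [coeff_linSub_diagonal, MvPolynomial.coeff_smul, smul_eq_mul]
    by_cases hβ : β.degree = 1
    · rw [Finset.prod_pow_eq_pow_sum, ← Finsupp.degree_eq_sum, hβ, pow_one]
    · rw [MvPolynomial.IsHomogeneous.coeff_eq_zero hf hβ, mul_zero, mul_zero]
  have h1 := hl.famSymb_eq (F := fun _ => MvPolynomial.homogeneousSubmodule (Fin r) A 1)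
    (fun _ => MvPolynomial.homogeneousSubmodule_fg _ _ 1) hcof hle
  have h2 := backDiff_replicate_choose (r := r) (g := ((subLength φ 1).toNat : ℤ))
    (f := famLength (prodFam (genMod A a (fun _ => (0 : Fin 1))))
      (prodFam fun _ => MvPolynomial.homogeneousSubmodule (Fin r) A 1)) (by
      intro m
      have hm : 0 ≤ fun _ : Fin 1 => (m : ℤ) := fun _ => by simp
      rw [famLength, hgen, prodFam_span_X _ _ hm, prodFam_homogeneousSubmodule _ hm,
        Int.toNat_natCast]
      change ((subLength φ m).toNat : ℤ) = _
      rw [(subLength_eq_of_det hφ h m).1, ENat.toNat_mul, ENat.toNat_natCast]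
      push_cast
      rfl)
  have e3 : ((List.finRange r).map fun _ => (Pi.single 0 1 : Fin 1 → ℤ)) =
      List.replicate r (Pi.single 0 1 : Fin 1 → ℤ) := by
    rw [List.map_const', List.length_finRange]
  rw [e3] at h1
  filter_upwards [h1, h2] with n e1 e2
  rw [e1, e2]

end Domain

/-! ### Comparison of the symbols of a matrix: the general case -/

section Comparison

variable {R : Type*} [CommRing R] {r : ℕ}

/-- The polynomials with coefficients in an algebra, as a polynomial ring. -/
noncomputable def polMonomial (R : Type*) {A : Type*} [CommRing R] [CommRing A] [Algebra R A]
    (r : ℕ) : PolMod r A →ₗ[R] MvPolynomial (Fin r) A :=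
  ((MvPolynomial.basisMonomials (Fin r) A).repr.symm.restrictScalars R).toLinearMap

section Algebra

variable {A : Type*} [CommRing A] [Algebra R A]

lemma coeff_polMonomial (f : PolMod r A) (β : Fin r →₀ ℕ) :
    (polMonomial R r f).coeff β = f β :=
  DFunLike.congr_fun ((MvPolynomial.basisMonomials (Fin r) A).repr.apply_symm_apply f) β

lemma polMonomial_injective : Function.Injective (polMonomial R (A := A) r) :=
  (MvPolynomial.basisMonomials (Fin r) A).repr.symm.injective

lemma polMonomial_surjective : Function.Surjective (polMonomial R (A := A) r) :=
  (MvPolynomial.basisMonomials (Fin r) A).repr.symm.surjective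

lemma polMonomial_single (β : Fin r →₀ ℕ) (a : A) :
    polMonomial R r (Finsupp.single β a) = MvPolynomial.monomial β a := by
  classical
  refine MvPolynomial.ext _ _ fun γ => ?_
  rw [coeff_polMonomial, MvPolynomial.coeff_monomial, Finsupp.single_apply]

lemma map_polMonomial (m : ℤ) :
    (polSub r (⊤ : Submodule R A) m).map (polMonomial R r) =
      (prodFam (fun _ : Fin 1 => MvPolynomial.homogeneousSubmodule (Fin r) A 1)
        (fun _ => m)).restrictScalars R := by
  ext f
  obtain ⟨g, rfl⟩ := polMonomial_surjective (R := R) f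
  rw [Submodule.restrictScalars_mem]
  have e : polMonomial R r g ∈ (polSub r (⊤ : Submodule R A) m).map (polMonomial R r) ↔
      g ∈ polSub r (⊤ : Submodule R A) m :=
    ⟨fun ⟨g', hg', h⟩ => polMonomial_injective h ▸ hg', fun h => ⟨g, h, rfl⟩⟩
  rw [e]
  by_cases hm : 0 ≤ m
  · rw [prodFam_homogeneousSubmodule _ fun _ => hm]
    constructor
    · intro hg β hβ
      rw [coeff_polMonomial] at hβ
      have : (β.degree : ℤ) = m := by
        by_contra h
        exact hβ (hg.2 β h)
      have h2 := DFunLike.congr_fun Finsupp.degree_eq_weight_one β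
      simp only [Pi.one_def] at h2 ⊢
      rw [← h2]
      omega
    · intro hg
      refine ⟨fun _ => trivial, fun β hβ => ?_⟩
      rw [← coeff_polMonomial (R := R)]
      exact MvPolynomial.IsHomogeneous.coeff_eq_zero hg (by omega)
  · rw [prodFam, if_neg fun h => hm (h 0), Submodule.mem_bot]
    constructor
    · intro hg
      have : g = 0 := Finsupp.ext fun β => hg.2 β (by omega)
      rw [this, map_zero]
    · intro hg
      rw [polMonomial_injective (hg.trans (map_zero _).symm)]
      exact zero_mem _

lemma polMonomial_linMul (φ : Matrix (Fin r) (Fin r) R) (i : Fin r) (f : PolMod r A) :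
    polMonomial R r (linMul (fun j => φ j i) f) =
      linSub (φ.map (algebraMap R A)) (MvPolynomial.X i) * polMonomial R r f := by
  induction f using Finsupp.induction_linear with
  | zero => simp
  | add f g hf hg => rw [map_add, map_add, hf, hg, map_add, mul_add]
  | single β a =>
    rw [linMul_single, linSub_X, map_sum, Finset.sum_mul, polMonomial_single]
    refine Finset.sum_congr rfl fun j _ => ?_
    rw [map_smul, polMonomial_single, Matrix.map_apply, smul_mul_assoc, mul_comm,
      MvPolynomial.X, MvPolynomial.monomial_mul, mul_one, algebraMap_smul]

/-- The symbol on polynomials with coefficients in an algebra which is a quotient of the base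
ring. -/
lemma polSymb_eq_famSymb (h : Function.Surjective (algebraMap R A))
    (φ : Matrix (Fin r) (Fin r) R) (m : ℤ) :
    polSymb φ (⊥ : Submodule R A) ⊤ m = famSymb ((List.finRange r).map (mulSys A
      (fun i => linSub (φ.map (algebraMap R A)) (MvPolynomial.X i)) fun _ => (0 : Fin 1))) ⊥
        (prodFam fun _ => MvPolynomial.homogeneousSubmodule (Fin r) A 1) fun _ => m := by
  set a : Fin r → MvPolynomial (Fin r) A := fun i =>
    linSub (φ.map (algebraMap R A)) (MvPolynomial.X i)
  rw [← famSymb_restrictScalars h, polSymb, List.map_map, List.map_map]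
  refine famSymb_eq_of_map (polMonomial R r) (fun m _ => m) (fun _ _ => linMul_commute _ _)
    (fun _ _ => LinearMap.ext fun _ => mul_left_comm _ _ _) ?_ ?_
    (fun t => polSub_mem_stableFam φ _ (Sum.inl t))
    (fun t => polSub_mem_stableFam φ _ (Sum.inl t)) ?_ ?_ ?_ ?_ _ m
  · intro i n
    funext k
    rw [Subsingleton.elim k 0]
    simp [polSys, mulSys]
  · intro i _ f _
    exact polMonomial_linMul φ i f
  · intro t n
    simp
  · have h1 := prodFam_mem_stableFam (R := A) (a := a) (κ := fun _ => (0 : Fin 1))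
      (M := fun _ => MvPolynomial.homogeneousSubmodule (Fin r) A 1)
      (fun t => linSub_mem _ (MvPolynomial.isHomogeneous_X A t))
    rintro t n _ ⟨v, hv, rfl⟩
    exact h1 t n ⟨v, hv, rfl⟩
  · intro n
    rw [map_polMonomial]
    exact (sup_eq_right.2 (by intro x hx; rw [(Submodule.mem_bot A).1 hx]; exact zero_mem _)).symm
  · intro n
    rw [polSub_bot]
    symm
    rw [eq_bot_iff]
    rintro f ⟨-, hf⟩
    exact polMonomial_injective ((show polMonomial R r f = 0 from hf).trans (map_zero _).symm)

/-- The linear form with given coefficients. -/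
noncomputable def linForm (R : Type*) {A : Type*} [CommRing R] [CommRing A] [Algebra R A]
    (r : ℕ) : (Fin r → A) →ₗ[R] MvPolynomial (Fin r) A where
  toFun v := ∑ i, v i • MvPolynomial.X i
  map_add' v w := by simp [add_smul, Finset.sum_add_distrib]
  map_smul' c v := by simp [Finset.smul_sum]

lemma linForm_apply (v : Fin r → A) : linForm R r v = ∑ i, v i • MvPolynomial.X i := rfl

lemma linForm_injective : Function.Injective (linForm R (A := A) r) := by
  intro v w h
  funext i
  have := congrArg (MvPolynomial.coeff (Finsupp.single i 1)) h
  simpa [linForm_apply, MvPolynomial.coeff_sum, MvPolynomial.coeff_X, Finsupp.single_left_inj]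
    using this

lemma linForm_matEnd (φ : Matrix (Fin r) (Fin r) R) (v : Fin r → A) :
    linForm R r (matEnd φ v) = linSub (φ.map (algebraMap R A)) (linForm R r v) := by
  simp only [linForm_apply, matEnd_apply, map_sum, map_smul, linSub_X, Finset.sum_smul,
    Finset.smul_sum, smul_smul]
  rw [Finset.sum_comm]
  refine Finset.sum_congr rfl fun i _ => Finset.sum_congr rfl fun j _ => ?_
  rw [Matrix.map_apply, mul_comm (v i), ← Algebra.smul_def]

lemma map_linForm : (powSub r (⊤ : Submodule R A)).map (linForm R r) =
    (MvPolynomial.homogeneousSubmodule (Fin r) A 1).restrictScalars R := by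
  ext f
  rw [Submodule.restrictScalars_mem, MvPolynomial.homogeneousSubmodule_one_eq_span_X,
    Submodule.mem_span_range_iff_exists_fun]
  constructor
  · rintro ⟨v, -, rfl⟩
    exact ⟨v, rfl⟩
  · rintro ⟨v, rfl⟩
    exact ⟨v, mem_powSub.2 fun _ => trivial, rfl⟩

/-- Over a domain a matrix with nonzero determinant is injective, so the kernel term disappears. The
cokernel on tuples is that of the substitution on linear forms. -/
lemma matSymb_eq_subLength [IsDomain A] (h : Function.Surjective (algebraMap R A))
    {φ : Matrix (Fin r) (Fin r) R} (hφ : (φ.map (algebraMap R A)).det ≠ 0) :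
    matSymb φ (⊥ : Submodule R A) ⊤ =
      ((subLength (φ.map (algebraMap R A)) 1).toNat : ℤ) := by
  have h1 : relLength (powSub r (⊥ : Submodule R A) ⊔ (powSub r ⊤).map (matEnd φ))
      (powSub r (⊤ : Submodule R A)) = subLength (φ.map (algebraMap R A)) 1 := by
    rw [subLength, ← relLength_restrictScalars h]
    refine relLength_eq_of_map (linForm R r) ?_ ?_
    · rw [map_linForm, right_eq_sup]
      rintro _ ⟨f, hf, rfl⟩
      exact linSub_mem _ hf
    · have hb : powSub r (⊥ : Submodule R A) = ⊥ := by
        rw [eq_bot_iff]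
        intro v hv
        exact funext fun i => mem_powSub.1 hv i
      rw [hb, bot_sup_eq]
      ext v
      constructor
      · rintro ⟨w, hw, rfl⟩
        refine ⟨mem_powSub.2 fun _ => trivial, ?_⟩
        rw [SetLike.mem_coe, Submodule.mem_comap, linForm_matEnd]
        exact ⟨_, (map_linForm (R := R)).le ⟨w, hw, rfl⟩, rfl⟩
      · rintro ⟨-, f, hf, hfv⟩
        obtain ⟨w, hw, rfl⟩ := (map_linForm (R := R)).ge hf
        refine ⟨w, hw, linForm_injective (R := R) ?_⟩
        rw [linForm_matEnd]
        exact hfv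
  have h2 : relLength (powSub r (⊥ : Submodule R A))
      (powSub r ⊤ ⊓ (powSub r (⊥ : Submodule R A)).comap (matEnd φ)) = 0 := by
    rw [relLength_eq_zero]
    rintro v ⟨-, hv⟩
    have hv0 : matEnd φ v = 0 := funext fun i => mem_powSub.1 hv i
    have : v = 0 := by
      refine linForm_injective (R := R) (linSub_injective hφ ?_)
      rw [← linForm_matEnd, hv0]
      simp
    rw [this]
    exact zero_mem _
  change ((relLength (powSub r (⊥ : Submodule R A) ⊔ (powSub r ⊤).map (matEnd φ))
    (powSub r (⊤ : Submodule R A))).toNat : ℤ) - ((relLength (powSub r (⊥ : Submodule R A))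
      (powSub r ⊤ ⊓ (powSub r (⊥ : Submodule R A)).comap (matEnd φ))).toNat : ℤ) = _
  rw [h1, h2]
  simp

end Algebra

section FiniteLength

variable [IsNoetherianRing R] {E : Type*} [AddCommGroup E] [Module R E] [Module.Finite R E]
  {J : Ideal R}

/-- When E has finite length, the symbol of any r operators of degree one is the r-th difference of
the same length function. Replacing the columns by the variables does not change it, and for the
variables it vanishes because stable families are generated by them in large degrees. -/
lemma polSymb_eventually_eq_zero (φ : Matrix (Fin r) (Fin r) R)
    (hJ : Module.length R (R ⧸ J) ≠ ⊤) (hE : ∀ a ∈ J, ∀ v : E, a • v = 0) :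
    ∀ᶠ m in atTop, polSymb φ (⊥ : Submodule R E) ⊤ m = 0 := by
  have hk : FiniteKilled atTop (polSys E φ) [] (polSub r ⊥) (polSub r ⊤) := by
    intro U' _ V' _ _ _ h3 _
    refine Eventually.of_forall fun m => ?_
    have : IsNoetherian R (polSub r (⊤ : Submodule R E) m) :=
      isNoetherian_of_fg_of_noetherian _ (polSub_fg Module.Finite.fg_top m)
    refine relLength_ne_top_of_smul_le (isNoetherian_submodule.1 ‹_› _ (h3 m)) hJ ?_
    rw [Submodule.smul_le]
    intro a ha f _
    have : a • f = 0 := Finsupp.ext fun β => hE a ha _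
    rw [this]
    exact zero_mem _
  have h := fun l : List (Fin r ⊕ Fin r) => famSymb_append (polSys_commute φ) (polSys_tendsto φ)
    (polSub_mem_stableFam φ (⊥ : Submodule R E)) (polSub_mem_stableFam φ ⊤)
    (polSub_mono bot_le) (l := l) hk
  have h0 := famSymb_eq_zero (polSys_commute φ) (polSys_tendsto φ)
    (polSub_mem_stableFam φ (⊥ : Submodule R E)) (polSub_mem_stableFam φ ⊤)
    (polSub_mono bot_le) (l := (List.finRange r).map Sum.inr) (by
      intro U' _ V' hV' _ _ h3 hk
      obtain ⟨N, hN⟩ := exists_bound_polSys φ Module.Finite.fg_top hV' h3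
      filter_upwards [eventually_gt_atTop N] with m hm
      refine (hN m hm).trans (iSup_le fun j => ?_)
      have := hk (Sum.inr j) (by simp) (m - 1)
      rwa [polSys_snd, sub_add_cancel] at this)
  filter_upwards [h ((List.finRange r).map Sum.inl), h ((List.finRange r).map Sum.inr), h0]
    with m e1 e2 e3
  rw [List.append_nil] at e1 e2
  rw [polSymb, e1, ← e3, e2]
  congr 1
  simp [polSys_snd]

/-- An endomorphism of a module of finite length has kernel and cokernel of the same length. -/
lemma matSymb_eq_zero (φ : Matrix (Fin r) (Fin r) R)
    (hJ : Module.length R (R ⧸ J) ≠ ⊤) (hE : ∀ a ∈ J, ∀ v : E, a • v = 0) :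
    matSymb φ (⊥ : Submodule R E) ⊤ = 0 := by
  have hk : FiniteKilled (pure ()) (matSys E φ) [] (fun _ => powSub r ⊥) (fun _ => powSub r ⊤) := by
    intro U' _ V' _ _ _ h3 _
    refine Eventually.of_forall fun m => ?_
    refine relLength_ne_top_of_smul_le (IsNoetherian.noetherian _) hJ ?_
    rw [Submodule.smul_le]
    intro a ha f _
    have : a • f = 0 := funext fun β => hE a ha _
    rw [this]
    exact zero_mem _
  have h := eventually_pure.1 (famSymb_append (matSys_commute φ) (fun _ => tendsto_pure_pure _ _)
    (powSub_mem_stableFam φ (⊥ : Submodule R E)) (powSub_mem_stableFam φ ⊤)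
    (fun _ => powSub_mono bot_le) (l := [true]) hk)
  rw [List.append_nil] at h
  rw [matSymb, h]
  exact sub_self _

end FiniteLength

/-- The symbol of the columns of a matrix on polynomials is eventually the symbol of the matrix on
tuples. -/
theorem polSymb_eq_matSymb_of_finite [IsNoetherianRing R] [IsLocalRing R] {K : Ideal R}
    {φ : Matrix (Fin r) (Fin r) R} (hJ : Module.length R (R ⧸ K ⊔ Ideal.span {φ.det}) ≠ ⊤)
    {E : Type*} [AddCommGroup E] [Module R E] [Module.Finite R E]
    (hE : ∀ a ∈ K, ∀ v : E, a • v = 0) :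
    ∀ᶠ m in atTop, polSymb φ (⊥ : Submodule R E) ⊤ m = matSymb φ (⊥ : Submodule R E) ⊤ := by
  revert hE
  -- Dévissage: both symbols are additive in E, so it suffices to treat E = 0 and E = R / P and to
  -- pass through short exact sequences.
  refine IsNoetherianRing.induction_on_isQuotientEquivQuotientPrime R (M := E) inferInstance
    (motive := fun N _ _ _ => (∀ a ∈ K, ∀ v : N, a • v = 0) →
      ∀ᶠ m in atTop, polSymb φ (⊥ : Submodule R N) ⊤ m = matSymb φ (⊥ : Submodule R N) ⊤) ?_ ?_ ?_
  · intro N _ _ _ _ _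
    have h0 : Module.length R (R ⧸ (⊤ : Ideal R)) ≠ ⊤ := by
      rw [Module.length_eq_zero]; simp
    have hN : ∀ a ∈ (⊤ : Ideal R), ∀ v : N, a • v = 0 := fun _ _ _ => Subsingleton.elim _ _
    rw [matSymb_eq_zero φ h0 hN]
    exact polSymb_eventually_eq_zero φ h0 hN
  · intro N _ _ _ P e hN
    have hb : (⊤ : Submodule R (R ⧸ P.1)) = ⊥ ⊔ (⊤ : Submodule R N).map e.toLinearMap := by
      rw [bot_sup_eq, Submodule.map_top, LinearMap.range_eq_top.2 e.surjective]
    have hb' : (⊥ : Submodule R N) = ⊤ ⊓ (⊥ : Submodule R (R ⧸ P.1)).comap e.toLinearMap := by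
      rw [top_inf_eq, ← LinearMap.ker, LinearMap.ker_eq_bot.2 e.injective]
    rw [matSymb_eq_of_map φ e.toLinearMap hb hb', polSymb_eq_of_map φ e.toLinearMap hb hb']
    have hKP : K ≤ P.1 := by
      intro a ha
      rw [← Ideal.Quotient.eq_zero_iff_mem]
      have := congrArg e (hN a ha (e.symm 1))
      rw [map_smul, e.apply_symm_apply, map_zero] at this
      rw [← this, Algebra.smul_def, mul_one]
      rfl
    by_cases hx : φ.det ∈ P.1
    -- If det φ lies in P, then P contains an ideal of finite colength and R / P has finite length.
    -- Both symbols vanish.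
    · have h0 : Module.length R (R ⧸ P.1) ≠ ⊤ :=
        length_quotient_mono (sup_le hKP (by rwa [Ideal.span_singleton_le_iff_mem])) hJ
      have hP : ∀ a ∈ P.1, ∀ v : R ⧸ P.1, a • v = 0 := by
        intro a ha v
        rw [Algebra.smul_def]
        have : algebraMap R (R ⧸ P.1) a = 0 := Ideal.Quotient.eq_zero_iff_mem.2 ha
        rw [this, zero_mul]
      rw [matSymb_eq_zero φ h0 hP]
      exact polSymb_eventually_eq_zero φ h0 hP
    -- If det φ is nonzero in the domain R / P, its quotient there has finite length as a quotient
    -- of R / (K + (det φ)). Both symbols are then the length of the cokernel of φ.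
    · have hsurj : Function.Surjective (algebraMap R (R ⧸ P.1)) := Ideal.Quotient.mk_surjective
      have hdet : (φ.map (algebraMap R (R ⧸ P.1))).det = algebraMap R (R ⧸ P.1) φ.det :=
        ((algebraMap R (R ⧸ P.1)).map_det φ).symm
      have hφ : (φ.map (algebraMap R (R ⧸ P.1))).det ≠ 0 := by
        rw [hdet]
        exact fun h => hx (Ideal.Quotient.eq_zero_iff_mem.1 h)
      have hord : ordLength (φ.map (algebraMap R (R ⧸ P.1))).det ≠ ⊤ := by
        rw [hdet, ordLength, relLength_top, ← Module.length_eq_of_surjective (S := R) hsurj]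
        let f : (R ⧸ K ⊔ Ideal.span {φ.det}) →ₗ[R]
            ((R ⧸ P.1) ⧸ Ideal.span {algebraMap R (R ⧸ P.1) φ.det}) :=
          Submodule.liftQ _ (Algebra.linearMap R _) (by
            rw [sup_le_iff, Ideal.span_singleton_le_iff_mem]
            refine ⟨fun a ha => ?_, ?_⟩
            · have : algebraMap R (R ⧸ P.1) a = 0 := Ideal.Quotient.eq_zero_iff_mem.2 (hKP ha)
              change Ideal.Quotient.mk _ (algebraMap R (R ⧸ P.1) a) = 0
              rw [this, map_zero]
            · change Ideal.Quotient.mk _ (algebraMap R (R ⧸ P.1) φ.det) = 0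
              exact Ideal.Quotient.eq_zero_iff_mem.2 (Ideal.mem_span_singleton_self _))
        have hf : Function.Surjective f := by
          intro y
          obtain ⟨y, rfl⟩ := Ideal.Quotient.mk_surjective y
          obtain ⟨y, rfl⟩ := Ideal.Quotient.mk_surjective y
          exact ⟨Submodule.Quotient.mk y, rfl⟩
        intro htop
        exact hJ (top_le_iff.1 (htop ▸ Module.length_le_of_surjective f hf))
      have : IsLocalRing (R ⧸ P.1) := IsLocalRing.of_surjective' _ hsurj
      obtain ⟨N', hN'⟩ := eventually_atTop_iff_forall_le.1 (famSymb_linSub hφ hord)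
      filter_upwards [eventually_ge_atTop N'] with m hm
      rw [polSymb_eq_famSymb hsurj, matSymb_eq_subLength hsurj hφ]
      exact hN' _ fun _ => hm
  · intro N₁ _ _ _ N₂ _ _ _ N₃ _ _ _ f g hf hg hfg h1 h3 hN
    have hN₁ : ∀ a ∈ K, ∀ v : N₁, a • v = 0 := fun a ha v =>
      hf (by rw [map_smul, hN a ha, map_zero])
    have hN₃ : ∀ a ∈ K, ∀ v : N₃, a • v = 0 := fun a ha v => by
      obtain ⟨w, rfl⟩ := hg v
      rw [← map_smul, hN a ha, map_zero]
    have hK : K • (⊤ : Submodule R N₂) ≤ ⊥ := by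
      rw [Submodule.smul_le]
      intro a ha v _
      exact hN a ha v
    -- The short exact sequence is realized inside the middle module, with the range of f as
    -- intermediate submodule.
    have a1 := polSymb_add hJ Module.Finite.fg_top hK (bot_le (a := LinearMap.range f)) le_top
    have a2 := matSymb_add hJ Module.Finite.fg_top hK (bot_le (a := LinearMap.range f)) le_top
    have c1 : LinearMap.range f = ⊥ ⊔ (⊤ : Submodule R N₁).map f := by
      rw [bot_sup_eq, Submodule.map_top]
    have c2 : (⊥ : Submodule R N₁) = ⊤ ⊓ (⊥ : Submodule R N₂).comap f := by
      rw [top_inf_eq, ← LinearMap.ker, LinearMap.ker_eq_bot.2 hf]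
    have c3 : (⊤ : Submodule R N₃) = ⊥ ⊔ (⊤ : Submodule R N₂).map g := by
      rw [bot_sup_eq, Submodule.map_top, LinearMap.range_eq_top.2 hg]
    have c4 : LinearMap.range f = ⊤ ⊓ (⊥ : Submodule R N₃).comap g := by
      rw [top_inf_eq, ← LinearMap.ker, LinearMap.exact_iff.1 hfg]
    rw [a2, ← matSymb_eq_of_map φ f c1 c2, matSymb_eq_of_map φ g c3 c4]
    filter_upwards [a1, h1 hN₁, h3 hN₃] with m e1 e2 e3
    rw [e1, ← polSymb_eq_of_map φ f c1 c2, polSymb_eq_of_map φ g c3 c4, e2, e3]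

/-- Symbols depend only on the quotient V / U, so the case of a module applies to this quotient. -/
theorem polSymb_eq_matSymb [IsNoetherianRing R] [IsLocalRing R] {K : Ideal R}
    {φ : Matrix (Fin r) (Fin r) R} (hJ : Module.length R (R ⧸ K ⊔ Ideal.span {φ.det}) ≠ ⊤)
    {E : Type*} [AddCommGroup E] [Module R E] {U V : Submodule R E} (hV : V.FG)
    (hUV : U ≤ V) (hK : K • V ≤ U) :
    ∀ᶠ m in atTop, polSymb φ U V m = matSymb φ U V := by
  have : Module.Finite R V := Module.Finite.iff_fg.2 hV
  have c1 : V = U ⊔ (⊤ : Submodule R V).map V.subtype := by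
    rw [Submodule.map_top, Submodule.range_subtype, sup_eq_right.2 hUV]
  have c2 : U.submoduleOf V = ⊤ ⊓ U.comap V.subtype := by
    rw [top_inf_eq]
    rfl
  have c3 : (⊤ : Submodule R (V ⧸ U.submoduleOf V)) =
      ⊥ ⊔ (⊤ : Submodule R V).map (U.submoduleOf V).mkQ := by
    rw [bot_sup_eq, Submodule.map_top, Submodule.range_mkQ]
  have c4 : U.submoduleOf V =
      ⊤ ⊓ (⊥ : Submodule R (V ⧸ U.submoduleOf V)).comap (U.submoduleOf V).mkQ := by
    rw [top_inf_eq, ← LinearMap.ker, Submodule.ker_mkQ]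
  rw [← matSymb_eq_of_map φ _ c1 c2, ← polSymb_eq_of_map φ _ c1 c2, matSymb_eq_of_map φ _ c3 c4,
    polSymb_eq_of_map φ _ c3 c4]
  refine polSymb_eq_matSymb_of_finite hJ fun a ha v => ?_
  obtain ⟨v, rfl⟩ := Submodule.mkQ_surjective _ v
  rw [← map_smul, Submodule.mkQ_apply, Submodule.Quotient.mk_eq_zero]
  exact hK (Submodule.smul_mem_smul ha v.2)

end Comparison

/-! ### Comparison of the symbols of a matrix in families -/

section Families

variable {R E ι τ : Type*} [CommRing R] [AddCommGroup E] [Module R E] [AddCommGroup ι] {r : ℕ}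

lemma powSub_map {E₁ E₂ : Type*} [AddCommGroup E₁] [Module R E₁] [AddCommGroup E₂] [Module R E₂]
    (θ : E₁ →ₗ[R] E₂) (V : Submodule R E₁) :
    (powSub r V).map (θ.compLeft (Fin r)) = powSub r (V.map θ) := by
  refine le_antisymm ?_ fun v hv => ?_
  · rintro _ ⟨v, hv, rfl⟩
    exact mem_powSub.2 fun i => ⟨v i, mem_powSub.1 hv i, rfl⟩
  · choose c hc hcb using mem_powSub.1 hv
    exact ⟨c, mem_powSub.2 hc, funext hcb⟩

lemma powSub_sup (U V : Submodule R E) : powSub r (U ⊔ V) = powSub r U ⊔ powSub r V := by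
  refine le_antisymm (fun v hv => ?_) (sup_le (powSub_mono le_sup_left) (powSub_mono le_sup_right))
  choose a ha b hb hab using fun i => Submodule.mem_sup.1 (mem_powSub.1 hv i)
  exact Submodule.mem_sup.2 ⟨a, mem_powSub.2 ha, b, mem_powSub.2 hb, funext hab⟩

/-- The families of polynomials with coefficients in the members of a family. -/
def polFam (r : ℕ) (U : ι → Submodule R E) (n : ι × ℤ) : Submodule R (PolMod r E) :=
  polSub r (U n.1) n.2

/-- The families of tuples with entries in the members of a family. -/
def powFam (r : ℕ) (U : ι → Submodule R E) (n : ι) : Submodule R (Fin r → E) := powSub r (U n)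

/-- The action of a system and of a matrix on polynomials. -/
noncomputable def polLift (φ : Matrix (Fin r) (Fin r) R) (y : τ → Module.End R E × ι) :
    τ ⊕ (Fin r ⊕ Fin r) → Module.End R (PolMod r E) × (ι × ℤ)
  | Sum.inl t => (Finsupp.mapRange.linearMap (y t).1, ((y t).2, 0))
  | Sum.inr u => ((polSys E φ u).1, (0, (polSys E φ u).2))

/-- The action of a system and of a matrix on tuples. -/
def powLift (φ : Matrix (Fin r) (Fin r) R) (y : τ → Module.End R E × ι) :
    τ ⊕ Bool → Module.End R (Fin r → E) × ι
  | Sum.inl t => ((y t).1.compLeft (Fin r), (y t).2)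
  | Sum.inr u => ((matSys E φ u).1, 0)

variable {y : τ → Module.End R E × ι} {φ : Matrix (Fin r) (Fin r) R} {U V : ι → Submodule R E}

lemma polLift_commute (hy : ∀ s t, Commute (y s).1 (y t).1) (s t : τ ⊕ (Fin r ⊕ Fin r)) :
    Commute (polLift φ y s).1 (polLift φ y t).1 := by
  have h : ∀ (t : τ) (u : Fin r ⊕ Fin r), Commute (polLift φ y (Sum.inl t)).1
      (polLift φ y (Sum.inr u)).1 := by
    rintro t (u | u) <;> exact LinearMap.ext fun f => mapRange_linMul _ _ f
  rcases s with s | s <;> rcases t with t | t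
  · refine LinearMap.ext fun f => Finsupp.ext fun β => ?_
    exact LinearMap.congr_fun (hy s t).eq (f β)
  · exact h s t
  · exact (h t s).symm
  · exact polSys_commute φ s t

lemma powLift_commute (hy : ∀ s t, Commute (y s).1 (y t).1) (s t : τ ⊕ Bool) :
    Commute (powLift φ y s).1 (powLift φ y t).1 := by
  have hcomm : ∀ (θ : Module.End R E) (φ : Matrix (Fin r) (Fin r) R) (v : Fin r → E),
      θ.compLeft (Fin r) (matEnd φ v) = matEnd φ (θ.compLeft (Fin r) v) := by
    intro θ φ v
    funext j
    simp [matEnd_apply, map_sum]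
  have h : ∀ (t : τ) (u : Bool), Commute (powLift φ y (Sum.inl t)).1
      (powLift φ y (Sum.inr u)).1 := by
    rintro t (u | u) <;> exact LinearMap.ext fun f => hcomm _ _ f
  rcases s with s | s <;> rcases t with t | t
  · refine LinearMap.ext fun f => funext fun i => ?_
    exact LinearMap.congr_fun (hy s t).eq (f i)
  · exact h s t
  · exact (h t s).symm
  · exact matSys_commute φ s t

lemma polFam_mem_stableFam (hU : U ∈ StableFam y) : polFam r U ∈ StableFam (polLift φ y) := by
  rintro (t | t) ⟨n, m⟩
  · change (polSub r (U n) m).map (Finsupp.mapRange.linearMap (y t).1) ≤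
      polSub r (U (n + (y t).2)) (m + 0)
    rw [polSub_map, add_zero]
    exact polSub_mono (hU t n) m
  · change _ ≤ polSub r (U (n + 0)) _
    rw [add_zero]
    exact polSub_mem_stableFam φ (U n) t m

lemma powFam_mem_stableFam (hU : U ∈ StableFam y) : powFam r U ∈ StableFam (powLift φ y) := by
  rintro (t | t) n
  · exact (powSub_map _ _).le.trans (powSub_mono (hU t n))
  · change _ ≤ powSub r (U (n + 0))
    rw [add_zero]
    exact powSub_mem_stableFam φ (U n) t ()

variable [IsNoetherianRing R] [IsLocalRing R] {K : Ideal R} {F : Filter ι}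

/-- On polynomials the symbol of the columns of a matrix can be replaced by the symbol of the
matrix on tuples. -/
theorem famSymb_polFam_eq (hy : ∀ s t, Commute (y s).1 (y t).1)
    (hF : ∀ t, Tendsto (fun n => n - (y t).2) F F)
    (hJ : Module.length R (R ⧸ K ⊔ Ideal.span {φ.det}) ≠ ⊤) (l : List τ)
    (hU : U ∈ StableFam y) (hV : V ∈ StableFam y) (hUV : U ≤ V)
    (hk : ∀ U' ∈ StableFam y, ∀ V' ∈ StableFam y, U ≤ U' → U' ≤ V' → V' ≤ V →
      (∀ t ∈ l, ∀ n, (V' n).map (y t).1 ≤ U' (n + (y t).2)) →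
      ∀ᶠ n in F, (V' n).FG ∧ K • V' n ≤ U' n) :
    ∀ᶠ n in F, ∀ᶠ m in atTop,
      famSymb ((l.map Sum.inl ++ ((List.finRange r).map Sum.inl).map Sum.inr).map (polLift φ y))
        (polFam r U) (polFam r V) (n, m) =
      famSymb ((l.map Sum.inl ++ [Sum.inr true]).map (powLift φ y)) (powFam r U) (powFam r V) n := by
  induction l generalizing U V with
  | nil =>
    -- With no other operators left, each degree n is treated separately: V n / U n is a finitely
    -- generated module killed by K. The required size of m depends on n, which is why the limits
    -- are iterated.
    filter_upwards [hk U hU V hV le_rfl hUV le_rfl (by simp)] with n hn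
    filter_upwards [polSymb_eq_matSymb hJ hn.1 (hUV n) hn.2] with m hm
    have e1 : polSymb φ (U n) (V n) m =
        famSymb (((List.finRange r).map Sum.inl).map fun u => polLift φ y (Sum.inr u))
          (polFam r U) (polFam r V) (n, m) := by
      refine famSymb_eq_of_map (y₂ := fun u => polLift φ y (Sum.inr u)) LinearMap.id
        (fun m => (n, m)) (polSys_commute φ) (fun _ _ => polSys_commute φ _ _) ?_
        (fun _ _ _ _ => rfl) (polSub_mem_stableFam φ _) (polSub_mem_stableFam φ _)
        (fun t => polFam_mem_stableFam hU (Sum.inr t))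
        (fun t => polFam_mem_stableFam hV (Sum.inr t)) ?_ ?_ _ m
      · intro t k
        simp [polLift]
      · intro k
        rw [Submodule.map_id]
        exact (sup_eq_right.2 (polSub_mono (hUV n) k)).symm
      · intro k
        exact (inf_eq_right.2 (polSub_mono (hUV n) k)).symm
    have e2 : matSymb φ (U n) (V n) = famSymb ([true].map fun u => powLift φ y (Sum.inr u))
          (powFam r U) (powFam r V) n := by
      refine famSymb_eq_of_map (y₂ := fun u => powLift φ y (Sum.inr u)) LinearMap.id
        (fun _ => n) (matSys_commute φ) (fun _ _ => matSys_commute φ _ _) ?_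
        (fun _ _ _ _ => rfl) (powSub_mem_stableFam φ _) (powSub_mem_stableFam φ _)
        (fun t => powFam_mem_stableFam hU (Sum.inr t))
        (fun t => powFam_mem_stableFam hV (Sum.inr t)) ?_ ?_ _ ()
      · intro t k
        simp [powLift]
      · intro k
        rw [Submodule.map_id]
        exact (sup_eq_right.2 (powSub_mono (hUV n))).symm
      · intro k
        exact (inf_eq_right.2 (powSub_mono (hUV n))).symm
    simp only [List.map_nil, List.nil_append]
    rw [List.map_map (g := polLift φ y)]
    exact e1.symm.trans (hm.trans e2)
  | cons t l ih =>
    have hpV : (famOp (y t)).push V ≤ V := fun n => by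
      have := hV t (n - (y t).2)
      rwa [sub_add_cancel] at this
    have hpU : U ≤ (famOp (y t)).pull U := fun n => Submodule.map_le_iff_le_comap.1 (hU t n)
    have h1 := ih (U := U ⊔ (famOp (y t)).push V) (V := V)
      (Sublattice.supClosed _ hU (StableFam.push_mem hy t hV)) hV (sup_le hUV hpV) (by
        intro U' hU' V' hV' h1 h2 h3 hl
        refine hk U' hU' V' hV' (le_sup_left.trans h1) h2 h3 (List.forall_mem_cons.2 ⟨?_, hl⟩)
        intro n
        have := (le_sup_right.trans h1) (n + (y t).2)
        refine le_trans (Submodule.map_mono (h3 n)) (le_trans (le_of_eq ?_) this)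
        simp [famOp])
    have h2 := (hF t).eventually (ih (U := U) (V := V ⊓ (famOp (y t)).pull U) hU
      (Sublattice.infClosed _ hV (StableFam.pull_mem hy t hU)) (le_inf hUV hpU) (by
        intro U' hU' V' hV' h1 h2 h3 hl
        refine hk U' hU' V' hV' h1 h2 (h3.trans inf_le_left) (List.forall_mem_cons.2 ⟨?_, hl⟩)
        intro n
        exact (Submodule.map_le_iff_le_comap.2 ((h3.trans inf_le_right) n)).trans (h1 _)))
    -- Polynomials and tuples are exact in their coefficients. Forming N / yN and (0 :_N y)
    -- therefore commutes with both constructions, and the outermost operator can be peeled off on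
    -- both sides.
    have p1 : polFam r (U ⊔ (famOp (y t)).push V) =
        polFam r U ⊔ (famOp (polLift φ y (Sum.inl t))).push (polFam r V) := by
      funext n
      refine (polSub_sup _ _ _).trans (congrArg _ ?_)
      refine (polSub_map _ _ _).symm.trans ?_
      change _ = (polSub r (V (n.1 - (y t).2)) (n.2 - 0)).map _
      rw [sub_zero]
      rfl
    have p2 : polFam r (V ⊓ (famOp (y t)).pull U) =
        polFam r V ⊓ (famOp (polLift φ y (Sum.inl t))).pull (polFam r U) := by
      funext n
      refine (polSub_inf_comap _ _ _ _).trans ?_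
      change _ = _ ⊓ (polSub r (U (n.1 + (y t).2)) (n.2 + 0)).comap _
      rw [add_zero]
      rfl
    have p3 : powFam r (U ⊔ (famOp (y t)).push V) =
        powFam r U ⊔ (famOp (powLift φ y (Sum.inl t))).push (powFam r V) := by
      funext n
      exact (powSub_sup _ _).trans (congrArg _ (powSub_map _ _).symm)
    have p4 : powFam r (V ⊓ (famOp (y t)).pull U) =
        powFam r V ⊓ (famOp (powLift φ y (Sum.inl t))).pull (powFam r U) := by
      funext n
      ext v
      simp only [powFam, famOp, mem_powSub, Submodule.mem_inf, Pi.inf_apply, Submodule.mem_comap,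
        forall_and]
      rfl
    rw [p1, p3] at h1
    rw [p2, p4] at h2
    filter_upwards [h1, h2] with n hn1 hn2
    filter_upwards [hn1, hn2] with m hm1 hm2
    have := congrArg₂ (fun a b : ℤ => a - b) hm1 hm2
    have e0 : (n - (y t).2, m) = (n, m) - (polLift φ y (Sum.inl t)).2 := by
      simp [polLift]
    rw [e0] at this
    exact this

end Families

/-! ### The multigraded polynomial ring -/

section ProdFamMore

variable {R A B : Type*} [CommRing R] [CommRing A] [Algebra R A] [CommRing B] [Algebra R B] {d : ℕ}

lemma prodFam_eq_bot (M : Fin d → Submodule R A) {n : Fin d → ℤ} {k : Fin d} (hk : n k < 0) :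
    prodFam M n = ⊥ := if_neg fun h => (h k).not_gt hk

lemma prodFam_le_mul (M : Fin d → Submodule R A) {n : Fin d → ℤ} {k : Fin d} (hk : 0 < n k) :
    prodFam M n ≤ M k * prodFam M (n - Pi.single k 1) := by
  by_cases hn : 0 ≤ n
  · have hn' : 0 ≤ n - Pi.single k 1 := fun i => by
      by_cases h : i = k
      · subst h; simp; omega
      · simpa [h] using hn i
    rw [prodFam_of_nonneg M hn, prodFam_of_nonneg M hn', ← Finset.mul_prod_erase _ _
      (Finset.mem_univ k), ← Finset.mul_prod_erase (a := k) _ (fun i => M i ^ ((n - _) i).toNat)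
      (Finset.mem_univ k), ← mul_assoc, ← pow_succ']
    refine le_of_eq ?_
    congr 1
    · congr 1
      simp only [Pi.sub_apply, Pi.single_eq_same]
      omega
    · refine Finset.prod_congr rfl fun i hi => ?_
      simp [Finset.ne_of_mem_erase hi]
  · rw [prodFam, if_neg hn]
    exact bot_le

lemma pow_mul_prodFam_le (M : Fin d → Submodule R A) (k : Fin d) (s : ℕ) (n : Fin d → ℤ) :
    M k ^ s * prodFam M n ≤ prodFam M (n + Pi.single k (s : ℤ)) := by
  induction s with
  | zero => simp
  | succ s ih =>
    rw [pow_succ', mul_assoc]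
    refine (mul_le_mul_right ih _).trans ((mul_prodFam_le M k _).trans (le_of_eq ?_))
    rw [add_assoc, ← Pi.single_add]
    push_cast
    rfl

lemma prodFam_fg {M : Fin d → Submodule R A} (hM : ∀ k, (M k).FG) (n : Fin d → ℤ) :
    (prodFam M n).FG := by
  by_cases hn : 0 ≤ n
  · rw [prodFam_of_nonneg _ hn]
    exact Finset.prod_induction _ Submodule.FG (fun _ _ => Submodule.FG.mul) ⟨{1}, by
      rw [Finset.coe_singleton, Submodule.one_eq_span]⟩ fun k _ => (hM k).pow _
  · rw [prodFam, if_neg hn]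
    exact Submodule.fg_bot

lemma prodFam_map (f : A →ₐ[R] B) (M : Fin d → Submodule R A) (n : Fin d → ℤ) :
    (prodFam M n).map f.toLinearMap = prodFam (fun k => (M k).map f.toLinearMap) n := by
  by_cases hn : 0 ≤ n
  · rw [prodFam_of_nonneg _ hn, prodFam_of_nonneg _ hn]
    have h := map_prod (Submodule.mapHom f) (fun k => M k ^ (n k).toNat) Finset.univ
    simp only [map_pow] at h
    exact h
  · rw [prodFam, if_neg hn, prodFam, if_neg hn, Submodule.map_bot]

/-- The equalizer of two algebra homomorphisms is a subalgebra, so only the generators that occur in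
degree n matter. -/
lemma algHom_eq_of_mem_prodFam {f g : A →ₐ[R] B} {M : Fin d → Submodule R A} {n : Fin d → ℤ}
    (h : ∀ k, n k ≠ 0 → ∀ x ∈ M k, f x = g x) {x : A} (hx : x ∈ prodFam M n) : f x = g x := by
  suffices prodFam M n ≤ Subalgebra.toSubmodule (AlgHom.equalizer f g) from this hx
  by_cases hn : 0 ≤ n
  · rw [prodFam_of_nonneg _ hn]
    have hone : (1 : Submodule R A) ≤ Subalgebra.toSubmodule (AlgHom.equalizer f g) :=
      Submodule.one_le.2 (AlgHom.equalizer f g).one_mem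
    have hmul : ∀ a b : Submodule R A, a ≤ Subalgebra.toSubmodule (AlgHom.equalizer f g) →
        b ≤ Subalgebra.toSubmodule (AlgHom.equalizer f g) →
        a * b ≤ Subalgebra.toSubmodule (AlgHom.equalizer f g) := fun a b ha hb =>
      Submodule.mul_le.2 fun x hx y hy => (AlgHom.equalizer f g).mul_mem (ha hx) (hb hy)
    refine Finset.prod_induction _ (· ≤ Subalgebra.toSubmodule (AlgHom.equalizer f g)) hmul hone
      fun k _ => ?_
    by_cases hk : n k = 0
    · rw [hk]
      simp only [Int.toNat_zero, pow_zero]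
      exact hone
    · have hk' : M k ≤ Subalgebra.toSubmodule (AlgHom.equalizer f g) := h k hk
      induction (n k).toNat with
      | zero => rw [pow_zero]; exact hone
      | succ s ih => rw [pow_succ]; exact hmul _ _ ih hk'
  · rw [prodFam, if_neg hn]
    exact bot_le

end ProdFamMore

section MultiGraded

variable {R : Type*} [CommRing R] {d : ℕ} {r : Fin d → ℕ}

/-- The polynomial ring with `r k` variables of degree `e_k` for all `k`. -/
abbrev BlockPoly (R : Type*) [CommRing R] {d : ℕ} (r : Fin d → ℕ) : Type _ :=
  MvPolynomial (Σ k, Fin (r k)) R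

/-- The linear forms in the variables of degree `e_k`. -/
noncomputable def blockMod (R : Type*) [CommRing R] {d : ℕ} (r : Fin d → ℕ) (k : Fin d) :
    Submodule R (BlockPoly R r) :=
  genMod R MvPolynomial.X Sigma.fst k

/-- The family of the homogeneous components of the multigraded polynomial ring. -/
noncomputable def blockFam (R : Type*) [CommRing R] {d : ℕ} (r : Fin d → ℕ) :
    (Fin d → ℤ) → Submodule R (BlockPoly R r) :=
  prodFam (blockMod R r)

/-- A linear form in the variables of degree `e_k`. -/
noncomputable def blockForm (k : Fin d) (c : Fin (r k) → R) : BlockPoly R r :=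
  ∑ i, c i • MvPolynomial.X ⟨k, i⟩

lemma X_mem_blockMod (k : Fin d) (i : Fin (r k)) :
    (MvPolynomial.X ⟨k, i⟩ : BlockPoly R r) ∈ blockMod R r k :=
  mem_genMod MvPolynomial.X Sigma.fst (⟨k, i⟩ : Σ k, Fin (r k))

lemma blockForm_mem (k : Fin d) (c : Fin (r k) → R) : blockForm k c ∈ blockMod R r k :=
  Submodule.sum_mem _ fun i _ => Submodule.smul_mem _ _ (X_mem_blockMod k i)

lemma blockForm_single (k : Fin d) (i : Fin (r k)) :
    blockForm k (Pi.single i (1 : R)) = MvPolynomial.X ⟨k, i⟩ := by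
  rw [blockForm, Finset.sum_eq_single i]
  · simp
  · intro j _ hj
    simp [hj]
  · simp

lemma sum_smul_blockForm {κ : Type*} (s : Finset κ) (k : Fin d) (a : κ → R)
    (c : κ → Fin (r k) → R) :
    ∑ x ∈ s, a x • blockForm k (c x) = blockForm k fun i => ∑ x ∈ s, a x * c x i := by
  simp only [blockForm, Finset.smul_sum, smul_smul, Finset.sum_smul]
  exact Finset.sum_comm

lemma blockMod_le_iff {k : Fin d} {U : Submodule R (BlockPoly R r)} :
    blockMod R r k ≤ U ↔ ∀ i, MvPolynomial.X ⟨k, i⟩ ∈ U := by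
  rw [blockMod, genMod, Submodule.span_le]
  constructor
  · exact fun h i => h ⟨⟨k, i⟩, rfl, rfl⟩
  · rintro h _ ⟨⟨_, i⟩, rfl, rfl⟩
    exact h i

lemma blockMod_fg (k : Fin d) : (blockMod R r k).FG :=
  Submodule.fg_span ((Set.toFinite _).image _)

lemma blockFam_fg (n : Fin d → ℤ) : (blockFam R r n).FG := prodFam_fg blockMod_fg n

lemma mul_mem_blockFam {k : Fin d} {f g : BlockPoly R r} {n : Fin d → ℤ}
    (hf : f ∈ blockMod R r k) (hg : g ∈ blockFam R r n) :
    f * g ∈ blockFam R r (n + Pi.single k 1) :=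
  mul_prodFam_le _ k n (Submodule.mul_mem_mul hf hg)

lemma blockFam_le_iff {k : Fin d} {n : Fin d → ℤ} (hk : 0 < n k)
    {U : Submodule R (BlockPoly R r)} : blockFam R r n ≤ U ↔
      ∀ i, ∀ g ∈ blockFam R r (n - Pi.single k 1), MvPolynomial.X ⟨k, i⟩ * g ∈ U := by
  constructor
  · intro h i g hg
    refine h ?_
    have := mul_mem_blockFam (X_mem_blockMod k i) hg
    rwa [sub_add_cancel] at this
  · intro h
    refine (prodFam_le_mul _ hk).trans ?_
    have : blockMod R r k = Submodule.span R (MvPolynomial.X '' {t : Σ k, Fin (r k) | t.1 = k}) :=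
      rfl
    rw [this, span_mul_le_iff]
    rintro _ ⟨⟨_, i⟩, rfl, rfl⟩ _ ⟨g, hg, rfl⟩
    exact h i g hg

/-- The algebra endomorphism given by matrices on the linear forms of all degrees. -/
noncomputable def blockEnd (Φ : ∀ k, Matrix (Fin (r k)) (Fin (r k)) R) :
    BlockPoly R r →ₐ[R] BlockPoly R r :=
  MvPolynomial.aeval fun t => blockForm t.1 fun i => Φ t.1 i t.2

lemma blockEnd_X (Φ : ∀ k, Matrix (Fin (r k)) (Fin (r k)) R) (k : Fin d) (i : Fin (r k)) :
    blockEnd Φ (MvPolynomial.X ⟨k, i⟩) = blockForm k fun j => Φ k j i := by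
  rw [blockEnd, MvPolynomial.aeval_X]

lemma blockEnd_blockForm (Φ : ∀ k, Matrix (Fin (r k)) (Fin (r k)) R) (k : Fin d)
    (c : Fin (r k) → R) : blockEnd Φ (blockForm k c) = blockForm k ((Φ k).mulVec c) := by
  have : blockEnd Φ (blockForm k c) = ∑ i, c i • blockForm k fun j => Φ k j i := by
    rw [blockForm, map_sum]
    exact Finset.sum_congr rfl fun i _ => by rw [map_smul, blockEnd_X]
  rw [this, sum_smul_blockForm]
  congr 1
  funext j
  exact Finset.sum_congr rfl fun i _ => mul_comm _ _

lemma blockEnd_mul (Φ Ψ : ∀ k, Matrix (Fin (r k)) (Fin (r k)) R) :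
    (blockEnd Φ).comp (blockEnd Ψ) = blockEnd (Φ * Ψ) := by
  refine MvPolynomial.algHom_ext fun t => ?_
  obtain ⟨k, i⟩ := t
  rw [AlgHom.comp_apply, blockEnd_X, blockEnd_blockForm, blockEnd_X]
  rfl

lemma blockEnd_commute {Φ Ψ : ∀ k, Matrix (Fin (r k)) (Fin (r k)) R} (h : Commute Φ Ψ) :
    Commute (blockEnd Φ).toLinearMap (blockEnd Ψ).toLinearMap := by
  have h1 := blockEnd_mul Φ Ψ
  rw [h.eq, ← blockEnd_mul] at h1
  exact LinearMap.ext fun f => DFunLike.congr_fun h1 f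

lemma map_blockEnd_blockFam_le (Φ : ∀ k, Matrix (Fin (r k)) (Fin (r k)) R) (n : Fin d → ℤ) :
    (blockFam R r n).map (blockEnd Φ).toLinearMap ≤ blockFam R r n := by
  rw [blockFam, prodFam_map]
  refine prodFam_mono (fun k => ?_) n
  rw [Submodule.map_le_iff_le_comap, blockMod_le_iff]
  intro i
  rw [Submodule.mem_comap, AlgHom.toLinearMap_apply, blockEnd_X]
  exact blockForm_mem k _

lemma blockEnd_eq_self {Φ : ∀ k, Matrix (Fin (r k)) (Fin (r k)) R} {n : Fin d → ℤ}
    (h : ∀ k, n k ≠ 0 → Φ k = 1) {f : BlockPoly R r} (hf : f ∈ blockFam R r n) :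
    blockEnd Φ f = f := by
  refine algHom_eq_of_mem_prodFam (g := AlgHom.id R _) (fun k hk x hx => ?_) hf
  have : blockMod R r k ≤ LinearMap.eqLocus (blockEnd Φ).toLinearMap LinearMap.id := by
    rw [blockMod_le_iff]
    intro i
    have := blockEnd_X Φ k i
    refine this.trans ?_
    rw [h k hk, LinearMap.id_apply, ← blockForm_single]
    congr 1
    funext j
    rw [Matrix.one_apply, Pi.single_apply]
  exact this hx

lemma blockEnd_mul_blockForm {Φ : ∀ k, Matrix (Fin (r k)) (Fin (r k)) R} {k : Fin d}
    (h : Φ k = 1) (c : Fin (r k) → R) (f : BlockPoly R r) :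
    blockEnd Φ (blockForm k c * f) = blockForm k c * blockEnd Φ f := by
  rw [map_mul, blockEnd_blockForm, h, Matrix.one_mulVec]

/-- The algebra endomorphism given by a matrix on the linear forms of degree `e_k`. -/
noncomputable def blockMap (k : Fin d) (M : Matrix (Fin (r k)) (Fin (r k)) R) :
    BlockPoly R r →ₐ[R] BlockPoly R r :=
  blockEnd (Pi.mulSingle k M)

lemma blockMap_mul_blockForm {k l : Fin d} (h : l ≠ k) (M : Matrix (Fin (r k)) (Fin (r k)) R)
    (c : Fin (r l) → R) (f : BlockPoly R r) :
    blockMap k M (blockForm l c * f) = blockForm l c * blockMap k M f :=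
  blockEnd_mul_blockForm (Pi.mulSingle_eq_of_ne h _) c f

lemma blockMap_commute {k l : Fin d} (h : k ≠ l) (M : Matrix (Fin (r k)) (Fin (r k)) R)
    (N : Matrix (Fin (r l)) (Fin (r l)) R) :
    Commute (blockMap k M).toLinearMap (blockMap l N).toLinearMap :=
  blockEnd_commute (Pi.mulSingle_commute (f := fun k => Matrix (Fin (r k)) (Fin (r k)) R) h M N)

lemma blockMap_commute_of_commute {k : Fin d} {M N : Matrix (Fin (r k)) (Fin (r k)) R}
    (h : Commute M N) : Commute (blockMap k M).toLinearMap (blockMap k N).toLinearMap := by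
  refine blockEnd_commute ?_
  rw [Commute, SemiconjBy, ← Pi.mulSingle_mul, ← Pi.mulSingle_mul, h.eq]

lemma blockMap_eq_self {k : Fin d} (M : Matrix (Fin (r k)) (Fin (r k)) R) {n : Fin d → ℤ}
    (hn : n k = 0) {f : BlockPoly R r} (hf : f ∈ blockFam R r n) : blockMap k M f = f :=
  blockEnd_eq_self (fun l hl => Pi.mulSingle_eq_of_ne (by rintro rfl; exact hl hn) _) hf

lemma blockMap_X (k : Fin d) (M : Matrix (Fin (r k)) (Fin (r k)) R) (i : Fin (r k)) :
    blockMap k M (MvPolynomial.X ⟨k, i⟩) = blockForm k fun j => M j i := by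
  rw [blockMap, blockEnd_X, Pi.mulSingle_eq_same]

/-- In degree one of block k an element is a sum of terms X g with g free of that block. There the
algebra endomorphism acts linearly in its matrix and Cramer's rule applies; in degree s of the block
a power det^s would appear instead. -/
lemma blockMap_adjugate {k : Fin d} (M : Matrix (Fin (r k)) (Fin (r k)) R) {n : Fin d → ℤ}
    (hn : n k = 1) {f : BlockPoly R r} (hf : f ∈ blockFam R r n) :
    blockMap k M (blockMap k M.adjugate f) = M.det • f := by
  have h : blockFam R r n ≤ LinearMap.eqLocus
      ((blockMap k M).comp (blockMap k M.adjugate)).toLinearMap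
      (LinearMap.lsmul R (BlockPoly R r) M.det) := by
    rw [blockFam_le_iff (k := k) (by omega)]
    intro i g hg
    have hg' : (n - Pi.single k 1 : Fin d → ℤ) k = 0 := by simp [hn]
    change blockMap k M (blockMap k M.adjugate (_ * g)) = M.det • (_ * g)
    rw [map_mul, map_mul, blockMap_eq_self _ hg' hg, blockMap_eq_self _ hg' hg, blockMap_X,
      blockMap, blockEnd_blockForm, Pi.mulSingle_eq_same, ← smul_mul_assoc]
    congr 1
    have : (M.mulVec fun j => M.adjugate j i) = fun j => (M * M.adjugate) j i := rfl
    rw [this, Matrix.mul_adjugate, ← blockForm_single]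
    simp only [blockForm, Finset.smul_sum, smul_smul]
    refine Finset.sum_congr rfl fun j _ => ?_
    rw [Matrix.smul_apply, Matrix.one_apply, Pi.single_apply, smul_eq_mul]
  exact h hf

lemma det_smul_X (k : Fin d) (M : Matrix (Fin (r k)) (Fin (r k)) R) (i : Fin (r k)) :
    M.det • (MvPolynomial.X ⟨k, i⟩ : BlockPoly R r) =
      ∑ l, M.adjugate l i • blockForm k fun j => M j l := by
  rw [sum_smul_blockForm, ← blockForm_single]
  simp only [blockForm, Finset.smul_sum, smul_smul]
  refine Finset.sum_congr rfl fun j _ => ?_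
  have h := congrFun (congrFun (Matrix.mul_adjugate M) j) i
  rw [Matrix.mul_apply, Matrix.smul_apply, Matrix.one_apply] at h
  rw [Pi.single_apply, ← smul_eq_mul M.det, ← h]
  exact congrArg (· • _) (Finset.sum_congr rfl fun l _ => mul_comm _ _)

/-- The evaluation of polynomials at the variables of degree `e_j`. -/
noncomputable def polEval (j : Fin d) : PolMod (r j) (BlockPoly R r) →ₗ[R] BlockPoly R r :=
  Finsupp.lsum R fun β => LinearMap.mulLeft R (∏ i, MvPolynomial.X ⟨j, i⟩ ^ β i)

lemma polEval_single (j : Fin d) (β : Fin (r j) →₀ ℕ) (v : BlockPoly R r) :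
    polEval j (Finsupp.single β v) = (∏ i, MvPolynomial.X ⟨j, i⟩ ^ β i) * v := by
  simp [polEval]

lemma polEval_linMul (j : Fin d) (c : Fin (r j) → R) (f : PolMod (r j) (BlockPoly R r)) :
    polEval j (linMul c f) = blockForm j c * polEval j f := by
  induction f using Finsupp.induction_linear with
  | zero => simp
  | add f g hf hg => rw [map_add, map_add, map_add, hf, hg, mul_add]
  | single β v =>
    rw [linMul_single, map_sum, blockForm, Finset.sum_mul]
    refine Finset.sum_congr rfl fun i _ => ?_
    rw [map_smul, polEval_single, polEval_single, smul_mul_assoc, ← mul_assoc]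
    congr 2
    simp only [Finsupp.add_apply, pow_add, Finset.prod_mul_distrib]
    rw [mul_comm]
    congr 1
    rw [Finset.prod_eq_single i]
    · simp
    · intro l _ hl
      simp [Ne.symm hl]
    · simp

/-- The splitting of the variables of degree `e_j` from the others. -/
noncomputable def blockSplit (j : Fin d) :
    BlockPoly R r →ₐ[R] MvPolynomial (Fin (r j)) (BlockPoly R r) :=
  MvPolynomial.aeval fun t => if h : t.1 = j then MvPolynomial.X (h ▸ t.2)
    else MvPolynomial.C (MvPolynomial.X t)

lemma blockSplit_eq_C {j : Fin d} {n : Fin d → ℤ} (hn : n j = 0) {f : BlockPoly R r}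
    (hf : f ∈ blockFam R r n) : blockSplit j f = MvPolynomial.C f := by
  refine algHom_eq_of_mem_prodFam
    (g := IsScalarTower.toAlgHom R _ (MvPolynomial (Fin (r j)) (BlockPoly R r)))
    (fun k hk x hx => ?_) hf
  have : blockMod R r k ≤ LinearMap.eqLocus (blockSplit j).toLinearMap (IsScalarTower.toAlgHom R
      (BlockPoly R r) (MvPolynomial (Fin (r j)) (BlockPoly R r))).toLinearMap := by
    rw [blockMod_le_iff]
    intro i
    have hkj : k ≠ j := by rintro rfl; exact hk hn
    change blockSplit j _ = _
    rw [blockSplit, MvPolynomial.aeval_X, dif_neg hkj]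
    rfl
  exact this hx

/-- When the coefficients do not involve block j, separating the variables of that block undoes the
evaluation. Injectivity of the evaluation follows. -/
lemma blockSplit_polEval {j : Fin d} {n : Fin d → ℤ} (hn : n j = 0)
    {f : PolMod (r j) (BlockPoly R r)} (hf : ∀ β, f β ∈ blockFam R r n) :
    blockSplit j (polEval j f) = polMonomial R (r j) f := by
  have h1 : polEval j f = ∑ β ∈ f.support, polEval j (Finsupp.single β (f β)) := by
    conv_lhs => rw [← Finsupp.sum_single f]
    rw [Finsupp.sum, map_sum]
  have h2 : polMonomial R (r j) f =
      ∑ β ∈ f.support, polMonomial R (r j) (Finsupp.single β (f β)) := by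
    conv_lhs => rw [← Finsupp.sum_single f]
    rw [Finsupp.sum, map_sum]
  rw [h1, h2, map_sum]
  refine Finset.sum_congr rfl fun β _ => ?_
  rw [polEval_single, map_mul, map_prod, blockSplit_eq_C hn (hf β), polMonomial_single,
    MvPolynomial.monomial_eq, mul_comm, Finsupp.prod_fintype _ _ (by simp)]
  congr 1
  refine Finset.prod_congr rfl fun i _ => ?_
  rw [map_pow, blockSplit, MvPolynomial.aeval_X, dif_pos rfl]

lemma polEval_eq_zero {j : Fin d} {n : Fin d → ℤ} (hn : n j = 0)
    {f : PolMod (r j) (BlockPoly R r)} (hf : ∀ β, f β ∈ blockFam R r n) (h : polEval j f = 0) :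
    f = 0 := by
  have := blockSplit_polEval hn hf
  rw [h, map_zero] at this
  exact polMonomial_injective (R := R) (this.symm.trans (map_zero _).symm)

/-- S is a polynomial ring in the variables of block j over the polynomial ring in the others. This
identifies its multigraded pieces with spaces of homogeneous polynomials whose coefficients are free
of block j. -/
lemma map_polEval_polSub {j : Fin d} {n : Fin d → ℤ} (hn : n j = 0) (m : ℤ) :
    (polSub (r j) (blockFam R r n) m).map (polEval j) =
      blockFam R r (Function.update n j m) := by
  have e : ∀ m, n + Pi.single j m = Function.update n j m := fun m => by
    funext k
    by_cases h : k = j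
    · subst h; simp [hn]
    · simp [h]
  refine le_antisymm ?_ ?_
  · rw [Submodule.map_le_iff_le_comap, polSub_le_iff]
    rintro β rfl v hv
    rw [Submodule.mem_comap, polEval_single, ← e]
    refine pow_mul_prodFam_le _ j _ n (Submodule.mul_mem_mul ?_ hv)
    rw [Finsupp.degree_eq_sum, ← Finset.prod_pow_eq_pow_sum]
    generalize (Finset.univ : Finset (Fin (r j))) = s
    induction s using Finset.induction_on with
    | empty => exact Submodule.one_le.1 le_rfl
    | insert i s hi ih =>
      rw [Finset.prod_insert hi, Finset.prod_insert hi]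
      exact Submodule.mul_mem_mul (Submodule.pow_mem_pow _ (X_mem_blockMod j i) _) ih
  · rcases lt_or_ge m 0 with hm | hm
    · rw [blockFam, prodFam_eq_bot _ (k := j) (by simpa using hm)]
      exact bot_le
    obtain ⟨m, rfl⟩ := Int.eq_ofNat_of_zero_le hm
    induction m with
    | zero =>
      rw [← e]
      intro v hv
      refine ⟨Finsupp.single 0 v, ?_, by simp [polEval_single]⟩
      simpa using single_mem_polSub (0 : Fin (r j) →₀ ℕ) (by simpa using hv)
    | succ m ih =>
      rw [blockFam_le_iff (k := j) (by simp)]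
      intro i g hg
      have e' : Function.update n j ((m + 1 : ℕ) : ℤ) - Pi.single j 1 =
          Function.update n j (m : ℤ) := by
        rw [← e, ← e, add_sub_assoc, ← Pi.single_sub]
        push_cast
        rw [add_sub_cancel_right]
      rw [e'] at hg
      obtain ⟨f, hf, rfl⟩ := ih (by omega) hg
      refine ⟨linMul (Pi.single i (1 : R)) f, ?_, ?_⟩
      · have := map_linMul_polSub_le (Pi.single i (1 : R)) _ _ ⟨f, hf, rfl⟩
        push_cast
        exact this
      · rw [polEval_linMul, blockForm_single]

/-- The linear forms in the variables of degree `e_j`. -/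
noncomputable def tupleEval (j : Fin d) : (Fin (r j) → BlockPoly R r) →ₗ[R] BlockPoly R r :=
  ∑ i, LinearMap.mulLeft R (MvPolynomial.X ⟨j, i⟩) ∘ₗ LinearMap.proj i

lemma tupleEval_apply (j : Fin d) (v : Fin (r j) → BlockPoly R r) :
    tupleEval j v = ∑ i, MvPolynomial.X ⟨j, i⟩ * v i := by
  simp [tupleEval, LinearMap.sum_apply]

lemma tupleEval_eq_polEval (j : Fin d) (v : Fin (r j) → BlockPoly R r) :
    tupleEval j v = polEval j (∑ i, Finsupp.single (Finsupp.single i 1) (v i)) := by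
  rw [tupleEval_apply, map_sum]
  refine Finset.sum_congr rfl fun i _ => ?_
  rw [polEval_single, Finset.prod_eq_single i]
  · simp
  · intro l _ hl
    simp [Ne.symm hl]
  · simp

lemma tupleEval_eq_zero {j : Fin d} {n : Fin d → ℤ} (hn : n j = 0)
    {v : Fin (r j) → BlockPoly R r} (hv : v ∈ powSub (r j) (blockFam R r n))
    (h : tupleEval j v = 0) : v = 0 := by
  classical
  rw [tupleEval_eq_polEval] at h
  have := polEval_eq_zero hn (fun β => ?_) h
  · funext i
    have := DFunLike.congr_fun this (Finsupp.single i 1)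
    rw [Finsupp.finsetSum_apply, Finset.sum_eq_single i] at this
    · simpa using this
    · intro l _ hl
      rw [Finsupp.single_apply, if_neg]
      intro h
      exact hl (Finsupp.single_left_injective one_ne_zero h)
    · simp
  · rw [Finsupp.finsetSum_apply]
    refine Submodule.sum_mem _ fun i _ => ?_
    rw [Finsupp.single_apply]
    split_ifs
    · exact mem_powSub.1 hv i
    · exact Submodule.zero_mem _

lemma map_tupleEval_powSub {j : Fin d} {n : Fin d → ℤ} (hn : n j = 0) :
    (powSub (r j) (blockFam R r n)).map (tupleEval j) =
      blockFam R r (Function.update n j 1) := by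
  have e : n + Pi.single j 1 = Function.update n j 1 := by
    funext k
    by_cases h : k = j
    · subst h; simp [hn]
    · simp [h]
  refine le_antisymm ?_ ?_
  · rintro _ ⟨v, hv, rfl⟩
    rw [tupleEval_apply, ← e]
    exact Submodule.sum_mem _ fun i _ =>
      mul_mem_blockFam (X_mem_blockMod j i) (mem_powSub.1 hv i)
  · rw [blockFam_le_iff (k := j) (by simp), ← e, add_sub_cancel_right]
    intro i g hg
    refine ⟨Pi.single i g, mem_powSub.2 fun l => ?_, ?_⟩
    · by_cases h : l = i
      · subst h; simpa using hg
      · simp [h]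
    · rw [tupleEval_apply, Finset.sum_eq_single i]
      · simp
      · intro l _ hl
        simp [hl]
      · simp

lemma tupleEval_matEnd {j : Fin d} {n : Fin d → ℤ} (hn : n j = 0)
    (M : Matrix (Fin (r j)) (Fin (r j)) R) {v : Fin (r j) → BlockPoly R r}
    (hv : v ∈ powSub (r j) (blockFam R r n)) :
    tupleEval j (matEnd M v) = blockMap j M (tupleEval j v) := by
  rw [tupleEval_apply, tupleEval_apply, map_sum]
  simp only [map_mul, blockMap_X, blockMap_eq_self M hn (mem_powSub.1 hv _), matEnd_apply,
    Finset.mul_sum, blockForm, Finset.sum_mul]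
  rw [Finset.sum_comm]
  refine Finset.sum_congr rfl fun i _ => Finset.sum_congr rfl fun l _ => ?_
  rw [mul_smul_comm, smul_mul_assoc]

end MultiGraded

/-! ### Killed families in the multigraded polynomial ring -/

section Stages

variable {R : Type*} [CommRing R] {d : ℕ} {r : Fin d → ℕ}

/-- The columns of a matrix and the unit vectors. -/
def polCol {r : ℕ} (φ : Matrix (Fin r) (Fin r) R) : Fin r ⊕ Fin r → Fin r → R
  | Sum.inl i => fun j => φ j i
  | Sum.inr i => Pi.single i 1

lemma polSys_eq {E : Type*} [AddCommGroup E] [Module R E] {r : ℕ} (φ : Matrix (Fin r) (Fin r) R)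
    (u : Fin r ⊕ Fin r) : polSys E φ u = (linMul (polCol φ u), 1) := by
  rcases u with u | u <;> rfl

/-- A matrix and its adjugate. -/
def matAdj {r : ℕ} (φ : Matrix (Fin r) (Fin r) R) : Bool → Matrix (Fin r) (Fin r) R
  | true => φ
  | false => φ.adjugate

lemma matSys_eq {E : Type*} [AddCommGroup E] [Module R E] {r : ℕ} (φ : Matrix (Fin r) (Fin r) R)
    (b : Bool) : matSys E φ b = (matEnd (matAdj φ b), ()) := by
  rcases b with b | b <;> rfl

lemma matAdj_commute {r : ℕ} (φ : Matrix (Fin r) (Fin r) R) (b c : Bool) :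
    Commute (matAdj φ b) (matAdj φ c) := by
  have h : Commute φ φ.adjugate := by
    rw [Commute, SemiconjBy, Matrix.mul_adjugate, Matrix.adjugate_mul]
  rcases b with b | b <;> rcases c with c | c
  exacts [Commute.refl _, h.symm, h, Commute.refl _]

/-- The index type of the operators on the multigraded polynomial ring. -/
abbrev BlockIdx (r : Fin d → ℕ) : Type := (Σ k, Fin (r k) ⊕ Fin (r k)) ⊕ (Fin d × Bool)

/-- The degree in which an operator is nontrivial. -/
def BlockIdx.block : BlockIdx r → Fin d
  | Sum.inl t => t.1
  | Sum.inr t => t.1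

/-- The multiplications by the columns of matrices and by the variables, and the actions of the
matrices and of their adjugates. -/
noncomputable def blockOp (φ : ∀ k, Matrix (Fin (r k)) (Fin (r k)) R) :
    BlockIdx r → Module.End R (BlockPoly R r) × (Fin d → ℤ)
  | Sum.inl t => (LinearMap.mulLeft R (blockForm t.1 (polCol (φ t.1) t.2)), Pi.single t.1 1)
  | Sum.inr t => ((blockMap t.1 (matAdj (φ t.1) t.2)).toLinearMap, 0)

variable (φ : ∀ k, Matrix (Fin (r k)) (Fin (r k)) R)

lemma blockOp_commute {s t : BlockIdx r} (h : s.block ≠ t.block) :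
    Commute (blockOp φ s).1 (blockOp φ t).1 := by
  have key : ∀ (k : Fin d) u (l : Fin d) b, k ≠ l →
      Commute (blockOp φ (Sum.inl ⟨k, u⟩)).1 (blockOp φ (Sum.inr (l, b))).1 :=
    fun k u l b h => LinearMap.ext fun f => (blockMap_mul_blockForm h _ _ f).symm
  rcases s with ⟨k, u⟩ | ⟨k, b⟩ <;> rcases t with ⟨l, v⟩ | ⟨l, c⟩
  · exact LinearMap.ext fun f => mul_left_comm _ _ f
  · exact key _ _ _ _ h
  · exact (key _ _ _ _ h.symm).symm
  · exact blockMap_commute h _ _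

lemma blockOp_inl_commute (s t : Σ k, Fin (r k) ⊕ Fin (r k)) :
    Commute (blockOp φ (Sum.inl s)).1 (blockOp φ (Sum.inl t)).1 :=
  LinearMap.ext fun f => mul_left_comm _ _ f

lemma blockOp_inr_commute (s t : Fin d × Bool) :
    Commute (blockOp φ (Sum.inr s)).1 (blockOp φ (Sum.inr t)).1 := by
  obtain ⟨k, b⟩ := s
  obtain ⟨l, c⟩ := t
  by_cases h : k = l
  · subst h
    exact blockMap_commute_of_commute (matAdj_commute _ b c)
  · exact blockMap_commute h _ _

lemma map_blockOp_blockFam_le (t : BlockIdx r) (n : Fin d → ℤ) :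
    (blockFam R r n).map (blockOp φ t).1 ≤ blockFam R r (n + (blockOp φ t).2) := by
  rcases t with t | t
  · rintro _ ⟨f, hf, rfl⟩
    exact mul_mem_blockFam (blockForm_mem _ _) hf
  · refine (map_blockEnd_blockFam_le _ n).trans (le_of_eq ?_)
    exact congrArg _ (add_zero n).symm

lemma blockOp_snd_apply {t : BlockIdx r} {k : Fin d} (h : t.block ≠ k) : (blockOp φ t).2 k = 0 := by
  rcases t with t | t
  · exact Pi.single_eq_of_ne (Ne.symm h) _
  · rfl

/-- The operators that are used at a stage: multiplications for the degrees before `j` and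
matrices for the degrees in `Q`. -/
def BlockIdx.Active (j : ℕ) (Q : Set (Fin d)) : BlockIdx r → Prop
  | Sum.inl t => (t.1 : ℕ) < j
  | Sum.inr t => t.1 ∈ Q

open Classical in
/-- The system of the operators that are used at a stage. -/
noncomputable def blockSys (j : ℕ) (Q : Set (Fin d)) (t : BlockIdx r) :
    Module.End R (BlockPoly R r) × (Fin d → ℤ) :=
  if t.Active j Q then blockOp φ t else 0

variable {φ} {j : ℕ} {Q : Set (Fin d)}

lemma blockSys_of_active {t : BlockIdx r} (h : t.Active j Q) : blockSys φ j Q t = blockOp φ t :=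
  if_pos h

/-- Within one block, multiplication by a form does not commute with the substitution by a matrix.
The hypothesis on `Q` keeps the blocks with multiplications and those with matrices disjoint. -/
lemma blockSys_commute (hQ : ∀ k ∈ Q, j ≤ (k : ℕ)) (s t : BlockIdx r) :
    Commute (blockSys φ j Q s).1 (blockSys φ j Q t).1 := by
  by_cases hs : s.Active j Q
  · by_cases ht : t.Active j Q
    · rw [blockSys_of_active hs, blockSys_of_active ht]
      rcases s with s | s <;> rcases t with t | t
      · exact blockOp_inl_commute φ s t
      · refine blockOp_commute φ fun h => ?_
        have h1 : (s.1 : ℕ) < j := hs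
        have h2 := hQ _ ht
        have h3 : s.1 = t.1 := h
        rw [h3] at h1
        omega
      · refine blockOp_commute φ fun h => ?_
        have h1 : (t.1 : ℕ) < j := ht
        have h2 := hQ _ hs
        have h3 : s.1 = t.1 := h
        rw [← h3] at h1
        omega
      · exact blockOp_inr_commute φ s t
    · rw [blockSys.eq_def φ j Q t, if_neg ht]
      exact Commute.zero_right _
  · rw [blockSys.eq_def φ j Q s, if_neg hs]
    exact Commute.zero_left _

lemma mem_stableFam_blockSys {U : (Fin d → ℤ) → Submodule R (BlockPoly R r)} :
    U ∈ StableFam (blockSys φ j Q) ↔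
      ∀ t : BlockIdx r, t.Active j Q → ∀ n, (U n).map (blockOp φ t).1 ≤ U (n + (blockOp φ t).2) := by
  constructor
  · intro h t ht n
    have := h t n
    rwa [blockSys_of_active ht] at this
  · intro h t n
    by_cases ht : t.Active j Q
    · rw [blockSys_of_active ht]
      exact h t ht n
    · rw [blockSys, if_neg ht]
      simp

lemma blockFam_mem_stableFam : blockFam R r ∈ StableFam (blockSys φ j Q) :=
  mem_stableFam_blockSys.2 fun t _ n => map_blockOp_blockFam_le φ t n

lemma blockSys_tendsto (hj : j ≤ d) (t : BlockIdx r) :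
    Tendsto (fun n => n - (blockSys φ j Q t).2) (iterFilter d j) (iterFilter d j) := by
  by_cases ht : t.Active j Q
  · rw [blockSys_of_active ht]
    rcases t with t | t
    · exact tendsto_iterFilter hj _ ht
    · simp only [blockOp, sub_zero]
      exact tendsto_id
  · rw [blockSys, if_neg ht]
    simp only [Prod.snd_zero, sub_zero]
    exact tendsto_id

/-- The families to which the analysis of killed subquotients applies. -/
structure BlockAdmissible (φ : ∀ k, Matrix (Fin (r k)) (Fin (r k)) R) (j : ℕ) (Q : Set (Fin d))
    (H : (Fin d → ℤ) → Submodule R (BlockPoly R r)) : Prop where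
  stable : H ∈ StableFam (blockSys φ j Q)
  adj : ∀ k ∈ Q, ∀ n, n k = 1 → ∀ f ∈ H n,
    blockMap k (φ k) (blockMap k (φ k).adjugate f) = (φ k).det • f
  gen : ∀ k : Fin d, (k : ℕ) < j → ∀ n, 0 < n k → ∀ U : Submodule R (BlockPoly R r),
    (∀ i, ∀ g ∈ H (n - Pi.single k 1), MvPolynomial.X ⟨k, i⟩ * g ∈ U) → H n ≤ U
  neg : ∀ k : Fin d, (k : ℕ) < j → ∀ n, n k < 0 → H n = ⊥
  fg : ∀ n, (H n).FG

lemma blockFam_admissible : BlockAdmissible φ j Q (blockFam R r) where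
  stable := blockFam_mem_stableFam
  adj _ _ _ hn _ hf := blockMap_adjugate _ hn hf
  gen _ _ _ hn _ h := (blockFam_le_iff hn).2 h
  neg _ _ _ hn := prodFam_eq_bot _ hn
  fg := blockFam_fg

/-- With block i frozen in degree 0 this is the coefficient family over which that block is treated
as polynomial variables. No active operator involves block i. -/
lemma blockFam_update_admissible (i : Fin d) (hi : j ≤ (i : ℕ)) (hiQ : i ∉ Q) :
    BlockAdmissible φ j Q fun n => blockFam R r (Function.update n i 0) where
  stable := by
    refine mem_stableFam_blockSys.2 fun t ht n => ?_
    have hb : t.block ≠ i := by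
      rintro rfl
      rcases t with t | t
      · exact absurd ht (not_lt.2 hi)
      · exact hiQ ht
    have e : Function.update (n + (blockOp φ t).2) i 0 =
        Function.update n i 0 + (blockOp φ t).2 := by
      funext k
      by_cases h : k = i
      · subst h; simp [blockOp_snd_apply φ hb]
      · simp [h]
    rw [e]
    exact map_blockOp_blockFam_le φ t _
  adj k hk n hn f hf := by
    have : k ≠ i := fun h => hiQ (h ▸ hk)
    exact blockMap_adjugate _ (by rw [Function.update_of_ne this]; exact hn) hf
  gen k hk n hn U h := by
    have hki : k ≠ i := by rintro rfl; omega
    refine (blockFam_le_iff (k := k) (by rw [Function.update_of_ne hki]; exact hn)).2 ?_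
    have e : Function.update (n - Pi.single k 1) i 0 =
        Function.update n i 0 - Pi.single k 1 := by
      funext l
      by_cases h : l = i
      · subst h; simp [hki.symm]
      · simp [h]
    rw [← e]
    exact h
  neg k hk n hn := by
    have hki : k ≠ i := by rintro rfl; omega
    exact prodFam_eq_bot _ (k := k) (by rw [Function.update_of_ne hki]; exact hn)
  fg n := blockFam_fg _

variable {H U V : (Fin d → ℤ) → Submodule R (BlockPoly R r)}

/-- Induction on the sum of the degrees: a positive degree in a block before j is lowered by
splitting off a variable, until the degree is 0 before j and 1 from j on. -/
lemma BlockAdmissible.le_of_stable (hH : BlockAdmissible φ j Q H)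
    {W : (Fin d → ℤ) → Submodule R (BlockPoly R r)}
    (hW : ∀ k : Fin d, (k : ℕ) < j → ∀ i n, ∀ g ∈ W n,
      MvPolynomial.X ⟨k, i⟩ * g ∈ W (n + Pi.single k 1))
    (h0 : H (fun k => if (k : ℕ) < j then 0 else 1) ≤ W fun k => if (k : ℕ) < j then 0 else 1)
    {n : Fin d → ℤ} (hn : ∀ k : Fin d, j ≤ (k : ℕ) → n k = 1) : H n ≤ W n := by
  generalize hs : ∑ k, (n k).toNat = s
  induction s using Nat.strong_induction_on generalizing n with
  | _ s ih =>
    by_cases h1 : ∃ k : Fin d, (k : ℕ) < j ∧ n k < 0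
    · obtain ⟨k, hk, hk'⟩ := h1
      rw [hH.neg k hk n hk']
      exact bot_le
    by_cases h2 : ∃ k : Fin d, (k : ℕ) < j ∧ 0 < n k
    · obtain ⟨k, hk, hk'⟩ := h2
      refine hH.gen k hk n hk' _ fun i g hg => ?_
      have := ih (∑ l, ((n - Pi.single k 1 : Fin d → ℤ) l).toNat) (by
        rw [← hs]
        refine Finset.sum_lt_sum (fun l _ => ?_) ⟨k, Finset.mem_univ k, ?_⟩
        · by_cases h : l = k
          · subst h; simp
          · simp [h]
        · simp; omega) (n := n - Pi.single k 1) (by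
        intro l hl
        have : l ≠ k := by rintro rfl; omega
        simpa [this] using hn l hl) rfl hg
      have := hW k hk i _ g this
      rwa [sub_add_cancel] at this
    · have e : n = fun k : Fin d => if (k : ℕ) < j then 0 else 1 := by
        funext k
        by_cases hk : (k : ℕ) < j
        · rw [if_pos hk]
          by_contra hne
          rcases lt_or_gt_of_ne hne with h | h
          · exact h1 ⟨k, hk, h⟩
          · exact h2 ⟨k, hk, h⟩
        · rw [if_neg hk]
          exact hn k (not_lt.1 hk)
      rw [e]
      exact h0

variable [IsNoetherianRing R]

/-- A killed subquotient is eventually killed by the determinants. -/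
theorem BlockAdmissible.eventually_det_smul (hj : j ≤ d) (hQ : ∀ k ∈ Q, j ≤ (k : ℕ))
    (hH : BlockAdmissible φ j Q H)
    (hV : V ∈ StableFam (blockSys φ j Q)) (hVH : V ≤ H)
    (hk : ∀ k : Fin d, (k : ℕ) < j → ∀ i n, ∀ f ∈ V n,
      blockForm k (fun l => φ k l i) * f ∈ U (n + Pi.single k 1))
    (hk' : ∀ k ∈ Q, ∀ n, ∀ f ∈ V n, blockMap k (φ k) f ∈ U n) :
    ∀ᶠ n in iterFilter d j, ∀ k : Fin d, (k : ℕ) < j ∨ k ∈ Q →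
      ∀ f ∈ V n, (φ k).det • f ∈ U n := by
  classical
  rw [mem_stableFam_blockSys] at hV
  -- Only the variables of the blocks before j are kept as operators with an effect on the degree;
  -- the remaining ones become zero.
  let y : (Σ k, Fin (r k)) → Module.End R (BlockPoly R r) × (Fin d → ℤ) :=
    fun t => blockSys φ j Q (Sum.inl ⟨t.1, Sum.inr t.2⟩)
  have hy : ∀ t : Σ k, Fin (r k), (t.1 : ℕ) < j →
      y t = (LinearMap.mulLeft R (MvPolynomial.X t), Pi.single t.1 1) := by
    rintro ⟨k, i⟩ ht
    refine (if_pos ht : blockSys φ j Q (Sum.inl ⟨k, Sum.inr i⟩) = _).trans ?_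
    change (LinearMap.mulLeft R (blockForm k (Pi.single i 1)), _) = _
    rw [blockForm_single]
  -- Restricting to degrees with entries 1 from j on makes the family lie in one generated by the
  -- finitely generated piece of degree (0, …, 0, 1, …, 1). Bounded generation then applies, and the
  -- iterated limit does not leave these degrees.
  let V' : (Fin d → ℤ) → Submodule R (BlockPoly R r) := fun n =>
    if ∀ k : Fin d, j ≤ (k : ℕ) → n k = 1 then V n else ⊥
  have hV' : V' ∈ StableFam y := by
    intro t n
    by_cases ht : (t.1 : ℕ) < j
    · by_cases hn : ∀ k : Fin d, j ≤ (k : ℕ) → n k = 1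
      · have hn' : ∀ k : Fin d, j ≤ (k : ℕ) → (n + (y t).2) k = 1 := fun k hk => by
          have : k ≠ t.1 := by rintro rfl; omega
          simpa [hy t ht, this] using hn k hk
        simp only [V']
        rw [if_pos hn, if_pos hn']
        have := hV (Sum.inl ⟨t.1, Sum.inr t.2⟩) ht n
        rwa [← (if_pos ht : y t = blockOp φ (Sum.inl ⟨t.1, Sum.inr t.2⟩))] at this
      · simp only [V']
        rw [if_neg hn, Submodule.map_bot]
        exact bot_le
    · have : y t = 0 := if_neg ht
      rw [this]
      simp
  obtain ⟨S, hS⟩ := hH.fg fun k => if (k : ℕ) < j then 0 else 1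
  have hgen : ∀ W ∈ StableFam y, (∀ p ∈ (fun v =>
      ((fun k : Fin d => if (k : ℕ) < j then (0 : ℤ) else 1), v)) '' (S : Set (BlockPoly R r)),
      p.2 ∈ W p.1) → V' ≤ W := by
    intro W hW hSW n
    by_cases hn : ∀ k : Fin d, j ≤ (k : ℕ) → n k = 1
    · simp only [V']
      rw [if_pos hn]
      refine (hVH n).trans (hH.le_of_stable (fun k hk i n g hg => ?_) ?_ hn)
      · have := hW ⟨k, i⟩ n
        rw [hy _ hk] at this
        exact this ⟨g, hg, rfl⟩
      · rw [← hS, Submodule.span_le]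
        exact fun v hv => hSW _ ⟨v, hv, rfl⟩
    · simp only [V']
      rw [if_neg hn]
      exact bot_le
  have hbound : ∀ k : Fin d, ∃ N : ℤ, ∀ n : Fin d → ℤ, N < n k →
      V' n ≤ ⨆ t : {t // Pi.evalAddMonoidHom (fun _ => ℤ) k (y t).2 ≠ 0},
        (V' (n - (y t).2)).map (y t).1 := fun k =>
    StableFam.exists_bound (fun _ _ => blockSys_commute hQ _ _) hV'
      ((Finset.finite_toSet S).image _) hgen (Pi.evalAddMonoidHom _ k)
  choose N hN using hbound
  obtain ⟨N', hN'⟩ := (Set.finite_range N).bddAbove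
  filter_upwards [iterFilter_ge hj (N' + 1), iterFilter_eq_one hj] with n hn hn1 k hkQ f hf
  rcases hkQ with hkj | hkQ
  · have hf' : f ∈ V' n := by
      simp only [V']
      rwa [if_pos hn1]
    -- For a block before j, in large degree V is generated by the variables of this block, and
    -- Cramer's rule turns det times a variable into a combination of the columns.
    have hle : V' n ≤ (U n).comap (LinearMap.lsmul R _ (φ k).det) := by
      refine (hN k n ?_).trans (iSup_le ?_)
      · have h1 : N k ≤ N' := hN' ⟨k, rfl⟩
        have h2 := hn k hkj
        omega
      rintro ⟨⟨l, i⟩, ht⟩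
      have hl : (l : ℕ) < j := by
        by_contra h
        have : y ⟨l, i⟩ = 0 := if_neg h
        rw [this] at ht
        simp at ht
      have hlk : l = k := by
        by_contra h
        rw [hy _ hl] at ht
        simp [Ne.symm h] at ht
      subst hlk
      have hyl := hy ⟨l, i⟩ hl
      change (V' (n - (y ⟨l, i⟩).2)).map (y ⟨l, i⟩).1 ≤ _
      rw [hyl]
      rintro _ ⟨g, hg, rfl⟩
      have hg' : g ∈ V (n - Pi.single l 1) := by
        simp only [V', SetLike.mem_coe] at hg
        split_ifs at hg with h
        · exact hg
        · rw [(Submodule.mem_bot R).1 hg]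
          exact zero_mem _
      rw [Submodule.mem_comap, LinearMap.lsmul_apply, LinearMap.mulLeft_apply, ← smul_mul_assoc,
        det_smul_X, Finset.sum_mul]
      refine Submodule.sum_mem _ fun a _ => ?_
      rw [smul_mul_assoc]
      have := hk l hl a _ g hg'
      rw [sub_add_cancel] at this
      exact Submodule.smul_mem _ _ this
    exact hle hf'
  -- For a block acting through its matrix the degree is 1, where det f = φ(adj f). Stability puts
  -- adj f into V, and φ maps V into U.
  · rw [← hH.adj k hkQ n (hn1 k (hQ k hkQ)) f (hVH n hf)]
    refine hk' k hkQ n _ ?_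
    have := hV (Sum.inr (k, false)) hkQ n ⟨f, hf, rfl⟩
    simpa [blockOp, matAdj] using this

end Stages

/-! ### Replacing multiplications by matrices -/

section Replacement

variable {R : Type*} [CommRing R] {d : ℕ} {r : Fin d → ℕ}
  (φ : ∀ k, Matrix (Fin (r k)) (Fin (r k)) R)

/-- The operators for the degree `e_k` at stage `j`: the columns of the matrix if `k < j`, and the
matrix otherwise. -/
def blockList (j : ℕ) (k : Fin d) : List (BlockIdx r) :=
  if (k : ℕ) < j then ((List.finRange (r k)).map Sum.inl).map fun u => Sum.inl ⟨k, u⟩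
  else [Sum.inr (k, true)]

lemma active_of_mem_blockList {j : ℕ} {Q : Set (Fin d)} {k : Fin d} (hQ : j ≤ (k : ℕ) → k ∈ Q)
    {t : BlockIdx r} (ht : t ∈ blockList j k) : t.Active j Q := by
  rw [blockList] at ht
  split_ifs at ht with h
  · obtain ⟨u, _, rfl⟩ := List.mem_map.1 ht
    exact h
  · rw [List.mem_singleton.1 ht]
    exact hQ (not_lt.1 h)

/-- The operators for the degrees in a list at stage `j`. -/
def stageList (j : ℕ) (L : List (Fin d)) : List (BlockIdx r) := L.flatMap (blockList j)

lemma map_blockSys_stageList {j : ℕ} {Q : Set (Fin d)} {L : List (Fin d)}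
    (hQ : ∀ k ∈ L, j ≤ (k : ℕ) → k ∈ Q) :
    (stageList j L).map (blockSys φ j Q) = (stageList j L).map (blockOp φ) := by
  refine List.map_congr_left fun t ht => ?_
  obtain ⟨k, hk, ht⟩ := List.mem_flatMap.1 ht
  exact blockSys_of_active (active_of_mem_blockList (hQ k hk) ht)

/-- The ideal generated by some of the determinants. -/
def detIdeal (P : Set (Fin d)) : Ideal R := Ideal.span ((fun k => (φ k).det) '' P)

variable {φ}

lemma polEval_mapRange {j : Fin d} {θ : Module.End R (BlockPoly R r)}
    (hθ : ∀ i f, θ (MvPolynomial.X ⟨j, i⟩ * f) = MvPolynomial.X ⟨j, i⟩ * θ f)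
    (f : PolMod (r j) (BlockPoly R r)) :
    polEval j (Finsupp.mapRange.linearMap θ f) = θ (polEval j f) := by
  induction f using Finsupp.induction_linear with
  | zero => simp
  | add f g hf hg => rw [map_add, map_add, map_add, hf, hg, map_add]
  | single β v =>
    rw [Finsupp.mapRange.linearMap_apply, Finsupp.mapRange_single, polEval_single, polEval_single]
    suffices ∀ f, θ ((∏ i, MvPolynomial.X ⟨j, i⟩ ^ β i) * f) =
      (∏ i, MvPolynomial.X ⟨j, i⟩ ^ β i) * θ f from (this v).symm
    refine Finset.prod_induction _ (fun a => ∀ f, θ (a * f) = a * θ f) ?_ ?_ ?_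
    · intro a b ha hb f
      rw [mul_assoc, ha, hb, mul_assoc]
    · simp
    · intro i _
      induction β i with
      | zero => simp
      | succ s ih =>
        intro f
        rw [pow_succ, mul_assoc, ih, hθ, mul_assoc]

lemma tupleEval_compLeft {j : Fin d} {θ : Module.End R (BlockPoly R r)}
    (hθ : ∀ i f, θ (MvPolynomial.X ⟨j, i⟩ * f) = MvPolynomial.X ⟨j, i⟩ * θ f)
    (v : Fin (r j) → BlockPoly R r) :
    tupleEval j (θ.compLeft (Fin (r j)) v) = θ (tupleEval j v) := by
  rw [tupleEval_apply, tupleEval_apply, map_sum]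
  exact Finset.sum_congr rfl fun i _ => (hθ i _).symm

/-- The family of the elements of degree `0` in the variables of degree `e_j`. -/
noncomputable def restFam (R : Type*) [CommRing R] {d : ℕ} (r : Fin d → ℕ) (j : Fin d) :
    (Fin d → ℤ) → Submodule R (BlockPoly R r) :=
  fun n => blockFam R r (Function.update n j 0)

/-- The system of the operators at stage `j` which are trivial in the degree `e_j`. -/
noncomputable abbrev restSys (φ : ∀ k, Matrix (Fin (r k)) (Fin (r k)) R) (j : Fin d) :
    BlockIdx r → Module.End R (BlockPoly R r) × (Fin d → ℤ) :=
  blockSys φ j {k | (j : ℕ) < k}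

lemma restSys_eq (j : Fin d) (t : BlockIdx r) :
    restSys φ j t = 0 ∨ t.block ≠ j ∧ restSys φ j t = blockOp φ t := by
  by_cases ht : t.Active j {k : Fin d | (j : ℕ) < k}
  · refine Or.inr ⟨?_, if_pos ht⟩
    rintro h
    rcases t with t | t
    · have h1 : (t.1 : ℕ) < j := ht
      have h2 : t.1 = j := h
      rw [h2] at h1
      omega
    · have h1 : (j : ℕ) < t.1 := ht
      have h2 : t.1 = j := h
      rw [h2] at h1
      omega
  · exact Or.inl (if_neg ht)

lemma restSys_commute (j : Fin d) (s t : BlockIdx r) :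
    Commute (restSys φ j s).1 (restSys φ j t).1 :=
  blockSys_commute (fun k (hk : (j : ℕ) < k) => hk.le) s t

lemma restSys_X_mul (j : Fin d) (t : BlockIdx r) (i : Fin (r j)) (f : BlockPoly R r) :
    (restSys φ j t).1 (MvPolynomial.X ⟨j, i⟩ * f) =
      MvPolynomial.X ⟨j, i⟩ * (restSys φ j t).1 f := by
  rcases restSys_eq (φ := φ) j t with h | ⟨hb, h⟩ <;> rw [h]
  · simp
  · rcases t with t | t
    · exact mul_left_comm _ _ _
    · rw [← blockForm_single]
      exact blockMap_mul_blockForm hb.symm _ _ _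

lemma restSys_snd_apply (j : Fin d) (t : BlockIdx r) : (restSys φ j t).2 j = 0 := by
  rcases restSys_eq (φ := φ) j t with h | ⟨hb, h⟩ <;> rw [h]
  · rfl
  · exact blockOp_snd_apply φ hb

lemma restFam_mem_stableFam (j : Fin d) : restFam R r j ∈ StableFam (restSys φ j) :=
  (blockFam_update_admissible (φ := φ) j le_rfl (by simp)).stable

lemma elim_commute {j : Fin d} {σ : Type*} (g : σ → BlockIdx r) (hg : ∀ u, (g u).block = j)
    (hc : ∀ u v, Commute (blockOp φ (g u)).1 (blockOp φ (g v)).1) (s t : BlockIdx r ⊕ σ) :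
    Commute (Sum.elim (restSys φ j) (fun u => blockOp φ (g u)) s).1
      (Sum.elim (restSys φ j) (fun u => blockOp φ (g u)) t).1 := by
  have key : ∀ t u, Commute (restSys φ j t).1 (blockOp φ (g u)).1 := by
    intro t u
    rcases restSys_eq (φ := φ) j t with h | ⟨hb, h⟩ <;> rw [h]
    · exact Commute.zero_left _
    · exact blockOp_commute φ (by rwa [hg])
  rcases s with s | s <;> rcases t with t | t
  · exact restSys_commute j s t
  · exact key s t
  · exact (key t s).symm
  · exact hc s t

lemma elim_mem_stableFam {j : Fin d} {σ : Type*} (g : σ → BlockIdx r)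
    {U : (Fin d → ℤ) → Submodule R (BlockPoly R r)} (hU : U = ⊥ ∨ U = blockFam R r) :
    U ∈ StableFam (Sum.elim (restSys φ j) fun u => blockOp φ (g u)) := by
  rcases hU with rfl | rfl
  · exact bot_mem_stableFam _
  · rintro (t | t) n
    · exact blockFam_mem_stableFam (φ := φ) t n
    · exact map_blockOp_blockFam_le φ (g t) n

/-- The symbol on the multigraded polynomial ring as a symbol on polynomials. -/
lemma famSymb_polLift (j : Fin d) (l : List (BlockIdx r)) (l' : List (Fin (r j) ⊕ Fin (r j)))
    (n : Fin d → ℤ) (m : ℤ) :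
    famSymb ((l.map Sum.inl ++ l'.map Sum.inr).map (polLift (φ j) (restSys φ j)))
      (polFam (r j) ⊥) (polFam (r j) (restFam R r j)) (n, m) =
    famSymb (l.map (restSys φ j) ++ l'.map fun u => blockOp φ (Sum.inl ⟨j, u⟩)) ⊥
      (blockFam R r) (Function.update n j m) := by
  rw [show l.map (restSys φ j) ++ l'.map (fun u => blockOp φ (Sum.inl ⟨j, u⟩)) =
    (l.map Sum.inl ++ l'.map Sum.inr).map
      (Sum.elim (restSys φ j) fun u => blockOp φ (Sum.inl ⟨j, u⟩)) by simp [Function.comp_def]]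
  have hz : ∀ n : Fin d → ℤ, Function.update n j 0 j = 0 := fun n => Function.update_self ..
  -- Evaluating the polynomial variables at those of block j sends degree (n, m) to n with j-th
  -- entry m. The original j-th entry of n plays no role, because the coefficients are taken in
  -- degree 0 of that block.
  refine famSymb_eq_of_map (polEval j) (fun p => Function.update p.1 j p.2)
    (polLift_commute (restSys_commute j))
    (elim_commute (fun u => Sum.inl ⟨j, u⟩) (fun _ => rfl) fun u v => blockOp_inl_commute φ _ _)
    ?_ ?_ (polFam_mem_stableFam (bot_mem_stableFam _))
    (polFam_mem_stableFam (restFam_mem_stableFam j))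
    (elim_mem_stableFam (fun u => Sum.inl ⟨j, u⟩) (Or.inl rfl))
    (elim_mem_stableFam (fun u => Sum.inl ⟨j, u⟩) (Or.inr rfl)) ?_ ?_ _ (n, m)
  · rintro (t | u) ⟨n, m⟩ <;> funext k
    · change Function.update (n + (restSys φ j t).2) j (m + 0) k =
        (Function.update n j m + (restSys φ j t).2) k
      by_cases h : k = j
      · subst h; simp [restSys_snd_apply]
      · simp [h]
    · change Function.update (n + 0) j (m + (polSys _ (φ j) u).2) k =
        (Function.update n j m + Pi.single j 1 : Fin d → ℤ) k
      by_cases h : k = j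
      · subst h; simp [polSys_snd]
      · simp [h]
  · rintro (t | u) n f -
    · exact polEval_mapRange (restSys_X_mul j t) f
    · change polEval j ((polSys _ (φ j) u).1 f) = _
      rw [polSys_eq, polEval_linMul]
      rfl
  · rintro ⟨n, m⟩
    have := map_polEval_polSub (R := R) (r := r) (hz n) m
    rw [Function.update_idem] at this
    exact this.symm.trans (bot_sup_eq _).symm
  · rintro ⟨n, m⟩
    refine (polSub_bot m).trans (eq_bot_iff.2 ?_).symm
    rintro f ⟨hf, h⟩
    exact polEval_eq_zero (hz n) hf.1 h

/-- The symbol on the multigraded polynomial ring as a symbol on tuples. -/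
lemma famSymb_powLift (j : Fin d) (l : List (BlockIdx r)) (l' : List Bool) (n : Fin d → ℤ) :
    famSymb ((l.map Sum.inl ++ l'.map Sum.inr).map (powLift (φ j) (restSys φ j)))
      (powFam (r j) ⊥) (powFam (r j) (restFam R r j)) n =
    famSymb (l.map (restSys φ j) ++ l'.map fun b => blockOp φ (Sum.inr (j, b))) ⊥
      (blockFam R r) (Function.update n j 1) := by
  rw [show l.map (restSys φ j) ++ l'.map (fun b => blockOp φ (Sum.inr (j, b))) =
    (l.map Sum.inl ++ l'.map Sum.inr).map
      (Sum.elim (restSys φ j) fun b => blockOp φ (Sum.inr (j, b))) by simp [Function.comp_def]]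
  have hz : ∀ n : Fin d → ℤ, Function.update n j 0 j = 0 := fun n => Function.update_self ..
  refine famSymb_eq_of_map (tupleEval j) (fun n => Function.update n j 1)
    (powLift_commute (restSys_commute j))
    (elim_commute (fun b => Sum.inr (j, b)) (fun _ => rfl) fun u v => blockOp_inr_commute φ _ _)
    ?_ ?_ (powFam_mem_stableFam (bot_mem_stableFam _))
    (powFam_mem_stableFam (restFam_mem_stableFam j))
    (elim_mem_stableFam (fun b => Sum.inr (j, b)) (Or.inl rfl))
    (elim_mem_stableFam (fun b => Sum.inr (j, b)) (Or.inr rfl)) ?_ ?_ _ n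
  · rintro (t | u) n <;> funext k
    · change Function.update (n + (restSys φ j t).2) j 1 k =
        (Function.update n j 1 + (restSys φ j t).2) k
      by_cases h : k = j
      · subst h; simp [restSys_snd_apply]
      · simp [h]
    · change Function.update (n + 0) j 1 k = (Function.update n j 1 + 0) k
      simp
  · rintro (t | u) n f hf
    · exact tupleEval_compLeft (restSys_X_mul j t) f
    · change tupleEval j ((matSys _ (φ j) u).1 f) = _
      rw [matSys_eq]
      exact tupleEval_matEnd (hz n) _ hf
  · intro n
    have := map_tupleEval_powSub (R := R) (r := r) (hz n)
    rw [Function.update_idem] at this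
    exact this.symm.trans (bot_sup_eq _).symm
  · intro n
    have hbot : powSub (r j) (⊥ : Submodule R (BlockPoly R r)) = ⊥ := by
      rw [eq_bot_iff]
      exact fun v hv => funext fun i => mem_powSub.1 hv i
    refine hbot.trans (eq_bot_iff.2 ?_).symm
    rintro f ⟨hf, h⟩
    exact tupleEval_eq_zero (hz n) hf h

lemma detIdeal_smul_le {P : Set (Fin d)} {U V : Submodule R (BlockPoly R r)}
    (h : ∀ k ∈ P, ∀ f ∈ V, (φ k).det • f ∈ U) : detIdeal φ P • V ≤ U := by
  rw [detIdeal, Submodule.span_smul_eq, Submodule.set_smul_le_iff]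
  rintro _ f ⟨k, hk, rfl⟩ hf
  exact h k hk f hf

variable [IsNoetherianRing R]

/-- Being killed by the list of a stage is translated into the two hypotheses on columns and on
matrices, and the determinants are collected into one ideal. Finite generation is inherited from H
over the Noetherian ring. -/
lemma BlockAdmissible.eventually_fg_and_smul_le {j : ℕ} {Q : Set (Fin d)} (hj : j ≤ d)
    (hQ : ∀ k ∈ Q, j ≤ (k : ℕ)) {H : (Fin d → ℤ) → Submodule R (BlockPoly R r)}
    (hH : BlockAdmissible φ j Q H) {L : List (Fin d)} (hL : ∀ k : Fin d, (k : ℕ) < j ∨ k ∈ Q → k ∈ L)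
    {U V : (Fin d → ℤ) → Submodule R (BlockPoly R r)} (hV : V ∈ StableFam (blockSys φ j Q))
    (hVH : V ≤ H)
    (hk : ∀ t ∈ stageList j L, ∀ n, (V n).map (blockSys φ j Q t).1 ≤
      U (n + (blockSys φ j Q t).2)) :
    ∀ᶠ n in iterFilter d j, (V n).FG ∧ detIdeal φ {k | (k : ℕ) < j ∨ k ∈ Q} • V n ≤ U n := by
  have := hH.eventually_det_smul (U := U) hj hQ hV hVH (fun k hkj i n f hf => ?_)
    fun k hkQ n f hf => ?_
  · filter_upwards [this] with n hn
    refine ⟨?_, detIdeal_smul_le hn⟩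
    have := isNoetherian_of_fg_of_noetherian _ (hH.fg n)
    exact isNoetherian_submodule.1 this _ (hVH n)
  · have h := hk (Sum.inl ⟨k, Sum.inl i⟩) (List.mem_flatMap.2 ⟨k, hL k (Or.inl hkj), by
      rw [blockList, if_pos hkj]; simp⟩) n
    have ha : BlockIdx.Active (r := r) j Q (Sum.inl ⟨k, Sum.inl i⟩) := hkj
    rw [blockSys_of_active ha] at h
    exact h ⟨f, hf, rfl⟩
  · have h := hk (Sum.inr (k, true)) (List.mem_flatMap.2 ⟨k, hL k (Or.inr hkQ), by
      rw [blockList, if_neg (not_lt.2 (hQ k hkQ))]; simp⟩) n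
    have ha : BlockIdx.Active (r := r) j Q (Sum.inr (k, true)) := hkQ
    rw [blockSys_of_active ha] at h
    have := h ⟨f, hf, rfl⟩
    simpa [blockOp, matAdj] using this

/-- At every stage each block acts, either by its columns or by its matrix. A killed subquotient is
thus eventually killed by all determinants, which generate an ideal of finite colength. -/
lemma stageList_finiteKilled (hJ : Module.length R (R ⧸ detIdeal φ Set.univ) ≠ ⊤) {j : ℕ}
    (hj : j ≤ d) : FiniteKilled (iterFilter d j) (blockSys φ j {k | j ≤ (k : ℕ)})
      (stageList j (List.finRange d)) ⊥ (blockFam R r) := by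
  intro U' _ V' hV' _ _ h3 hk
  have := blockFam_admissible.eventually_fg_and_smul_le (Q := {k : Fin d | j ≤ (k : ℕ)}) hj
    (fun k hk => hk)
    (fun k _ => List.mem_finRange k) hV' h3 hk
  have hP : {k : Fin d | (k : ℕ) < j ∨ k ∈ {k : Fin d | j ≤ (k : ℕ)}} = Set.univ := by
    ext k
    simpa using lt_or_ge _ _
  rw [hP] at this
  filter_upwards [this] with n hn
  exact relLength_ne_top_of_smul_le hn.1 hJ hn.2

/-- The operators of block i are moved to the end of the list. In this position they act on the
subquotients produced by all other operators, where `famSymb_polFam_eq` can replace them. -/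
lemma famSymb_stageList_perm (hJ : Module.length R (R ⧸ detIdeal φ Set.univ) ≠ ⊤) {j : ℕ}
    (hj : j ≤ d) (i : Fin d) : ∀ᶠ n in iterFilter d j,
      famSymb ((stageList j (List.finRange d)).map (blockOp φ)) ⊥ (blockFam R r) n =
      famSymb ((stageList j ((List.finRange d).erase i)).map (blockOp φ) ++
        (blockList j i).map (blockOp φ)) ⊥ (blockFam R r) n := by
  have hp : (stageList (r := r) j (List.finRange d)).Perm
      (stageList j ((List.finRange d).erase i) ++ blockList j i) := by
    refine ((List.perm_cons_erase (List.mem_finRange i)).flatMap_right _).trans ?_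
    rw [List.flatMap_cons]
    exact List.perm_append_comm
  have := famSymb_perm (blockSys_commute (φ := φ) (Q := {k : Fin d | j ≤ (k : ℕ)}) fun k hk => hk)
    (blockSys_tendsto hj)
    (bot_mem_stableFam _) blockFam_mem_stableFam bot_le hp (stageList_finiteKilled hJ hj)
  have hQ : ∀ k : Fin d, j ≤ (k : ℕ) → k ∈ {k : Fin d | j ≤ (k : ℕ)} := fun k h => h
  rw [List.map_append, map_blockSys_stageList φ fun k _ => hQ k,
    map_blockSys_stageList φ fun k _ => hQ k,
    List.map_congr_left fun t ht => blockSys_of_active (φ := φ) (active_of_mem_blockList (hQ i) ht)]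
    at this
  exact this

variable [IsLocalRing R]

/-- One block changes its role. Its columns are moved to the end, the degree m of this block is read
as the degree of a polynomial, and for large m the columns are exchanged for the matrix in degree 1.
A second permutation restores the order. -/
lemma famSymb_stage_succ (hJ : Module.length R (R ⧸ detIdeal φ Set.univ) ≠ ⊤) {j : ℕ}
    (hj : j < d) : ∀ᶠ n in iterFilter d j, ∀ᶠ m in atTop,
      famSymb ((stageList (j + 1) (List.finRange d)).map (blockOp φ)) ⊥ (blockFam R r)
        (Function.update n ⟨j, hj⟩ m) =
      famSymb ((stageList j (List.finRange d)).map (blockOp φ)) ⊥ (blockFam R r) n := by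
  set i : Fin d := ⟨j, hj⟩
  have hA := (eventually_iterFilter_succ hj).1 (famSymb_stageList_perm (φ := φ) hJ hj i)
  have hB := famSymb_stageList_perm (φ := φ) hJ hj.le i
  have hmem : ∀ k : Fin d, k ∈ (List.finRange d).erase i ↔ k ≠ i := fun k => by
    rw [(List.nodup_finRange d).mem_erase_iff]
    simp
  have hne : ∀ k : Fin d, k ≠ i → (k : ℕ) ≠ j := fun k hk h => hk (Fin.ext h)
  have hst : stageList (r := r) (j + 1) ((List.finRange d).erase i) =
      stageList j ((List.finRange d).erase i) := by
    refine List.flatMap_congr fun k hk => ?_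
    have := hne k ((hmem k).1 hk)
    rw [blockList, blockList]
    congr 1
    exact propext (by omega)
  have hsys : (stageList j ((List.finRange d).erase i)).map (blockOp φ) =
      (stageList j ((List.finRange d).erase i)).map (restSys φ i) := by
    refine (map_blockSys_stageList φ fun k hk hjk => ?_).symm
    have := hne k ((hmem k).1 hk)
    exact lt_of_le_of_ne hjk this.symm
  -- The ideal K for the coefficients is generated by the determinants of the other blocks. Together
  -- with the determinant of block i it is the full determinantal ideal.
  have hP : detIdeal φ {k : Fin d | (k : ℕ) < j ∨ k ∈ {k : Fin d | (i : ℕ) < k}} ⊔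
      Ideal.span {(φ i).det} = detIdeal φ Set.univ := by
    rw [detIdeal, detIdeal, ← Ideal.span_union, ← Set.image_singleton (f := fun k => (φ k).det)
      (a := i), ← Set.image_union]
    congr 2
    ext k
    simp only [Set.mem_union, Set.mem_ofPred_eq, Set.mem_singleton_iff, Set.mem_univ, iff_true]
    by_cases h : k = i
    · exact Or.inr h
    · have := hne k h
      exact Or.inl (by change _ ∨ j < _; omega)
  have hE := famSymb_polFam_eq (F := iterFilter d j) (φ := φ i) (U := ⊥) (V := restFam R r i)
    (K := detIdeal φ {k : Fin d | (k : ℕ) < j ∨ k ∈ {k : Fin d | (i : ℕ) < k}})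
    (restSys_commute (φ := φ) i) (blockSys_tendsto hj.le) (by rw [hP]; exact hJ)
    (stageList j ((List.finRange d).erase i)) (bot_mem_stableFam _) (restFam_mem_stableFam i)
    bot_le (fun U' _ V' hV' _ _ h3 hk =>
      (blockFam_update_admissible (φ := φ) (Q := {k : Fin d | (i : ℕ) < k}) i le_rfl
        (by simp)).eventually_fg_and_smul_le (j := j) hj.le
        (fun k (hk : j < (k : ℕ)) => hk.le) (fun k hk => (hmem k).2 (by
          rintro rfl
          rcases hk with hk | hk
          · exact lt_irrefl _ hk
          · exact lt_irrefl _ (show j < j from hk))) hV' h3 hk)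
  filter_upwards [hA, hB, hE, iterFilter_eq_one hj.le] with n hAn hBn hEn hn1
  filter_upwards [hAn, hEn] with m hAm hEm
  rw [hAm, hBn, hst, hsys]
  have e1 := famSymb_polLift (φ := φ) i (stageList j ((List.finRange d).erase i))
    ((List.finRange (r i)).map Sum.inl) n m
  have e2 := famSymb_powLift (φ := φ) i (stageList j ((List.finRange d).erase i)) [true] n
  have hn : Function.update n i 1 = n := Function.update_eq_self_iff.2 (hn1 i le_rfl).symm
  rw [hn] at e2
  rw [blockList, if_pos (Nat.lt_succ_self j), blockList, if_neg (lt_irrefl j), List.map_map]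
  exact e1.symm.trans (hEm.trans e2)

/-- The symbol of all columns in large degrees is the symbol of the matrices in degree
`(1, …, 1)`. -/
theorem famSymb_columns_eq (hJ : Module.length R (R ⧸ detIdeal φ Set.univ) ≠ ⊤) :
    ∀ᶠ n in iterFilter d d,
      famSymb ((stageList d (List.finRange d)).map (blockOp φ)) ⊥ (blockFam R r) n =
      famSymb ((stageList 0 (List.finRange d)).map (blockOp φ)) ⊥ (blockFam R r) 1 := by
  suffices ∀ j ≤ d, ∀ᶠ n in iterFilter d j,
      famSymb ((stageList j (List.finRange d)).map (blockOp φ)) ⊥ (blockFam R r) n =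
      famSymb ((stageList 0 (List.finRange d)).map (blockOp φ)) ⊥ (blockFam R r) 1 from
    this d le_rfl
  intro j hj
  induction j with
  | zero => simp [iterFilter]
  | succ j ih =>
    rw [eventually_iterFilter_succ hj]
    filter_upwards [ih (by omega), famSymb_stage_succ (φ := φ) hJ hj] with n h1 h2
    filter_upwards [h2] with m hm
    rw [hm, h1]

end Replacement

/-! ### Lengths of homology modules of cones -/

section Cone

variable {R M : Type*} [CommRing R] [AddCommGroup M] [Module R M]

/-- The differential of the cone of an endomorphism of a differential module. -/
def coneEnd (D X : Module.End R M) : Module.End R (M × M) :=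
  LinearMap.prod (D.coprod X) (-(D ∘ₗ LinearMap.snd R M M))

lemma coneEnd_apply (D X : Module.End R M) (a b : M) :
    coneEnd D X (a, b) = (D a + X b, -D b) := by
  simp [coneEnd]

variable {D X : Module.End R M} {U₀ U₁ U₂ V₁ V₂ V₃ : Submodule R M}

/-- The homology of the cone in terms of the first components of the cycles. -/
lemma relLength_cone_eq_add (hD : ∀ a, D (D a) = 0) (hDX : ∀ a, D (X a) = X (D a))
    (hU₂ : U₂ ≤ V₂) (hU₁ : U₁ ≤ V₁) (hDU₂ : ∀ a ∈ U₂, D a ∈ U₁) (hDU₁ : ∀ a ∈ U₁, D a ∈ U₀)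
    (hDV₃ : ∀ a ∈ V₃, D a ∈ V₂) (hDV₂ : ∀ a ∈ V₂, D a ∈ V₁)
    (hXU₁ : ∀ a ∈ U₁, X a ∈ U₁) (hXV₂ : ∀ a ∈ V₂, X a ∈ V₂) :
    relLength (U₂.prod U₁ ⊔ (V₃.prod V₂).map (coneEnd D X))
      (V₂.prod V₁ ⊓ (U₁.prod U₀).comap (coneEnd D X)) =
    relLength ((U₂ ⊔ V₂.map X) ⊔ V₃.map D) (((V₂.prod V₁ ⊓ (U₁.prod U₀).comap (coneEnd D X))).map
      (LinearMap.fst R M M)) +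
    relLength (U₁ ⊔ (V₂ ⊓ (U₂ ⊔ V₃.map D).comap X).map D) ((V₁ ⊓ U₁.comap X) ⊓ U₀.comap D) := by
  set B := U₂.prod U₁ ⊔ (V₃.prod V₂).map (coneEnd D X)
  set Z := V₂.prod V₁ ⊓ (U₁.prod U₀).comap (coneEnd D X)
  set C := (U₂ ⊔ V₂.map X) ⊔ V₃.map D
  have hZ : ∀ a b, (a, b) ∈ Z ↔ (a ∈ V₂ ∧ b ∈ V₁) ∧ D a + X b ∈ U₁ ∧ D b ∈ U₀ := by
    intro a b
    simp only [Z, Submodule.mem_inf, Submodule.mem_comap, coneEnd_apply, Submodule.mem_prod,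
      neg_mem_iff]
  have hB : ∀ a b, (a, b) ∈ B ↔ ∃ a' ∈ V₃, ∃ b' ∈ V₂, a - (D a' + X b') ∈ U₂ ∧ b + D b' ∈ U₁ := by
    intro a b
    constructor
    · intro h
      obtain ⟨⟨u, u'⟩, ⟨hu, hu'⟩, _, ⟨⟨a', b'⟩, ⟨ha', hb'⟩, rfl⟩, h⟩ := Submodule.mem_sup.1 h
      rw [coneEnd_apply, Prod.mk_add_mk, Prod.mk.injEq] at h
      refine ⟨a', ha', b', hb', ?_, ?_⟩
      · rw [← h.1, add_sub_cancel_right]; exact hu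
      · rw [← h.2, neg_add_cancel_right]; exact hu'
    · rintro ⟨a', ha', b', hb', h1, h2⟩
      refine Submodule.mem_sup.2 ⟨(a - (D a' + X b'), b + D b'), ⟨h1, h2⟩, _,
        ⟨(a', b'), ⟨ha', hb'⟩, rfl⟩, ?_⟩
      rw [coneEnd_apply, Prod.mk_add_mk, sub_add_cancel, add_neg_cancel_right]
  have hC : ∀ a, a ∈ C ↔ ∃ a' ∈ V₃, ∃ b' ∈ V₂, a - (D a' + X b') ∈ U₂ := by
    intro a
    constructor
    · intro h
      obtain ⟨_, hw, _, ⟨a', ha', rfl⟩, rfl⟩ := Submodule.mem_sup.1 h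
      obtain ⟨u, hu, _, ⟨b', hb', rfl⟩, rfl⟩ := Submodule.mem_sup.1 hw
      refine ⟨a', ha', b', hb', ?_⟩
      have e : u + X b' + D a' - (D a' + X b') = u := by abel
      rw [e]
      exact hu
    · rintro ⟨a', ha', b', hb', h⟩
      have : a = (a - (D a' + X b') + X b') + D a' := by abel
      rw [this]
      exact Submodule.add_mem_sup (Submodule.add_mem_sup h ⟨b', hb', rfl⟩) ⟨a', ha', rfl⟩
  have hBZ : B ≤ Z := by
    refine sup_le ?_ ?_
    · rintro ⟨a, b⟩ ⟨ha, hb⟩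
      exact (hZ a b).2 ⟨⟨hU₂ ha, hU₁ hb⟩, add_mem (hDU₂ a ha) (hXU₁ b hb), hDU₁ b hb⟩
    · rintro _ ⟨⟨a, b⟩, ⟨ha, hb⟩, rfl⟩
      rw [coneEnd_apply, hZ]
      refine ⟨⟨add_mem (hDV₃ a ha) (hXV₂ b hb), neg_mem (hDV₂ b hb)⟩, ?_, ?_⟩
      · simp [hD, hDX]
      · simp [hD]
  -- The cycles of the cone are filtered by their first component modulo the boundaries of N / XN.
  -- The upper part is the image in the homology of N / XN, the lower part comes from cycles of (0
  -- :_N X) in the second component.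
  rw [relLength_add (W := Z ⊓ C.comap (LinearMap.fst R M M)) ?_ inf_le_left, add_comm]
  · congr 1
    · refine relLength_eq_of_map (LinearMap.fst R M M) ?_ rfl
      refine (sup_eq_right.2 fun a ha => ?_).symm
      obtain ⟨a', ha', b', hb', h⟩ := (hC a).1 ha
      exact ⟨(a, -D b'), hBZ ((hB _ _).2 ⟨a', ha', b', hb', h, by simp⟩), rfl⟩
    · refine (relLength_eq_of_map (LinearMap.inr R M M) ?_ ?_).symm
      · refine le_antisymm ?_ (sup_le (le_inf hBZ ?_) ?_)
        · rintro ⟨a, b⟩ ⟨hz, hc⟩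
          obtain ⟨a', ha', b', hb', h⟩ := (hC a).1 hc
          refine Submodule.mem_sup.2 ⟨(a, -D b'), (hB _ _).2 ⟨a', ha', b', hb', h, by simp⟩,
            (0, b + D b'), ⟨b + D b', ?_, rfl⟩, by simp⟩
          have h1 := (hB a (-D b')).2 ⟨a', ha', b', hb', h, by simp⟩
          have h2 := Submodule.sub_mem _ hz (hBZ h1)
          rw [Prod.mk_sub_mk, sub_self, sub_neg_eq_add, hZ, map_zero, zero_add] at h2
          exact ⟨⟨h2.1.2, h2.2.1⟩, h2.2.2⟩
        · rintro ⟨a, b⟩ hb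
          obtain ⟨a', ha', b', hb', h, _⟩ := (hB a b).1 hb
          exact (hC a).2 ⟨a', ha', b', hb', h⟩
        · rintro _ ⟨c, ⟨⟨h1, h2⟩, h3⟩, rfl⟩
          refine ⟨(hZ _ _).2 ⟨⟨zero_mem _, h1⟩, ?_, h3⟩, zero_mem C⟩
          change D 0 + X c ∈ U₁
          rw [map_zero, zero_add]
          exact h2
      · ext c
        rw [Submodule.mem_inf, Submodule.mem_comap, LinearMap.inr_apply, hB]
        constructor
        · intro hc
          obtain ⟨u, hu, _, ⟨b', ⟨hb', hx⟩, rfl⟩, rfl⟩ := Submodule.mem_sup.1 hc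
          obtain ⟨v, hv, _, ⟨a', ha', rfl⟩, h⟩ := Submodule.mem_sup.1 hx
          refine ⟨⟨⟨add_mem (hU₁ hu) (hDV₂ b' hb'), ?_⟩, ?_⟩, a', ha', -b', neg_mem hb', ?_, ?_⟩
          · rw [SetLike.mem_coe, Submodule.mem_comap, map_add, ← hDX, ← h, map_add, hD, add_zero]
            exact add_mem (hXU₁ u hu) (hDU₂ v hv)
          · rw [SetLike.mem_coe, Submodule.mem_comap, map_add, hD, add_zero]
            exact hDU₁ u hu
          · rw [map_neg, ← h]
            simpa using hv
          · simpa using hu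
        · rintro ⟨_, a', ha', b', hb', h1, h2⟩
          refine Submodule.mem_sup.2 ⟨c + D b', h2, D (-b'), ⟨-b', ⟨neg_mem hb', ?_⟩, rfl⟩, by simp⟩
          refine Submodule.mem_sup.2 ⟨_, h1, D a', ⟨a', ha', rfl⟩, ?_⟩
          rw [map_neg]
          abel
  · refine le_inf hBZ ?_
    rintro ⟨a, b⟩ hb
    obtain ⟨a', ha', b', hb', h, _⟩ := (hB a b).1 hb
    exact (hC a).2 ⟨a', ha', b', hb', h⟩

/-- This is exactness at the homology of N / XN, with N = V / U. A cycle a of N / XN has Da = -Xb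
for some b, and the connecting map sends it to Db in the homology of (0 :_N X); a lifts to a cycle
of the cone exactly when this class vanishes. -/
lemma relLength_cone_fst :
    relLength (((V₂.prod V₁ ⊓ (U₁.prod U₀).comap (coneEnd D X))).map (LinearMap.fst R M M))
      (V₂ ⊓ (U₁ ⊔ V₁.map X).comap D) =
    relLength (U₀ ⊔ (V₁ ⊓ U₁.comap X).map D) (U₀ ⊔ (V₁ ⊓ (U₁ ⊔ V₂.map D).comap X).map D) := by
  set P := ((V₂.prod V₁ ⊓ (U₁.prod U₀).comap (coneEnd D X))).map (LinearMap.fst R M M)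
  have hP : ∀ a, a ∈ P ↔ a ∈ V₂ ∧ ∃ b ∈ V₁, D a + X b ∈ U₁ ∧ D b ∈ U₀ := by
    intro a
    constructor
    · rintro ⟨⟨a, b⟩, ⟨⟨ha, hb⟩, h⟩, rfl⟩
      simp only [SetLike.mem_coe, Submodule.mem_comap, coneEnd_apply, Submodule.mem_prod,
        neg_mem_iff] at h
      exact ⟨ha, b, hb, h⟩
    · rintro ⟨ha, b, hb, h⟩
      refine ⟨(a, b), ⟨⟨ha, hb⟩, ?_⟩, rfl⟩
      simpa only [SetLike.mem_coe, Submodule.mem_comap, coneEnd_apply, Submodule.mem_prod,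
        neg_mem_iff] using h
  -- The pairs (a, b) with Da + Xb = 0 in N map onto both subquotients, by (a, b) ↦ a and by (a, b)
  -- ↦ Db, with the same kernel.
  let Y : Submodule R (M × M) := V₂.prod V₁ ⊓ U₁.comap (D.coprod X)
  have hY : ∀ a b, (a, b) ∈ Y ↔ (a ∈ V₂ ∧ b ∈ V₁) ∧ D a + X b ∈ U₁ := by
    intro a b
    simp only [Y, Submodule.mem_inf, Submodule.mem_comap, LinearMap.coprod_apply,
      Submodule.mem_prod]
  have hsub : P ≤ V₂ ⊓ (U₁ ⊔ V₁.map X).comap D := by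
    intro a ha
    obtain ⟨ha, b, hb, h, _⟩ := (hP a).1 ha
    refine ⟨ha, Submodule.mem_sup.2 ⟨_, h, X (-b), ⟨-b, neg_mem hb, rfl⟩, ?_⟩⟩
    rw [map_neg, add_neg_cancel_right]
  have h1 : relLength (Y ⊓ P.comap (LinearMap.fst R M M)) Y =
      relLength P (V₂ ⊓ (U₁ ⊔ V₁.map X).comap D) := by
    refine relLength_eq_of_map (LinearMap.fst R M M) (le_antisymm ?_ (sup_le hsub ?_)) rfl
    · rintro a ⟨ha, h⟩
      obtain ⟨u, hu, _, ⟨b, hb, rfl⟩, h⟩ := Submodule.mem_sup.1 h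
      refine Submodule.mem_sup_right ⟨(a, -b), (hY _ _).2 ⟨⟨ha, neg_mem hb⟩, ?_⟩, rfl⟩
      rw [map_neg, ← h, add_neg_cancel_right]
      exact hu
    · rintro _ ⟨⟨a, b⟩, h, rfl⟩
      obtain ⟨⟨ha, hb⟩, h⟩ := (hY a b).1 h
      refine ⟨ha, Submodule.mem_sup.2 ⟨_, h, X (-b), ⟨-b, neg_mem hb, rfl⟩, ?_⟩⟩
      rw [map_neg, add_neg_cancel_right]
      rfl
  rw [← h1]
  refine relLength_eq_of_map (D ∘ₗ LinearMap.snd R M M) (le_antisymm ?_ ?_) ?_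
  · refine sup_le (le_sup_left.trans le_sup_left) ?_
    rintro _ ⟨b, ⟨hb, hx⟩, rfl⟩
    obtain ⟨u, hu, _, ⟨a, ha, rfl⟩, h⟩ := Submodule.mem_sup.1 hx
    refine Submodule.mem_sup_right ⟨(-a, b), (hY _ _).2 ⟨⟨neg_mem ha, hb⟩, ?_⟩, rfl⟩
    rw [← h, map_neg, neg_add_cancel_comm_assoc]
    exact hu
  · refine sup_le (sup_le_sup_left (Submodule.map_mono
      (inf_le_inf_left _ (Submodule.comap_mono le_sup_left))) _) ?_
    rintro _ ⟨⟨a, b⟩, h, rfl⟩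
    obtain ⟨⟨ha, hb⟩, h⟩ := (hY a b).1 h
    refine Submodule.mem_sup_right ⟨b, ⟨hb, Submodule.mem_sup.2 ⟨_, h, D (-a),
      ⟨-a, neg_mem ha, rfl⟩, ?_⟩⟩, rfl⟩
    rw [map_neg]
    abel
  · ext ⟨a, b⟩
    simp only [Submodule.mem_inf, Submodule.mem_comap]
    refine and_congr_right fun hy => ?_
    obtain ⟨⟨ha, hb⟩, h⟩ := (hY a b).1 hy
    rw [LinearMap.fst_apply, hP]
    constructor
    · rintro ⟨_, c, hc, h1, h2⟩
      refine Submodule.mem_sup.2 ⟨D c, h2, D (b - c), ⟨b - c, ⟨sub_mem hb hc, ?_⟩, rfl⟩, by simp⟩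
      rw [SetLike.mem_coe, Submodule.mem_comap, map_sub]
      convert sub_mem h h1 using 1
      abel
    · intro h'
      obtain ⟨u, hu, _, ⟨c, ⟨hc, hc'⟩, rfl⟩, h'⟩ := Submodule.mem_sup.1 h'
      refine ⟨ha, b - c, sub_mem hb hc, ?_, ?_⟩
      · rw [map_sub]
        convert sub_mem h hc' using 1
        abel
      · have h'' : u + D c = D b := h'
        rw [map_sub, ← h'', add_sub_cancel_right]
        exact hu

/-- The Euler relation for the homology of a cone. -/
theorem relLength_cone (hD : ∀ a, D (D a) = 0) (hDX : ∀ a, D (X a) = X (D a))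
    (hU₂ : U₂ ≤ V₂) (hU₁ : U₁ ≤ V₁) (hDU₂ : ∀ a ∈ U₂, D a ∈ U₁) (hDU₁ : ∀ a ∈ U₁, D a ∈ U₀)
    (hDV₃ : ∀ a ∈ V₃, D a ∈ V₂) (hDV₂ : ∀ a ∈ V₂, D a ∈ V₁)
    (hXU₁ : ∀ a ∈ U₁, X a ∈ U₁) (hXV₂ : ∀ a ∈ V₂, X a ∈ V₂) :
    relLength (U₂.prod U₁ ⊔ (V₃.prod V₂).map (coneEnd D X))
      (V₂.prod V₁ ⊓ (U₁.prod U₀).comap (coneEnd D X)) +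
    relLength (U₀ ⊔ (V₁ ⊓ U₁.comap X).map D) (U₀ ⊔ (V₁ ⊓ (U₁ ⊔ V₂.map D).comap X).map D) +
    relLength (U₁ ⊔ (V₂ ⊓ U₂.comap X).map D) (U₁ ⊔ (V₂ ⊓ (U₂ ⊔ V₃.map D).comap X).map D) =
    relLength ((U₂ ⊔ V₂.map X) ⊔ V₃.map D) (V₂ ⊓ (U₁ ⊔ V₁.map X).comap D) +
    relLength (U₁ ⊔ (V₂ ⊓ U₂.comap X).map D) ((V₁ ⊓ U₁.comap X) ⊓ U₀.comap D) := by
  rw [relLength_cone_eq_add hD hDX hU₂ hU₁ hDU₂ hDU₁ hDV₃ hDV₂ hXU₁ hXV₂,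
    ← relLength_cone_fst]
  set P := ((V₂.prod V₁ ⊓ (U₁.prod U₀).comap (coneEnd D X))).map (LinearMap.fst R M M)
  -- The homology of N / XN splits into the part that lifts to the cone and the image of the
  -- connecting map; that of (0 :_N X) splits into the image of the preceding connecting map and the
  -- part surviving in the cone.
  rw [relLength_add (U := (U₂ ⊔ V₂.map X) ⊔ V₃.map D) (W := P)
    (V := V₂ ⊓ (U₁ ⊔ V₁.map X).comap D) ?_ ?_,
    relLength_add (U := U₁ ⊔ (V₂ ⊓ U₂.comap X).map D)
    (W := U₁ ⊔ (V₂ ⊓ (U₂ ⊔ V₃.map D).comap X).map D)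
    (V := (V₁ ⊓ U₁.comap X) ⊓ U₀.comap D) ?_ ?_]
  · ring
  · exact sup_le_sup_left (Submodule.map_mono (inf_le_inf_left _
      (Submodule.comap_mono le_sup_left))) _
  · refine sup_le (fun u hu => ⟨⟨hU₁ hu, hXU₁ u hu⟩, hDU₁ u hu⟩) ?_
    rintro _ ⟨b, ⟨hb, hx⟩, rfl⟩
    obtain ⟨u, hu, _, ⟨a, ha, rfl⟩, h⟩ := Submodule.mem_sup.1 hx
    refine ⟨⟨hDV₂ b hb, ?_⟩, ?_⟩
    · rw [SetLike.mem_coe, Submodule.mem_comap, ← hDX, ← h, map_add, hD, add_zero]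
      exact hDU₂ u hu
    · rw [SetLike.mem_coe, Submodule.mem_comap, hD]
      exact zero_mem _
  · have key : ∀ a b, a ∈ V₂ → b ∈ V₁ → D a + X b ∈ U₁ → D b ∈ U₀ → a ∈ P := by
      intro a b ha hb h1 h2
      refine ⟨(a, b), ⟨⟨ha, hb⟩, ?_⟩, rfl⟩
      simpa only [SetLike.mem_coe, Submodule.mem_comap, coneEnd_apply, Submodule.mem_prod,
        neg_mem_iff] using ⟨h1, h2⟩
    refine sup_le (sup_le (fun u hu => ?_) ?_) ?_
    · exact key u 0 (hU₂ hu) (zero_mem _) (by simpa using hDU₂ u hu) (by simp)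
    · rintro _ ⟨b, hb, rfl⟩
      refine key _ (-D b) (hXV₂ b hb) (neg_mem (hDV₂ b hb)) ?_ (by simp [hD])
      simp [hDX]
    · rintro _ ⟨a, ha, rfl⟩
      exact key _ 0 (hDV₃ a ha) (zero_mem _) (by simp [hD]) (by simp)
  · rintro _ ⟨⟨a, b⟩, ⟨⟨ha, hb⟩, h⟩, rfl⟩
    simp only [SetLike.mem_coe, Submodule.mem_comap, coneEnd_apply, Submodule.mem_prod] at h
    refine ⟨ha, Submodule.mem_sup.2 ⟨_, h.1, X (-b), ⟨-b, neg_mem hb, rfl⟩, ?_⟩⟩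
    rw [map_neg, add_neg_cancel_right]
    rfl

end Cone

/-! ### Koszul complexes -/

section RelLengthEquiv

variable {R M M' : Type*} [CommRing R] [AddCommGroup M] [Module R M] [AddCommGroup M'] [Module R M']

lemma relLength_inf_left (U V : Submodule R M) : relLength (U ⊓ V) V = relLength U V := by
  have : (U ⊓ V).submoduleOf V = U.submoduleOf V := by
    ext x
    simp [Submodule.submoduleOf]
  rw [relLength, relLength, this]

lemma relLength_map_equiv (e : M ≃ₗ[R] M') (U V : Submodule R M) :
    relLength (U.map (e : M →ₗ[R] M')) (V.map (e : M →ₗ[R] M')) = relLength U V := by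
  rw [← relLength_inf_left U V, ← relLength_inf_left (U.map _)]
  refine (relLength_eq_of_map (e : M →ₗ[R] M') (sup_eq_right.2 inf_le_right).symm ?_).symm
  rw [Submodule.comap_inf, Submodule.comap_map_eq_of_injective e.injective,
    Submodule.comap_map_eq_of_injective e.injective, inf_comm V, inf_assoc, inf_idem]

lemma relLength_homology_equiv (e : M ≃ₗ[R] M') {D : Module.End R M} {D' : Module.End R M'}
    (h : ∀ x, e (D x) = D' (e x)) (U₁ U₂ V₂ V₃ : Submodule R M) :
    relLength (U₂ ⊔ V₃.map D) (V₂ ⊓ U₁.comap D) =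
      relLength (U₂.map (e : M →ₗ[R] M') ⊔ (V₃.map (e : M →ₗ[R] M')).map D')
        (V₂.map (e : M →ₗ[R] M') ⊓ (U₁.map (e : M →ₗ[R] M')).comap D') := by
  have hD : (e : M →ₗ[R] M') ∘ₗ D = D' ∘ₗ (e : M →ₗ[R] M') := LinearMap.ext h
  rw [← Submodule.map_comp, ← hD, Submodule.map_comp, ← Submodule.map_sup,
    ← relLength_map_equiv e]
  congr 1
  ext y
  obtain ⟨x, rfl⟩ := e.surjective y
  have key : ∀ (W : Submodule R M) z, e z ∈ W.map (e : M →ₗ[R] M') ↔ z ∈ W := fun W z =>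
    ⟨fun ⟨w, hw, hwz⟩ => e.injective hwz ▸ hw, fun hz => ⟨z, hz, rfl⟩⟩
  rw [key, Submodule.mem_inf, Submodule.mem_inf, key, Submodule.mem_comap, Submodule.mem_comap,
    ← h, key]

end RelLengthEquiv

section Koszul

variable {R T : Type*} [CommRing R] [AddCommGroup T] [Module R T] {q : ℕ}

/-- The differential of the Koszul complex on the sum of all its terms. -/
noncomputable def koszulTotal (Φ : Fin q → Module.End R T) : Module.End R (Finset (Fin q) → T) :=
  LinearMap.pi fun s => ∑ k, if k ∈ s then 0 else
    ((-1 : R) ^ koszulExponent s k) • (Φ k ∘ₗ LinearMap.proj (insert k s))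

lemma koszulTotal_apply (Φ : Fin q → Module.End R T) (f : Finset (Fin q) → T) (s : Finset (Fin q)) :
    koszulTotal Φ f s = ∑ k, if k ∈ s then 0 else
      ((-1 : R) ^ koszulExponent s k) • Φ k (f (insert k s)) := by
  rw [koszulTotal, LinearMap.pi_apply, LinearMap.sum_apply]
  refine Finset.sum_congr rfl fun k _ => ?_
  split_ifs <;> simp

/-- The term of degree `p` with coefficients in `V`. -/
def koszulSub (q : ℕ) (V : Submodule R T) (p : ℤ) : Submodule R (Finset (Fin q) → T) where
  carrier := {f | ∀ s, f s ∈ V ∧ ((s.card : ℤ) ≠ p → f s = 0)}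
  zero_mem' := fun _ => ⟨V.zero_mem, fun _ => rfl⟩
  add_mem' := fun {f g} hf hg s => ⟨V.add_mem (hf s).1 (hg s).1, fun h => by
    rw [Pi.add_apply, (hf s).2 h, (hg s).2 h, add_zero]⟩
  smul_mem' := fun c f hf s => ⟨V.smul_mem c (hf s).1, fun h => by
    rw [Pi.smul_apply, (hf s).2 h, smul_zero]⟩

lemma koszulSub_mono {U V : Submodule R T} (h : U ≤ V) (p : ℤ) :
    koszulSub q U p ≤ koszulSub q V p := fun _ hf s => ⟨h (hf s).1, (hf s).2⟩

lemma koszulSub_eq_bot (V : Submodule R T) {p : ℤ} (hp : p < 0 ∨ (q : ℤ) < p) :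
    koszulSub q V p = ⊥ := by
  rw [eq_bot_iff]
  intro f hf
  refine funext fun s => (hf s).2 ?_
  have : s.card ≤ q := by simpa using s.card_le_univ
  omega

lemma koszulTotal_mem {Φ : Fin q → Module.End R T} {V : Submodule R T}
    (hV : ∀ k, ∀ v ∈ V, Φ k v ∈ V) {p : ℤ} {f : Finset (Fin q) → T} (hf : f ∈ koszulSub q V p) :
    koszulTotal Φ f ∈ koszulSub q V (p - 1) := by
  intro s
  rw [koszulTotal_apply]
  refine ⟨Submodule.sum_mem _ fun k _ => ?_, fun h => Finset.sum_eq_zero fun k _ => ?_⟩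
  · split_ifs
    · exact zero_mem _
    · exact V.smul_mem _ (hV k _ (hf _).1)
  · split_ifs with hk
    · rfl
    · rw [(hf (insert k s)).2, map_zero, smul_zero]
      rw [Finset.card_insert_of_notMem hk]
      push_cast
      omega

lemma koszulSub_map (X : Module.End R T) (V : Submodule R T) (p : ℤ) :
    (koszulSub q V p).map (X.compLeft (Finset (Fin q))) = koszulSub q (V.map X) p := by
  classical
  refine le_antisymm ?_ fun f hf => ?_
  · rintro _ ⟨f, hf, rfl⟩ s
    refine ⟨⟨f s, (hf s).1, rfl⟩, fun h => ?_⟩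
    change X (f s) = 0
    rw [(hf s).2 h, map_zero]
  · choose g hg hgf using fun s => (hf s).1
    refine ⟨fun s => if (s.card : ℤ) = p then g s else 0, fun s => ⟨?_, fun h => if_neg h⟩, ?_⟩
    · dsimp only
      split_ifs
      · exact hg s
      · exact zero_mem _
    · funext s
      change X (ite _ _ _) = f s
      split_ifs with h
      · exact hgf s
      · rw [map_zero, (hf s).2 h]

lemma koszulSub_sup (U V : Submodule R T) (p : ℤ) :
    koszulSub q (U ⊔ V) p = koszulSub q U p ⊔ koszulSub q V p := by
  classical
  refine le_antisymm (fun f hf => ?_)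
    (sup_le (koszulSub_mono le_sup_left p) (koszulSub_mono le_sup_right p))
  choose a ha b hb hab using fun s => Submodule.mem_sup.1 (hf s).1
  refine Submodule.mem_sup.2 ⟨fun s => if (s.card : ℤ) = p then a s else 0,
    fun s => ⟨?_, fun h => if_neg h⟩, fun s => if (s.card : ℤ) = p then b s else 0,
    fun s => ⟨?_, fun h => if_neg h⟩, ?_⟩
  · dsimp only
    split_ifs
    exacts [ha s, zero_mem _]
  · dsimp only
    split_ifs
    exacts [hb s, zero_mem _]
  · funext s
    rw [Pi.add_apply]
    split_ifs with h
    · exact hab s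
    · rw [add_zero, (hf s).2 h]

lemma koszulSub_inf_comap (X : Module.End R T) (U V : Submodule R T) (p : ℤ) :
    koszulSub q (V ⊓ U.comap X) p =
      koszulSub q V p ⊓ (koszulSub q U p).comap (X.compLeft (Finset (Fin q))) := by
  ext f
  constructor
  · intro hf
    refine ⟨fun s => ⟨(hf s).1.1, (hf s).2⟩, fun s => ⟨(hf s).1.2, fun h => ?_⟩⟩
    change X (f s) = 0
    rw [(hf s).2 h, map_zero]
  · rintro ⟨h1, h2⟩ s
    exact ⟨⟨(h1 s).1, (h2 s).1⟩, (h1 s).2⟩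

/-- The subsets of `{0, …, q}` as pairs of a subset of `{1, …, q}` and the information whether
they contain `0`. -/
noncomputable def koszulSplit (R T : Type*) [CommRing R] [AddCommGroup T] [Module R T] (q : ℕ) :
    (Finset (Fin (q + 1)) → T) ≃ₗ[R] (Finset (Fin q) → T) × (Finset (Fin q) → T) where
  toFun f := (fun s => f (s.map (Fin.succEmb q)), fun s => f (insert 0 (s.map (Fin.succEmb q))))
  map_add' _ _ := rfl
  map_smul' _ _ := rfl
  invFun g s := if 0 ∈ s then g.2 (Finset.univ.filter fun k => k.succ ∈ s)
    else g.1 (Finset.univ.filter fun k => k.succ ∈ s)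
  left_inv f := by
    funext s
    dsimp only
    split_ifs with h
    · congr 1
      ext k
      refine Fin.cases ?_ (fun k => ?_) k
      · simp [h]
      · simp [Fin.succ_ne_zero]
    · congr 1
      ext k
      refine Fin.cases ?_ (fun k => ?_) k
      · simp [h, Fin.succ_ne_zero]
      · simp
  right_inv g := by
    refine Prod.ext ?_ ?_ <;> funext s
    · dsimp only
      rw [if_neg (by simp [Fin.succ_ne_zero])]
      exact congrArg g.1 (by ext k; simp)
    · dsimp only
      rw [if_pos (by simp)]
      exact congrArg g.2 (by ext k; simp [Fin.succ_ne_zero])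

lemma koszulExponent_map_succ (s : Finset (Fin q)) (k : Fin q) :
    koszulExponent (s.map (Fin.succEmb q)) k.succ = koszulExponent s k := by
  rw [koszulExponent, Finset.filter_map, Finset.card_map, koszulExponent]
  congr 1
  ext i
  rw [Finset.mem_filter, Finset.mem_filter]
  exact and_congr_right fun _ => Fin.succ_lt_succ_iff

/-- Split the index sets by whether they contain 0. Removing 0 carries the sign +1, and its presence
flips all other signs, so the Koszul complex is the cone of Φ 0 on the Koszul complex of the
remaining endomorphisms. -/
lemma koszulSplit_koszulTotal (Φ : Fin (q + 1) → Module.End R T) (f : Finset (Fin (q + 1)) → T) :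
    koszulSplit R T q (koszulTotal Φ f) =
      coneEnd (koszulTotal fun k : Fin q => Φ k.succ) ((Φ 0).compLeft (Finset (Fin q)))
        (koszulSplit R T q f) := by
  have hm : ∀ (s : Finset (Fin q)) (k : Fin q), k.succ ∈ s.map (Fin.succEmb q) ↔ k ∈ s := by simp
  have h0 : ∀ s : Finset (Fin q), (0 : Fin (q + 1)) ∉ s.map (Fin.succEmb q) := by
    simp [Fin.succ_ne_zero]
  have hi : ∀ (s : Finset (Fin q)) (k : Fin q), insert k.succ (s.map (Fin.succEmb q)) =
      (insert k s).map (Fin.succEmb q) := by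
    intro s k
    rw [Finset.map_insert]
    rfl
  have e : koszulSplit R T q f = (fun s => f (s.map (Fin.succEmb q)),
    fun s => f (insert 0 (s.map (Fin.succEmb q)))) := rfl
  rw [e, coneEnd_apply]
  refine Prod.ext ?_ ?_ <;> funext s
  · change koszulTotal Φ f (s.map (Fin.succEmb q)) = koszulTotal (fun k : Fin q => Φ k.succ) _ s +
      Φ 0 (f (insert 0 (s.map (Fin.succEmb q))))
    rw [koszulTotal_apply, koszulTotal_apply, Fin.sum_univ_succ, if_neg (h0 s), add_comm]
    congr 1
    · refine Finset.sum_congr rfl fun k _ => ?_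
      rw [koszulExponent_map_succ, hi]
      simp only [hm]
    · have : koszulExponent (s.map (Fin.succEmb q)) 0 = 0 := by simp [koszulExponent]
      rw [this, pow_zero, one_smul]
  · change koszulTotal Φ f (insert 0 (s.map (Fin.succEmb q))) =
      - koszulTotal (fun k : Fin q => Φ k.succ) _ s
    rw [koszulTotal_apply, koszulTotal_apply, Fin.sum_univ_succ,
      if_pos (Finset.mem_insert_self _ _), zero_add, ← Finset.sum_neg_distrib]
    refine Finset.sum_congr rfl fun k _ => ?_
    rw [koszulExponent_insert_of_lt (h0 s) (Fin.succ_pos k), koszulExponent_map_succ,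
      Finset.insert_comm, hi]
    simp only [Finset.mem_insert, Fin.succ_ne_zero, false_or, hm]
    split_ifs
    · simp
    · rw [pow_succ, mul_neg_one, neg_smul]

lemma map_koszulSplit (V : Submodule R T) (p : ℤ) :
    (koszulSub (q + 1) V p).map (koszulSplit R T q : _ →ₗ[R] _) =
      (koszulSub q V p).prod (koszulSub q V (p - 1)) := by
  have h0 : ∀ s : Finset (Fin q), (0 : Fin (q + 1)) ∉ s.map (Fin.succEmb q) := by
    simp [Fin.succ_ne_zero]
  refine le_antisymm ?_ ?_
  · rintro _ ⟨f, hf, rfl⟩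
    refine ⟨fun s => ?_, fun s => ?_⟩
    · have := hf (s.map (Fin.succEmb q))
      rw [Finset.card_map] at this
      exact this
    · have := hf (insert 0 (s.map (Fin.succEmb q)))
      rw [Finset.card_insert_of_notMem (h0 s), Finset.card_map] at this
      exact ⟨this.1, fun h => this.2 (by push_cast; omega)⟩
  · rintro g ⟨h1, h2⟩
    refine ⟨(koszulSplit R T q).symm g, fun s => ?_, (koszulSplit R T q).apply_symm_apply g⟩
    have hc : s.card = (Finset.univ.filter fun k : Fin q => k.succ ∈ s).card +
        if 0 ∈ s then 1 else 0 := by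
      have : s = (Finset.univ.filter fun k : Fin q => k.succ ∈ s).map (Fin.succEmb q) ∪
          if 0 ∈ s then {0} else ∅ := by
        ext k
        refine Fin.cases ?_ (fun k => ?_) k
        · by_cases h : (0 : Fin (q + 1)) ∈ s <;> simp [h, Fin.succ_ne_zero]
        · by_cases h : (0 : Fin (q + 1)) ∈ s <;> simp [h, Fin.succ_ne_zero]
      conv_lhs => rw [this]
      rw [Finset.card_union_of_disjoint, Finset.card_map]
      · split_ifs <;> simp
      · split_ifs <;> simp [Fin.succ_ne_zero]
    change (if 0 ∈ s then _ else _) ∈ V ∧ (_ → (if 0 ∈ s then _ else _) = 0)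
    split_ifs at hc ⊢ with h
    · exact ⟨(h2 _).1, fun hp => (h2 _).2 (by omega)⟩
    · exact ⟨(h1 _).1, fun hp => (h1 _).2 (by omega)⟩

lemma koszulTotal_koszulTotal {Φ : Fin q → Module.End R T} (hΦ : ∀ k l, Commute (Φ k) (Φ l))
    (f : Finset (Fin q) → T) : koszulTotal Φ (koszulTotal Φ f) = 0 := by
  induction q with
  | zero => funext s; rw [koszulTotal_apply]; simp
  | succ q ih =>
    apply (koszulSplit R T q).injective
    rw [koszulSplit_koszulTotal, koszulSplit_koszulTotal, map_zero]
    obtain ⟨a, b⟩ := koszulSplit R T q f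
    have h1 := ih (Φ := fun k : Fin q => Φ k.succ) (fun _ _ => hΦ _ _)
    have h2 : ∀ b : Finset (Fin q) → T, koszulTotal (fun k : Fin q => Φ k.succ)
        ((Φ 0).compLeft _ b) = (Φ 0).compLeft _ (koszulTotal (fun k : Fin q => Φ k.succ) b) := by
      intro b
      funext s
      change _ = Φ 0 (koszulTotal (fun k : Fin q => Φ k.succ) b s)
      rw [koszulTotal_apply, koszulTotal_apply, map_sum]
      refine Finset.sum_congr rfl fun k _ => ?_
      split_ifs
      · rw [map_zero]
      · rw [map_smul]
        exact congrArg _ (LinearMap.congr_fun (hΦ k.succ 0).eq _)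
    rw [coneEnd_apply, coneEnd_apply, map_add, map_neg, map_neg, h1, h1, h2]
    simp

lemma koszulTotal_compLeft {Φ : Fin q → Module.End R T} {X : Module.End R T}
    (hX : ∀ k, Commute (Φ k) X) (f : Finset (Fin q) → T) :
    koszulTotal Φ (X.compLeft _ f) = X.compLeft _ (koszulTotal Φ f) := by
  funext s
  change _ = X (koszulTotal Φ f s)
  rw [koszulTotal_apply, koszulTotal_apply, map_sum]
  refine Finset.sum_congr rfl fun k _ => ?_
  split_ifs
  · rw [map_zero]
  · rw [map_smul]
    exact congrArg _ (LinearMap.congr_fun (hX k).eq _)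

/-- The length of the `p`-th homology module of the Koszul complex on `V / U`. -/
noncomputable def koszulLength (Φ : Fin q → Module.End R T) (U V : Submodule R T) (p : ℤ) : ℕ∞ :=
  relLength (koszulSub q U p ⊔ (koszulSub q V (p + 1)).map (koszulTotal Φ))
    (koszulSub q V p ⊓ (koszulSub q U (p - 1)).comap (koszulTotal Φ))

lemma koszulLength_eq_zero (Φ : Fin q → Module.End R T) (U V : Submodule R T) {p : ℤ}
    (hp : p < 0 ∨ (q : ℤ) < p) : koszulLength Φ U V p = 0 := by
  rw [koszulLength, relLength_eq_zero, koszulSub_eq_bot V hp]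
  exact inf_le_left.trans bot_le

/-- The Euler relation for the homology of a Koszul complex. -/
theorem koszulLength_succ {Φ : Fin (q + 1) → Module.End R T} (hΦ : ∀ k l, Commute (Φ k) (Φ l))
    {U V : Submodule R T} (hU : ∀ k, ∀ v ∈ U, Φ k v ∈ U) (hV : ∀ k, ∀ v ∈ V, Φ k v ∈ V)
    (hUV : U ≤ V) : ∃ F : ℤ → ℕ∞, (∀ p, p < 0 ∨ (q : ℤ) < p → F p = 0) ∧ ∀ p,
      koszulLength Φ U V p + F (p - 2) + F (p - 1) =
        koszulLength (fun k : Fin q => Φ k.succ) (U ⊔ V.map (Φ 0)) V p +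
        koszulLength (fun k : Fin q => Φ k.succ) U (V ⊓ U.comap (Φ 0)) (p - 1) := by
  set D := koszulTotal fun k : Fin q => Φ k.succ
  set X := (Φ 0).compLeft (Finset (Fin q))
  have hDm : ∀ {W : Submodule R T}, (∀ k, ∀ v ∈ W, Φ k v ∈ W) → ∀ p, ∀ a ∈ koszulSub q W p,
      D a ∈ koszulSub q W (p - 1) := fun hW p a ha => koszulTotal_mem (fun k => hW k.succ) ha
  have hXm : ∀ {W : Submodule R T}, (∀ k, ∀ v ∈ W, Φ k v ∈ W) → ∀ p, ∀ a ∈ koszulSub q W p,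
      X a ∈ koszulSub q W p := fun {W} hW p a ha => by
    have h : (koszulSub q W p).map X ≤ koszulSub q W p := by
      rw [koszulSub_map]
      refine koszulSub_mono ?_ p
      rintro _ ⟨w, hw, rfl⟩
      exact hW 0 w hw
    exact h ⟨a, ha, rfl⟩
  -- With N = V / U, the correction F p is the length of the image of the connecting map from degree
  -- p + 2 of the homology on N / Φ_0 N to degree p of that on (0 :_N Φ_0). It enters the relation
  -- for two consecutive degrees.
  refine ⟨fun p => relLength (koszulSub q U p ⊔
      (koszulSub q V (p + 1) ⊓ (koszulSub q U (p + 1)).comap X).map D)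
    (koszulSub q U p ⊔ (koszulSub q V (p + 1) ⊓
      (koszulSub q U (p + 1) ⊔ (koszulSub q V (p + 2)).map D).comap X).map D), ?_, ?_⟩
  · intro p hp
    rw [relLength_eq_zero]
    refine sup_le le_sup_left ?_
    rintro _ ⟨a, ha, rfl⟩
    have h := hDm hV _ a ha.1
    rw [add_sub_cancel_right, koszulSub_eq_bot V hp] at h
    rw [(Submodule.mem_bot R).1 h]
    exact zero_mem _
  · intro p
    have e1 : p - 2 + 1 = p - 1 := by ring
    have e2 : p - 2 + 2 = p := by ring
    have e3 : p - 1 + 1 = p := by ring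
    have e4 : p - 1 + 2 = p + 1 := by ring
    have e5 : p + 1 - 1 = p := by ring
    have e6 : p - 1 - 1 = p - 2 := by ring
    simp only [e1, e2, e3, e4]
    have h3 := hDm hV (p + 1)
    rw [e5] at h3
    have h4 := hDm hU (p - 1)
    rw [e6] at h4
    have := relLength_cone (D := D) (X := X) (U₀ := koszulSub q U (p - 2))
      (U₁ := koszulSub q U (p - 1)) (U₂ := koszulSub q U p) (V₁ := koszulSub q V (p - 1))
      (V₂ := koszulSub q V p) (V₃ := koszulSub q V (p + 1))
      (koszulTotal_koszulTotal fun _ _ => hΦ _ _) (koszulTotal_compLeft fun _ => hΦ _ _)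
      (koszulSub_mono hUV p) (koszulSub_mono hUV _) (hDm hU p) h4 h3 (hDm hV p)
      (hXm hU _) (hXm hV p)
    rw [koszulLength, relLength_homology_equiv (koszulSplit R T q) (koszulSplit_koszulTotal Φ),
      map_koszulSplit, map_koszulSplit, map_koszulSplit, map_koszulSplit, e5, e6, this,
      koszulLength, koszulLength, e3, e6]
    simp only [koszulSub_sup, ← koszulSub_map, koszulSub_inf_comap]
    rfl

end Koszul

/-! ### The Euler–Poincaré characteristic of a Koszul complex -/

section AltSum

/-- The alternating sum of a sequence of lengths. -/
noncomputable def altSum (F : ℤ → ℕ∞) : ℤ :=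
  ∑ᶠ p : ℤ, (p.negOnePow : ℤ) * ((F p).toNat : ℤ)

lemma finsum_negOnePow_shift (f : ℤ → ℤ) :
    ∑ᶠ p : ℤ, (p.negOnePow : ℤ) * f (p - 1) = -∑ᶠ p : ℤ, (p.negOnePow : ℤ) * f p := by
  rw [← finsum_neg_distrib, ← finsum_comp_equiv (f := fun p : ℤ => -((p.negOnePow : ℤ) * f p))
    (Equiv.subRight (1 : ℤ))]
  refine finsum_congr fun p => ?_
  have : (p.negOnePow : ℤ) = -((p - 1).negOnePow : ℤ) := by
    rw [← Units.val_neg, ← Int.negOnePow_succ, sub_add_cancel]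
  rw [this, Equiv.subRight_apply]
  ring

lemma finite_support_of_vanish {q : ℤ} {f : ℤ → ℤ} (hf : ∀ p, p < 0 ∨ q < p → f p = 0) (c : ℤ) :
    (Function.support fun p : ℤ => (p.negOnePow : ℤ) * f (p - c)).Finite := by
  refine (Set.finite_Icc c (q + c)).subset fun p hp => ?_
  rw [Function.mem_support] at hp
  by_contra h
  refine hp ?_
  rw [hf, mul_zero]
  rw [Set.mem_Icc] at h
  omega

/-- The correction terms enter in two consecutive degrees and cancel in the alternating sum, while
the shift of H by one degree produces the minus sign. Finiteness of A and F is forced by that of G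
and H. -/
lemma altSum_eq_sub {q : ℤ} {A F G H : ℤ → ℕ∞}
    (hF : ∀ p, p < 0 ∨ q < p → F p = 0) (hG : ∀ p, p < 0 ∨ q < p → G p = 0)
    (hH : ∀ p, p < 0 ∨ q < p → H p = 0) (hG' : ∀ p, G p ≠ ⊤) (hH' : ∀ p, H p ≠ ⊤)
    (h : ∀ p, A p + F (p - 2) + F (p - 1) = G p + H (p - 1)) :
    (∀ p, A p ≠ ⊤) ∧ altSum A = altSum G - altSum H := by
  have hsum : ∀ p, A p + F (p - 2) + F (p - 1) ≠ ⊤ := fun p => by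
    rw [h]
    exact WithTop.add_ne_top.2 ⟨hG' p, hH' _⟩
  have hA' : ∀ p, A p ≠ ⊤ := fun p =>
    (WithTop.add_ne_top.1 (WithTop.add_ne_top.1 (hsum p)).1).1
  have hF' : ∀ p, F p ≠ ⊤ := fun p => by
    have := (WithTop.add_ne_top.1 (hsum (p + 1))).2
    rwa [add_sub_cancel_right] at this
  refine ⟨hA', ?_⟩
  have key : ∀ p : ℤ, (p.negOnePow : ℤ) * ((A p).toNat : ℤ) =
      ((p.negOnePow : ℤ) * ((G p).toNat : ℤ) + (p.negOnePow : ℤ) * ((H (p - 1)).toNat : ℤ)) -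
      ((p.negOnePow : ℤ) * ((F (p - 2)).toNat : ℤ) +
        (p.negOnePow : ℤ) * ((F (p - 1)).toNat : ℤ)) := by
    intro p
    have := congrArg ENat.toNat (h p)
    have hAF : A p + F (p - 2) ≠ ⊤ := WithTop.add_ne_top.2 ⟨hA' p, hF' _⟩
    rw [ENat.toNat_add hAF (hF' (p - 1)),
      ENat.toNat_add (hA' p) (hF' (p - 2)),
      ENat.toNat_add (hG' p) (hH' (p - 1))] at this
    have h' : ((A p).toNat : ℤ) = ((G p).toNat + (H (p - 1)).toNat) -
      ((F (p - 2)).toNat + (F (p - 1)).toNat) := by omega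
    rw [h']
    ring
  have s : ∀ {B : ℤ → ℕ∞}, (∀ p, p < 0 ∨ q < p → B p = 0) → ∀ c : ℤ,
      (Function.support fun p : ℤ => (p.negOnePow : ℤ) * ((B (p - c)).toNat : ℤ)).Finite :=
    fun {B} hB c => finite_support_of_vanish (q := q) (f := fun p => ((B p).toNat : ℤ))
      (fun p hp => by simp [hB p hp]) c
  have sG := s hG 0
  simp only [sub_zero] at sG
  have e1 := finsum_negOnePow_shift fun p => ((H p).toNat : ℤ)
  have e2 := finsum_negOnePow_shift fun p => ((F (p - 1)).toNat : ℤ)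
  simp only [sub_sub, one_add_one_eq_two] at e2
  rw [altSum, finsum_congr key,
    finsum_sub_distrib ((sG.union (s hH 1)).subset (Function.support_add _ _))
      (((s hF 2).union (s hF 1)).subset (Function.support_add _ _)),
    finsum_add_distrib sG (s hH 1), finsum_add_distrib (s hF 2) (s hF 1), e1, e2, altSum, altSum]
  ring

end AltSum

/-! ### Koszul homology and the symbol -/

section KoszulSymbol

variable {R E ι τ : Type*} [CommRing R] [AddCommGroup E] [Module R E] [AddCommGroup ι]
  {y : τ → Module.End R E × ι}

lemma koszulLength_zero (Φ : Fin 0 → Module.End R E) {U V : Submodule R E} (hUV : U ≤ V) :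
    koszulLength Φ U V 0 = relLength U V := by
  have hD : ∀ f, koszulTotal Φ f = 0 := fun f => by
    funext s
    rw [koszulTotal_apply]
    simp
  have hs : ∀ s : Finset (Fin 0), s = ∅ := fun s => Subsingleton.elim _ _
  have hm : ∀ {W : Submodule R E} {f : Finset (Fin 0) → E}, f ∈ koszulSub 0 W 0 ↔ f ∅ ∈ W := by
    intro W f
    refine ⟨fun h => (h ∅).1, fun h s => ?_⟩
    rw [hs s]
    exact ⟨h, fun h' => absurd rfl h'⟩
  rw [koszulLength, zero_add, koszulSub_eq_bot V (p := 1) (by simp), Submodule.map_bot, sup_bot_eq]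
  refine relLength_eq_of_map (LinearMap.proj ∅) ?_ ?_
  · refine le_antisymm (fun v hv => ?_) (sup_le hUV ?_)
    · have : (fun _ => v) ∈ koszulSub 0 V 0 ⊓ (koszulSub 0 U (0 - 1)).comap (koszulTotal Φ) := by
        rw [Submodule.mem_inf, Submodule.mem_comap, hD]
        exact ⟨hm.2 hv, zero_mem _⟩
      exact Submodule.mem_sup_right ⟨_, this, rfl⟩
    · rintro _ ⟨f, hf, rfl⟩
      exact hm.1 hf.1
  · ext f
    rw [Submodule.mem_inf, Submodule.mem_inf, Submodule.mem_comap, Submodule.mem_comap, hD, hm, hm]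
    exact ⟨fun h => ⟨⟨hUV h, zero_mem _⟩, h⟩, fun h => h.2⟩

/-- The alternating sum of the lengths of the homology modules of a Koszul complex is the symbol of
its endomorphisms. -/
theorem altSum_koszulLength (hy : ∀ s t, Commute (y s).1 (y t).1) {q : ℕ} (g : Fin q → τ)
    (hg : ∀ k, (y (g k)).2 = 0) {U V : ι → Submodule R E} (hU : U ∈ StableFam y)
    (hV : V ∈ StableFam y) (hUV : U ≤ V) (n : ι)
    (hk : FiniteKilled (pure n) y ((List.finRange q).map g) U V) :
    (∀ p, koszulLength (fun k => (y (g k)).1) (U n) (V n) p ≠ ⊤) ∧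
      altSum (koszulLength (fun k => (y (g k)).1) (U n) (V n)) =
        famSymb (((List.finRange q).map g).map y) U V n := by
  induction q generalizing U V with
  | zero =>
    have hz : ∀ p, p ≠ 0 → koszulLength (fun k => (y (g k)).1) (U n) (V n) p = 0 := fun p hp =>
      koszulLength_eq_zero _ _ _ (by simp; omega)
    have h0 := koszulLength_zero (fun k => (y (g k)).1) (hUV n)
    have hfin := eventually_pure.1 (hk U hU V hV le_rfl hUV le_rfl (by simp))
    refine ⟨fun p => ?_, ?_⟩
    · by_cases hp : p = 0
      · rw [hp, h0]
        exact hfin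
      · rw [hz p hp]
        simp
    · rw [altSum, finsum_eq_single _ 0 fun p hp => by rw [hz p hp]; simp, h0]
      simp [famSymb, LatOp.symb, famLength]
  | succ q ih =>
    set x := y (g 0)
    have hstab : ∀ {W : ι → Submodule R E}, W ∈ StableFam y → ∀ k, ∀ v ∈ W n,
        (y (g k)).1 v ∈ W n := fun {W} hW k v hv => by
      have := hW (g k) n ⟨v, hv, rfl⟩
      rwa [hg, add_zero] at this
    have hpV : (famOp x).push V ≤ V := fun m => by
      have := hV (g 0) (m - x.2)
      rwa [sub_add_cancel] at this
    have hpU : U ≤ (famOp x).pull U := fun m => Submodule.map_le_iff_le_comap.1 (hU (g 0) m)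
    have h1 := ih (fun k => g k.succ) (fun k => hg _) (U := U ⊔ (famOp x).push V) (V := V)
      (Sublattice.supClosed _ hU (StableFam.push_mem hy _ hV)) hV (sup_le hUV hpV) (by
        intro U' hU' V' hV' h1 h2 h3 hl
        refine hk U' hU' V' hV' (le_sup_left.trans h1) h2 h3 ?_
        rw [List.finRange_succ, List.map_cons, List.map_map]
        refine List.forall_mem_cons.2 ⟨fun m => ?_, hl⟩
        have := (le_sup_right.trans h1) (m + x.2)
        refine le_trans (Submodule.map_mono (h3 m)) (le_trans (le_of_eq ?_) this)
        simp [famOp, x])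
    have h2 := ih (fun k => g k.succ) (fun k => hg _) (U := U) (V := V ⊓ (famOp x).pull U) hU
      (Sublattice.infClosed _ hV (StableFam.pull_mem hy _ hU)) (le_inf hUV hpU) (by
        intro U' hU' V' hV' h1 h2 h3 hl
        refine hk U' hU' V' hV' h1 h2 (h3.trans inf_le_left) ?_
        rw [List.finRange_succ, List.map_cons, List.map_map]
        refine List.forall_mem_cons.2 ⟨fun m => ?_, hl⟩
        exact (Submodule.map_le_iff_le_comap.2 ((h3.trans inf_le_right) m)).trans (h1 _))
    have e1 : (U ⊔ (famOp x).push V) n = U n ⊔ (V n).map x.1 := by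
      have : x.2 = 0 := hg 0
      simp [famOp, this]
    have e2 : (V ⊓ (famOp x).pull U) n = V n ⊓ (U n).comap x.1 := by
      have : x.2 = 0 := hg 0
      simp [famOp, this]
    obtain ⟨F, hF, h⟩ := koszulLength_succ (Φ := fun k => (y (g k)).1) (fun _ _ => hy _ _)
      (hstab hU) (hstab hV) (hUV n)
    rw [e1] at h1
    rw [e2] at h2
    -- The recursion for the Euler–Poincaré characteristic is the one defining the symbol: the value
    -- on N / xN minus the value on (0 :_N x).
    have := altSum_eq_sub hF (fun p hp => koszulLength_eq_zero _ _ _ hp)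
      (fun p hp => koszulLength_eq_zero _ _ _ hp) h1.1 h2.1 h
    refine ⟨this.1, this.2.trans ?_⟩
    rw [h1.2, h2.2, List.finRange_succ, List.map_cons, List.map_map, List.map_cons]
    have e0 : n - x.2 = n := by rw [show x.2 = 0 from hg 0, sub_zero]
    -- The operator has degree 0, so the shift in the symbol is trivial. It is inserted in the
    -- second term only, where the definition contains it.
    conv_lhs => rw [← e0]
    conv_lhs => enter [1]; rw [e0]
    rw [List.map_map, List.map_map]
    rfl

end KoszulSymbol

/-! ### Lengths of the homology of `koszulComplex` -/

section Homology

universe v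

variable {R : Type*} [CommRing R]

lemma length_homology_eq (S : ShortComplex (ModuleCat.{v} R)) :
    Module.length R S.homology = relLength (LinearMap.range S.f.hom) (LinearMap.ker S.g.hom) := by
  rw [S.moduleCatHomologyIso.toLinearEquiv.length_eq, relLength]
  have : LinearMap.range S.moduleCatToCycles =
      (LinearMap.range S.f.hom).submoduleOf (LinearMap.ker S.g.hom) := by
    ext x
    constructor
    · rintro ⟨a, rfl⟩
      exact ⟨a, rfl⟩
    · rintro ⟨a, ha⟩
      exact ⟨a, Subtype.ext ha⟩
  rw [← this]
  rfl

variable {T : Type v} {E : Type*} [AddCommGroup T] [Module R T] [AddCommGroup E] [Module R E] {q : ℕ}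

/-- The inclusion of a term of the Koszul complex into the sum of all terms, composed with a
linear map of the coefficients. -/
def koszulEmb (θ : T →ₗ[R] E) (p : ℕ) : (KoszulIndex q p → T) →ₗ[R] (Finset (Fin q) → E) :=
  LinearMap.pi fun s => if h : s.card = p then θ ∘ₗ LinearMap.proj ⟨s, h⟩ else 0

lemma koszulEmb_apply (θ : T →ₗ[R] E) (p : ℕ) (x : KoszulIndex q p → T) (s : Finset (Fin q)) :
    koszulEmb θ p x s = if h : s.card = p then θ (x ⟨s, h⟩) else 0 := by
  rw [koszulEmb, LinearMap.pi_apply]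
  split_ifs <;> rfl

variable {θ : T →ₗ[R] E} {Φ : Fin q → Module.End R T} {Ψ : Fin q → Module.End R E}

lemma koszulTotal_koszulEmb (hθ : ∀ k x, θ (Φ k x) = Ψ k (θ x)) (p : ℕ)
    (x : KoszulIndex q (p + 1) → T) :
    koszulTotal Ψ (koszulEmb θ (p + 1) x) = koszulEmb θ p (koszulDifferential Φ p x) := by
  funext s
  rw [koszulTotal_apply, koszulEmb_apply]
  split_ifs with h
  · rw [koszulDifferential_apply, map_sum]
    have := Finset.sum_subtype (F := inferInstance) (Finset.univ.filter fun k : Fin q => k ∉ s) (p := fun k => k ∉ s)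
      (by simp) (fun k => ((-1 : R) ^ koszulExponent s k) • Ψ k (koszulEmb θ (p + 1) x (insert k s)))
    rw [Finset.sum_filter] at this
    simp only [ite_not] at this
    refine this.trans (Finset.sum_congr rfl fun k _ => ?_)
    have hc : (insert k.1 s).card = p + 1 := by rw [Finset.card_insert_of_notMem k.2, h]
    rw [koszulEmb_apply, dif_pos hc, map_smul, hθ]
    rfl
  · refine Finset.sum_eq_zero fun k _ => ?_
    split_ifs with hk
    · rfl
    · have hc : (insert k s).card ≠ p + 1 := by rw [Finset.card_insert_of_notMem hk]; omega
      rw [koszulEmb_apply, dif_neg hc, map_zero, smul_zero]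

lemma koszulEmb_injective (hinj : Function.Injective θ) (p : ℕ) :
    Function.Injective (koszulEmb (q := q) θ p) := by
  intro x x' h
  funext s
  have := congrFun h s.1
  rw [koszulEmb_apply, koszulEmb_apply, dif_pos s.2, dif_pos s.2] at this
  exact hinj this

lemma range_koszulEmb (p : ℕ) :
    LinearMap.range (koszulEmb (q := q) θ p) = koszulSub q (LinearMap.range θ) p := by
  refine le_antisymm ?_ fun f hf => ?_
  · rintro _ ⟨x, rfl⟩ s
    rw [koszulEmb_apply]
    refine ⟨?_, fun h => dif_neg fun h' => h (by rw [h'])⟩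
    split_ifs
    · exact ⟨_, rfl⟩
    · exact zero_mem _
  · choose x hx using fun s => (hf s).1
    refine ⟨fun s => x s.1, funext fun s => ?_⟩
    rw [koszulEmb_apply]
    split_ifs with h
    · exact hx s
    · exact ((hf s).2 (by exact_mod_cast h)).symm

/-- The length of a homology module of the Koszul complex. -/
theorem length_homology_koszulComplex (hΦ : ∀ k l, Commute (Φ k) (Φ l))
    (hinj : Function.Injective θ) (hθ : ∀ k x, θ (Φ k x) = Ψ k (θ x)) (p : ℕ) :
    Module.length R ((koszulComplex Φ hΦ).homology p) =
      koszulLength Ψ ⊥ (LinearMap.range θ) p := by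
  set C := koszulComplex Φ hΦ
  have hd : ∀ p, (C.d (p + 1) p).hom = koszulDifferential Φ p := fun p => by
    have : C.d (p + 1) p = ModuleCat.ofHom (koszulDifferential Φ p) :=
      ChainComplex.of_d (fun p => ModuleCat.of R (KoszulIndex q p → T))
        (fun p => ModuleCat.ofHom (koszulDifferential Φ p)) p
    rw [this]
    rfl
  have hstab : ∀ k, ∀ v ∈ LinearMap.range θ, Ψ k v ∈ LinearMap.range θ := by
    rintro k _ ⟨x, rfl⟩
    exact ⟨Φ k x, hθ k x⟩
  -- Here j is the successor of p in the complex shape: p - 1 in general, and 0 itself for p = 0,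
  -- where the differential is zero and the next term of `koszulSub` is trivial.
  have key : ∀ j, (∀ x : C.X p, (C.d p j).hom x = 0 ↔ koszulTotal Ψ (koszulEmb θ p x) = 0) →
      Module.length R (C.sc' (p + 1) p j).homology = koszulLength Ψ ⊥ (LinearMap.range θ) p := by
    intro j hj
    rw [length_homology_eq]
    change relLength (LinearMap.range (C.d (p + 1) p).hom) (LinearMap.ker (C.d p j).hom) = _
    rw [hd]
    have hbot : ∀ p, koszulSub q (⊥ : Submodule R E) p = ⊥ := fun p => by
      rw [eq_bot_iff]
      exact fun f hf => funext fun s => (hf s).1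
    have hB : (koszulSub q (LinearMap.range θ) (p + 1)).map (koszulTotal Ψ) =
        (LinearMap.range (koszulDifferential Φ p)).map (koszulEmb θ p) := by
      have h1 := range_koszulEmb (q := q) (θ := θ) (p + 1)
      push_cast at h1
      rw [← h1, ← LinearMap.range_comp, ← LinearMap.range_comp]
      congr 1
      exact LinearMap.ext fun x => koszulTotal_koszulEmb hθ p x
    rw [koszulLength, hbot, hbot, bot_sup_eq, hB]
    refine relLength_eq_of_map (koszulEmb θ p) ?_ ?_
    · refine le_antisymm ?_ (sup_le ?_ ?_)
      · rintro f ⟨h1, h2⟩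
        rw [← range_koszulEmb] at h1
        obtain ⟨x, rfl⟩ := h1
        exact Submodule.mem_sup_right ⟨x, (hj x).2 h2, rfl⟩
      · rw [← hB]
        rintro _ ⟨f, hf, rfl⟩
        have := koszulTotal_mem hstab hf
        rw [add_sub_cancel_right] at this
        refine ⟨this, ?_⟩
        rw [← Nat.cast_one, ← Nat.cast_add, ← range_koszulEmb] at hf
        obtain ⟨x, rfl⟩ := hf
        rw [koszulTotal_koszulEmb hθ]
        refine (Submodule.mem_bot R).2 ((hj _).1 ?_)
        rw [← hd]
        exact congrArg (fun f => f.hom x) (C.d_comp_d (p + 1) p j)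
      · rintro _ ⟨x, hx, rfl⟩
        exact ⟨range_koszulEmb (θ := θ) p ▸ ⟨x, rfl⟩, (hj x).1 hx⟩
    · rw [Submodule.comap_map_eq_of_injective (koszulEmb_injective hinj p)]
      refine (inf_eq_right.2 ?_).symm
      rintro _ ⟨x, rfl⟩
      rw [← hd]
      exact congrArg (fun f => f.hom x) (C.d_comp_d (p + 1) p j)
  have hsc : ∀ j, (ComplexShape.down ℕ).next p = j → 
      Module.length R (C.homology p) = Module.length R (C.sc' (p + 1) p j).homology := fun j h =>
    (ShortComplex.homologyMapIso
      (C.isoSc' (p + 1) p j (by simp) h)).toLinearEquiv.length_eq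
  rcases p with _ | p
  · rw [hsc 0 (by simp)]
    refine key 0 fun x => ?_
    have h0 : C.d 0 0 = 0 := C.shape _ _ (by simp)
    have h1 : koszulEmb θ 0 x ∈ koszulSub q (LinearMap.range θ) 0 := by
      rw [← Nat.cast_zero, ← range_koszulEmb]
      exact ⟨x, rfl⟩
    have h2 := koszulTotal_mem hstab h1
    rw [koszulSub_eq_bot _ (Or.inl (by norm_num))] at h2
    rw [h0]
    exact iff_of_true rfl h2
  · rw [hsc p (by simp)]
    refine key p fun x => ?_
    rw [hd]
    have : ∀ x : KoszulIndex q (p + 1) → T, koszulDifferential Φ p x = 0 ↔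
        koszulTotal Ψ (koszulEmb θ (p + 1) x) = 0 := fun x => by
      rw [koszulTotal_koszulEmb hθ, map_eq_zero_iff _ (koszulEmb_injective hinj p)]
    exact this x

end Homology

/-! ### Tensor products of free modules as multihomogeneous polynomials -/

section Tensor

variable {R : Type*} [CommRing R] {d : ℕ} {r : Fin d → ℕ} {F : Fin d → Type*}
  [∀ k, AddCommGroup (F k)] [∀ k, Module R (F k)] (b : ∀ k, Module.Basis (Fin (r k)) R (F k))

/-- The elements of a free module as linear forms in the variables of degree `e_k`. -/
noncomputable def toForm (k : Fin d) : F k →ₗ[R] BlockPoly R r :=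
  (b k).constr R fun i => MvPolynomial.X ⟨k, i⟩

lemma toForm_apply (k : Fin d) (v : F k) : toForm b k v = blockForm k ((b k).repr v) := by
  rw [toForm, Module.Basis.constr_apply_fintype]
  rfl

lemma toForm_basis (k : Fin d) (i : Fin (r k)) : toForm b k (b k i) = MvPolynomial.X ⟨k, i⟩ :=
  (b k).constr_basis R _ i

lemma range_toForm (k : Fin d) : LinearMap.range (toForm b k) = blockMod R r k := by
  refine le_antisymm ?_ (blockMod_le_iff.2 fun i => ⟨b k i, toForm_basis b k i⟩)
  rintro _ ⟨v, rfl⟩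
  rw [toForm_apply]
  exact blockForm_mem _ _

lemma blockMap_toForm_self (k : Fin d) (f : Module.End R (F k)) (v : F k) :
    blockMap k (LinearMap.toMatrix (b k) (b k) f) (toForm b k v) = toForm b k (f v) := by
  rw [toForm_apply, toForm_apply, blockMap, blockEnd_blockForm, Pi.mulSingle_eq_same,
    LinearMap.toMatrix_mulVec_repr]

lemma blockMap_toForm_of_ne {k l : Fin d} (h : l ≠ k) (M : Matrix (Fin (r k)) (Fin (r k)) R)
    (v : F l) : blockMap k M (toForm b l v) = toForm b l v := by
  rw [toForm_apply, blockMap, blockEnd_blockForm, Pi.mulSingle_eq_of_ne h, Matrix.one_mulVec]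

/-- The elements of a tensor product of free modules as multihomogeneous polynomials. -/
noncomputable def tensorToPoly : (⨂[R] k, F k) →ₗ[R] BlockPoly R r :=
  PiTensorProduct.lift
    ((MultilinearMap.mkPiAlgebra R (Fin d) (BlockPoly R r)).compLinearMap (toForm b))

lemma tensorToPoly_tprod (v : ∀ k, F k) :
    tensorToPoly b (PiTensorProduct.tprod R v) = ∏ k, toForm b k (v k) := by
  rw [tensorToPoly, PiTensorProduct.lift.tprod, MultilinearMap.compLinearMap_apply,
    MultilinearMap.mkPiAlgebra_apply]

lemma range_tensorToPoly : LinearMap.range (tensorToPoly b) = blockFam R r 1 := by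
  have h1 : blockFam R r 1 = ∏ k, Submodule.span R (Set.range (toForm b k)) := by
    rw [blockFam, prodFam_of_nonneg _ zero_le_one]
    refine Finset.prod_congr rfl fun k _ => ?_
    rw [Pi.one_apply, Int.toNat_one, pow_one, ← range_toForm b, ← LinearMap.coe_range,
      Submodule.span_eq]
  rw [h1, Submodule.prod_span, LinearMap.range_eq_map, ← PiTensorProduct.span_tprod_eq_top,
    Submodule.map_span]
  congr 1
  ext f
  rw [Set.mem_fintype_prod]
  constructor
  · rintro ⟨_, ⟨v, rfl⟩, rfl⟩
    exact ⟨_, fun {k} => ⟨v k, rfl⟩, (tensorToPoly_tprod b v).symm⟩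
  · rintro ⟨g, hg, rfl⟩
    choose v hv using fun k => @hg k
    refine ⟨_, ⟨v, rfl⟩, ?_⟩
    rw [tensorToPoly_tprod]
    exact Finset.prod_congr rfl fun k _ => hv k

/-- Basis tensors are sent to distinct monomials, one variable being chosen from each block. -/
lemma tensorToPoly_injective : Function.Injective (tensorToPoly b) := by
  refine LinearMap.injective_of_linearIndependent (v := Basis.piTensorProduct b)
    (Basis.piTensorProduct b).span_eq ?_
  have h : tensorToPoly b ∘ Basis.piTensorProduct b = MvPolynomial.basisMonomials _ R ∘
      fun f : ∀ k, Fin (r k) => ∑ k, Finsupp.single (⟨k, f k⟩ : Σ k, Fin (r k)) 1 := by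
    funext f
    rw [Function.comp_apply, Basis.piTensorProduct_apply, tensorToPoly_tprod,
      Function.comp_apply, MvPolynomial.coe_basisMonomials]
    refine Eq.trans ?_ (MvPolynomial.monomial_sum_one _ _).symm
    exact Finset.prod_congr rfl fun k _ => toForm_basis b k _
  rw [h]
  refine (MvPolynomial.basisMonomials _ R).linearIndependent.comp _ fun f g hfg => ?_
  funext k
  have := DFunLike.congr_fun hfg ⟨k, f k⟩
  rw [Finsupp.finsetSum_apply, Finsupp.finsetSum_apply,
    Finset.sum_eq_single k (fun l _ hl => Finsupp.single_eq_of_ne (by simp [hl.symm])) (by simp),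
    Finset.sum_eq_single k (fun l _ hl => Finsupp.single_eq_of_ne (by simp [hl.symm])) (by simp),
    Finsupp.single_eq_same] at this
  by_contra hne
  rw [Finsupp.single_eq_of_ne (by simpa using hne)] at this
  exact one_ne_zero this

lemma tensorToPoly_tensorEnd (φ : ∀ k, Module.End R (F k)) (k : Fin d) (x : ⨂[R] k, F k) :
    tensorToPoly b (tensorEnd φ k x) =
      blockMap k (LinearMap.toMatrix (b k) (b k) (φ k)) (tensorToPoly b x) := by
  suffices tensorToPoly b ∘ₗ tensorEnd φ k =
      (blockMap k (LinearMap.toMatrix (b k) (b k) (φ k))).toLinearMap ∘ₗ tensorToPoly b from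
    LinearMap.congr_fun this x
  refine PiTensorProduct.ext (MultilinearMap.ext fun v => ?_)
  simp only [LinearMap.compMultilinearMap_apply, LinearMap.comp_apply, AlgHom.toLinearMap_apply]
  rw [tensorEnd, PiTensorProduct.map_tprod, tensorToPoly_tprod, tensorToPoly_tprod, map_prod]
  refine Finset.prod_congr rfl fun l _ => ?_
  by_cases h : l = k
  · subst h
    rw [Function.update_self, blockMap_toForm_self]
  · rw [Function.update_of_ne h, blockMap_toForm_of_ne b h, LinearMap.id_apply]

lemma stageList_zero (L : List (Fin d)) :
    stageList (r := r) 0 L = L.map fun k => Sum.inr (k, true) := by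
  rw [stageList, List.map_eq_flatMap]
  rfl

lemma eulerPoincareChar_eq_altSum {C : ChainComplex (ModuleCat R) ℕ} {L : ℤ → ℕ∞}
    (h : ∀ p : ℕ, Module.length R (C.homology p) = L p) (hL : ∀ p < 0, L p = 0) :
    eulerPoincareChar C = altSum L := by
  have h1 : eulerPoincareChar C = ∑ᶠ p : ℕ, (((p : ℤ).negOnePow : ℤ) * ((L p).toNat : ℤ)) := by
    refine finsum_congr fun p => ?_
    rw [h]
    simp [Int.negOnePow_def]
  rw [h1, altSum, ← finsum_mem_range (f := fun p : ℤ => (p.negOnePow : ℤ) * ((L p).toNat : ℤ))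
    (g := ((↑) : ℕ → ℤ)) Nat.cast_injective]
  refine finsum_congr fun p => ?_
  by_cases hp : p < 0
  · rw [hL p hp]
    simp
  · have : p ∈ Set.range ((↑) : ℕ → ℤ) := ⟨p.toNat, Int.toNat_of_nonneg (not_lt.1 hp)⟩
    simp only [this, finsum_true]

/-- The Euler–Poincaré characteristic of the tensor product complex as a symbol. -/
theorem eulerPoincareChar_tensorKoszulComplex [IsNoetherianRing R] (φ : ∀ k, Module.End R (F k))
    (hJ : Module.length R (R ⧸ detIdeal (fun k => LinearMap.toMatrix (b k) (b k) (φ k)) Set.univ) ≠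
      ⊤) :
    HasFiniteLengthHomology (tensorKoszulComplex φ) ∧
    eulerPoincareChar (tensorKoszulComplex φ) =
      famSymb ((stageList 0 (List.finRange d)).map
        (blockOp fun k => LinearMap.toMatrix (b k) (b k) (φ k))) ⊥ (blockFam R r) 1 := by
  set Φ := fun k => LinearMap.toMatrix (b k) (b k) (φ k)
  set Q : Set (Fin d) := {k | 0 ≤ (k : ℕ)}
  have hQ : ∀ k, k ∈ Q := fun k => Nat.zero_le _
  have hsys : ∀ k : Fin d, blockSys Φ 0 Q (Sum.inr (k, true)) = blockOp Φ (Sum.inr (k, true)) :=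
    fun k => blockSys_of_active (show BlockIdx.Active 0 Q (Sum.inr (k, true)) from hQ k)
  have hlen : ∀ p : ℕ, Module.length R ((tensorKoszulComplex φ).homology p) =
      koszulLength (fun k => (blockSys Φ 0 Q (Sum.inr (k, true))).1) ⊥ (blockFam R r 1) p := by
    intro p
    rw [← range_tensorToPoly b]
    refine length_homology_koszulComplex (tensorEnd_commute φ) (tensorToPoly_injective b)
      (fun k x => ?_) p
    rw [tensorToPoly_tensorEnd, hsys]
    rfl
  have hk := stageList_finiteKilled hJ (Nat.zero_le d)
  rw [stageList_zero] at hk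
  -- Stage 0 has only matrices, all of degree 0. Finiteness is therefore needed only at the single
  -- degree (1, …, 1), where the filter of stage 0 is concentrated.
  obtain ⟨h1, h2⟩ := altSum_koszulLength (y := blockSys Φ 0 Q)
    (blockSys_commute fun k _ => Nat.zero_le _) (fun k => Sum.inr (k, true))
    (fun k => by rw [hsys]; rfl) (bot_mem_stableFam _) blockFam_mem_stableFam
    bot_le 1 hk
  refine ⟨fun p => Module.length_ne_top_iff.1 (by rw [hlen]; exact h1 p), ?_⟩
  rw [eulerPoincareChar_eq_altSum hlen fun p hp => koszulLength_eq_zero _ _ _ (Or.inl hp),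
    ← map_blockSys_stageList Φ (Q := Q) fun k _ _ => hQ k, stageList_zero]
  exact h2

end Tensor

/-! ### Passage from the symmetric algebra to the polynomial ring -/

section Transfer

variable {R : Type*} [CommRing R] {d : ℕ} {r : Fin d → ℕ} {F : Fin d → Type*}
  [∀ k, AddCommGroup (F k)] [∀ k, Module R (F k)] (b : ∀ k, Module.Basis (Fin (r k)) R (F k))

/-- The symmetric algebra of a direct sum of free modules as a polynomial ring. -/
noncomputable def symToPoly : SymmetricAlgebra R (∀ k, F k) ≃ₐ[R] BlockPoly R r :=
  SymmetricAlgebra.equivMvPolynomial (Pi.basis b)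

lemma symToPoly_ι_single (k : Fin d) (v : F k) :
    symToPoly b (SymmetricAlgebra.ι R (∀ k, F k) (LinearMap.single R F k v)) = toForm b k v := by
  suffices (symToPoly b).toLinearMap ∘ₗ SymmetricAlgebra.ι R (∀ k, F k) ∘ₗ LinearMap.single R F k =
      toForm b k from LinearMap.congr_fun this v
  refine (b k).ext fun i => ?_
  rw [toForm_basis]
  have : LinearMap.single R F k (b k i) = Pi.basis b ⟨k, i⟩ := by
    rw [Pi.basis_apply]
    rfl
  simp only [LinearMap.comp_apply, this]
  exact SymmetricAlgebra.equivMvPolynomial_ι_apply _ _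

lemma map_symImage (k : Fin d) (N : Submodule R (F k)) :
    (symImage k N).map (symToPoly b).toAlgHom.toLinearMap = N.map (toForm b k) := by
  rw [symImage, ← Submodule.map_comp]
  congr 1
  exact LinearMap.ext fun v => symToPoly_ι_single b k v

lemma map_symProd (M : ∀ k, Submodule R (F k)) (n : Fin d → ℕ) :
    (symProd M n).map (symToPoly b).toAlgHom.toLinearMap =
      ∏ k, (M k).map (toForm b k) ^ n k := by
  have h := map_prod (Submodule.mapHom (symToPoly b).toAlgHom) (fun k => symImage k (M k) ^ n k)
    Finset.univ
  simp only [map_pow] at h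
  refine h.trans (Finset.prod_congr rfl fun k _ => ?_)
  rw [← map_symImage]
  rfl

/-- The symmetric algebra of a free module is a polynomial ring, and the isomorphism sends products
of submodules to products. -/
lemma jointBuchsbaumRimFunction_eq (M : ∀ k, Submodule R (F k)) (n : Fin d → ℕ) :
    jointBuchsbaumRimFunction M n =
      relLength (prodFam (fun k => (M k).map (toForm b k)) fun k => (n k : ℤ))
        (blockFam R r fun k => (n k : ℤ)) := by
  have h := relLength_map_equiv (symToPoly b).toLinearEquiv (symProd M n) (symProd (fun _ => ⊤) n)
  refine h.symm.trans ?_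
  rw [blockFam, prodFam_natCast, prodFam_natCast]
  congr 1
  · exact map_symProd b M n
  · refine (map_symProd b (fun _ => ⊤) n).trans (Finset.prod_congr rfl fun k _ => ?_)
    rw [Submodule.map_top, range_toForm]

lemma map_toForm_range (k : Fin d) (φ : Module.End R (F k)) :
    (LinearMap.range φ).map (toForm b k) = Submodule.span R (Set.range fun i =>
      blockForm k fun j => LinearMap.toMatrix (b k) (b k) φ j i) := by
  rw [LinearMap.range_eq_map, ← (b k).span_eq, Submodule.map_span, Submodule.map_span,
    ← Set.range_comp, ← Set.range_comp]
  congr 2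
  funext i
  rw [Function.comp_apply, Function.comp_apply, toForm_apply]
  congr 1
  funext j
  rw [LinearMap.toMatrix_apply]

lemma jointReduction_toForm {B M : ∀ k, Submodule R (F k)} (h : IsJointReduction B M) :
    ∃ m : ℕ, ∏ k, (M k).map (toForm b k) ^ (m + 1) ≤ ⨆ k, (B k).map (toForm b k) *
      ∏ i, (M i).map (toForm b i) ^ Function.update (fun _ => m + 1) k m i := by
  obtain ⟨m, hm⟩ := h.equation
  refine ⟨m, ?_⟩
  rw [← map_symProd b M fun _ => m + 1, hm, ← Submodule.mapHom_apply, map_sum]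
  refine Finset.sum_induction _ (· ≤ _) (fun _ _ => sup_le) bot_le fun k _ => ?_
  rw [Submodule.mapHom_apply, Submodule.map_mul]
  refine (le_of_eq ?_).trans (le_iSup _ k)
  exact congrArg₂ _ (map_symImage b k _) (map_symProd b M _)

end Transfer

/-! ### Finite colength of the ideal of determinants -/

section Determinants

variable {R : Type*} [CommRing R] [IsNoetherianRing R] {d : ℕ} {r : Fin d → ℕ}

lemma Submodule.prod_mem_prod_of_forall {R A ι : Type*} [CommRing R] [CommRing A] [Algebra R A]
    (s : Finset ι) {x : ι → A} {N : ι → Submodule R A} (h : ∀ i, x i ∈ N i) :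
    ∏ i ∈ s, x i ∈ ∏ i ∈ s, N i := by
  classical
  induction s using Finset.induction_on with
  | empty => simpa using Submodule.one_le.1 (le_refl (1 : Submodule R A))
  | insert i s hi ih =>
    rw [Finset.prod_insert hi, Finset.prod_insert hi]
    exact Submodule.mul_mem_mul (h i) ih

/-- The determinants of the columns of a joint reduction generate an ideal of finite colength. -/
theorem length_quotient_detIdeal_ne_top {Φ : ∀ k, Matrix (Fin (r k)) (Fin (r k)) R}
    {M : Fin d → Submodule R (BlockPoly R r)} (hM : ∀ k, Cofinite (M k) (blockMod R r k))
    (hred : ∃ m : ℕ, ∏ k, M k ^ (m + 1) ≤ ⨆ k,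
      Submodule.span R (Set.range fun i => blockForm k fun j => Φ k j i) *
        ∏ i, M i ^ Function.update (fun _ => m + 1) k m i) :
    Module.length R (R ⧸ detIdeal Φ Set.univ) ≠ ⊤ := by
  obtain ⟨m, hm⟩ := hred
  choose J hJ hJM using hM
  have hprod : Module.length R (R ⧸ ∏ k, J k) ≠ ⊤ := by
    refine Finset.prod_induction J (fun I => Module.length R (R ⧸ I) ≠ ⊤)
      (fun _ _ => length_quotient_mul_ne_top) ?_ fun k _ => hJ k
    rw [← relLength_top, Ideal.one_eq_top, relLength_self]
    simp
  have hrad : ∏ k, J k ≤ (detIdeal Φ Set.univ).radical := by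
    rw [Ideal.radical_eq_sInf]
    refine le_sInf ?_
    -- It suffices that every prime containing all determinants contains some J k, where J k
    -- multiplies all linear forms of block k into M k.
    rintro P ⟨hdet, hP⟩
    have hker : ∀ k, ∃ v : Fin (r k) → R ⧸ P, v ≠ 0 ∧
        Matrix.vecMul v ((Φ k).map (Ideal.Quotient.mk P)) = 0 := fun k => by
      refine Matrix.exists_vecMul_eq_zero_iff.2 ?_
      have := RingHom.map_det (Ideal.Quotient.mk P) (Φ k)
      rw [RingHom.mapMatrix_apply] at this
      rw [← this]
      exact Ideal.Quotient.eq_zero_iff_mem.2 (hdet (Ideal.subset_span ⟨k, trivial, rfl⟩))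
    choose v hv0 hv using hker
    -- Over the domain R / P each matrix has a nonzero vector v k killed by all its columns.
    -- Evaluation at these vectors kills all the forms given by the columns.
    let ev : BlockPoly R r →ₐ[R] R ⧸ P := MvPolynomial.aeval fun t => v t.1 t.2
    have hB : ∀ k i, ev (blockForm k fun j => Φ k j i) = 0 := fun k i => by
      rw [blockForm, map_sum]
      refine Eq.trans ?_ (congrFun (hv k) i)
      refine Finset.sum_congr rfl fun j _ => ?_
      rw [map_smul, MvPolynomial.aeval_X, Algebra.smul_def, mul_comm]
      rfl
    -- By the reduction equation the evaluation kills the product of the powers of the M k. As the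
    -- target is a domain, it must kill some M k entirely.
    obtain ⟨k, hk⟩ : ∃ k, ∀ x ∈ M k, ev x = 0 := by
      by_contra! hne
      choose x hx hx0 using hne
      have h1 : ∏ k, x k ^ (m + 1) ∈ ∏ k, M k ^ (m + 1) :=
        Submodule.prod_mem_prod_of_forall _ fun k => Submodule.pow_mem_pow _ (hx k) _
      have h2 : (⨆ k, Submodule.span R (Set.range fun i => blockForm k fun j => Φ k j i) *
          ∏ i, M i ^ Function.update (fun _ => m + 1) k m i) ≤ LinearMap.ker ev.toLinearMap := by
        refine iSup_le fun k => Submodule.mul_le.2 fun y hy z _ => ?_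
        have h3 : Submodule.span R (Set.range fun i => blockForm k fun j => Φ k j i) ≤
            LinearMap.ker ev.toLinearMap := by
          rw [Submodule.span_le]
          rintro _ ⟨i, rfl⟩
          exact hB k i
        have h4 : ev y = 0 := h3 hy
        change ev (y * z) = 0
        rw [map_mul, h4, zero_mul]
      have h5 : ev (∏ k, x k ^ (m + 1)) = 0 := h2 (hm h1)
      rw [map_prod] at h5
      obtain ⟨k, _, hk⟩ := Finset.prod_eq_zero_iff.1 h5
      rw [map_pow] at hk
      exact hx0 k (pow_eq_zero_iff (Nat.succ_ne_zero m) |>.1 hk)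
    -- For a in J k the form aX_i lies in M k, so a times the i-th entry of v k vanishes modulo P.
    -- Choosing a nonzero entry gives a ∈ P.
    refine (Ideal.prod_le_inf.trans (Finset.inf_le (Finset.mem_univ k))).trans fun a ha => ?_
    obtain ⟨i, hi⟩ := Function.ne_iff.1 (hv0 k)
    have h1 := hk _ (hJM k (Submodule.smul_mem_smul ha (X_mem_blockMod k i)))
    rw [map_smul, MvPolynomial.aeval_X, Algebra.smul_def] at h1
    exact Ideal.Quotient.eq_zero_iff_mem.1 ((mul_eq_zero.1 h1).resolve_right hi)
  obtain ⟨n, hn⟩ := Ideal.exists_pow_le_of_le_radical_of_fg hrad (IsNoetherian.noetherian _)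
  exact length_quotient_mono hn (length_quotient_pow_ne_top hprod n)

end Determinants

/-! ### The joint Buchsbaum–Rim polynomial and the Euler–Poincaré characteristic -/

section EventualPolynomials

variable {d : ℕ}

lemma eventually_eval_polyBackDiff {p : MvPolynomial (Fin d) ℚ} {f : (Fin d → ℤ) → ℤ}
    (h : ∀ᶠ n in atTop, MvPolynomial.eval (fun k => (n k : ℚ)) p = f n) (k : Fin d) (s : ℕ) :
    ∀ᶠ n in atTop, MvPolynomial.eval (fun k => (n k : ℚ)) ((polyBackDiff k)^[s] p) =
      backDiff (List.replicate s (Pi.single k 1)) f n := by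
  induction s with
  | zero => exact h
  | succ s ih =>
    have ht : Tendsto (fun n : Fin d → ℤ => n - Pi.single k 1) atTop atTop := by
      simp only [sub_eq_add_neg]
      exact tendsto_atTop_add_const_right _ _ tendsto_id
    filter_upwards [ih, ht.eventually ih] with n h1 h2
    rw [Function.iterate_succ_apply', eval_polyBackDiff, h1, h2, ← Int.cast_sub]
    rfl

lemma eventually_eval_foldr_polyBackDiff {p : MvPolynomial (Fin d) ℚ} {f : (Fin d → ℤ) → ℤ}
    (h : ∀ᶠ n in atTop, MvPolynomial.eval (fun k => (n k : ℚ)) p = f n) (r : Fin d → ℕ)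
    (l : List (Fin d)) :
    ∀ᶠ n in atTop, MvPolynomial.eval (fun k => (n k : ℚ))
        (l.foldr (fun k q => (polyBackDiff k)^[r k] q) p) =
      backDiff (l.flatMap fun k => List.replicate (r k) (Pi.single k 1)) f n := by
  induction l with
  | nil => exact h
  | cons k l ih =>
    rw [List.flatMap_cons, backDiff_append]
    exact eventually_eval_polyBackDiff ih k (r k)

end EventualPolynomials

section Main

variable {R : Type*} [CommRing R] {d : ℕ} {r : Fin d → ℕ} {F : Fin d → Type*}
  [∀ k, AddCommGroup (F k)] [∀ k, Module R (F k)] (b : ∀ k, Module.Basis (Fin (r k)) R (F k))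
  {M B : ∀ k, Submodule R (F k)}

/-- The ideal is the annihilator of F / N. It is the kernel of the map sending a to the classes of a
times the basis elements, so its quotient embeds into finitely many copies of a module of finite
length. -/
lemma cofinite_map_toForm {k : Fin d} {N : Submodule R (F k)} (h : IsFiniteLength R (F k ⧸ N)) :
    Cofinite (N.map (toForm b k)) (blockMod R r k) := by
  let g : R →ₗ[R] Fin (r k) → F k ⧸ N :=
    LinearMap.pi fun i => LinearMap.toSpanSingleton R _ (N.mkQ (b k i))
  obtain ⟨_, _⟩ := isFiniteLength_iff_isNoetherian_isArtinian.1 h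
  refine ⟨LinearMap.ker g, ?_, ?_⟩
  · refine ne_top_of_le_ne_top (Module.length_ne_top_iff.2
      (isFiniteLength_iff_isNoetherian_isArtinian.2 ⟨inferInstance, inferInstance⟩))
      (Module.length_le_of_injective ((LinearMap.ker g).liftQ g le_rfl)
        (LinearMap.ker_eq_bot.1 (Submodule.ker_liftQ_eq_bot' _ _ rfl)))
  · rw [← range_toForm b, Submodule.smul_le]
    rintro a ha _ ⟨v, rfl⟩
    refine ⟨a • v, ?_, map_smul _ _ _⟩
    have : a • N.mkQ = 0 := (b k).ext fun i => congrFun ha i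
    have := LinearMap.congr_fun this v
    rw [← N.ker_mkQ]
    exact (map_smul _ _ _).trans this

lemma isJointBuchsbaumRimPolynomial_of_famLength [IsNoetherianRing R] (h : ∀ k, IsFiniteLength R (F k ⧸ M k))
    {p : MvPolynomial (Fin d) ℚ}
    (hp : ∀ᶠ n in atTop, MvPolynomial.eval (fun k => ((n k : ℤ) : ℚ)) p =
      famLength (prodFam fun k => (M k).map (toForm b k)) (blockFam R r) n) :
    IsJointBuchsbaumRimPolynomial M p := by
  obtain ⟨N, hN⟩ := eventually_atTop_iff_forall_le.1 hp
  refine ⟨N.toNat, fun n hn => ?_⟩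
  have h1 := hN (fun k => (n k : ℤ)) fun k => by have := hn k; omega
  have h2 := relLength_prodFam_ne_top (fun k => blockMod_fg (R := R) (r := r) k)
    (fun k => cofinite_map_toForm b (h k)) fun k => (n k : ℤ)
  refine ⟨_, (jointBuchsbaumRimFunction_eq b M n).trans (ENat.natCast_toNat h2).symm, ?_⟩
  rw [famLength] at h1
  exact_mod_cast h1

/-- The relation between the length function and the Euler–Poincaré characteristic. -/
theorem exists_polynomial_and_euler [IsNoetherianRing R] [IsLocalRing R]
    (b : ∀ k, Module.Basis (Fin (r k)) R (F k)) (hfin : ∀ k, IsFiniteLength R (F k ⧸ M k))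
    (hred : IsJointReduction B M) (φ : ∀ k, Module.End R (F k))
    (hφ : ∀ k, LinearMap.range (φ k) = B k) :
    HasFiniteLengthHomology (tensorKoszulComplex φ) ∧
    ∃ p : MvPolynomial (Fin d) ℚ, IsJointBuchsbaumRimPolynomial M p ∧
      (∏ k, ((r k).factorial : ℚ)) * p.coeff (Finsupp.equivFunOnFinite.symm r) =
        eulerPoincareChar (tensorKoszulComplex φ) := by
  set Φ := fun k => LinearMap.toMatrix (b k) (b k) (φ k)
  have hB : ∀ k, (B k).map (toForm b k) =
      Submodule.span R (Set.range fun i => blockForm k fun j => Φ k j i) := fun k => by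
    rw [← hφ, map_toForm_range]
  obtain ⟨m, hm⟩ := jointReduction_toForm b hred
  simp only [hB] at hm
  have hJ := length_quotient_detIdeal_ne_top (fun k => cofinite_map_toForm b (hfin k)) ⟨m, hm⟩
  obtain ⟨hfl, hχ⟩ := eulerPoincareChar_tensorKoszulComplex b φ hJ
  refine ⟨hfl, ?_⟩
  have : ∀ k, Module.Finite R (F k) := fun k => Module.Finite.of_basis (b k)
  choose s c hc using fun k => Submodule.fg_iff_exists_fin_generating_family.1
    (IsNoetherian.noetherian (M k))
  -- The columns are listed alongside generators of M k. The modules generated are still the M k,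
  -- since B k lies in M k, and the columns form a sublist to which the reduction equation applies.
  let a : (Σ k, Fin (r k) ⊕ Fin (s k)) → BlockPoly R r := fun t =>
    t.2.elim (fun i => blockForm t.1 fun j => Φ t.1 j i) fun i => toForm b t.1 (c t.1 i)
  let κ : (Σ k, Fin (r k) ⊕ Fin (s k)) → Fin d := Sigma.fst
  have hgen : genMod R a κ = fun k => (M k).map (toForm b k) := by
    funext k
    refine le_antisymm (Submodule.span_le.2 ?_) ?_
    · rintro _ ⟨⟨_, i | i⟩, rfl, rfl⟩
      · refine Submodule.map_mono (hred.le _) ?_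
        rw [hB]
        exact Submodule.subset_span ⟨i, rfl⟩
      · exact ⟨c _ i, hc _ ▸ Submodule.subset_span ⟨i, rfl⟩, rfl⟩
    · rw [← hc, Submodule.map_span, Submodule.span_le]
      rintro _ ⟨_, ⟨i, rfl⟩, rfl⟩
      exact Submodule.subset_span ⟨⟨k, Sum.inr i⟩, rfl, rfl⟩
  let l : List (Σ k, Fin (r k) ⊕ Fin (s k)) :=
    (List.finRange d).flatMap fun k => (List.finRange (r k)).map fun i => ⟨k, Sum.inl i⟩
  have hl : IsReduction R a κ l := by
    refine ⟨m, ?_⟩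
    rw [hgen]
    refine hm.trans (iSup_mono fun k => mul_le_mul_left (Submodule.span_mono ?_) _)
    rintro _ ⟨i, rfl⟩
    exact ⟨⟨k, Sum.inl i⟩, ⟨by simp [l], rfl⟩, rfl⟩
  have hsys : l.map (mulSys R a κ) = (stageList d (List.finRange d)).map (blockOp Φ) := by
    rw [List.map_flatMap, stageList, List.map_flatMap]
    refine List.flatMap_congr fun k _ => ?_
    rw [blockList, if_pos k.2, List.map_map, List.map_map, List.map_map]
    rfl
  have hmono : ∀ k, genMod R a κ k ≤ blockMod R r k := fun k => by
    rw [hgen, ← range_toForm b]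
    exact LinearMap.map_le_range
  have hcof : ∀ k, Cofinite (genMod R a κ k) (blockMod R r k) := fun k => by
    rw [hgen]
    exact cofinite_map_toForm b (hfin k)
  obtain ⟨p, hp⟩ := exists_mvPolynomial_famLength (a := a) (κ := κ) MvPolynomial.X Sigma.fst hcof hmono
  have hsymb := hl.famSymb_eq blockMod_fg hcof hmono
  have hdeg : (l.map fun t => (Pi.single (κ t) 1 : Fin d → ℤ)) =
      (List.finRange d).flatMap fun k => List.replicate (r k) (Pi.single k 1) := by
    rw [List.map_flatMap]
    refine List.flatMap_congr fun k _ => ?_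
    rw [List.map_map]
    refine List.eq_replicate_iff.2 ⟨by simp, fun e he => ?_⟩
    obtain ⟨i, _, rfl⟩ := List.mem_map.1 he
    rfl
  rw [hsys, hdeg] at hsymb
  refine ⟨p, isJointBuchsbaumRimPolynomial_of_famLength b hfin (hgen ▸ hp), ?_⟩
  -- The difference formula holds for all large n, the comparison with χ only along the iterated
  -- limit, which refines the former. A polynomial vanishing along the iterated limit is zero, so
  -- the identity holds for polynomials.
  have hconst : (List.finRange d).foldr (fun k q => (polyBackDiff k)^[r k] q) p =
      MvPolynomial.C (eulerPoincareChar (tensorKoszulComplex φ) : ℚ) := by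
    rw [← sub_eq_zero]
    refine mvPolynomial_eq_zero_of_iterFilter ?_
    filter_upwards [iterFilter_le_atTop hsymb, famSymb_columns_eq hJ,
      iterFilter_le_atTop (eventually_eval_foldr_polyBackDiff hp r (List.finRange d))]
      with n h1 h2 h3
    rw [map_sub, MvPolynomial.eval_C, h3, hχ, ← h2]
    exact sub_eq_zero.2 (congrArg _ h1.symm)
  have := coeff_of_polyBackDiff_const r _ (List.nodup_finRange d) hconst
  rw [← Fin.prod_univ_def, ← Fin.sum_univ_def] at this
  rw [← this]
  congr 2
  exact (Finsupp.univ_sum_single (Finsupp.equivFunOnFinite.symm r)).symm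

lemma IsJointBuchsbaumRimPolynomial.unique {p q : MvPolynomial (Fin d) ℚ}
    (hp : IsJointBuchsbaumRimPolynomial M p) (hq : IsJointBuchsbaumRimPolynomial M q) : p = q := by
  obtain ⟨N, hN⟩ := hp
  obtain ⟨N', hN'⟩ := hq
  refine sub_eq_zero.1 (mvPolynomial_eq_zero_of_eval_nat (max N N') fun n hn => ?_)
  obtain ⟨u, h1, h2⟩ := hN n fun k => (le_max_left _ _).trans (hn k)
  obtain ⟨u', h1', h2'⟩ := hN' n fun k => (le_max_right _ _).trans (hn k)
  have : u = u' := by exact_mod_cast h1.symm.trans h1'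
  rw [map_sub, h2, h2', this, sub_self]

end Main

theorem mainTheorem6 {R : Type*} [CommRing R] [IsLocalRing R] [IsNoetherianRing R]
    [Infinite (IsLocalRing.ResidueField R)]
    (d : ℕ) (hd : 0 < d) (hdim : ringKrullDim R = d)
    {F : Fin d → Type*} [∀ k, AddCommGroup (F k)] [∀ k, Module R (F k)]
    [∀ k, Module.Free R (F k)] [∀ k, Module.Finite R (F k)]
    (M B : ∀ k, Submodule R (F k))
    (hfin : ∀ k, IsFiniteLength R (F k ⧸ M k))
    (hproper : ∀ k, M k < ⊤)
    (hred : IsJointReduction B M)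
    (φ : ∀ k, Module.End R (F k))
    (hφ : ∀ k, LinearMap.range (φ k) = B k) :
    (∃! p : MvPolynomial (Fin d) ℚ, IsJointBuchsbaumRimPolynomial M p) ∧
      HasFiniteLengthHomology (tensorKoszulComplex φ) ∧
      mixedBuchsbaumRimMultiplicity M = (eulerPoincareChar (tensorKoszulComplex φ) : ℚ) := by
  obtain ⟨h1, p, hp, h2⟩ :=
    exists_polynomial_and_euler (fun k => Module.finBasis R (F k)) hfin hred φ hφ
  refine ⟨⟨p, hp, fun q hq => hq.unique hp⟩, h1, ?_⟩
  have hex : ∃ p, IsJointBuchsbaumRimPolynomial M p := ⟨p, hp⟩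
  -- The polynomial chosen in the definition coincides with p by uniqueness.
  rw [mixedBuchsbaumRimMultiplicity, dif_pos hex, hex.choose_spec.unique hp]
  exact h2
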